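/- Let $\mathcal V=(\mathcal V,\otimes,\mathbf 1)$ be a cosmos, i.e. a complete and cocomplete symmetric monoidal closed category. Let $(\mathcal C,\boxtimes,I,\alpha,\lambda,\rho)$ be a small monoidal $\mathcal V$-category (a $\mathcal V$-category with a $\mathcal V$-functor $\boxtimes:\mathcal C\otimes\mathcal C\to\mathcal C$, an object $I$, and $\mathcal V$-natural isomorphisms $\alpha,\lambda,\rho$ satisfying the pentagon and triangle equations), and let $(\mathcal M,\boxdot,\alpha_\wr,\lambda_\wr)$ be a small left $\mathcal C$-module (a $\mathcal V$-category with a $\mathcal V$-functor $\boxdot:\mathcal C\otimes\mathcal M\to\mathcal M$ and $\mathcal V$-natural isomorphisms $\alpha_\wr:(x\boxtimes y)\boxdot m\cong x\boxdot(y\boxdot m)$ and $\lambda_\wr:I\boxdot m\cong m$ satisfying the module pentagon and triangle equations). **Conventions.** Write $[m,n]=\mathcal M(m,n)$. A profunctor $F:\mathcal A⇸\mathcal B$ has objects $F(b,a)\in\mathcal V$ with compatible actions of $\mathcal B$ (contravariant) and $\mathcal A$ (covariant); composition is $(G\bullet F)(e,c)=\int^{d}G(e,d)\otimes F(d,c)$,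 $\mathrm{Id}$ is given by the hom objects, $F\otimes G$ is the external tensor product and $*$ is the unit $\mathcal V$-category; maps $\Rightarrow$ are $\mathcal V$-natural transformations. The coprojections of all coends are written $\iota$. Canonical isomorphisms (associators, unitors, interchange) are suppressed. **Probimonads.** A *probimonad* on a $\mathcal V$-category $\mathcal A$ consists of profunctors $T:\mathcal A⇸\mathcal A$, $M:\mathcal A\otimes\mathcal A⇸\mathcal A$, $U:*⇸\mathcal A$ and maps $$\mu:T\bullet T\Rightarrow T,\quad \eta:\mathrm{Id}\Rightarrow T,\quad \tau:T\bullet M\Rightarrow M\bullet(T\otimes T),\quad \nu:T\bullet U\Rightarrow U,$$ and invertible maps $$\alpha^\bullet:M\bullet(M\otimes\mathrm{Id})\Rightarrow M\bullet(\mathrm{Id}\otimes M),\quad \lambda^\bullet:M\bullet(U\otimes\mathrm{Id})\Rightarrow\mathrm{Id},\quad \rho^\bullet:M\bullet(\mathrm{Id}\otimes U)\Rightarrow\mathrm{Id},$$ such that 1. $(T,\mu,\eta)$ is a promonad: $\mu$ is associative with two-sided unit $\eta$; 2. $\alpha^\bullet,\lambda^\bullet,\rho^\bullet$ satisfy the pentagon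 and triangle equations of a promonoidal structure; 3. $\tau\circ(\mu\bullet M)=(M\bullet(\mu\otimes\mu))\circ(\tau\bullet(T\otimes T))\circ(T\bullet\tau)$ and $\tau\circ(\eta\bullet M)=M\bullet(\eta\otimes\eta)$; 4. $\nu\circ(\mu\bullet U)=\nu\circ(T\bullet\nu)$ and $\nu\circ(\eta\bullet U)=\mathrm{id}_U$; 5. the two maps $T\bullet M\bullet(M\otimes\mathrm{Id})\Rightarrow M\bullet(\mathrm{Id}\otimes M)\bullet(T\otimes(T\otimes T))$, "apply $\tau$ twice, then $\alpha^\bullet$" and "apply $\alpha^\bullet$, then $\tau$ twice", are equal; 6. the two maps $T\bullet M\bullet(U\otimes\mathrm{Id})\Rightarrow T$, "apply $\tau$, then $\nu$, then $\lambda^\bullet$" and "apply $\lambda^\bullet$", are equal, and likewise for $T\bullet M\bullet(\mathrm{Id}\otimes U)$ and $\rho^\bullet$. **The data.** Let $\mathcal A=\mathcal M^{\mathrm{op}}\otimes\mathcal M$ and consider the profunctors $$T\big((a,b),(m,n)\big)=\int^{x\in\mathcal C}[x\boxdot m,a]\otimes[b,x\boxdot n],$$ $$M\big((a,b),((m_1,n_1),(m_2,n_2))\big)=[m_1,a]\otimes[m_2,n_1]\otimes[b,n_2],\qquad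 U\big((a,b),*\big)=[b,a],$$ with the evident actions ($T$ is the underlying profunctor of the promonad $\mathrm{MH}_{\mathcal C}\mathcal M$). Consider maps $\mu,\eta,\tau,\nu,\alpha^\bullet,\lambda^\bullet,\rho^\bullet$ of the above types whose composites with the coprojections are as follows; "compose" means composition in $\mathcal M$, after permuting the tensor factors by the symmetry. * $\mu$ on the components $x,y\in\mathcal C$, $(p,q)\in\mathcal A$: from $[x\boxdot p,a]\otimes[b,x\boxdot q]\otimes[y\boxdot m,p]\otimes[q,y\boxdot n]$ apply $x\boxdot-$ to the last two factors, compose to $[x\boxdot(y\boxdot m),a]\otimes[b,x\boxdot(y\boxdot n)]$, precompose with $\alpha_\wr$ and postcompose with $\alpha_\wr^{-1}$ to reach $[(x\boxtimes y)\boxdot m,a]\otimes[b,(x\boxtimes y)\boxdot n]$, then apply $\iota_{x\boxtimes y}$. * $\eta$: on $[m,a]\otimes[b,n]$, precompose with $\lambda_\wr$ and postcompose with $\lambda_\wr^{-1}$ to reach $[I\boxdot m,a]\otimes[b,I\boxdot n]$, then apply $\iota_I$. * $\tau$ on the components $x$, $(p,q)$: from $[x\boxdot p,a]\otimes[b,x\boxdot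 q]\otimes[m_1,p]\otimes[m_2,n_1]\otimes[q,n_2]$ apply $x\boxdot-$ to the last three factors, compose to $[x\boxdot m_1,a]\otimes[x\boxdot m_2,x\boxdot n_1]\otimes[b,x\boxdot n_2]=M\big((a,b),((x\boxdot m_1,x\boxdot n_1),(x\boxdot m_2,x\boxdot n_2))\big)$, tensor with the elements $\iota_x(\mathrm{id}_{x\boxdot m_i}\otimes\mathrm{id}_{x\boxdot n_i}):\mathbf 1\to T\big((x\boxdot m_i,x\boxdot n_i),(m_i,n_i)\big)$, $i=1,2$, and apply the coprojection of $M\bullet(T\otimes T)$ at $\big((x\boxdot m_1,x\boxdot n_1),(x\boxdot m_2,x\boxdot n_2)\big)$. * $\nu$ on the components $x$, $(m,n)$: from $[x\boxdot m,a]\otimes[b,x\boxdot n]\otimes[n,m]$ apply $x\boxdot-$ to the last factor and compose to $[b,a]$. * $\alpha^\bullet$ on the component $((p,q),(p',q'))$: from $[p,a]\otimes[p',q]\otimes[b,q']\otimes[m_1,p]\otimes[m_2,n_1]\otimes[q,n_2]\otimes[m_3,p']\otimes[q',n_3]$ compose to $[m_1,a]\otimes[m_2,n_1]\otimes[m_3,n_2]\otimes[b,n_3]$,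 insert identities to reach $([m_1,a]\otimes[m_2,n_1]\otimes[b,n_3])\otimes([m_1,m_1]\otimes[n_1,n_1])\otimes([m_2,m_2]\otimes[m_3,n_2]\otimes[n_3,n_3])$, and apply the coprojection of $M\bullet(\mathrm{Id}\otimes M)$ at $((m_1,n_1),(m_2,n_3))$. * $\lambda^\bullet$ and $\rho^\bullet$ on the component $((p,q),(p',q'))$: compose, respectively, $$[p,a]\otimes[p',q]\otimes[b,q']\otimes[q,p]\otimes[m,p']\otimes[q',n]\to[m,a]\otimes[b,n],$$ $$[p,a]\otimes[p',q]\otimes[b,q']\otimes[m,p]\otimes[q,n]\otimes[q',p']\to[m,a]\otimes[b,n].$$ **Claim.** There are unique such maps $\mu,\eta,\tau,\nu,\alpha^\bullet,\lambda^\bullet,\rho^\bullet$, and $(T,\mu,\eta,M,U,\tau,\nu,\alpha^\bullet,\lambda^\bullet,\rho^\bullet)$ is a probimonad on $\mathcal M^{\mathrm{op}}\otimes\mathcal M$. -/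

import Mathlib

open CategoryTheory MonoidalCategory Limits Opposite

universe v u

noncomputable section

namespace ProV

section Product

variable {V : Type u} [Category.{v} V] [MonoidalCategory V] [SymmetricCategory V]

/-- Two maps of the form `X ⊗ Y ⟶ Z`, side by side. -/
def tt {X Y Z X' Y' Z' : V} (f : X ⊗ Y ⟶ Z) (f' : X' ⊗ Y' ⟶ Z') :
    (X ⊗ X') ⊗ (Y ⊗ Y') ⟶ Z ⊗ Z' :=
  tensorμ X X' Y Y' ≫ (f ⊗ₘ f')

theorem comp_tensor {A B C D E : V} (f : A ⟶ B) (g : B ⟶ C) (h : D ⟶ E) :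
    (f ≫ g) ⊗ₘ h = f ▷ D ≫ (g ⊗ₘ h) := by
  simp [MonoidalCategory.tensorHom_def]

theorem tensor_comp {A B C D E : V} (f : A ⟶ B) (g : B ⟶ C) (h : D ⟶ E) :
    h ⊗ₘ (f ≫ g) = D ◁ f ≫ (h ⊗ₘ g) := by
  simp [MonoidalCategory.tensorHom_def']

theorem tt_left {W W' X Y Z X' Y' Z' : V} (a : W ⟶ X) (a' : W' ⟶ X')
    (f : X ⊗ Y ⟶ Z) (f' : X' ⊗ Y' ⟶ Z') :
    (a ⊗ₘ a') ▷ (Y ⊗ Y') ≫ tt f f' = tt (a ▷ Y ≫ f) (a' ▷ Y' ≫ f') := by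
  rw [tt, tensorμ_natural_left_assoc, tensorHom_comp_tensorHom]; rfl

theorem tt_right {W W' X Y Z X' Y' Z' : V} (a : W ⟶ Y) (a' : W' ⟶ Y')
    (f : X ⊗ Y ⟶ Z) (f' : X' ⊗ Y' ⟶ Z') :
    (X ⊗ X') ◁ (a ⊗ₘ a') ≫ tt f f' = tt (X ◁ a ≫ f) (X' ◁ a' ≫ f') := by
  rw [tt, tensorμ_natural_right_assoc, tensorHom_comp_tensorHom]; rfl

theorem tt_comp {X Y Z W X' Y' Z' W' : V} (f : X ⊗ Y ⟶ Z) (f' : X' ⊗ Y' ⟶ Z')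
    (a : Z ⟶ W) (a' : Z' ⟶ W') : tt f f' ≫ (a ⊗ₘ a') = tt (f ≫ a) (f' ≫ a') := by
  simp [tt]

theorem tt_assoc {X Y Z W U P X' Y' Z' W' U' P' : V}
    {f : X ⊗ Y ⟶ W} {g : W ⊗ Z ⟶ U} {h : Y ⊗ Z ⟶ P} {k : X ⊗ P ⟶ U}
    {f' : X' ⊗ Y' ⟶ W'} {g' : W' ⊗ Z' ⟶ U'} {h' : Y' ⊗ Z' ⟶ P'} {k' : X' ⊗ P' ⟶ U'}
    (e : f ▷ Z ≫ g = (α_ X Y Z).hom ≫ X ◁ h ≫ k)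
    (e' : f' ▷ Z' ≫ g' = (α_ X' Y' Z').hom ≫ X' ◁ h' ≫ k') :
    tt f f' ▷ (Z ⊗ Z') ≫ tt g g' =
      (α_ (X ⊗ X') (Y ⊗ Y') (Z ⊗ Z')).hom ≫ (X ⊗ X') ◁ tt h h' ≫ tt k k' := by
  have := tensor_associativity X X' Y Y' Z Z'
  simp only [tt, comp_whiskerRight, Category.assoc, tensorμ_natural_left_assoc,
    tensorHom_comp_tensorHom, e, e', MonoidalCategory.whiskerLeft_comp,
    tensorμ_natural_right_assoc]
  simp only [← tensorHom_comp_tensorHom, reassoc_of% this]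

theorem tt_unit_left (X Y : V) : ((λ_ (𝟙_ V)).inv ▷ (X ⊗ Y)) ≫ tt (λ_ X).hom (λ_ Y).hom =
    (λ_ (X ⊗ Y)).hom := by
  rw [tensor_left_unitality]; rfl

theorem tt_unit_right (X Y : V) : ((X ⊗ Y) ◁ (λ_ (𝟙_ V)).inv) ≫ tt (ρ_ X).hom (ρ_ Y).hom =
    (ρ_ (X ⊗ Y)).hom := by
  rw [tensor_right_unitality]; rfl

variable (V) in
theorem eId_eComp {C : Type v} [EnrichedCategory V C] (X Y : C) :
    eId V X ▷ _ ≫ eComp V X X Y = (λ_ (X ⟶[V] Y)).hom := by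
  rw [← cancel_epi (λ_ (X ⟶[V] Y)).inv]; simp

variable (V) in
theorem eComp_eId {C : Type v} [EnrichedCategory V C] (X Y : C) :
    _ ◁ eId V Y ≫ eComp V X Y Y = (ρ_ (X ⟶[V] Y)).hom := by
  rw [← cancel_epi (ρ_ (X ⟶[V] Y)).inv]; simp

/-- The tensor product of two `V`-categories. -/
instance prodEnriched (C D : Type v) [EnrichedCategory V C] [EnrichedCategory V D] :
    EnrichedCategory V (C × D) where
  Hom X Y := (X.1 ⟶[V] Y.1) ⊗ (X.2 ⟶[V] Y.2)
  id X := (λ_ (𝟙_ V)).inv ≫ (eId V X.1 ⊗ₘ eId V X.2)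
  comp X Y Z := tt (eComp V X.1 Y.1 Z.1) (eComp V X.2 Y.2 Z.2)
  id_comp X Y := by
    rw [comp_whiskerRight, Category.assoc, tt_left, eId_eComp, eId_eComp, tt_unit_left,
      Iso.inv_hom_id]
  comp_id X Y := by
    rw [MonoidalCategory.whiskerLeft_comp, Category.assoc, tt_right, eComp_eId, eComp_eId,
      tt_unit_right, Iso.inv_hom_id]
  assoc W X Y Z := by
    rw [tt_assoc (e_assoc' V _ _ _ _).symm (e_assoc' V _ _ _ _).symm, Iso.inv_hom_id_assoc]

/-- The unit `V`-category. -/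
instance unitEnriched : EnrichedCategory V PUnit.{v + 1} where
  Hom _ _ := 𝟙_ V
  id _ := 𝟙 _
  comp _ _ _ := (λ_ (𝟙_ V)).hom
  id_comp _ _ := by simp
  comp_id _ _ := by simp [unitors_equal]
  assoc _ _ _ _ := by simp [unitors_equal]

theorem tt_alpha {X₁ Y₁ Z₁ X₂ Y₂ Z₂ X₃ Y₃ Z₃ : V} (f : X₁ ⊗ Y₁ ⟶ Z₁) (g : X₂ ⊗ Y₂ ⟶ Z₂)
    (h : X₃ ⊗ Y₃ ⟶ Z₃) : tt (tt f g) h ≫ (α_ _ _ _).hom =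
      ((α_ _ _ _).hom ⊗ₘ (α_ _ _ _).hom) ≫ tt f (tt g h) := by
  have := associator_monoidal X₁ X₂ X₃ Y₁ Y₂ Y₃
  rw [tt, tt, tt, tt, comp_tensor, tensor_comp, Category.assoc, Category.assoc,
    associator_naturality, reassoc_of% this]

theorem tt_lambda {X Y Z : V} (f : X ⊗ Y ⟶ Z) :
    tt (λ_ (𝟙_ V)).hom f ≫ (λ_ _).hom = ((λ_ _).hom ⊗ₘ (λ_ _).hom) ≫ f := by
  rw [leftUnitor_monoidal, tt, MonoidalCategory.tensorHom_def, Category.assoc, Category.assoc,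
    Category.assoc, Category.assoc, leftUnitor_naturality]

theorem tt_rho {X Y Z : V} (f : X ⊗ Y ⟶ Z) :
    tt f (λ_ (𝟙_ V)).hom ≫ (ρ_ _).hom = ((ρ_ _).hom ⊗ₘ (ρ_ _).hom) ≫ f := by
  rw [rightUnitor_monoidal, tt, MonoidalCategory.tensorHom_def', Category.assoc, Category.assoc,
    Category.assoc, Category.assoc, rightUnitor_naturality]

/-- The associator of the tensor product of `V`-categories. -/
def assocF (C D E : Type v) [EnrichedCategory V C] [EnrichedCategory V D] [EnrichedCategory V E] :
    EnrichedFunctor V ((C × D) × E) (C × (D × E)) where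
  obj X := (X.1.1, (X.1.2, X.2))
  map X Y := (α_ _ _ _).hom
  map_id X := by
    change ((λ_ (𝟙_ V)).inv ≫ (((λ_ (𝟙_ V)).inv ≫ (eId V X.1.1 ⊗ₘ eId V X.1.2)) ⊗ₘ eId V X.2)) ≫ _
      = (λ_ (𝟙_ V)).inv ≫ (eId V X.1.1 ⊗ₘ ((λ_ (𝟙_ V)).inv ≫ (eId V X.1.2 ⊗ₘ eId V X.2)))
    monoidal
  map_comp X Y Z := by
    change tt (tt (eComp V X.1.1 Y.1.1 Z.1.1) (eComp V X.1.2 Y.1.2 Z.1.2)) (eComp V X.2 Y.2 Z.2) ≫ _ =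
      _ ≫ tt (eComp V X.1.1 Y.1.1 Z.1.1) (tt (eComp V X.1.2 Y.1.2 Z.1.2) (eComp V X.2 Y.2 Z.2))
    exact tt_alpha _ _ _

/-- The inverse associator of the tensor product of `V`-categories. -/
def assocF' (C D E : Type v) [EnrichedCategory V C] [EnrichedCategory V D] [EnrichedCategory V E] :
    EnrichedFunctor V (C × (D × E)) ((C × D) × E) where
  obj X := ((X.1, X.2.1), X.2.2)
  map X Y := (α_ _ _ _).inv
  map_id X := by
    change ((λ_ (𝟙_ V)).inv ≫ (eId V X.1 ⊗ₘ ((λ_ (𝟙_ V)).inv ≫ (eId V X.2.1 ⊗ₘ eId V X.2.2)))) ≫ _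
      = (λ_ (𝟙_ V)).inv ≫ (((λ_ (𝟙_ V)).inv ≫ (eId V X.1 ⊗ₘ eId V X.2.1)) ⊗ₘ eId V X.2.2)
    monoidal
  map_comp X Y Z := by
    change tt (eComp V X.1 Y.1 Z.1) (tt (eComp V X.2.1 Y.2.1 Z.2.1) (eComp V X.2.2 Y.2.2 Z.2.2)) ≫ _ =
      _ ≫ tt (tt (eComp V X.1 Y.1 Z.1) (eComp V X.2.1 Y.2.1 Z.2.1)) (eComp V X.2.2 Y.2.2 Z.2.2)
    rw [Iso.comp_inv_eq, Category.assoc, tt_alpha, tensorHom_comp_tensorHom_assoc,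
      Iso.inv_hom_id, Iso.inv_hom_id, id_tensorHom_id, Category.id_comp]

/-- The left unitor of the tensor product of `V`-categories. -/
def leftF (C : Type v) [EnrichedCategory V C] : EnrichedFunctor V (PUnit.{v + 1} × C) C where
  obj X := X.2
  map X Y := (λ_ _).hom
  map_id X := by
    change ((λ_ (𝟙_ V)).inv ≫ (𝟙 _ ⊗ₘ eId V X.2)) ≫ (λ_ _).hom = eId V X.2
    simp
  map_comp X Y Z := by
    change tt (λ_ (𝟙_ V)).hom (eComp V X.2 Y.2 Z.2) ≫ (λ_ _).hom =
      ((λ_ _).hom ⊗ₘ (λ_ _).hom) ≫ eComp V X.2 Y.2 Z.2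
    exact tt_lambda _

/-- The inverse left unitor of the tensor product of `V`-categories. -/
def leftF' (C : Type v) [EnrichedCategory V C] : EnrichedFunctor V C (PUnit.{v + 1} × C) where
  obj X := (PUnit.unit, X)
  map X Y := (λ_ _).inv
  map_id X := by
    change eId V X ≫ (λ_ _).inv = (λ_ (𝟙_ V)).inv ≫ (𝟙 _ ⊗ₘ eId V X)
    simp
  map_comp X Y Z := by
    change eComp V X Y Z ≫ (λ_ _).inv =
      ((λ_ _).inv ⊗ₘ (λ_ _).inv) ≫ tt (λ_ (𝟙_ V)).hom (eComp V X Y Z)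
    rw [Iso.comp_inv_eq, Category.assoc, tt_lambda, tensorHom_comp_tensorHom_assoc,
      Iso.inv_hom_id, Iso.inv_hom_id, id_tensorHom_id, Category.id_comp]

/-- The right unitor of the tensor product of `V`-categories. -/
def rightF (C : Type v) [EnrichedCategory V C] : EnrichedFunctor V (C × PUnit.{v + 1}) C where
  obj X := X.1
  map X Y := (ρ_ _).hom
  map_id X := by
    change ((λ_ (𝟙_ V)).inv ≫ (eId V X.1 ⊗ₘ 𝟙 _)) ≫ (ρ_ _).hom = eId V X.1
    simp [unitors_inv_equal]
  map_comp X Y Z := by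
    change tt (eComp V X.1 Y.1 Z.1) (λ_ (𝟙_ V)).hom ≫ (ρ_ _).hom =
      ((ρ_ _).hom ⊗ₘ (ρ_ _).hom) ≫ eComp V X.1 Y.1 Z.1
    exact tt_rho _

variable {C C' D D' : Type v} [EnrichedCategory V C] [EnrichedCategory V C']
  [EnrichedCategory V D] [EnrichedCategory V D']

/-- The tensor product of two `V`-functors. -/
def prodF (F : EnrichedFunctor V C D) (G : EnrichedFunctor V C' D') :
    EnrichedFunctor V (C × C') (D × D') where
  obj X := (F.obj X.1, G.obj X.2)
  map X Y := F.map X.1 Y.1 ⊗ₘ G.map X.2 Y.2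
  map_id X := by
    change ((λ_ (𝟙_ V)).inv ≫ (eId V X.1 ⊗ₘ eId V X.2)) ≫ _ =
      (λ_ (𝟙_ V)).inv ≫ (eId V (F.obj X.1) ⊗ₘ eId V (G.obj X.2))
    simp
  map_comp X Y Z := by
    change tt (eComp V X.1 Y.1 Z.1) (eComp V X.2 Y.2 Z.2) ≫ _ =
      _ ≫ tt (eComp V _ _ _) (eComp V _ _ _)
    change _ = ((_ ⊗ₘ _) ⊗ₘ (_ ⊗ₘ _)) ≫ _
    rw [tt_comp, tt, tt, tensorμ_natural_assoc, tensorHom_comp_tensorHom, F.map_comp, G.map_comp]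

end Product

end ProV

namespace ProV

section Coend

variable {V : Type u} [Category.{v} V] [MonoidalCategory V]
variable {ι ρ : Type v} {K : ι → V} {R : ρ → V} {s t : ρ → ι}

/-- `(P, i)` is the colimit of the objects `K a`, glued along the pairs `K (s j) ⟵ R j ⟶ K (t j)`. -/
structure IsCoend (l : ∀ j, R j ⟶ K (s j)) (r : ∀ j, R j ⟶ K (t j)) {P : V}
    (i : ∀ a, K a ⟶ P) : Prop where
  cond : ∀ j, l j ≫ i (s j) = r j ≫ i (t j)
  exists_desc : ∀ {Z : V} (k : ∀ a, K a ⟶ Z), (∀ j, l j ≫ k (s j) = r j ≫ k (t j)) →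
    ∃ f : P ⟶ Z, ∀ a, i a ≫ f = k a
  ext : ∀ {Z : V} (f g : P ⟶ Z), (∀ a, i a ≫ f = i a ≫ g) → f = g

namespace IsCoend

variable {l : ∀ j, R j ⟶ K (s j)} {r : ∀ j, R j ⟶ K (t j)} {P : V} {i : ∀ a, K a ⟶ P}

/-- The map out of a colimit given by a compatible family. -/
def desc (h : IsCoend l r i) {Z : V} (k : ∀ a, K a ⟶ Z)
    (hk : ∀ j, l j ≫ k (s j) = r j ≫ k (t j)) : P ⟶ Z :=
  (h.exists_desc k hk).choose

theorem fac (h : IsCoend l r i) {Z : V} (k : ∀ a, K a ⟶ Z)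
    (hk : ∀ j, l j ≫ k (s j) = r j ≫ k (t j)) (a : ι) : i a ≫ h.desc k hk = k a :=
  (h.exists_desc k hk).choose_spec a

theorem whiskerLeft [MonoidalClosed V] (h : IsCoend l r i) (X : V) :
    IsCoend (K := fun a => X ⊗ K a) (fun j => X ◁ l j) (fun j => X ◁ r j) (fun a => X ◁ i a) where
  cond j := by simp only [← MonoidalCategory.whiskerLeft_comp, h.cond]
  exists_desc k hk := by
    refine ⟨MonoidalClosed.uncurry (h.desc (fun a => MonoidalClosed.curry (k a)) fun j => ?_),
      fun a => ?_⟩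
    · rw [← MonoidalClosed.curry_natural_left, ← MonoidalClosed.curry_natural_left]
      exact congrArg _ (hk j)
    · rw [← MonoidalClosed.uncurry_natural_left, h.fac, MonoidalClosed.uncurry_curry]
  ext f g hfg := by
    apply MonoidalClosed.curry_injective
    apply h.ext
    intro a
    rw [← MonoidalClosed.curry_natural_left, ← MonoidalClosed.curry_natural_left]
    exact congrArg _ (hfg a)

theorem whiskerRight [MonoidalClosed V] [SymmetricCategory V] (h : IsCoend l r i) (X : V) :
    IsCoend (K := fun a => K a ⊗ X) (fun j => l j ▷ X) (fun j => r j ▷ X) (fun a => i a ▷ X) where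
  cond j := by simp only [← comp_whiskerRight, h.cond]
  exists_desc k hk := by
    refine ⟨(β_ _ _).hom ≫ (h.whiskerLeft X).desc (fun a => (β_ _ _).hom ≫ k a) fun j => ?_,
      fun a => ?_⟩
    · rw [BraidedCategory.braiding_naturality_right_assoc,
        BraidedCategory.braiding_naturality_right_assoc, hk]
    · rw [BraidedCategory.braiding_naturality_left_assoc, (h.whiskerLeft X).fac,
        SymmetricCategory.symmetry_assoc]
  ext f g hfg := by
    rw [← cancel_epi (β_ X P).hom]
    apply (h.whiskerLeft X).ext
    intro a
    rw [BraidedCategory.braiding_naturality_right_assoc,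
      BraidedCategory.braiding_naturality_right_assoc, hfg]

end IsCoend

variable (l : ∀ j, R j ⟶ K (s j)) (r : ∀ j, R j ⟶ K (t j))

/-- The colimit of the objects `K a`, glued along the pairs `K (s j) ⟵ R j ⟶ K (t j)`. -/
def Coend [HasColimitsOfSize.{v, v} V] : V :=
  coequalizer (Sigma.desc fun j => l j ≫ Sigma.ι K (s j)) (Sigma.desc fun j => r j ≫ Sigma.ι K (t j))

/-- The coprojections. -/
def Coend.inj [HasColimitsOfSize.{v, v} V] (a : ι) : K a ⟶ Coend l r :=
  Sigma.ι K a ≫ coequalizer.π _ _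

theorem Coend.isCoend [HasColimitsOfSize.{v, v} V] : IsCoend l r (Coend.inj l r) where
  cond j := by
    have := Sigma.ι R j ≫= coequalizer.condition (Sigma.desc fun j => l j ≫ Sigma.ι K (s j))
      (Sigma.desc fun j => r j ≫ Sigma.ι K (t j))
    simp only [colimit.ι_desc_assoc, Cofan.mk_ι_app, Category.assoc] at this
    exact this
  exists_desc k hk := by
    refine ⟨coequalizer.desc (Sigma.desc k) ?_, fun a => ?_⟩
    · apply Sigma.hom_ext
      intro j
      simpa using hk j
    · exact (Category.assoc _ _ _).trans
        ((Sigma.ι K a ≫= coequalizer.π_desc _ _).trans (Sigma.ι_desc _ _))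
  ext f g hfg := by
    apply coequalizer.hom_ext
    apply Sigma.hom_ext
    intro a
    exact (Category.assoc _ _ _).symm.trans ((hfg a).trans (Category.assoc _ _ _))

end Coend

variable (V : Type u) [Category.{v} V] [MonoidalCategory V] [SymmetricCategory V]

/-- A `V`-profunctor from `C` to `D`: objects `obj d c` of `V`, contravariant in `d : D` and
covariant in `c : C`, with the actions of the hom objects of `D` and of `C`. -/
structure Prof (C D : Type v) [EnrichedCategory V C] [EnrichedCategory V D] where
  obj : D → C → V
  la : ∀ d d' c, (d ⟶[V] d') ⊗ obj d' c ⟶ obj d c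
  ra : ∀ d c c', obj d c ⊗ (c ⟶[V] c') ⟶ obj d c'
  la_id : ∀ d c, eId V d ▷ obj d c ≫ la d d c = (λ_ _).hom
  ra_id : ∀ d c, obj d c ◁ eId V c ≫ ra d c c = (ρ_ _).hom
  la_la : ∀ d d' d'' c, eComp V d d' d'' ▷ obj d'' c ≫ la d d'' c =
    (α_ _ _ _).hom ≫ _ ◁ la d' d'' c ≫ la d d' c
  ra_ra : ∀ d c c' c'', ra d c c' ▷ _ ≫ ra d c' c'' =
    (α_ _ _ _).hom ≫ obj d c ◁ eComp V c c' c'' ≫ ra d c c''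
  la_ra : ∀ d d' c c', la d d' c ▷ _ ≫ ra d c c' =
    (α_ _ _ _).hom ≫ _ ◁ ra d' c c' ≫ la d d' c'

namespace Prof


variable {V}
variable {C D E C' D' E' : Type v} [EnrichedCategory V C] [EnrichedCategory V D]
  [EnrichedCategory V E] [EnrichedCategory V C'] [EnrichedCategory V D'] [EnrichedCategory V E']

/-- A map of profunctors. -/
@[ext]
structure Hom (F G : Prof V C D) where
  app : ∀ d c, F.obj d c ⟶ G.obj d c
  la_app : ∀ d d' c, F.la d d' c ≫ app d c = _ ◁ app d' c ≫ G.la d d' c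
  ra_app : ∀ d c c', F.ra d c c' ≫ app d c' = app d c ▷ _ ≫ G.ra d c c'


instance : Category (Prof V C D) where
  Hom F G := Hom F G
  id F := { app := fun _ _ => 𝟙 _, la_app := by simp, ra_app := by simp }
  comp f g :=
    { app := fun d c => f.app d c ≫ g.app d c
      la_app := by simp [reassoc_of% f.la_app, g.la_app]
      ra_app := by simp [reassoc_of% f.ra_app, g.ra_app] }

@[simp] theorem id_app (F : Prof V C D) (d : D) (c : C) : Hom.app (𝟙 F) d c = 𝟙 _ := rfl

@[simp] theorem comp_app {F G H : Prof V C D} (f : F ⟶ G) (g : G ⟶ H) (d : D) (c : C) :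
    Hom.app (f ≫ g) d c = Hom.app f d c ≫ Hom.app g d c := rfl

/-- The identity profunctor. -/
abbrev one (C : Type v) [EnrichedCategory V C] : Prof V C C where
  obj d c := d ⟶[V] c
  la d d' c := eComp V d d' c
  ra d c c' := eComp V d c c'
  la_id d c := eId_eComp V d c
  ra_id d c := eComp_eId V d c
  la_la _ _ _ _ := (e_assoc' V _ _ _ _).symm
  ra_ra _ _ _ _ := (e_assoc' V _ _ _ _).symm
  la_ra _ _ _ _ := (e_assoc' V _ _ _ _).symm

/-- Restriction of a profunctor along a `V`-functor in the contravariant variable. -/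
abbrev resL (F : Prof V C D) (H : EnrichedFunctor V D' D) : Prof V C D' where
  obj d c := F.obj (H.obj d) c
  la d d' c := H.map d d' ▷ _ ≫ F.la _ _ _
  ra d c c' := F.ra _ _ _
  la_id d c := by rw [← comp_whiskerRight_assoc, H.map_id, F.la_id]
  ra_id d c := F.ra_id _ _
  la_la d d' d'' c := by
    rw [← comp_whiskerRight_assoc, H.map_comp, comp_whiskerRight_assoc, F.la_la]
    simp only [MonoidalCategory.tensorHom_def, comp_whiskerRight, Category.assoc,
      MonoidalCategory.whiskerLeft_comp, whisker_exchange_assoc, whisker_assoc,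
      associator_naturality_left_assoc, Iso.inv_hom_id_assoc]
  ra_ra d c c' c'' := F.ra_ra _ _ _ _
  la_ra d d' c c' := by
    rw [comp_whiskerRight_assoc, F.la_ra, associator_naturality_left_assoc, whisker_exchange_assoc]

/-- Restriction of a profunctor along a `V`-functor in the covariant variable. -/
abbrev resR (F : Prof V C D) (K : EnrichedFunctor V C' C) : Prof V C' D where
  obj d c := F.obj d (K.obj c)
  la d d' c := F.la _ _ _
  ra d c c' := _ ◁ K.map c c' ≫ F.ra _ _ _
  la_id d c := F.la_id _ _
  ra_id d c := by rw [← MonoidalCategory.whiskerLeft_comp_assoc, K.map_id, F.ra_id]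
  la_la d d' d'' c := F.la_la _ _ _ _
  ra_ra d c c' c'' := by
    simp only [comp_whiskerRight, Category.assoc, ← MonoidalCategory.whiskerLeft_comp_assoc,
      K.map_comp]
    rw [← whisker_exchange_assoc, F.ra_ra]
    simp [MonoidalCategory.tensorHom_def, whisker_exchange_assoc]
  la_ra d d' c c' := by
    rw [← whisker_exchange_assoc, F.la_ra]
    simp

/-- Restriction of maps of profunctors. -/
def resRHom {F G : Prof V C D} (f : F ⟶ G) (K : EnrichedFunctor V C' C) :
    F.resR K ⟶ G.resR K where
  app d c := f.app _ _
  la_app d d' c := f.la_app _ _ _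
  ra_app d c c' := by
    change (_ ≫ _) ≫ _ = _ ≫ _ ≫ _
    rw [Category.assoc, f.ra_app, whisker_exchange_assoc]

/-- The (external) tensor product of profunctors. -/
abbrev tens (F : Prof V C D) (G : Prof V C' D') : Prof V (C × C') (D × D') where
  obj d c := F.obj d.1 c.1 ⊗ G.obj d.2 c.2
  la d d' c := tt (F.la d.1 d'.1 c.1) (G.la d.2 d'.2 c.2)
  ra d c c' := tt (F.ra d.1 c.1 c'.1) (G.ra d.2 c.2 c'.2)
  la_id d c := by
    change ((λ_ (𝟙_ V)).inv ≫ (eId V d.1 ⊗ₘ eId V d.2)) ▷ _ ≫ _ = _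
    rw [comp_whiskerRight, Category.assoc, tt_left, F.la_id, G.la_id, tt_unit_left]
  ra_id d c := by
    change _ ◁ ((λ_ (𝟙_ V)).inv ≫ (eId V c.1 ⊗ₘ eId V c.2)) ≫ _ = _
    rw [MonoidalCategory.whiskerLeft_comp, Category.assoc, tt_right, F.ra_id, G.ra_id,
      tt_unit_right]
  la_la d d' d'' c := tt_assoc (F.la_la _ _ _ _) (G.la_la _ _ _ _)
  ra_ra d c c' c'' := tt_assoc (F.ra_ra _ _ _ _) (G.ra_ra _ _ _ _)
  la_ra d d' c c' := tt_assoc (F.la_ra _ _ _ _) (G.la_ra _ _ _ _)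

/-- The tensor product of maps of profunctors. -/
def tensHom {F F' : Prof V C D} {G G' : Prof V C' D'} (f : F ⟶ F') (g : G ⟶ G') :
    F.tens G ⟶ F'.tens G' where
  app d c := f.app d.1 c.1 ⊗ₘ g.app d.2 c.2
  la_app d d' c := by
    exact (tt_comp _ _ _ _).trans ((congrArg₂ tt (f.la_app _ _ _) (g.la_app _ _ _)).trans
      (tt_right _ _ _ _).symm)
  ra_app d c c' := by
    exact (tt_comp _ _ _ _).trans ((congrArg₂ tt (f.ra_app _ _ _) (g.ra_app _ _ _)).trans
      (tt_left _ _ _ _).symm)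

section coend

/-- A diagram of profunctors to be glued pointwise. -/
structure Glue (C D : Type v) [EnrichedCategory V C] [EnrichedCategory V D] where
  ι : Type v
  ρ : Type v
  K : ι → Prof V C D
  R : ρ → D → C → V
  s : ρ → ι
  t : ρ → ι
  l : ∀ j d c, R j d c ⟶ (K (s j)).obj d c
  r : ∀ j d c, R j d c ⟶ (K (t j)).obj d c
  Rl : ∀ j (d d' : D) c, (d ⟶[V] d') ⊗ R j d' c ⟶ R j d c
  Rr : ∀ j d (c c' : C), R j d c ⊗ (c ⟶[V] c') ⟶ R j d c'
  ll : ∀ j d d' c, Rl j d d' c ≫ l j d c = _ ◁ l j d' c ≫ (K (s j)).la d d' c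
  rl : ∀ j d d' c, Rl j d d' c ≫ r j d c = _ ◁ r j d' c ≫ (K (t j)).la d d' c
  lr : ∀ j d c c', Rr j d c c' ≫ l j d c' = l j d c ▷ _ ≫ (K (s j)).ra d c c'
  rr : ∀ j d c c', Rr j d c c' ≫ r j d c' = r j d c ▷ _ ≫ (K (t j)).ra d c c'

namespace Glue

variable [MonoidalClosed V] [HasColimitsOfSize.{v, v} V] (g : Glue (V := V) C D)

/-- The glued object. -/
def obj (d : D) (c : C) : V :=
  Coend (K := fun a => (g.K a).obj d c) (R := fun j => g.R j d c) (s := g.s) (t := g.t)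
    (fun j => g.l j d c) (fun j => g.r j d c)

/-- The coprojections. -/
def inj (a : g.ι) (d : D) (c : C) : (g.K a).obj d c ⟶ g.obj d c :=
  Coend.inj (K := fun a => (g.K a).obj d c) (R := fun j => g.R j d c) (s := g.s) (t := g.t)
    (fun j => g.l j d c) (fun j => g.r j d c) a

theorem isCoend (d : D) (c : C) :
    IsCoend (K := fun a => (g.K a).obj d c) (R := fun j => g.R j d c) (s := g.s) (t := g.t)
      (fun j => g.l j d c) (fun j => g.r j d c) (fun a => g.inj a d c) :=
  Coend.isCoend (K := fun a => (g.K a).obj d c) (R := fun j => g.R j d c) (s := g.s) (t := g.t)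
    (fun j => g.l j d c) (fun j => g.r j d c)

/-- The left action. -/
def la (d d' : D) (c : C) : (d ⟶[V] d') ⊗ g.obj d' c ⟶ g.obj d c :=
  ((g.isCoend d' c).whiskerLeft (d ⟶[V] d')).desc (fun a => (g.K a).la d d' c ≫ g.inj a d c)
    fun j => by
      rw [← Category.assoc, ← Category.assoc, ← g.ll, ← g.rl, Category.assoc, Category.assoc,
        (g.isCoend d c).cond]

/-- The right action. -/
def ra (d : D) (c c' : C) : g.obj d c ⊗ (c ⟶[V] c') ⟶ g.obj d c' :=
  ((g.isCoend d c).whiskerRight (c ⟶[V] c')).desc (fun a => (g.K a).ra d c c' ≫ g.inj a d c')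
    fun j => by
      rw [← Category.assoc, ← Category.assoc, ← g.lr, ← g.rr, Category.assoc, Category.assoc,
        (g.isCoend d c').cond]

theorem inj_la (a : g.ι) (d d' : D) (c : C) :
    _ ◁ g.inj a d' c ≫ g.la d d' c = (g.K a).la d d' c ≫ g.inj a d c :=
  ((g.isCoend d' c).whiskerLeft (d ⟶[V] d')).fac _ _ a

theorem inj_ra (a : g.ι) (d : D) (c c' : C) :
    g.inj a d c ▷ _ ≫ g.ra d c c' = (g.K a).ra d c c' ≫ g.inj a d c' :=
  ((g.isCoend d c).whiskerRight (c ⟶[V] c')).fac _ _ a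

/-- A pointwise colimit of profunctors. -/
def coend : Prof V C D where
  obj := g.obj
  la := g.la
  ra := g.ra
  la_id d c := ((g.isCoend d c).whiskerLeft _).ext _ _ fun a => by
    rw [whisker_exchange_assoc, inj_la, reassoc_of% la_id, leftUnitor_naturality]
  ra_id d c := ((g.isCoend d c).whiskerRight _).ext _ _ fun a => by
    rw [← whisker_exchange_assoc, inj_ra, reassoc_of% ra_id, rightUnitor_naturality]
  la_la d d' d'' c := ((g.isCoend d'' c).whiskerLeft _).ext _ _ fun a => by
    rw [whisker_exchange_assoc, inj_la, reassoc_of% la_la, associator_naturality_right_assoc,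
      ← MonoidalCategory.whiskerLeft_comp_assoc, inj_la,
      MonoidalCategory.whiskerLeft_comp_assoc, inj_la]
  ra_ra d c c' c'' := (((g.isCoend d c).whiskerRight _).whiskerRight _).ext _ _ fun a => by
    rw [← comp_whiskerRight_assoc, inj_ra, comp_whiskerRight_assoc, inj_ra,
      reassoc_of% ra_ra, associator_naturality_left_assoc, ← whisker_exchange_assoc, inj_ra]
  la_ra d d' c c' := (((g.isCoend d' c).whiskerLeft _).whiskerRight _).ext _ _ fun a => by
    rw [← comp_whiskerRight_assoc, inj_la, comp_whiskerRight_assoc, inj_ra,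
      reassoc_of% la_ra, associator_naturality_middle_assoc, ← MonoidalCategory.whiskerLeft_comp_assoc,
      inj_ra, MonoidalCategory.whiskerLeft_comp_assoc, inj_la]

end Glue

end coend

end Prof

end ProV

namespace ProV
namespace Prof

variable {V : Type u} [Category.{v} V] [MonoidalCategory V] [SymmetricCategory V]
variable {B C D E C' D' E' : Type v} [EnrichedCategory V B] [EnrichedCategory V C]
  [EnrichedCategory V D]
  [EnrichedCategory V E] [EnrichedCategory V C'] [EnrichedCategory V D'] [EnrichedCategory V E']


theorem comp_tensor' {A B C D E : V} (f : A ⟶ B) (g : B ⟶ C) (h : D ⟶ E) :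
    (f ≫ g) ⊗ₘ h = (f ⊗ₘ h) ≫ g ▷ E := by
  simp [MonoidalCategory.tensorHom_def']

theorem tensor_comp' {A B C D E : V} (f : A ⟶ B) (g : B ⟶ C) (h : D ⟶ E) :
    h ⊗ₘ (f ≫ g) = (h ⊗ₘ f) ≫ E ◁ g := by
  simp [MonoidalCategory.tensorHom_def]

theorem exch1 {A B C W B' C' : V} (g : A ⊗ B ⟶ B') (r : C ⊗ W ⟶ C') :
    ((α_ A B C).inv ≫ g ▷ C) ▷ W ≫ (α_ _ _ _).hom ≫ B' ◁ r =
      (α_ _ _ _).hom ≫ A ◁ ((α_ _ _ _).hom ≫ B ◁ r) ≫ (α_ _ _ _).inv ≫ g ▷ C' := by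
  have h : (α_ A B (C ⊗ W)).hom ≫ A ◁ B ◁ r ≫ (α_ A B C').inv ≫ g ▷ C' =
    g ▷ (C ⊗ W) ≫ B' ◁ r := by
    rw [← whisker_exchange]; monoidal
  calc _ = ((α_ A B C).inv ▷ W ≫ (α_ _ C W).hom) ≫ g ▷ (C ⊗ W) ≫ B' ◁ r := by monoidal
    _ = _ := by rw [← h]; monoidal

theorem exch2 {A B C W B' C' : V} (g : A ⊗ B ⟶ B') (r : C ⊗ W ⟶ C') :
    ((α_ A (B ⊗ C) W).inv ≫ ((α_ A B C).inv ≫ g ▷ C) ▷ W) ≫ (α_ _ _ _).hom ≫ B' ◁ r =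
      A ◁ ((α_ _ _ _).hom ≫ B ◁ r) ≫ (α_ _ _ _).inv ≫ g ▷ C' := by
  rw [Category.assoc, exch1, Iso.inv_hom_id_assoc]

theorem glue_aux1 {A B C F B' C' D : V} {l : A ⊗ B ⟶ B'} {r : B' ⊗ C ⟶ D}
    {r' : B ⊗ C ⟶ C'} {l' : A ⊗ C' ⟶ D} (h : l ▷ C ≫ r = (α_ _ _ _).hom ≫ A ◁ r' ≫ l') :
    ((α_ A (B ⊗ C) F).inv ≫ ((α_ A B C).inv ≫ l ▷ C) ▷ F) ≫ r ▷ F =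
      A ◁ r' ▷ F ≫ (α_ _ _ _).inv ≫ l' ▷ F := by
  rw [Category.assoc, ← comp_whiskerRight, Category.assoc, h]
  monoidal

theorem glue_aux2 {A B C W B' C' : V} (g : A ⊗ B ⟶ B') (r : C ⊗ W ⟶ C') :
    ((α_ (A ⊗ B) C W).hom ≫ (A ⊗ B) ◁ r) ≫ g ▷ C' =
      g ▷ C ▷ W ≫ (α_ _ _ _).hom ≫ B' ◁ r := by
  rw [Category.assoc, whisker_exchange, associator_naturality_left_assoc]

theorem glue_aux3 {G A B C B' C' D : V} {l : A ⊗ B ⟶ B'} {r : B' ⊗ C ⟶ D}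
    {r' : B ⊗ C ⟶ C'} {l' : A ⊗ C' ⟶ D} (h : l ▷ C ≫ r = (α_ _ _ _).hom ≫ A ◁ r' ≫ l') :
    ((α_ (G ⊗ A) B C).hom ≫ (G ⊗ A) ◁ r') ≫ (α_ _ _ _).hom ≫ G ◁ l' =
      ((α_ G A B).hom ≫ G ◁ l) ▷ C ≫ (α_ _ _ _).hom ≫ G ◁ r := by
  trans (α_ G A B).hom ▷ C ≫ (α_ _ _ _).hom ≫ G ◁ (l ▷ C ≫ r)
  · rw [h]; monoidal
  · monoidal

/-- The integrand of the composition of two profunctors. -/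
def outer (G : Prof V D E) (F : Prof V C D) (d : D) : Prof V C E where
  obj e c := G.obj e d ⊗ F.obj d c
  la e e' c := (α_ _ _ _).inv ≫ G.la e e' d ▷ F.obj d c
  ra e c c' := (α_ _ _ _).hom ≫ G.obj e d ◁ F.ra d c c'
  la_id e c := by
    rw [associator_inv_naturality_left_assoc, ← comp_whiskerRight, G.la_id]
    simp
  ra_id e c := by
    rw [associator_naturality_right_assoc, ← MonoidalCategory.whiskerLeft_comp, F.ra_id]
    simp
  la_la e e' e'' c := by
    rw [associator_inv_naturality_left_assoc, ← comp_whiskerRight, G.la_la]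
    simp
  ra_ra e c c' c'' := by
    rw [comp_whiskerRight, Category.assoc, associator_naturality_middle_assoc,
      ← MonoidalCategory.whiskerLeft_comp, F.ra_ra]
    simp
  la_ra e e' c c' := exch1 _ _

variable [MonoidalClosed V] [HasColimitsOfSize.{v, v} V]

/-- The diagram whose pointwise colimit is the composition of two profunctors. -/
def glue (G : Prof V D E) (F : Prof V C D) : Glue (V := V) C E where
  ι := D
  ρ := D × D
  K := outer G F
  R j e c := (G.obj e j.1 ⊗ (j.1 ⟶[V] j.2)) ⊗ F.obj j.2 c
  s := Prod.snd
  t := Prod.fst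
  l j e c := G.ra e j.1 j.2 ▷ F.obj j.2 c
  r j e c := (α_ _ _ _).hom ≫ G.obj e j.1 ◁ F.la j.1 j.2 c
  Rl j e e' c := (α_ _ _ _).inv ≫ ((α_ _ _ _).inv ≫ G.la e e' j.1 ▷ _) ▷ _
  Rr j e c c' := (α_ _ _ _).hom ≫ _ ◁ F.ra j.2 c c'
  ll j e e' c := glue_aux1 (G.la_ra e e' j.1 j.2)
  rl j e e' c := exch2 _ _
  lr j e c c' := glue_aux2 _ _
  rr j e c c' := glue_aux3 (F.la_ra j.1 j.2 c c')

/-- The composition `G • F` of profunctors, `(G • F)(e, c) = ∫ d, G(e, d) ⊗ F(d, c)`. -/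
def comp (G : Prof V D E) (F : Prof V C D) : Prof V C E := (glue G F).coend

/-- The coprojections of the composition of two profunctors. -/
def inj (G : Prof V D E) (F : Prof V C D) (d : D) (e : E) (c : C) :
    G.obj e d ⊗ F.obj d c ⟶ (G.comp F).obj e c := (glue G F).inj d e c

theorem isCoend (G : Prof V D E) (F : Prof V C D) (e : E) (c : C) :
    IsCoend (K := fun d => G.obj e d ⊗ F.obj d c)
      (R := fun j : D × D => (G.obj e j.1 ⊗ (j.1 ⟶[V] j.2)) ⊗ F.obj j.2 c)
      (s := Prod.snd) (t := Prod.fst)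
      (fun j => G.ra e j.1 j.2 ▷ F.obj j.2 c)
      (fun j => (α_ _ _ _).hom ≫ G.obj e j.1 ◁ F.la j.1 j.2 c) (fun d => inj G F d e c) :=
  (glue G F).isCoend e c

theorem inj_bal (G : Prof V D E) (F : Prof V C D) (d d' : D) (e : E) (c : C) :
    G.ra e d d' ▷ F.obj d' c ≫ inj G F d' e c =
      (α_ _ _ _).hom ≫ G.obj e d ◁ F.la d d' c ≫ inj G F d e c := by
  simpa using (isCoend G F e c).cond (d, d')

theorem inj_bal' (G : Prof V D E) (F : Prof V C D) (d d' : D) (e : E) (c : C) :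
    G.obj e d ◁ F.la d d' c ≫ inj G F d e c =
      (α_ _ _ _).inv ≫ G.ra e d d' ▷ F.obj d' c ≫ inj G F d' e c := by
  rw [inj_bal, Iso.inv_hom_id_assoc]

theorem inj_la (G : Prof V D E) (F : Prof V C D) (d : D) (e e' : E) (c : C) :
    (e ⟶[V] e') ◁ inj G F d e' c ≫ (G.comp F).la e e' c =
      (α_ _ _ _).inv ≫ G.la e e' d ▷ F.obj d c ≫ inj G F d e c :=
  ((glue G F).inj_la d e e' c).trans (Category.assoc _ _ _)

theorem inj_ra (G : Prof V D E) (F : Prof V C D) (d : D) (e : E) (c c' : C) :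
    inj G F d e c ▷ (c ⟶[V] c') ≫ (G.comp F).ra e c c' =
      (α_ _ _ _).hom ≫ G.obj e d ◁ F.ra d c c' ≫ inj G F d e c' :=
  ((glue G F).inj_ra d e c c').trans (Category.assoc _ _ _)

/-- The map out of a composition of profunctors given by a balanced family of maps. -/
def liftApp (G : Prof V D E) (F : Prof V C D) (e : E) (c : C) {Z : V}
    (k : ∀ d, G.obj e d ⊗ F.obj d c ⟶ Z)
    (bal : ∀ d d', G.ra e d d' ▷ F.obj d' c ≫ k d' =
      (α_ _ _ _).hom ≫ G.obj e d ◁ F.la d d' c ≫ k d) : (G.comp F).obj e c ⟶ Z :=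
  (isCoend G F e c).desc k fun j => by rw [bal, Category.assoc]

theorem inj_liftApp (G : Prof V D E) (F : Prof V C D) (e : E) (c : C) {Z : V}
    (k : ∀ d, G.obj e d ⊗ F.obj d c ⟶ Z) (bal) (d : D) :
    inj G F d e c ≫ liftApp G F e c k bal = k d :=
  (isCoend G F e c).fac k _ d

/-- The map out of a composition of profunctors given by a balanced family of maps. -/
def lift (G : Prof V D E) (F : Prof V C D) (H : Prof V C E)
    (k : ∀ d e c, G.obj e d ⊗ F.obj d c ⟶ H.obj e c)
    (bal : ∀ d d' e c, G.ra e d d' ▷ F.obj d' c ≫ k d' e c =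
      (α_ _ _ _).hom ≫ G.obj e d ◁ F.la d d' c ≫ k d e c)
    (hl : ∀ d e e' c, (α_ _ _ _).inv ≫ G.la e e' d ▷ F.obj d c ≫ k d e c =
      (e ⟶[V] e') ◁ k d e' c ≫ H.la e e' c)
    (hr : ∀ d e c c', (α_ _ _ _).hom ≫ G.obj e d ◁ F.ra d c c' ≫ k d e c' =
      k d e c ▷ (c ⟶[V] c') ≫ H.ra e c c') : G.comp F ⟶ H where
  app e c := liftApp G F e c (fun d => k d e c) (fun d d' => bal d d' e c)
  la_app e e' c := ((isCoend G F e' c).whiskerLeft _).ext _ _ fun d => by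
    rw [reassoc_of% inj_la, inj_liftApp, ← MonoidalCategory.whiskerLeft_comp_assoc, inj_liftApp, hl]
  ra_app e c c' := ((isCoend G F e c).whiskerRight _).ext _ _ fun d => by
    rw [reassoc_of% inj_ra, inj_liftApp, ← comp_whiskerRight_assoc, inj_liftApp, hr]

theorem inj_lift (G : Prof V D E) (F : Prof V C D) (H : Prof V C E)
    (k : ∀ d e c, G.obj e d ⊗ F.obj d c ⟶ H.obj e c) (bal) (hl) (hr) (d : D) (e : E) (c : C) :
    inj G F d e c ≫ (lift G F H k bal hl hr).app e c = k d e c :=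
  inj_liftApp G F e c (fun d => k d e c) (fun d d' => bal d d' e c) d

/-- Horizontal composition of maps of profunctors. -/
def hcomp {G G' : Prof V D E} {F F' : Prof V C D} (g : G ⟶ G') (f : F ⟶ F') :
    G.comp F ⟶ G'.comp F' :=
  lift _ _ _ (fun d e c => (g.app e d ⊗ₘ f.app d c) ≫ inj G' F' d e c)
    (fun d d' e c => by
      rw [← reassoc_of% comp_tensor, g.ra_app, ← reassoc_of% tensor_comp, f.la_app, reassoc_of% comp_tensor',
        reassoc_of% tensor_comp', inj_bal, ← tensorHom_id, associator_naturality_assoc, id_tensorHom])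
    (fun d e e' c => by
      rw [← reassoc_of% comp_tensor, g.la_app, MonoidalCategory.whiskerLeft_comp_assoc, inj_la,
        reassoc_of% comp_tensor', ← id_tensorHom, ← id_tensorHom, ← associator_inv_naturality_assoc])
    (fun d e c c' => by
      rw [← reassoc_of% tensor_comp, f.ra_app, comp_whiskerRight_assoc, inj_ra,
        reassoc_of% tensor_comp', ← tensorHom_id, ← tensorHom_id, ← associator_naturality_assoc])

theorem inj_hcomp {G G' : Prof V D E} {F F' : Prof V C D} (g : G ⟶ G') (f : F ⟶ F') (d : D) (e : E)
    (c : C) : inj G F d e c ≫ (hcomp g f).app e c =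
      (g.app e d ⊗ₘ f.app d c) ≫ inj G' F' d e c :=
  inj_lift _ _ _ _ _ _ _ d e c

/-- The associator of the composition of profunctors. -/
def as (H : Prof V D E) (G : Prof V C D) (F : Prof V B C) :
    (H.comp G).comp F ⟶ H.comp (G.comp F) :=
  let k (c : C) (e : E) (b : B) : (H.comp G).obj e c ⊗ F.obj c b ⟶ (H.comp (G.comp F)).obj e b :=
    ((isCoend H G e c).whiskerRight (F.obj c b)).desc
      (fun d => (α_ _ _ _).hom ≫ H.obj e d ◁ inj G F c d b ≫ inj H (G.comp F) d e b)
      (fun j => by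
        trans (α_ _ _ _).hom ▷ _ ≫ (α_ _ _ _).hom ≫
          H.obj e j.1 ◁ (G.la j.1 j.2 c ▷ F.obj c b ≫ inj G F c j.1 b) ≫ inj H (G.comp F) j.1 e b
        · rw [associator_naturality_left_assoc, ← whisker_exchange_assoc, inj_bal,
            associator_naturality_right_assoc, ← MonoidalCategory.whiskerLeft_comp_assoc, inj_la]
          monoidal
        · monoidal)
  have hk (c : C) (e : E) (b : B) (d : D) : inj H G d e c ▷ F.obj c b ≫ k c e b =
      (α_ _ _ _).hom ≫ H.obj e d ◁ inj G F c d b ≫ inj H (G.comp F) d e b :=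
    ((isCoend H G e c).whiskerRight (F.obj c b)).fac _ _ d
  lift _ _ _ k
    (fun c c' e b => (((isCoend H G e c).whiskerRight _).whiskerRight _).ext _ _ fun d => by
      trans (α_ _ _ _).hom ▷ _ ≫ (α_ _ _ _).hom ≫
        H.obj e d ◁ (G.ra d c c' ▷ F.obj c' b ≫ inj G F c' d b) ≫ inj H (G.comp F) d e b
      · rw [← comp_whiskerRight_assoc, inj_ra, comp_whiskerRight_assoc, comp_whiskerRight_assoc, hk]
        monoidal
      · rw [associator_naturality_left_assoc, ← whisker_exchange_assoc, hk, inj_bal]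
        monoidal)
    (fun c e e' b => (((isCoend H G e' c).whiskerRight _).whiskerLeft _).ext _ _ fun d => by
      rw [associator_inv_naturality_middle_assoc, ← comp_whiskerRight_assoc, inj_la,
        ← MonoidalCategory.whiskerLeft_comp_assoc, hk, comp_whiskerRight_assoc,
        comp_whiskerRight_assoc, hk, MonoidalCategory.whiskerLeft_comp_assoc,
        MonoidalCategory.whiskerLeft_comp_assoc, inj_la, associator_inv_naturality_right_assoc,
        whisker_exchange_assoc]
      monoidal)
    (fun c e b b' => (((isCoend H G e c).whiskerRight _).whiskerRight _).ext _ _ fun d => by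
      rw [associator_naturality_left_assoc, ← whisker_exchange_assoc, hk,
        ← comp_whiskerRight_assoc, hk, comp_whiskerRight_assoc, comp_whiskerRight_assoc, inj_ra,
        associator_naturality_middle_assoc, ← MonoidalCategory.whiskerLeft_comp_assoc _ (_ ▷ _),
        inj_ra]
      monoidal)

/-- The inverse associator of the composition of profunctors. -/
def as' (H : Prof V D E) (G : Prof V C D) (F : Prof V B C) :
    H.comp (G.comp F) ⟶ (H.comp G).comp F :=
  let k (d : D) (e : E) (b : B) : H.obj e d ⊗ (G.comp F).obj d b ⟶ ((H.comp G).comp F).obj e b :=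
    ((isCoend G F d b).whiskerLeft (H.obj e d)).desc
      (fun c => (α_ _ _ _).inv ≫ inj H G d e c ▷ F.obj c b ≫ inj (H.comp G) F c e b)
      (fun j => by
        rw [MonoidalCategory.whiskerLeft_comp_assoc, associator_inv_naturality_right_assoc,
          whisker_exchange_assoc, inj_bal', associator_inv_naturality_left_assoc,
          ← comp_whiskerRight_assoc, inj_ra]
        monoidal)
  have hk (d : D) (e : E) (b : B) (c : C) : H.obj e d ◁ inj G F c d b ≫ k d e b =
      (α_ _ _ _).inv ≫ inj H G d e c ▷ F.obj c b ≫ inj (H.comp G) F c e b :=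
    ((isCoend G F d b).whiskerLeft (H.obj e d)).fac _ _ c
  lift _ _ _ k
    (fun d d' e b => ((isCoend G F d' b).whiskerLeft _).ext _ _ fun c => by
      rw [whisker_exchange_assoc, hk, associator_naturality_right_assoc,
        ← MonoidalCategory.whiskerLeft_comp_assoc, inj_la, MonoidalCategory.whiskerLeft_comp_assoc,
        MonoidalCategory.whiskerLeft_comp_assoc, hk, associator_inv_naturality_left_assoc,
        ← comp_whiskerRight_assoc, inj_bal]
      monoidal)
    (fun d e e' b => (((isCoend G F d b).whiskerLeft _).whiskerLeft _).ext _ _ fun c => by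
      rw [associator_inv_naturality_right_assoc, whisker_exchange_assoc, hk,
        ← MonoidalCategory.whiskerLeft_comp_assoc, hk, MonoidalCategory.whiskerLeft_comp_assoc,
        MonoidalCategory.whiskerLeft_comp_assoc, inj_la, associator_inv_naturality_middle_assoc,
        ← comp_whiskerRight_assoc (_ ◁ _), inj_la]
      monoidal)
    (fun d e b b' => (((isCoend G F d b).whiskerLeft _).whiskerRight _).ext _ _ fun c => by
      rw [associator_naturality_middle_assoc, ← MonoidalCategory.whiskerLeft_comp_assoc, inj_ra,
        MonoidalCategory.whiskerLeft_comp_assoc, MonoidalCategory.whiskerLeft_comp_assoc, hk,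
        ← comp_whiskerRight_assoc, hk, comp_whiskerRight_assoc, comp_whiskerRight_assoc, inj_ra,
        associator_naturality_left_assoc, ← whisker_exchange_assoc]
      monoidal)

end Prof

end ProV

namespace ProV
namespace Prof

variable {V : Type u} [Category.{v} V] [MonoidalCategory V] [SymmetricCategory V]
variable {B C D E C' D' E' : Type v} [EnrichedCategory V B] [EnrichedCategory V C]
  [EnrichedCategory V D]
  [EnrichedCategory V E] [EnrichedCategory V C'] [EnrichedCategory V D'] [EnrichedCategory V E']

/-- A pointwise inverse of a map of profunctors is a map of profunctors. -/
def invHom {F G : Prof V C D} (f : F ⟶ G) (g : ∀ d c, G.obj d c ⟶ F.obj d c)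
    (h : ∀ d c, Hom.app f d c ≫ g d c = 𝟙 _) (h' : ∀ d c, g d c ≫ Hom.app f d c = 𝟙 _) :
    G ⟶ F where
  app := g
  la_app d d' c := by
    rw [← Category.comp_id (_ ≫ F.la d d' c), ← h, Category.assoc, reassoc_of% f.la_app,
      ← MonoidalCategory.whiskerLeft_comp_assoc, h', MonoidalCategory.whiskerLeft_id,
      Category.id_comp]
  ra_app d c c' := by
    rw [← Category.comp_id (_ ≫ F.ra d c c'), ← h, Category.assoc, reassoc_of% f.ra_app,
      ← comp_whiskerRight_assoc, h', id_whiskerRight, Category.id_comp]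

/-- The identity profunctor of a tensor product. -/
def oneProd (C D : Type v) [EnrichedCategory V C] [EnrichedCategory V D] :
    one (V := V) (C × D) ⟶ (one C).tens (one D) where
  app _ _ := 𝟙 _
  la_app d d' c := (Category.comp_id (tt (eComp V d.1 d'.1 c.1) (eComp V d.2 d'.2 c.2))).trans
    ((congrArg (· ≫ _) (MonoidalCategory.whiskerLeft_id _ _)).trans (Category.id_comp _)).symm
  ra_app d c c' := (Category.comp_id (tt (eComp V d.1 c.1 c'.1) (eComp V d.2 c.2 c'.2))).trans
    ((congrArg (· ≫ _) (id_whiskerRight _ _)).trans (Category.id_comp _)).symm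

variable [MonoidalClosed V] [HasColimitsOfSize.{v, v} V]

/-- The left unitor. -/
def lu (F : Prof V C D) : (one D).comp F ⟶ F :=
  lift _ _ _ (fun d e c => F.la e d c)
    (fun d d' e c => F.la_la e d d' c)
    (fun d e e' c => (Iso.inv_comp_eq _).2 (F.la_la e e' d c))
    (fun d e c c' => (F.la_ra _ _ _ _).symm)

/-- The inverse left unitor. -/
def lu' (F : Prof V C D) : F ⟶ (one D).comp F :=
  invHom (lu F) (fun e c => (λ_ _).inv ≫ eId V e ▷ _ ≫ inj (one D) F e e c)
    (fun e c => (isCoend _ _ _ _).ext _ _ fun d => by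
      rw [lu, reassoc_of% inj_lift, leftUnitor_inv_naturality_assoc, whisker_exchange_assoc,
        inj_bal' (one D) F e d e c, associator_inv_naturality_left_assoc]
      have h : eId V e ▷ (one D).obj e d ▷ F.obj d c ≫ (one D).ra e e d ▷ F.obj d c =
          (λ_ _).hom ▷ _ := by
        rw [← comp_whiskerRight]
        exact congrArg (· ▷ _) (eId_eComp V e d)
      rw [reassoc_of% h]
      simp)
    (fun e c => by
      rw [lu, Category.assoc, Category.assoc, inj_lift, F.la_id, Iso.inv_hom_id])

/-- The right unitor. -/
def ru (F : Prof V C D) : F.comp (one C) ⟶ F :=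
  lift _ _ _ (fun d e c => F.ra e d c)
    (fun d d' e c => F.ra_ra e d d' c)
    (fun d e e' c => (Iso.inv_comp_eq _).2 (F.la_ra e e' d c))
    (fun d e c c' => (F.ra_ra _ _ _ _).symm)

/-- The inverse right unitor. -/
def ru' (F : Prof V C D) : F ⟶ F.comp (one C) :=
  invHom (ru F) (fun e c => (ρ_ _).inv ≫ _ ◁ eId V c ≫ inj F (one C) c e c)
    (fun e c => (isCoend _ _ _ _).ext _ _ fun d => by
      rw [ru, reassoc_of% inj_lift, rightUnitor_inv_naturality_assoc, ← whisker_exchange_assoc,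
        inj_bal F (one C) d c e c, associator_naturality_right_assoc]
      have h : F.obj e d ◁ (one C).obj d c ◁ eId V c ≫ F.obj e d ◁ (one C).la d c c =
          _ ◁ (ρ_ _).hom := by
        rw [← MonoidalCategory.whiskerLeft_comp]
        exact congrArg (_ ◁ ·) (eComp_eId V d c)
      rw [reassoc_of% h]
      simp)
    (fun e c => by
      rw [ru, Category.assoc, Category.assoc, inj_lift, F.ra_id, Iso.inv_hom_id])

/-- The interchange of composition and tensor product. -/
def ix (G : Prof V D E) (F : Prof V C D) (G' : Prof V D' E') (F' : Prof V C' D') :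
    (G.tens G').comp (F.tens F') ⟶ (G.comp F).tens (G'.comp F') :=
  lift _ _ _ (fun d e c => tt (inj G F d.1 e.1 c.1) (inj G' F' d.2 e.2 c.2))
    (fun d d' e c => tt_assoc (inj_bal _ _ _ _ _ _) (inj_bal _ _ _ _ _ _))
    (fun d e e' c => by
      rw [Iso.inv_comp_eq]
      exact tt_assoc (by rw [inj_la]; simp) (by rw [inj_la]; simp))
    (fun d e c c' =>
      (tt_assoc (inj_ra _ _ _ _ _ _) (inj_ra _ _ _ _ _ _)).symm)

theorem delta_nat {X₁ X₂ Y₁ Y₂ U₁ U₂ V₁ V₂ : V} (f₁ : X₁ ⟶ Y₁) (f₂ : X₂ ⟶ Y₂) (g₁ : U₁ ⟶ V₁)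
    (g₂ : U₂ ⟶ V₂) : ((f₁ ⊗ₘ f₂) ⊗ₘ (g₁ ⊗ₘ g₂)) ≫ tensorδ Y₁ V₁ Y₂ V₂ =
      tensorδ X₁ U₁ X₂ U₂ ≫ ((f₁ ⊗ₘ g₁) ⊗ₘ (f₂ ⊗ₘ g₂)) := by
  have h : tensorμ X₁ U₁ X₂ U₂ ≫ ((f₁ ⊗ₘ f₂) ⊗ₘ (g₁ ⊗ₘ g₂)) ≫ tensorδ Y₁ V₁ Y₂ V₂ =
      ((f₁ ⊗ₘ g₁) ⊗ₘ (f₂ ⊗ₘ g₂)) := by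
    rw [← tensorμ_natural_assoc, tensorμ_tensorδ, Category.comp_id]
  rw [← h, tensorδ_tensorμ_assoc]

theorem delta_bal {G G' A A' F F' H H' L L' Z : V} {r : G ⊗ A ⟶ H} {r' : G' ⊗ A' ⟶ H'}
    {l : A ⊗ F ⟶ L} {l' : A' ⊗ F' ⟶ L'} {k : (G ⊗ G') ⊗ (L ⊗ L') ⟶ Z}
    {k' : (H ⊗ H') ⊗ (F ⊗ F') ⟶ Z}
    (bal : tt r r' ▷ (F ⊗ F') ≫ k' = (α_ _ _ _).hom ≫ (G ⊗ G') ◁ tt l l' ≫ k) :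
    (r ▷ F ⊗ₘ r' ▷ F') ≫ tensorδ H H' F F' ≫ k' =
      ((α_ _ _ _).hom ≫ G ◁ l ⊗ₘ (α_ _ _ _).hom ≫ G' ◁ l') ≫ tensorδ G G' L L' ≫ k := by
  have h1 := delta_nat r (𝟙 F) r' (𝟙 F')
  have h2 := delta_nat (𝟙 G) l (𝟙 G') l'
  have h3 := tensor_associativity G G' A A' F F'
  have h4 : tensorδ (G ⊗ A) (G' ⊗ A') F F' ≫ tensorδ G G' A A' ▷ (F ⊗ F') ≫
      (α_ (G ⊗ G') (A ⊗ A') (F ⊗ F')).hom ≫ (G ⊗ G') ◁ tensorμ A A' F F' =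
        ((α_ G A F).hom ⊗ₘ (α_ G' A' F').hom) ≫ tensorδ G G' (A ⊗ F) (A' ⊗ F') := by
    have : Mono (tensorμ G G' (A ⊗ F) (A' ⊗ F')) :=
      mono_of_mono_fac (tensorμ_tensorδ G G' (A ⊗ F) (A' ⊗ F'))
    rw [← cancel_mono (tensorμ G G' (A ⊗ F) (A' ⊗ F'))]
    simp only [Category.assoc, ← h3, tensorδ_tensorμ, Category.comp_id]
    rw [← comp_whiskerRight_assoc, tensorδ_tensorμ, id_whiskerRight, Category.id_comp,
      tensorδ_tensorμ_assoc]
  have h5 := (tensorδ (G ⊗ A) (G' ⊗ A') F F' ≫ tensorδ G G' A A' ▷ (F ⊗ F')) ≫= bal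
  simp only [tt, comp_whiskerRight, Category.assoc, MonoidalCategory.whiskerLeft_comp,
    reassoc_of% h4] at h5
  rw [← comp_whiskerRight_assoc (tensorδ _ _ _ _), tensorδ_tensorμ, id_whiskerRight,
    Category.id_comp] at h5
  simp only [tensorHom_id, id_tensorHom, id_whiskerRight] at h1 h2
  rw [reassoc_of% h1, h5, ← tensorHom_comp_tensorHom_assoc, reassoc_of% h2]

theorem ix_exists (G : Prof V D E) (F : Prof V C D) (G' : Prof V D' E') (F' : Prof V C' D')
    (e : E × E') (c : C × C') {Z : V}
    (k : ∀ d : D × D', (G.tens G').obj e d ⊗ (F.tens F').obj d c ⟶ Z)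
    (bal : ∀ d d', (G.tens G').ra e d d' ▷ (F.tens F').obj d' c ≫ k d' =
      (α_ _ _ _).hom ≫ (G.tens G').obj e d ◁ (F.tens F').la d d' c ≫ k d) :
    ∃ f : (G.comp F).obj e.1 c.1 ⊗ (G'.comp F').obj e.2 c.2 ⟶ Z,
      ∀ d, (inj G F d.1 e.1 c.1 ⊗ₘ inj G' F' d.2 e.2 c.2) ≫ f = tensorδ _ _ _ _ ≫ k d := by
  have h1 (q : D') := (((isCoend G F e.1 c.1).whiskerRight (G'.obj e.2 q ⊗ F'.obj q c.2))).exists_desc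
    (fun p => tensorδ _ _ _ _ ≫ k (p, q)) (fun j => by
      have h := (_ ◁ ((ρ_ _).inv ≫ G'.obj e.2 q ◁ eId V q) ▷ F'.obj q c.2) ≫=
        delta_bal (bal (j.1, q) (j.2, q))
      rw [← id_tensorHom, tensorHom_comp_tensorHom_assoc, tensorHom_comp_tensorHom_assoc,
        ← comp_whiskerRight, Category.assoc, G'.ra_id, Iso.inv_hom_id, comp_whiskerRight,
        Category.assoc, associator_naturality_middle_assoc, ← MonoidalCategory.whiskerLeft_comp,
        F'.la_id] at h
      simpa using h)
  choose f1 hf1 using h1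
  obtain ⟨f, hf⟩ := ((isCoend G' F' e.2 c.2).whiskerLeft ((G.comp F).obj e.1 c.1)).exists_desc f1
    (fun j => (((isCoend G F e.1 c.1).whiskerRight _)).ext _ _ fun p => by
      have h := (((ρ_ _).inv ≫ G.obj e.1 p ◁ eId V p) ▷ F.obj p c.1 ▷ _) ≫=
        delta_bal (bal (p, j.1) (p, j.2))
      rw [← tensorHom_id, tensorHom_comp_tensorHom_assoc, tensorHom_comp_tensorHom_assoc,
        ← comp_whiskerRight, Category.assoc, G.ra_id, Iso.inv_hom_id, comp_whiskerRight,
        Category.assoc, associator_naturality_middle_assoc, ← MonoidalCategory.whiskerLeft_comp,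
        F.la_id] at h
      rw [← whisker_exchange_assoc, ← whisker_exchange_assoc, hf1, hf1]
      simpa using h)
  refine ⟨f, fun d => ?_⟩
  rw [MonoidalCategory.tensorHom_def, Category.assoc, hf, hf1]

/-- The inverse of the interchange. -/
def ix' (G : Prof V D E) (F : Prof V C D) (G' : Prof V D' E') (F' : Prof V C' D') :
    (G.comp F).tens (G'.comp F') ⟶ (G.tens G').comp (F.tens F') :=
  invHom (ix G F G' F')
    (fun e c => (ix_exists G F G' F' e c (fun d => inj _ _ d e c)
      (fun d d' => inj_bal _ _ _ _ _ _)).choose)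
    (fun e c => (isCoend _ _ _ _).ext _ _ fun d => by
      rw [ix, reassoc_of% inj_lift, tt, Category.assoc, (ix_exists G F G' F' e c (fun d => inj _ _ d e c)
        (fun d d' => inj_bal _ _ _ _ _ _)).choose_spec d, tensorμ_tensorδ_assoc, Category.comp_id])
    (fun e c => by
      apply ((isCoend G F e.1 c.1).whiskerRight _).ext
      intro p
      apply ((isCoend G' F' e.2 c.2).whiskerLeft _).ext
      intro q
      have := (ix_exists G F G' F' e c (fun d => inj _ _ d e c)
        (fun d d' => inj_bal _ _ _ _ _ _)).choose_spec (p, q)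
      rw [← MonoidalCategory.tensorHom_def'_assoc, ← MonoidalCategory.tensorHom_def'_assoc,
        reassoc_of% this, ix, inj_lift, tt, tensorδ_tensorμ_assoc, Category.comp_id])

end Prof

end ProV

namespace ProV
namespace Prof

section bend


variable {V : Type u} [Category.{v} V] [MonoidalCategory V] [SymmetricCategory V]
variable {A A' A₂ B B' B₂ P Q R S T : V}

theorem two_la {Q₂ : V} {lB' : B' ⊗ P ⟶ Q₂} {lA' : A' ⊗ Q₂ ⟶ Q} {lB : B ⊗ Q ⟶ R} {lA : A ⊗ R ⟶ S}
    {cB : B ⊗ B' ⟶ B₂} {cA : A ⊗ A' ⟶ A₂} {lB₂ : B₂ ⊗ P ⟶ T} {lA₂ : A₂ ⊗ T ⟶ S}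
    {lB'' : B ⊗ Q₂ ⟶ T} {lA'' : A' ⊗ T ⟶ R}
    (hB : cB ▷ P ≫ lB₂ = (α_ _ _ _).hom ≫ B ◁ lB' ≫ lB'')
    (hA : cA ▷ T ≫ lA₂ = (α_ _ _ _).hom ≫ A ◁ lA'' ≫ lA)
    (h : B ◁ lA' ≫ lB = (α_ _ _ _).inv ≫ (β_ _ _).hom ▷ Q₂ ≫ (α_ _ _ _).hom ≫ A' ◁ lB'' ≫ lA'') :
    tt cA cB ▷ P ≫ (α_ _ _ _).hom ≫ A₂ ◁ lB₂ ≫ lA₂ =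
      (α_ _ _ _).hom ≫ (A ⊗ B) ◁ ((α_ _ _ _).hom ≫ A' ◁ lB' ≫ lA') ≫
        (α_ _ _ _).hom ≫ A ◁ lB ≫ lA := by
  trans (α_ _ _ _).hom ≫ (α_ _ _ _).hom ≫
    A ◁ (B ◁ (α_ _ _ _).hom ≫ B ◁ A' ◁ lB' ≫ B ◁ lA' ≫ lB) ≫ lA
  · rw [h, associator_inv_naturality_right_assoc, whisker_exchange_assoc]
    trans tensorμ A B A' B' ▷ P ≫ (α_ _ _ _).hom ≫ (A ⊗ A') ◁ (cB ▷ P ≫ lB₂) ≫ cA ▷ T ≫ lA₂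
    · rw [MonoidalCategory.whiskerLeft_comp_assoc, whisker_exchange_assoc, tt,
        MonoidalCategory.tensorHom_def']
      monoidal
    · rw [hA, hB, tensorμ]
      monoidal
  · monoidal

theorem two_ra {Q₂ : V} {rA : P ⊗ A ⟶ Q} {rB : Q ⊗ B ⟶ Q₂} {rA' : Q₂ ⊗ A' ⟶ R} {rB' : R ⊗ B' ⟶ S}
    {cB : B ⊗ B' ⟶ B₂} {cA : A ⊗ A' ⟶ A₂} {rA₂ : P ⊗ A₂ ⟶ T} {rB₂ : T ⊗ B₂ ⟶ S}
    {rA'' : Q ⊗ A' ⟶ T} {rB'' : T ⊗ B ⟶ R}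
    (hA : P ◁ cA ≫ rA₂ = (α_ _ _ _).inv ≫ rA ▷ A' ≫ rA'')
    (hB : T ◁ cB ≫ rB₂ = (α_ _ _ _).inv ≫ rB'' ▷ B' ≫ rB')
    (h : rB ▷ A' ≫ rA' = (α_ _ _ _).hom ≫ Q ◁ (β_ _ _).hom ≫ (α_ _ _ _).inv ≫ rA'' ▷ B ≫ rB'') :
    ((α_ _ _ _).inv ≫ rA ▷ B ≫ rB) ▷ (A' ⊗ B') ≫ (α_ _ _ _).inv ≫ rA' ▷ B' ≫ rB' =
      (α_ _ _ _).hom ≫ P ◁ tt cA cB ≫ (α_ _ _ _).inv ≫ rA₂ ▷ B₂ ≫ rB₂ := by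
  trans (α_ _ _ _).inv ≫ (((α_ _ _ _).inv ≫ rA ▷ B) ▷ A' ≫ rB ▷ A' ≫ rA') ▷ B' ≫ rB'
  · monoidal
  · trans (α_ _ _ _).hom ≫ P ◁ tensorμ A B A' B' ≫ (α_ _ _ _).inv ≫
      (P ◁ cA ≫ rA₂) ▷ (B ⊗ B') ≫ T ◁ cB ≫ rB₂
    · rw [h, hA, hB]
      simp only [comp_whiskerRight, Category.assoc]
      trans (α_ _ _ _).inv ≫ (α_ _ _ _).inv ▷ A' ▷ B' ≫ (α_ _ _ _).hom ▷ B' ≫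
        (rA ▷ (B ⊗ A') ≫ Q ◁ (β_ B A').hom) ▷ B' ≫ (α_ _ _ _).inv ▷ B' ≫ rA'' ▷ B ▷ B' ≫
        rB'' ▷ B' ≫ rB'
      · monoidal
      · rw [← whisker_exchange, tensorμ]
        monoidal
    · rw [comp_whiskerRight_assoc, ← whisker_exchange_assoc, tt, MonoidalCategory.tensorHom_def]
      monoidal

theorem comm_aux (g : B ⊗ Q ⟶ R) (k : R ⊗ A ⟶ S) :
    B ◁ (β_ A Q).hom ≫ (α_ _ _ _).inv ≫ g ▷ A ≫ k =
    (α_ _ _ _).inv ≫ (β_ B A).hom ▷ Q ≫ (α_ _ _ _).hom ≫ A ◁ g ≫ (β_ A R).hom ≫ k := by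
  rw [BraidedCategory.braiding_naturality_right_assoc, BraidedCategory.braiding_tensor_right_hom]
  simp only [Category.assoc, Iso.hom_inv_id_assoc]
  rw [← comp_whiskerRight_assoc, SymmetricCategory.symmetry]
  simp

theorem comm_aux' (g : Q ⊗ B ⟶ R) (k : A ⊗ R ⟶ S) :
    (β_ Q A).hom ▷ B ≫ (α_ _ _ _).hom ≫ A ◁ g ≫ k =
    (α_ _ _ _).hom ≫ Q ◁ (β_ A B).hom ≫ (α_ _ _ _).inv ≫ g ▷ A ≫ (β_ R A).hom ≫ k := by
  rw [BraidedCategory.braiding_naturality_left_assoc, BraidedCategory.braiding_tensor_left_hom]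
  simp only [Category.assoc, Iso.inv_hom_id_assoc]
  rw [← MonoidalCategory.whiskerLeft_comp_assoc, SymmetricCategory.symmetry]
  simp

theorem push_bal {F F' a b X X' Y Y' Z : V} {h : a ⟶ b} {r : F ⊗ b ⟶ F'} {x : a ⊗ X' ⟶ X}
    {t' : X' ⟶ Y'} {t : X ⟶ Y} {y : b ⊗ Y' ⟶ Y} {i : F ⊗ Y ⟶ Z} {i' : F' ⊗ Y' ⟶ Z}
    (ht : x ≫ t = a ◁ t' ≫ h ▷ Y' ≫ y) (hi : r ▷ Y' ≫ i' = (α_ _ _ _).hom ≫ F ◁ y ≫ i) :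
    (F ◁ h ≫ r) ▷ X' ≫ F' ◁ t' ≫ i' = (α_ _ _ _).hom ≫ F ◁ x ≫ F ◁ t ≫ i := by
  rw [← MonoidalCategory.whiskerLeft_comp_assoc, ht, ← whisker_exchange_assoc,
    comp_whiskerRight_assoc, hi]
  monoidal

theorem push_ra {F c b X X' Y Y' Z Z' : V} {h : c ⟶ b} {x : X ⊗ c ⟶ X'} {t : X ⟶ Y}
    {t' : X' ⟶ Y'} {y : Y ⊗ b ⟶ Y'} {i : F ⊗ Y ⟶ Z} {i' : F ⊗ Y' ⟶ Z'} {z : Z ⊗ b ⟶ Z'}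
    (ht : x ≫ t' = t ▷ c ≫ Y ◁ h ≫ y) (hi : i ▷ b ≫ z = (α_ _ _ _).hom ≫ F ◁ y ≫ i') :
    (α_ _ _ _).hom ≫ F ◁ x ≫ F ◁ t' ≫ i' = (F ◁ t ≫ i) ▷ c ≫ Z ◁ h ≫ z := by
  rw [← MonoidalCategory.whiskerLeft_comp_assoc, ht, comp_whiskerRight_assoc,
    ← whisker_exchange_assoc i, hi]
  monoidal

end bend

variable {V : Type u} [Category.{v} V] [MonoidalCategory V] [SymmetricCategory V]
variable {A B C D E C' D' E' : Type v} [EnrichedCategory V A] [EnrichedCategory V B]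
  [EnrichedCategory V C] [EnrichedCategory V D]
  [EnrichedCategory V E] [EnrichedCategory V C'] [EnrichedCategory V D'] [EnrichedCategory V E']

/-- The associativity of the tensor product of profunctors. -/
def tensAssoc (X : Prof V A B) (Y : Prof V C D) (Z : Prof V C' D') :
    (X.tens Y).tens Z ⟶ ((X.tens (Y.tens Z)).resL (assocF B D D')).resR (assocF A C C') where
  app _ _ := (α_ _ _ _).hom
  la_app d d' c := by
    exact (tt_alpha _ _ _).trans ((congrArg (· ≫ _) (MonoidalCategory.tensorHom_def' _ _)).trans
      (Category.assoc _ _ _))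
  ra_app d c c' := by
    exact (tt_alpha _ _ _).trans ((congrArg (· ≫ _) (MonoidalCategory.tensorHom_def _ _)).trans
      (Category.assoc _ _ _))

/-- The unitality of the tensor product of profunctors. -/
def tensLeft (X : Prof V A B) :
    (one PUnit).tens X ⟶ (X.resL (leftF B)).resR (leftF A) where
  app _ _ := (λ_ _).hom
  la_app d d' c := by
    exact (tt_lambda _).trans ((congrArg (· ≫ _) (MonoidalCategory.tensorHom_def' _ _)).trans
      (Category.assoc _ _ _))
  ra_app d c c' := by
    exact (tt_lambda _).trans ((congrArg (· ≫ _) (MonoidalCategory.tensorHom_def _ _)).trans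
      (Category.assoc _ _ _))

/-- The unitality of the tensor product of profunctors. -/
def tensRight (X : Prof V A B) :
    X.tens (one PUnit) ⟶ (X.resL (rightF B)).resR (rightF A) where
  app _ _ := (ρ_ _).hom
  la_app d d' c := by
    exact (tt_rho _).trans ((congrArg (· ≫ _) (MonoidalCategory.tensorHom_def' _ _)).trans
      (Category.assoc _ _ _))
  ra_app d c c' := by
    exact (tt_rho _).trans ((congrArg (· ≫ _) (MonoidalCategory.tensorHom_def _ _)).trans
      (Category.assoc _ _ _))


/-- The profunctor from the unit `V`-category to `Mᵒᵖ ⊗ M` with value `M(b, a)` at `(a, b)`. -/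
def ev (M : Type v) [EnrichedCategory V M] : Prof V PUnit.{v + 1} (Mᵒᵖ × M) where
  obj d _ := d.2 ⟶[V] d.1.unop
  la d d' _ := (α_ _ _ _).hom ≫ _ ◁ eComp V d.2 d'.2 d'.1.unop ≫ (β_ _ _).hom ≫
    eComp V d.2 d'.1.unop d.1.unop
  ra d _ _ := (ρ_ _).hom
  la_id d c := by
    change ((λ_ (𝟙_ V)).inv ≫ (eId V d.1.unop ⊗ₘ eId V d.2)) ▷ _ ≫ _ = _
    have h1 := eId_eComp V d.2 d.1.unop
    have h2 := eComp_eId V d.2 d.1.unop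
    trans ((λ_ (𝟙_ V)).inv ≫ eId V d.1.unop ▷ _) ▷ _ ≫ (α_ _ _ _).hom ≫
      _ ◁ (eId V d.2 ▷ _ ≫ eComp V d.2 d.2 d.1.unop) ≫ (β_ _ _).hom ≫
      eComp V d.2 d.1.unop d.1.unop
    · rw [MonoidalCategory.tensorHom_def]
      monoidal
    · rw [h1, comp_whiskerRight_assoc, associator_naturality_left_assoc, ← whisker_exchange_assoc,
        BraidedCategory.braiding_naturality_left_assoc, h2]
      simp
  ra_id d c := by
    change _ ◁ (𝟙 _) ≫ _ = _
    simp
  la_la d d' d'' c := by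
    refine two_la (e_assoc' V _ _ _ _).symm (lA'' := (β_ _ _).hom ≫ eComp V _ _ _)
      (e_assoc' V d.1 d'.1 d''.1 (op d.2)).symm ?_
    have h := e_assoc V d.2 d'.2 d''.1.unop d'.1.unop
    rw [MonoidalCategory.whiskerLeft_comp_assoc, ← h]
    exact comm_aux _ _
  ra_ra d c c' c'' := by
    change (ρ_ _).hom ▷ 𝟙_ V ≫ (ρ_ _).hom = _ ≫ _ ◁ (λ_ (𝟙_ V)).hom ≫ (ρ_ _).hom
    exact (triangle_assoc _ _ _).symm
  la_ra d d' c c' := by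
    change (_ ≫ _) ▷ 𝟙_ V ≫ (ρ_ _).hom = (α_ _ _ (𝟙_ V)).hom ≫ _ ◁ (ρ_ _).hom ≫ _
    rw [rightUnitor_naturality]
    simp

/-- The profunctor from `M ⊗ Mᵒᵖ` to the unit `V`-category with value `M(m, n)` at `(n, m)`. -/
def coev (M : Type v) [EnrichedCategory V M] : Prof V (M × Mᵒᵖ) PUnit.{v + 1} where
  obj _ c := c.2.unop ⟶[V] c.1
  la _ _ c := (λ_ _).hom
  ra _ c c' := (α_ _ _ _).inv ≫ eComp V c.2.unop c.1 c'.1 ▷ _ ≫ (β_ _ _).hom ≫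
    eComp V c'.2.unop c.2.unop c'.1
  la_id d c := by
    change (𝟙 _) ▷ _ ≫ _ = _
    simp
  ra_id d c := by
    change _ ◁ ((λ_ (𝟙_ V)).inv ≫ (eId V c.1 ⊗ₘ eId V c.2.unop)) ≫ _ = _
    have h1 := eId_eComp V c.2.unop c.1
    have h2 := eComp_eId V c.2.unop c.1
    trans _ ◁ ((λ_ (𝟙_ V)).inv ≫ _ ◁ eId V c.2.unop) ≫ (α_ _ _ _).inv ≫
      (_ ◁ eId V c.1 ≫ eComp V c.2.unop c.1 c.1) ▷ _ ≫ (β_ _ _).hom ≫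
      eComp V c.2.unop c.2.unop c.1
    · rw [MonoidalCategory.tensorHom_def']
      monoidal
    · rw [h2, MonoidalCategory.whiskerLeft_comp_assoc, associator_inv_naturality_right_assoc,
        whisker_exchange_assoc, BraidedCategory.braiding_naturality_right_assoc, h1]
      simp [unitors_inv_equal]
  la_la d d' d'' c := by
    change (λ_ (𝟙_ V)).hom ▷ _ ≫ (λ_ _).hom = (α_ (𝟙_ V) (𝟙_ V) _).hom ≫ 𝟙_ V ◁ (λ_ _).hom ≫ _
    simp
  ra_ra d c c' c'' := by
    refine two_ra (rA'' := eComp V c.2.unop c'.1 c''.1)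
      (rB'' := (β_ _ _).hom ≫ eComp V c'.2.unop c.2.unop c''.1)
      (e_assoc V _ _ _ _).symm (e_assoc V (op c''.1) c.2 c'.2 c''.2).symm ?_
    have h := e_assoc' V c'.2.unop c.2.unop c'.1 c''.1
    rw [comp_whiskerRight_assoc, ← h]
    exact comm_aux' _ _
  la_ra d d' c c' := by
    change (λ_ _).hom ▷ _ ≫ _ = (α_ (𝟙_ V) _ _).hom ≫ 𝟙_ V ◁ (_ ≫ _) ≫ (λ_ _).hom
    rw [leftUnitor_naturality]
    simp

variable [MonoidalClosed V] [HasColimitsOfSize.{v, v} V]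

/-- Composition with a restricted profunctor. -/
def push (F : Prof V D E) (H : EnrichedFunctor V D' D) (X : Prof V C' D') (Y : Prof V C D)
    (K : EnrichedFunctor V C' C) (θ : X ⟶ (Y.resL H).resR K) :
    (F.resR H).comp X ⟶ (F.comp Y).resR K :=
  lift _ _ _ (fun d e c => F.obj e (H.obj d) ◁ Hom.app θ d c ≫ inj F Y (H.obj d) e (K.obj c))
    (fun d d' e c => push_bal (θ.la_app d d' c)
      (inj_bal F Y (H.obj d) (H.obj d') e (K.obj c)))
    (fun d e e' c => by
      have h := inj_la F Y (H.obj d) e e' (K.obj c)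
      change _ = _ ◁ (_ ≫ _) ≫ (F.comp Y).la e e' (K.obj c)
      rw [MonoidalCategory.whiskerLeft_comp_assoc, h, ← whisker_exchange_assoc,
        associator_inv_naturality_right_assoc])
    (fun d e c c' => push_ra (θ.ra_app d c c') (inj_ra F Y (H.obj d) e (K.obj c) (K.obj c')))

end Prof

end ProV

namespace ProV
namespace Prof

variable {V : Type u} [Category.{v} V] [MonoidalCategory V] [SymmetricCategory V]
variable {A B C D E B' C' D' E' : Type v} [EnrichedCategory V A] [EnrichedCategory V B]
  [EnrichedCategory V C] [EnrichedCategory V D] [EnrichedCategory V E]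
  [EnrichedCategory V B'] [EnrichedCategory V C'] [EnrichedCategory V D'] [EnrichedCategory V E']

/-- A profunctor is its restriction along the identity. -/
def resId (F : Prof V C D) : F ⟶ F.resR (EnrichedFunctor.id V C) where
  app d c := 𝟙 _
  la_app d d' c := by
    change F.la d d' c ≫ 𝟙 _ = _ ◁ 𝟙 _ ≫ F.la d d' c
    simp
  ra_app d c c' := by
    change F.ra d c c' ≫ 𝟙 _ = 𝟙 _ ▷ _ ≫ _ ◁ 𝟙 _ ≫ F.ra d c c'
    simp

/-- The tensor product of maps of profunctors, over a tensor product of `V`-functors. -/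
def tensHomRes {F : Prof V C D} {F' : Prof V B D} {G : Prof V C' D'} {G' : Prof V B' D'}
    {K : EnrichedFunctor V C B} {L : EnrichedFunctor V C' B'} (f : F ⟶ F'.resR K)
    (g : G ⟶ G'.resR L) : F.tens G ⟶ (F'.tens G').resR (prodF K L) where
  app d c := f.app d.1 c.1 ⊗ₘ g.app d.2 c.2
  la_app d d' c := (tensHom f g).la_app d d' c
  ra_app d c c' := by
    refine ((tensHom f g).ra_app d c c').trans ?_
    exact congrArg _ (tt_right _ _ _ _).symm

variable [MonoidalClosed V] [HasColimitsOfSize.{v, v} V]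

/-- Composition with a map of profunctors over a `V`-functor. -/
def compRes (F : Prof V D E) {X : Prof V C D} {Y : Prof V B D} {K : EnrichedFunctor V C B}
    (θ : X ⟶ Y.resR K) : F.comp X ⟶ (F.comp Y).resR K :=
  lift _ _ _ (fun d e c => F.obj e d ◁ Hom.app θ d c ≫ inj F Y d e (K.obj c))
    (fun d d' e c => by
      have h := push_bal (h := 𝟙 (d ⟶[V] d')) (r := F.ra e d d')
        ((θ.la_app d d' c).trans (by rw [id_whiskerRight, Category.id_comp]))
        (inj_bal F Y d d' e (K.obj c))
      rwa [MonoidalCategory.whiskerLeft_id, Category.id_comp] at h)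
    (fun d e e' c => by
      have h := inj_la F Y d e e' (K.obj c)
      change _ = _ ◁ (_ ≫ _) ≫ (F.comp Y).la e e' (K.obj c)
      rw [MonoidalCategory.whiskerLeft_comp_assoc, h, ← whisker_exchange_assoc,
        associator_inv_naturality_right_assoc])
    (fun d e c c' => push_ra (θ.ra_app d c c') (inj_ra F Y d e (K.obj c) (K.obj c')))

section conv

variable {B₁ B₂ B₃ : Type v} [EnrichedCategory V B₁] [EnrichedCategory V B₂]
  [EnrichedCategory V B₃]
variable {B₁' B₂' : Type v} [EnrichedCategory V B₁'] [EnrichedCategory V B₂']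
variable (M : Prof V (A × A) A) (U : Prof V PUnit.{v + 1} A)

/-- The tree with root `M` and with branches `F` and `G`. -/
abbrev conv (F : Prof V B₁ A) (G : Prof V B₂ A) : Prof V (B₁ × B₂) A := M.comp (F.tens G)

/-- The effect on trees of maps of the branches. -/
def convHom {F F' : Prof V B₁ A} {G G' : Prof V B₂ A} (f : F ⟶ F') (g : G ⟶ G') :
    conv M F G ⟶ conv M F' G' := hcomp (𝟙 M) (tensHom f g)

/-- The effect on trees of maps of the branches over `V`-functors. -/
def convHomRes {F : Prof V B₁ A} {F' : Prof V B₁' A} {G : Prof V B₂ A} {G' : Prof V B₂' A}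
    {K : EnrichedFunctor V B₁ B₁'} {L : EnrichedFunctor V B₂ B₂'} (f : F ⟶ F'.resR K)
    (g : G ⟶ G'.resR L) : conv M F G ⟶ (conv M F' G').resR (prodF K L) :=
  compRes M (tensHomRes f g)

variable {M U}

/-- A map `M • (M ⊗ 1) ⟶ M • (1 ⊗ M)`, applied at the root of a tree. -/
def alphaAt (a : conv M M (one A) ⟶ (conv M (one A) M).resR (assocF A A A))
    (F : Prof V B₁ A) (G : Prof V B₂ A) (H : Prof V B₃ A) :
    conv M (conv M F G) H ⟶ (conv M F (conv M G H)).resR (assocF B₁ B₂ B₃) :=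
  hcomp (𝟙 M) (tensHom (𝟙 (conv M F G)) (lu' H) ≫ ix' M (F.tens G) (one A) H) ≫
    as' M (M.tens (one A)) ((F.tens G).tens H) ≫
    hcomp a (𝟙 _) ≫
    push (conv M (one A) M) (assocF A A A) _ (F.tens (G.tens H)) (assocF B₁ B₂ B₃)
      (tensAssoc F G H) ≫
    resRHom (as M ((one A).tens M) (F.tens (G.tens H)) ≫
      hcomp (𝟙 M) (ix (one A) F M (G.tens H) ≫ tensHom (lu F) (𝟙 (conv M G H)))) _

/-- A map `M • (U ⊗ 1) ⟶ 1`, applied at the root of a tree. -/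
def lambdaAt (l : conv M U (one A) ⟶ (one A).resR (leftF A)) (F : Prof V B₁ A) :
    conv M U F ⟶ F.resR (leftF B₁) :=
  hcomp (𝟙 M) (tensHom (ru' U) (lu' F) ≫ ix' U (one PUnit) (one A) F) ≫
    as' M (U.tens (one A)) ((one PUnit).tens F) ≫
    hcomp l (𝟙 _) ≫
    push (one A) (leftF A) _ F (leftF B₁) (tensLeft F) ≫
    resRHom (lu F) _

/-- A map `M • (1 ⊗ U) ⟶ 1`, applied at the root of a tree. -/
def rhoAt (r : conv M (one A) U ⟶ (one A).resR (rightF A)) (F : Prof V B₁ A) :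
    conv M F U ⟶ F.resR (rightF B₁) :=
  hcomp (𝟙 M) (tensHom (lu' F) (ru' U) ≫ ix' (one A) F U (one PUnit)) ≫
    as' M ((one A).tens U) (F.tens (one PUnit)) ≫
    hcomp r (𝟙 _) ≫
    push (one A) (rightF A) _ F (rightF B₁) (tensRight F) ≫
    resRHom (lu F) _

/-- A map `T • M ⟶ M • (T ⊗ T)`, applied at the root of a tree. -/
def tauAt {T : Prof V A A} (τ : T.comp M ⟶ conv M T T) (F : Prof V B₁ A) (G : Prof V B₂ A) :
    T.comp (conv M F G) ⟶ conv M (T.comp F) (T.comp G) :=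
  as' T M (F.tens G) ≫ hcomp τ (𝟙 _) ≫ as M (T.tens T) (F.tens G) ≫ hcomp (𝟙 M) (ix T F T G)

end conv

/-- The data of a probimonad: an endo-profunctor `T` of `A` with a multiplication `μ` and a unit
`η`, profunctors `M : A ⊗ A ⇸ A` and `U : * ⇸ A` with associativity and unitality maps `α`, `l`,
`r`, and maps `τ`, `ν` that let `T` pass through `M` and `U`. -/
@[ext]
structure ProbimonadData (T : Prof V A A) (M : Prof V (A × A) A) (U : Prof V PUnit.{v + 1} A) where
  μ : T.comp T ⟶ T
  η : one A ⟶ T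
  τ : T.comp M ⟶ conv M T T
  ν : T.comp U ⟶ U
  α : conv M M (one A) ⟶ (conv M (one A) M).resR (assocF A A A)
  l : conv M U (one A) ⟶ (one A).resR (leftF A)
  r : conv M (one A) U ⟶ (one A).resR (rightF A)

/-- The axioms of a probimonad. -/
structure ProbimonadData.IsProbimonad {T : Prof V A A} {M : Prof V (A × A) A}
    {U : Prof V PUnit.{v + 1} A} (S : ProbimonadData T M U) : Prop where
  /-- `T` is a promonad -/
  mu_assoc : hcomp S.μ (𝟙 T) ≫ S.μ = as T T T ≫ hcomp (𝟙 T) S.μ ≫ S.μ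
  eta_mu : hcomp S.η (𝟙 T) ≫ S.μ = lu T
  mu_eta : hcomp (𝟙 T) S.η ≫ S.μ = ru T
  /-- `(M, U)` is a promonoidal structure -/
  alpha_iso : IsIso S.α
  l_iso : IsIso S.l
  r_iso : IsIso S.r
  /-- stated for the components, since the targets are restrictions along different composites of
  associators of `A` with the same effect on objects -/
  pentagon : ∀ a x,
    (alphaAt S.α (conv M (one A) (one A)) (one A) (one A) ≫
      resRHom (alphaAt S.α (one A) (one A) (conv M (one A) (one A))) _).app a x =
    (convHomRes M (alphaAt S.α (one A) (one A) (one A)) (resId (one A)) ≫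
      resRHom (alphaAt S.α (one A) (conv M (one A) (one A)) (one A) ≫
        resRHom (convHomRes M (resId (one A)) (alphaAt S.α (one A) (one A) (one A))) _) _).app a x
  triangle : ∀ a x,
    (alphaAt S.α (one A) U (one A) ≫ resRHom (convHomRes M (resId (one A)) S.l) _).app a x =
      (convHomRes M S.r (resId (one A))).app a x
  /-- `τ` and `ν` are compatible with the promonad structure -/
  mu_tau : hcomp S.μ (𝟙 M) ≫ S.τ =
    as T T M ≫ hcomp (𝟙 T) S.τ ≫ tauAt S.τ T T ≫ convHom M S.μ S.μ
  eta_tau : hcomp S.η (𝟙 M) ≫ S.τ =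
    lu M ≫ ru' M ≫ hcomp (𝟙 M) (oneProd A A) ≫ convHom M S.η S.η
  mu_nu : hcomp S.μ (𝟙 U) ≫ S.ν = as T T U ≫ hcomp (𝟙 T) S.ν ≫ S.ν
  eta_nu : hcomp S.η (𝟙 U) ≫ S.ν = lu U
  /-- `τ` and `ν` are compatible with the promonoidal structure -/
  tau_alpha : tauAt S.τ M (one A) ≫ convHom M S.τ (ru T) ≫ alphaAt S.α T T T =
    compRes T S.α ≫ resRHom (tauAt S.τ (one A) M ≫ convHom M (ru T) S.τ) _
  tau_l : tauAt S.τ U (one A) ≫ convHom M S.ν (ru T) ≫ lambdaAt S.l T =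
    compRes T S.l ≫ resRHom (ru T) _
  tau_r : tauAt S.τ (one A) U ≫ convHom M (ru T) S.ν ≫ rhoAt S.r T =
    compRes T S.r ≫ resRHom (ru T) _

end Prof

end ProV

namespace ProV

section Two

variable {V : Type u} [Category.{v} V] [MonoidalCategory V] [SymmetricCategory V]

theorem mu_braid (X X' Y Y' : V) :
    tensorμ X X' Y Y' ≫ ((β_ X Y).hom ⊗ₘ (β_ X' Y').hom) =
      (β_ (X ⊗ X') (Y ⊗ Y')).hom ≫ tensorμ Y Y' X X' := by
  simp [tensorμ, SymmetricCategory.braiding_swap_eq_inv_braiding X Y',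
    MonoidalCategory.tensorHom_def]

theorem tt_braid {X Y Z X' Y' Z' : V} (f : Y ⊗ X ⟶ Z) (f' : Y' ⊗ X' ⟶ Z') :
    tt ((β_ X Y).hom ≫ f) ((β_ X' Y').hom ≫ f') = (β_ _ _).hom ≫ tt f f' := by
  rw [tt, tt, ← tensorHom_comp_tensorHom, reassoc_of% mu_braid]

/-- Exchange of the last two factors. -/
def sw (X Y Z : V) : (X ⊗ Y) ⊗ Z ⟶ (X ⊗ Z) ⊗ Y :=
  (α_ _ _ _).hom ≫ X ◁ (β_ _ _).hom ≫ (α_ _ _ _).inv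

theorem sw_mu (X Y Z X' Y' Z' : V) :
    tensorμ X X' Y Y' ▷ (Z ⊗ Z') ≫ tensorμ (X ⊗ Y) (X' ⊗ Y') Z Z' ≫ (sw X Y Z ⊗ₘ sw X' Y' Z') =
      sw (X ⊗ X') (Y ⊗ Y') (Z ⊗ Z') ≫ tensorμ X X' Z Z' ▷ (Y ⊗ Y') ≫
        tensorμ (X ⊗ Z) (X' ⊗ Z') Y Y' := by
  have h1 := tensor_associativity X X' Y Y' Z Z'
  have h2 := tensor_associativity X X' Z Z' Y Y'
  have h3 := mu_braid Y Y' Z Z'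
  have h4 : (α_ (X ⊗ X') (Z ⊗ Z') (Y ⊗ Y')).inv ≫ tensorμ X X' Z Z' ▷ (Y ⊗ Y') ≫
      tensorμ (X ⊗ Z) (X' ⊗ Z') Y Y' = (X ⊗ X') ◁ tensorμ Z Z' Y Y' ≫
        tensorμ X X' (Z ⊗ Y) (Z' ⊗ Y') ≫ ((α_ _ _ _).inv ⊗ₘ (α_ _ _ _).inv) := by
    rw [Iso.inv_comp_eq, ← reassoc_of% h2, tensorHom_comp_tensorHom, Iso.hom_inv_id,
      Iso.hom_inv_id, id_tensorHom_id, Category.comp_id]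
  simp only [sw, Category.assoc]
  rw [h4, ← tensorHom_comp_tensorHom, reassoc_of% h1, ← tensorHom_comp_tensorHom,
    ← MonoidalCategory.whiskerLeft_comp_assoc, ← h3, MonoidalCategory.whiskerLeft_comp_assoc,
    tensorμ_natural_right_assoc]

theorem tt_sw {X Y Z W W₂ P X' Y' Z' W' W₂' P' : V}
    {f : X ⊗ Y ⟶ W} {g : W ⊗ Z ⟶ P} {h : X ⊗ Z ⟶ W₂} {k : W₂ ⊗ Y ⟶ P}
    {f' : X' ⊗ Y' ⟶ W'} {g' : W' ⊗ Z' ⟶ P'} {h' : X' ⊗ Z' ⟶ W₂'} {k' : W₂' ⊗ Y' ⟶ P'}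
    (e : f ▷ Z ≫ g = sw _ _ _ ≫ h ▷ Y ≫ k) (e' : f' ▷ Z' ≫ g' = sw _ _ _ ≫ h' ▷ Y' ≫ k') :
    tt f f' ▷ (Z ⊗ Z') ≫ tt g g' = sw _ _ _ ≫ tt h h' ▷ (Y ⊗ Y') ≫ tt k k' := by
  have := sw_mu X Y Z X' Y' Z'
  simp only [tt, comp_whiskerRight, Category.assoc, tensorμ_natural_left_assoc,
    tensorHom_comp_tensorHom, e, e']
  simp only [← tensorHom_comp_tensorHom, reassoc_of% this]

theorem sw_unit {X Y W : V} (f : X ⊗ Y ⟶ W) :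
    f ▷ 𝟙_ V ≫ (ρ_ W).hom = sw _ _ _ ≫ (ρ_ X).hom ▷ Y ≫ f := by
  rw [rightUnitor_naturality, sw]
  simp

theorem assoc_unit {X Y W : V} (f : X ⊗ Y ⟶ W) :
    f ▷ 𝟙_ V ≫ (ρ_ W).hom = (α_ _ _ _).hom ≫ X ◁ (ρ_ Y).hom ≫ f := by
  rw [rightUnitor_naturality]
  simp

theorem tt_nat {X₁ X₂ Y₁ Y₂ U₁ U₂ V₁ V₂ Z Z' : V} (a : X₁ ⟶ Y₁) (b : X₂ ⟶ Y₂) (c : U₁ ⟶ V₁)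
    (d : U₂ ⟶ V₂) (f : Y₁ ⊗ V₁ ⟶ Z) (f' : Y₂ ⊗ V₂ ⟶ Z') :
    ((a ⊗ₘ b) ⊗ₘ (c ⊗ₘ d)) ≫ tt f f' = tt ((a ⊗ₘ c) ≫ f) ((b ⊗ₘ d) ≫ f') := by
  rw [tt, tensorμ_natural_assoc, tensorHom_comp_tensorHom, tt]

theorem sect_left {W₁ W₂ W X Y Z : V} {u : 𝟙_ V ⟶ W₁} {u' : 𝟙_ V ⟶ W₂} {m : W₁ ⊗ W₂ ⟶ W}
    {w : 𝟙_ V ⟶ W} (h : (u ⊗ₘ u') ≫ m = (λ_ _).hom ≫ w) (f : X ⊗ Y ⟶ Z) :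
    ((λ_ _).inv ≫ u ▷ X ⊗ₘ (λ_ _).inv ≫ u' ▷ Y) ≫ tt m f = f ≫ (λ_ _).inv ≫ w ▷ Z := by
  have h1 : (u ▷ X ⊗ₘ u' ▷ Y) ≫ tt m f = tt (λ_ (𝟙_ V)).hom f ≫ w ▷ Z := by
    rw [← tensorHom_id, ← tensorHom_id, ← tensorHom_id, tt_nat, h, tt_comp, id_tensorHom_id,
      Category.id_comp, Category.comp_id]
  rw [← tensorHom_comp_tensorHom, Category.assoc, h1, ← Category.assoc, ← Category.assoc]
  congr 1
  rw [Iso.eq_comp_inv, Category.assoc, tt_lambda, tensorHom_comp_tensorHom_assoc,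
      Iso.inv_hom_id, Iso.inv_hom_id, id_tensorHom_id, Category.id_comp]

theorem sect_right {W₁ W₂ W X Y Z : V} {u : 𝟙_ V ⟶ W₁} {u' : 𝟙_ V ⟶ W₂} {m : W₁ ⊗ W₂ ⟶ W}
    {w : 𝟙_ V ⟶ W} (h : (u ⊗ₘ u') ≫ m = (λ_ _).hom ≫ w) (f : X ⊗ Y ⟶ Z) :
    ((ρ_ _).inv ≫ X ◁ u ⊗ₘ (ρ_ _).inv ≫ Y ◁ u') ≫ tt f m = f ≫ (ρ_ _).inv ≫ Z ◁ w := by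
  have h1 : (X ◁ u ⊗ₘ Y ◁ u') ≫ tt f m = tt f (λ_ (𝟙_ V)).hom ≫ Z ◁ w := by
    rw [← id_tensorHom, ← id_tensorHom, ← id_tensorHom, tt_nat, h, tt_comp, id_tensorHom_id,
      Category.id_comp, Category.comp_id]
  rw [← tensorHom_comp_tensorHom, Category.assoc, h1, ← Category.assoc, ← Category.assoc]
  congr 1
  rw [Iso.eq_comp_inv, Category.assoc, tt_rho, tensorHom_comp_tensorHom_assoc,
      Iso.inv_hom_id, Iso.inv_hom_id, id_tensorHom_id, Category.id_comp]

theorem sect_mixed {W W' X Y : V} {u : 𝟙_ V ⟶ W} {u' : 𝟙_ V ⟶ W'} {m : W ⊗ Y ⟶ Y}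
    {m' : X ⊗ W' ⟶ X} (h : u ▷ Y ≫ m = (λ_ _).hom) (h' : X ◁ u' ≫ m' = (ρ_ _).hom) :
    ((λ_ _).inv ≫ u ▷ X ⊗ₘ (ρ_ _).inv ≫ Y ◁ u') ≫ tt m m' = (β_ _ _).hom := by
  have h1 : (u ▷ X ⊗ₘ Y ◁ u') ≫ tt m m' = tt (λ_ Y).hom (ρ_ X).hom := by
    rw [← tensorHom_id, ← id_tensorHom, tt_nat, tensorHom_id, id_tensorHom, h, h']
  rw [← tensorHom_comp_tensorHom, Category.assoc, h1, tt, tensorμ]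
  monoidal

theorem sect_mixed' {W W' X Y : V} {u : 𝟙_ V ⟶ W} {u' : 𝟙_ V ⟶ W'} {m : Y ⊗ W ⟶ Y}
    {m' : W' ⊗ X ⟶ X} (h : Y ◁ u ≫ m = (ρ_ _).hom) (h' : u' ▷ X ≫ m' = (λ_ _).hom) :
    ((ρ_ _).inv ≫ Y ◁ u' ⊗ₘ (λ_ _).inv ≫ u ▷ X) ≫ tt m m' = 𝟙 _ := by
  have h1 : (Y ◁ u' ⊗ₘ u ▷ X) ≫ tt m m' = tt (ρ_ Y).hom (λ_ X).hom := by
    rw [← tensorHom_id, ← id_tensorHom, tt_nat, tensorHom_id, id_tensorHom, h, h']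
  rw [← tensorHom_comp_tensorHom, Category.assoc, h1, tt, tensorμ, braiding_tensorUnit_left]
  monoidal

theorem map_sect {A B C A' B' C' Y₁ Y₂ : V} {c : A ⊗ B ⟶ C} {F₁ : A ⟶ A'} {F₂ : B ⟶ B'}
    {F₃ : C ⟶ C'} {c' : A' ⊗ B' ⟶ C'} {a : Y₁ ⟶ A} {b : Y₂ ⟶ B} {k : Y₁ ⊗ Y₂ ⟶ C}
    (h : c ≫ F₃ = (F₁ ⊗ₘ F₂) ≫ c') (h' : (a ⊗ₘ b) ≫ c = k) :
    (a ≫ F₁ ⊗ₘ b ≫ F₂) ≫ c' = k ≫ F₃ := by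
  rw [← tensorHom_comp_tensorHom, Category.assoc, ← h, ← Category.assoc, h']

theorem act_exchange {P Q Q' R A B A₁ B₁ A₂ B₂ T : V} {r : P ⊗ A₁ ⟶ Q} {r' : Q ⊗ B₁ ⟶ R}
    {s : P ⊗ B₂ ⟶ Q'} {s' : Q' ⊗ A₂ ⟶ R} {t : P ⊗ T ⟶ R} {c : A₁ ⊗ B₁ ⟶ T} {c' : B₂ ⊗ A₂ ⟶ T}
    {a : A ⟶ A₁} {b : B ⟶ B₁} {a' : A ⟶ A₂} {b' : B ⟶ B₂}
    (h : r ▷ B₁ ≫ r' = (α_ _ _ _).hom ≫ P ◁ c ≫ t)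
    (h' : s ▷ A₂ ≫ s' = (α_ _ _ _).hom ≫ P ◁ c' ≫ t)
    (e : (a ⊗ₘ b) ≫ c = (β_ _ _).hom ≫ (b' ⊗ₘ a') ≫ c') :
    (P ◁ a ≫ r) ▷ B ≫ Q ◁ b ≫ r' = sw _ _ _ ≫ (P ◁ b' ≫ s) ▷ A ≫ Q' ◁ a' ≫ s' := by
  trans (α_ _ _ _).hom ≫ P ◁ ((a ⊗ₘ b) ≫ c) ≫ t
  · rw [comp_whiskerRight_assoc, ← whisker_exchange_assoc, h, MonoidalCategory.tensorHom_def]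
    monoidal
  · rw [e, comp_whiskerRight_assoc, ← whisker_exchange_assoc, h', MonoidalCategory.tensorHom_def,
      sw]
    monoidal

theorem glue_left {H P Q R W W' T : V} {u : W ⟶ W'} {a : H ⊗ P ⟶ Q} {b : Q ⊗ W' ⟶ T}
    {b' : P ⊗ W' ⟶ R} {a' : H ⊗ R ⟶ T} (h : a ▷ W' ≫ b = (α_ _ _ _).hom ≫ H ◁ b' ≫ a') :
    ((α_ _ _ _).inv ≫ a ▷ W) ≫ Q ◁ u ≫ b = H ◁ (P ◁ u ≫ b') ≫ a' := by
  rw [Category.assoc, ← whisker_exchange_assoc, h]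
  monoidal

theorem glue_right {H P Q R W W' T : V} {u : W ⟶ W'} {a : P ⊗ H ⟶ Q} {b : Q ⊗ W' ⟶ T}
    {b' : P ⊗ W' ⟶ R} {a' : R ⊗ H ⟶ T} (h : a ▷ W' ≫ b = sw _ _ _ ≫ b' ▷ H ≫ a') :
    (sw _ _ _ ≫ a ▷ W) ≫ Q ◁ u ≫ b = (P ◁ u ≫ b') ▷ H ≫ a' := by
  have h' : sw P W H ≫ (P ⊗ H) ◁ u ≫ sw P H W' = (P ◁ u) ▷ H := by
    have h0 : (β_ W H).hom ≫ H ◁ u ≫ (β_ H W').hom = u ▷ H := by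
      rw [BraidedCategory.braiding_naturality_right, SymmetricCategory.symmetry_assoc]
    trans (α_ _ _ _).hom ≫ P ◁ u ▷ H ≫ (α_ _ _ _).inv
    · rw [sw, sw, ← h0]
      monoidal
    · monoidal
  rw [Category.assoc, ← whisker_exchange_assoc, h, reassoc_of% h', comp_whiskerRight_assoc]

end Two

section Functors

variable {V : Type u} [Category.{v} V] [MonoidalCategory V] [SymmetricCategory V]
variable {C D E : Type v} [EnrichedCategory V C] [EnrichedCategory V D] [EnrichedCategory V E]

/-- The opposite of a `V`-functor. -/
def opF (F : EnrichedFunctor V C D) : EnrichedFunctor V Cᵒᵖ Dᵒᵖ where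
  obj X := op (F.obj X.unop)
  map X Y := F.map Y.unop X.unop
  map_id X := F.map_id X.unop
  map_comp X Y Z := by
    change ((β_ _ _).hom ≫ eComp V _ _ _) ≫ _ = _ ≫ (β_ _ _).hom ≫ eComp V _ _ _
    rw [Category.assoc, F.map_comp]
    exact (BraidedCategory.braiding_naturality_assoc _ _ _).symm

/-- The tensor product commutes with opposites. -/
def opProd (C D : Type v) [EnrichedCategory V C] [EnrichedCategory V D] :
    EnrichedFunctor V (Cᵒᵖ × Dᵒᵖ) (C × D)ᵒᵖ where
  obj X := op (X.1.unop, X.2.unop)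
  map X Y := 𝟙 _
  map_id X := by exact Category.comp_id _
  map_comp X Y Z := by
    change tt ((β_ _ _).hom ≫ eComp V Z.1.unop Y.1.unop X.1.unop)
      ((β_ _ _).hom ≫ eComp V Z.2.unop Y.2.unop X.2.unop) ≫ 𝟙 _ = (𝟙 _ ⊗ₘ 𝟙 _) ≫ (β_ _ _).hom ≫
        tt (eComp V Z.1.unop Y.1.unop X.1.unop) (eComp V Z.2.unop Y.2.unop X.2.unop)
    rw [tt_braid, id_tensorHom_id, Category.comp_id, Category.id_comp]

/-- A `V`-functor of two variables with the first variable fixed. -/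
def sectL (F : EnrichedFunctor V (C × D) E) (X : C) : EnrichedFunctor V D E where
  obj Y := F.obj (X, Y)
  map Y Y' := ((λ_ _).inv ≫ eId V X ▷ _) ≫ F.map (X, Y) (X, Y')
  map_id Y := by
    rw [← F.map_id]
    change _ = ((λ_ (𝟙_ V)).inv ≫ (eId V X ⊗ₘ eId V Y)) ≫ _
    rw [Category.assoc, leftUnitor_inv_naturality_assoc, whisker_exchange_assoc, MonoidalCategory.tensorHom_def]
    simp
  map_comp Y Y' Y'' := by
    have h : (eId V X ⊗ₘ eId V X) ≫ eComp V X X X = (λ_ _).hom ≫ eId V X := by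
      rw [MonoidalCategory.tensorHom_def', Category.assoc, eId_eComp, leftUnitor_naturality]
    exact (Category.assoc _ _ _).symm.trans (map_sect (F.map_comp (X, Y) (X, Y') (X, Y''))
      (sect_left h (eComp V Y Y' Y''))).symm

/-- A `V`-functor of two variables with the second variable fixed. -/
def sectR (F : EnrichedFunctor V (C × D) E) (Y : D) : EnrichedFunctor V C E where
  obj X := F.obj (X, Y)
  map X X' := ((ρ_ _).inv ≫ _ ◁ eId V Y) ≫ F.map (X, Y) (X', Y)
  map_id X := by
    rw [← F.map_id]
    change _ = ((λ_ (𝟙_ V)).inv ≫ (eId V X ⊗ₘ eId V Y)) ≫ _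
    rw [Category.assoc, rightUnitor_inv_naturality_assoc, ← whisker_exchange_assoc, MonoidalCategory.tensorHom_def']
    simp [unitors_inv_equal]
  map_comp X X' X'' := by
    have h : (eId V Y ⊗ₘ eId V Y) ≫ eComp V Y Y Y = (λ_ _).hom ≫ eId V Y := by
      rw [MonoidalCategory.tensorHom_def', Category.assoc, eId_eComp, leftUnitor_naturality]
    exact (Category.assoc _ _ _).symm.trans (map_sect (F.map_comp (X, Y) (X', Y) (X'', Y))
      (sect_right h (eComp V X X' X''))).symm

theorem sect_exchange (F : EnrichedFunctor V (C × D) E) (X X' : C) (Y Y' : D) :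
    ((sectL F X).map Y Y' ⊗ₘ (sectR F Y').map X X') ≫ eComp V _ _ _ =
      (β_ _ _).hom ≫ ((sectR F Y).map X X' ⊗ₘ (sectL F X').map Y Y') ≫ eComp V _ _ _ := by
  have h1 := map_sect (F.map_comp (X, Y) (X, Y') (X', Y'))
    (sect_mixed (eId_eComp V X X') (eComp_eId V Y Y'))
  have h2 := map_sect (F.map_comp (X, Y) (X', Y) (X', Y'))
    (sect_mixed' (eComp_eId V X X') (eId_eComp V Y Y'))
  exact h1.trans (congrArg _ (h2.trans (Category.id_comp _)).symm)

end Functors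

namespace Prof

variable {V : Type u} [Category.{v} V] [MonoidalCategory V] [SymmetricCategory V]
variable {C X Y Z W X' Y' : Type v} [EnrichedCategory V C] [EnrichedCategory V X]
  [EnrichedCategory V Y] [EnrichedCategory V Z] [EnrichedCategory V W]
  [EnrichedCategory V X'] [EnrichedCategory V Y']

theorem sect_ra (P : Prof V X X') (F : EnrichedFunctor V (C × Z) X) (d : X') (x x' : C) (z z' : Z) :
    (P.resR (sectL F x)).ra d z z' ▷ _ ≫ (P.resR (sectR F z')).ra d x x' =
      sw _ _ _ ≫ (P.resR (sectR F z)).ra d x x' ▷ _ ≫ (P.resR (sectL F x')).ra d z z' :=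
  act_exchange (P.ra_ra d (F.obj (x, z)) (F.obj (x, z')) (F.obj (x', z')))
    (P.ra_ra d (F.obj (x, z)) (F.obj (x', z)) (F.obj (x', z'))) (sect_exchange F x x' z z')

variable [MonoidalClosed V] [HasColimitsOfSize.{v, v} V]

/-- The diagram whose pointwise colimit is the coend below. -/
def glue₂ (P : Prof V X X') (Q : Prof V Y Y') (F : EnrichedFunctor V (Cᵒᵖ × Z) X)
    (G : EnrichedFunctor V (C × W) Y) : Glue (V := V) (Z × W) (X' × Y') where
  ι := C
  ρ := C × C
  K x := (P.resR (sectL F (op x))).tens (Q.resR (sectL G x))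
  R j d c := (P.obj d.1 (F.obj (op j.2, c.1)) ⊗ Q.obj d.2 (G.obj (j.1, c.2))) ⊗ (j.1 ⟶[V] j.2)
  s := Prod.fst
  t := Prod.snd
  l j d c := _ ◁ (ρ_ _).inv ≫ tt ((P.resR (sectR F c.1)).ra d.1 (op j.2) (op j.1)) (ρ_ _).hom
  r j d c := _ ◁ (λ_ _).inv ≫ tt (ρ_ _).hom ((Q.resR (sectR G c.2)).ra d.2 j.1 j.2)
  Rl j d d' c := (α_ _ _ _).inv ≫ tt (P.la d.1 d'.1 _) (Q.la d.2 d'.2 _) ▷ _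
  Rr j d c c' := sw _ _ _ ≫ tt ((P.resR (sectL F (op j.2))).ra d.1 c.1 c'.1)
    ((Q.resR (sectL G j.1)).ra d.2 c.2 c'.2) ▷ _
  ll j d d' c := glue_left (tt_assoc ((P.resR (sectR F c.1)).la_ra d.1 d'.1 (op j.2) (op j.1))
    (assoc_unit (Q.la d.2 d'.2 (G.obj (j.1, c.2)))))
  rl j d d' c := glue_left (tt_assoc (assoc_unit (P.la d.1 d'.1 (F.obj (op j.2, c.1))))
    ((Q.resR (sectR G c.2)).la_ra d.2 d'.2 j.1 j.2))
  lr j d c c' := glue_right (tt_sw (sect_ra P F d.1 (op j.2) (op j.1) c.1 c'.1)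
    (sw_unit ((Q.resR (sectL G j.1)).ra d.2 c.2 c'.2)))
  rr j d c c' := glue_right (tt_sw (sw_unit ((P.resR (sectL F (op j.2))).ra d.1 c.1 c'.1))
    (sect_ra Q G d.2 j.1 j.2 c.2 c'.2))

/-- The profunctor `∫ x, P(a, F(x, z)) ⊗ Q(b, G(x, w))`. -/
def coend₂ (P : Prof V X X') (Q : Prof V Y Y') (F : EnrichedFunctor V (Cᵒᵖ × Z) X)
    (G : EnrichedFunctor V (C × W) Y) : Prof V (Z × W) (X' × Y') := (glue₂ P Q F G).coend

end Prof

end ProV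

namespace ProV

section Points

variable {V : Type u} [Category.{v} V] [MonoidalCategory V] [SymmetricCategory V]
variable {C D E : Type v} [EnrichedCategory V C] [EnrichedCategory V D] [EnrichedCategory V E]

/-- Precomposition with a morphism `f : X ⟶ Y` of the underlying category. -/
def pre {X Y : C} (f : 𝟙_ V ⟶ (X ⟶[V] Y)) (Z : C) : (Y ⟶[V] Z) ⟶ (X ⟶[V] Z) :=
  (λ_ _).inv ≫ f ▷ _ ≫ eComp V X Y Z

/-- Postcomposition with a morphism `f : Y ⟶ Z` of the underlying category. -/
def post {Y Z : C} (f : 𝟙_ V ⟶ (Y ⟶[V] Z)) (X : C) : (X ⟶[V] Y) ⟶ (X ⟶[V] Z) :=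
  (ρ_ _).inv ≫ _ ◁ f ≫ eComp V X Y Z

/-- The image of two morphisms of the underlying categories under a `V`-functor of two variables. -/
def pmap (F : EnrichedFunctor V (C × D) E) {X X' : C} {Y Y' : D} (f : 𝟙_ V ⟶ (X ⟶[V] X'))
    (g : 𝟙_ V ⟶ (Y ⟶[V] Y')) : 𝟙_ V ⟶ (F.obj (X, Y) ⟶[V] F.obj (X', Y')) :=
  (λ_ (𝟙_ V)).inv ≫ (f ⊗ₘ g) ≫ F.map (X, Y) (X', Y')

/-- A `V`-natural isomorphism. -/
structure VNatIso (F G : EnrichedFunctor V C D) where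
  hom : ∀ X, 𝟙_ V ⟶ (F.obj X ⟶[V] G.obj X)
  inv : ∀ X, 𝟙_ V ⟶ (G.obj X ⟶[V] F.obj X)
  hom_inv : ∀ X, hom X ≫ post (inv X) _ = eId V _
  inv_hom : ∀ X, inv X ≫ post (hom X) _ = eId V _
  natural : ∀ X Y, F.map X Y ≫ post (hom Y) _ = G.map X Y ≫ pre (hom X) _

variable (V) in
/-- A monoidal structure on a `V`-category. -/
structure MonoidalStr (C : Type v) [EnrichedCategory V C] where
  tensor : EnrichedFunctor V (C × C) C
  unit : C
  assoc : VNatIso ((prodF tensor (EnrichedFunctor.id V C)).comp V tensor)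
    ((assocF C C C).comp V ((prodF (EnrichedFunctor.id V C) tensor).comp V tensor))
  left : VNatIso (sectL tensor unit) (EnrichedFunctor.id V C)
  right : VNatIso (sectR tensor unit) (EnrichedFunctor.id V C)
  pentagon : ∀ X Y Z W : C,
    assoc.hom ((tensor.obj (X, Y), Z), W) ≫ post (assoc.hom ((X, Y), tensor.obj (Z, W))) _ =
      pmap tensor (assoc.hom ((X, Y), Z)) (eId V W) ≫
        post (assoc.hom ((X, tensor.obj (Y, Z)), W)) _ ≫
        post (pmap tensor (eId V X) (assoc.hom ((Y, Z), W))) _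
  triangle : ∀ X Y : C,
    assoc.hom ((X, unit), Y) ≫ post (pmap tensor (eId V X) (left.hom Y)) _ =
      pmap tensor (right.hom X) (eId V Y)

/-- The structure of a left module over a monoidal `V`-category `C` on a `V`-category `M`. -/
structure ModuleStr {C : Type v} [EnrichedCategory V C] (S : MonoidalStr V C) (M : Type v)
    [EnrichedCategory V M] where
  act : EnrichedFunctor V (C × M) M
  assoc : VNatIso ((prodF S.tensor (EnrichedFunctor.id V M)).comp V act)
    ((assocF C C M).comp V ((prodF (EnrichedFunctor.id V C) act).comp V act))
  left : VNatIso (sectL act S.unit) (EnrichedFunctor.id V M)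
  pentagon : ∀ (X Y Z : C) (m : M),
    assoc.hom ((S.tensor.obj (X, Y), Z), m) ≫ post (assoc.hom ((X, Y), act.obj (Z, m))) _ =
      pmap act (S.assoc.hom ((X, Y), Z)) (eId V m) ≫
        post (assoc.hom ((X, S.tensor.obj (Y, Z)), m)) _ ≫
        post (pmap act (eId V X) (assoc.hom ((Y, Z), m))) _
  triangle : ∀ (X : C) (m : M),
    assoc.hom ((X, S.unit), m) ≫ post (pmap act (eId V X) (left.hom m)) _ =
      pmap act (S.right.hom X) (eId V m)

end Points

end ProV

namespace ProV

section Multiplication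

variable {V : Type u} [Category.{v} V] [MonoidalCategory V] [SymmetricCategory V]
variable (V) (M : Type v) [EnrichedCategory V M]

/-- The profunctor `(Mᵒᵖ ⊗ M) ⊗ (Mᵒᵖ ⊗ M) ⇸ Mᵒᵖ ⊗ M` with value
`M(m₁, a) ⊗ (M(m₂, n₁) ⊗ M(b, n₂))` at `((a, b), ((m₁, n₁), (m₂, n₂)))`. -/
def mulP : Prof V ((Mᵒᵖ × M) × (Mᵒᵖ × M)) (Mᵒᵖ × M) :=
  (((Prof.one Mᵒᵖ).tens ((Prof.coev M).tens (Prof.one M))).resL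
    (prodF (EnrichedFunctor.id V Mᵒᵖ) (leftF' M))).resR
    ((assocF Mᵒᵖ M (Mᵒᵖ × M)).comp V (prodF (EnrichedFunctor.id V Mᵒᵖ) (assocF' M Mᵒᵖ M)))

variable {V M}

/-- Composition in the opposite order. -/
def rComp (x y z : M) : (y ⟶[V] z) ⊗ (x ⟶[V] y) ⟶ (x ⟶[V] z) :=
  (β_ _ _).hom ≫ eComp V x y z

/-- Exchange of the first two factors. -/
def sw' (X Y Z : V) : X ⊗ (Y ⊗ Z) ⟶ Y ⊗ (X ⊗ Z) :=
  (α_ _ _ _).inv ≫ (β_ _ _).hom ▷ Z ≫ (α_ _ _ _).hom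

variable (V) in
/-- The pair of identities of `m` and of `n`. -/
def twoId (m n : M) : 𝟙_ V ⟶ (m ⟶[V] m) ⊗ (n ⟶[V] n) :=
  (λ_ (𝟙_ V)).inv ≫ (eId V m ⊗ₘ eId V n)

/-- Composition to the common target of the two sides of the associativity map. -/
def alphaComp (a b m₁ n₁ m₂ n₂ m₃ n₃ p q p' q' : M) :
    ((p ⟶[V] a) ⊗ ((p' ⟶[V] q) ⊗ (b ⟶[V] q'))) ⊗
      (((m₁ ⟶[V] p) ⊗ ((m₂ ⟶[V] n₁) ⊗ (q ⟶[V] n₂))) ⊗ ((m₃ ⟶[V] p') ⊗ (q' ⟶[V] n₃))) ⟶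
    (m₁ ⟶[V] a) ⊗ ((m₂ ⟶[V] n₁) ⊗ ((m₃ ⟶[V] n₂) ⊗ (b ⟶[V] n₃))) :=
  tensorμ _ _ _ _ ≫
    ((α_ _ _ _).inv ≫ rComp m₁ p a ▷ _ ⊗ₘ tt (rComp m₃ p' q) (eComp V b q' n₃)) ≫
    (α_ _ _ _).hom ≫ _ ◁ ((α_ _ _ _).hom ≫ _ ◁ ((α_ _ _ _).inv ≫ rComp m₃ q n₂ ▷ _))

/-- Insertion of identities. -/
def alphaExpand (a b m₁ n₁ m₂ n₂ m₃ n₃ : M) :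
    (m₁ ⟶[V] a) ⊗ ((m₂ ⟶[V] n₁) ⊗ ((m₃ ⟶[V] n₂) ⊗ (b ⟶[V] n₃))) ⟶
    ((m₁ ⟶[V] a) ⊗ ((m₂ ⟶[V] n₁) ⊗ (b ⟶[V] n₃))) ⊗
      (((m₁ ⟶[V] m₁) ⊗ (n₁ ⟶[V] n₁)) ⊗ ((m₂ ⟶[V] m₂) ⊗ ((m₃ ⟶[V] n₂) ⊗ (n₃ ⟶[V] n₃)))) :=
  _ ◁ (_ ◁ (β_ _ _).hom ≫ (α_ _ _ _).inv) ≫ (α_ _ _ _).inv ≫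
    _ ◁ ((λ_ _).inv ≫ (twoId V m₁ n₁ ⊗ₘ
      ((λ_ _).inv ≫ (eId V m₂ ⊗ₘ ((ρ_ _).inv ≫ _ ◁ eId V n₃)))))

/-- The component of the associativity map. -/
def alphaMap (a b m₁ n₁ m₂ n₂ m₃ n₃ p q p' q' : M) :
    ((p ⟶[V] a) ⊗ ((p' ⟶[V] q) ⊗ (b ⟶[V] q'))) ⊗
      (((m₁ ⟶[V] p) ⊗ ((m₂ ⟶[V] n₁) ⊗ (q ⟶[V] n₂))) ⊗ ((m₃ ⟶[V] p') ⊗ (q' ⟶[V] n₃))) ⟶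
    ((m₁ ⟶[V] a) ⊗ ((m₂ ⟶[V] n₁) ⊗ (b ⟶[V] n₃))) ⊗
      (((m₁ ⟶[V] m₁) ⊗ (n₁ ⟶[V] n₁)) ⊗ ((m₂ ⟶[V] m₂) ⊗ ((m₃ ⟶[V] n₂) ⊗ (n₃ ⟶[V] n₃)))) :=
  alphaComp a b m₁ n₁ m₂ n₂ m₃ n₃ p q p' q' ≫ alphaExpand a b m₁ n₁ m₂ n₂ m₃ n₃

/-- The component of the left unitality map. -/
def lambdaMap (a b m n p q p' q' : M) :
    ((p ⟶[V] a) ⊗ ((p' ⟶[V] q) ⊗ (b ⟶[V] q'))) ⊗ ((q ⟶[V] p) ⊗ ((m ⟶[V] p') ⊗ (q' ⟶[V] n))) ⟶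
    (m ⟶[V] a) ⊗ (b ⟶[V] n) :=
  tt (rComp q p a) (tt (rComp m p' q) (eComp V b q' n)) ≫ (α_ _ _ _).inv ≫ rComp m q a ▷ _

/-- The component of the right unitality map. -/
def rhoMap (a b m n p q p' q' : M) :
    ((p ⟶[V] a) ⊗ ((p' ⟶[V] q) ⊗ (b ⟶[V] q'))) ⊗ (((m ⟶[V] p) ⊗ (q ⟶[V] n)) ⊗ (q' ⟶[V] p')) ⟶
    (m ⟶[V] a) ⊗ (b ⟶[V] n) :=
  _ ◁ (α_ _ _ _).hom ≫ tt (rComp m p a) (tt (eComp V p' q n) (eComp V b q' p')) ≫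
    _ ◁ rComp b p' n

end Multiplication

namespace ModuleStr

variable {V : Type u} [Category.{v} V] [MonoidalCategory V] [SymmetricCategory V]
variable {C M : Type v} [EnrichedCategory V C] [EnrichedCategory V M]
variable {S : MonoidalStr V C} (L : ModuleStr S M)

/-- The `V`-functor `x ⊡ -`. -/
abbrev ac (x : C) : EnrichedFunctor V M M := sectL L.act x

/-- The component of the multiplication. -/
def muMap (x y : C) (a b m n p q : M) :
    (((L.ac x).obj p ⟶[V] a) ⊗ (b ⟶[V] (L.ac x).obj q)) ⊗
      (((L.ac y).obj m ⟶[V] p) ⊗ (q ⟶[V] (L.ac y).obj n)) ⟶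
    ((L.ac (S.tensor.obj (x, y))).obj m ⟶[V] a) ⊗ (b ⟶[V] (L.ac (S.tensor.obj (x, y))).obj n) :=
  tt (_ ◁ (L.ac x).map _ _ ≫ rComp _ _ _ ≫ pre (L.assoc.hom ((x, y), m)) a)
    (_ ◁ (L.ac x).map _ _ ≫ eComp V _ _ _ ≫ post (L.assoc.inv ((x, y), n)) b)

/-- The component of the unit. -/
def etaMap (a b m n : M) : (m ⟶[V] a) ⊗ (b ⟶[V] n) ⟶
    ((L.ac S.unit).obj m ⟶[V] a) ⊗ (b ⟶[V] (L.ac S.unit).obj n) :=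
  pre (L.left.hom m) a ⊗ₘ post (L.left.inv n) b

/-- The component of the map that lets `T` pass through `M`, without its insertion of identities. -/
def tauMap (x : C) (a b m₁ n₁ m₂ n₂ p q : M) :
    (((L.ac x).obj p ⟶[V] a) ⊗ (b ⟶[V] (L.ac x).obj q)) ⊗
      ((m₁ ⟶[V] p) ⊗ ((m₂ ⟶[V] n₁) ⊗ (q ⟶[V] n₂))) ⟶
    ((L.ac x).obj m₁ ⟶[V] a) ⊗
      (((L.ac x).obj m₂ ⟶[V] (L.ac x).obj n₁) ⊗ (b ⟶[V] (L.ac x).obj n₂)) :=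
  tensorμ _ _ _ _ ≫ ((_ ◁ (L.ac x).map m₁ p ≫ rComp _ _ _) ⊗ₘ
    (sw' _ _ _ ≫ ((L.ac x).map m₂ n₁ ⊗ₘ (_ ◁ (L.ac x).map q n₂ ≫ eComp V _ _ _))))

/-- The component of the map that lets `U` absorb `T`. -/
def nuMap (x : C) (a b m n : M) :
    (((L.ac x).obj m ⟶[V] a) ⊗ (b ⟶[V] (L.ac x).obj n)) ⊗ (n ⟶[V] m) ⟶ (b ⟶[V] a) :=
  (β_ _ _).hom ▷ _ ≫ (α_ _ _ _).hom ≫ _ ◁ (_ ◁ (L.ac x).map n m ≫ rComp _ _ _) ≫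
    eComp V b ((L.ac x).obj n) a

variable [MonoidalClosed V] [HasColimitsOfSize.{v, v} V]

/-- The profunctor `Mᵒᵖ ⊗ M ⇸ Mᵒᵖ ⊗ M` with value `∫ x, M(x ⊡ m, a) ⊗ M(b, x ⊡ n)` at
`((a, b), (m, n))`. -/
def T : Prof V (Mᵒᵖ × M) (Mᵒᵖ × M) :=
  Prof.coend₂ (Prof.one Mᵒᵖ) (Prof.one M) ((opProd C M).comp V (opF L.act)) L.act

/-- The coprojections of the coend. -/
def ιT (x : C) (a b m n : M) :
    (((L.ac x).obj m ⟶[V] a) ⊗ (b ⟶[V] (L.ac x).obj n)) ⟶ L.T.obj (op a, b) (op m, n) :=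
  (Prof.glue₂ (Prof.one Mᵒᵖ) (Prof.one M) ((opProd C M).comp V (opF L.act)) L.act).inj x
    (op a, b) (op m, n)

/-- The element of `T` given by `x` and the identities of `x ⊡ m` and `x ⊡ n`. -/
def idT (x : C) (m n : M) : 𝟙_ V ⟶ L.T.obj (op ((L.ac x).obj m), (L.ac x).obj n) (op m, n) :=
  twoId V _ _ ≫ L.ιT x _ _ m n

/-- The data `(T, μ, η)`, `(M, τ, U, ν)` and `(α, l, r)` are the canonical ones: their composites
with the coprojections of the coends are as prescribed. -/
structure IsCanonical (P : Prof.ProbimonadData L.T (mulP V M) (Prof.ev M)) : Prop where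
  mu : ∀ (x y : C) (a b m n p q : M),
    (L.ιT x a b p q ⊗ₘ L.ιT y p q m n) ≫ L.T.inj L.T (op p, q) (op a, b) (op m, n) ≫
        P.μ.app (op a, b) (op m, n) =
      L.muMap x y a b m n p q ≫ L.ιT _ a b m n
  eta : ∀ a b m n : M,
    P.η.app (op a, b) (op m, n) = L.etaMap a b m n ≫ L.ιT _ a b m n
  tau : ∀ (x : C) (a b m₁ n₁ m₂ n₂ p q : M),
    L.ιT x a b p q ▷ _ ≫
        L.T.inj (mulP V M) (op p, q) (op a, b) ((op m₁, n₁), (op m₂, n₂)) ≫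
        P.τ.app (op a, b) ((op m₁, n₁), (op m₂, n₂)) =
      L.tauMap x a b m₁ n₁ m₂ n₂ p q ≫ (ρ_ _).inv ≫
        _ ◁ ((λ_ (𝟙_ V)).inv ≫ (L.idT x m₁ n₁ ⊗ₘ L.idT x m₂ n₂)) ≫
        (mulP V M).inj (L.T.tens L.T)
          ((op ((L.ac x).obj m₁), (L.ac x).obj n₁), (op ((L.ac x).obj m₂), (L.ac x).obj n₂))
          (op a, b) ((op m₁, n₁), (op m₂, n₂))
  nu : ∀ (x : C) (a b m n : M),
    L.ιT x a b m n ▷ _ ≫ L.T.inj (Prof.ev M) (op m, n) (op a, b) PUnit.unit ≫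
        P.ν.app (op a, b) PUnit.unit =
      L.nuMap x a b m n
  alpha : ∀ a b m₁ n₁ m₂ n₂ m₃ n₃ p q p' q' : M,
    (mulP V M).inj ((mulP V M).tens (Prof.one (Mᵒᵖ × M))) ((op p, q), (op p', q')) (op a, b)
        (((op m₁, n₁), (op m₂, n₂)), (op m₃, n₃)) ≫
        P.α.app (op a, b) (((op m₁, n₁), (op m₂, n₂)), (op m₃, n₃)) =
      alphaMap a b m₁ n₁ m₂ n₂ m₃ n₃ p q p' q' ≫
        (mulP V M).inj ((Prof.one (Mᵒᵖ × M)).tens (mulP V M)) ((op m₁, n₁), (op m₂, n₃)) (op a, b)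
          ((op m₁, n₁), ((op m₂, n₂), (op m₃, n₃)))
  l : ∀ a b m n p q p' q' : M,
    (mulP V M).inj ((Prof.ev M).tens (Prof.one (Mᵒᵖ × M))) ((op p, q), (op p', q')) (op a, b)
        (PUnit.unit, (op m, n)) ≫ P.l.app (op a, b) (PUnit.unit, (op m, n)) =
      lambdaMap a b m n p q p' q'
  r : ∀ a b m n p q p' q' : M,
    (mulP V M).inj ((Prof.one (Mᵒᵖ × M)).tens (Prof.ev M)) ((op p, q), (op p', q')) (op a, b)
        ((op m, n), PUnit.unit) ≫ P.r.app (op a, b) ((op m, n), PUnit.unit) =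
      rhoMap a b m n p q p' q'

end ModuleStr

end ProV

end

/-! Every map in the claim is prescribed on a coend of tensor products of hom objects, so the axioms
would be formal calculations if hom objects had enough elements. Points `𝟙_ V ⟶ X` do not separate
maps in general. The proof therefore uses generalised elements: an element of `X` is a map to `X`
from the tensor product of a word of labelled objects, taken up to permutation of the letters
(`El`). Pairing is concatenation of words, and on pairs the associators, unitors and braidings act
by the evident rearrangements (`El.map_assoc`, `El.map_left`, `El.map_braid`).

No information is lost. An element represented by an isomorphism from a word with distinct labels is
generic, and two maps that agree on one generic element are equal (`El.Generic.ext`). This is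
coherence for symmetric monoidal categories, in the form `Shuffle.sortWord_eq`: when the labels are
distinct, any permutation followed by sorting is sorting, because adjacent swaps are involutive and
satisfy the Yang-Baxter equation. Since `V` is closed, tensoring preserves the jointly epic families
of coprojections, so generic elements of the integrands test equality of maps out of coends, of
their tensor products and of iterated coends (`Cover`).

On elements a `V`-category becomes an ordinary category, a `V`-functor a functor, and the
constraints of the module become natural isomorphisms. An element of `T` is generated by an object
`x` and two morphisms, with the relation that a morphism `x ⟶ x'` passes from the contravariant leg
to the covariant one (`tE_bal`). An element of a composite is generated by pairs, with the balancing
relation `cp_bal`. Moving all morphisms towards the root of a tree gives standard forms with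
identities at the leaves: `wE` for `M • (T ⊗ T)`, `qE` and `qE'` for the two sides of the
associativity map, `eE` and `eE'` for those of the unit maps.

What remains is ordinary category theory. Well-definedness of the maps is naturality of the
constraints and bifunctoriality of the action; for `τ`, which duplicates `x`, it is `wE_bal_left`
and `wE_bal_right`. Associativity of `μ` is the module pentagon. Its unit laws are the triangle and
the left triangle `left_triangleE`, which Kelly's argument deduces from the pentagon and the
triangles. Compatibility of `τ` and `ν` with `μ` and `η` is naturality of the constraints, and their
compatibility with `α`, `l`, `r` is functoriality of `x ⊡ -`. The promonoidal axioms reduce to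
associativity of composition in `M`. Uniqueness holds because the prescribed values are values on
generators. -/

noncomputable section

namespace ProV

/-! ### Words of labelled objects, and coherence of their permutations -/

section Words

variable {V : Type u} [Category.{v} V] [MonoidalCategory V] [SymmetricCategory V]

/-- The tensor product of a word of labelled objects. -/
@[reducible]
def word : List (V × ℕ) → V
  | [] => 𝟙_ V
  | a :: l => a.1 ⊗ word l

/-- The tensor product of a concatenation. -/
def wordAppend : ∀ l l' : List (V × ℕ), word (l ++ l') ≅ word l ⊗ word l'
  | [], _ => (λ_ _).symm
  | a :: l, l' => whiskerLeftIso a.1 (wordAppend l l') ≪≫ (α_ _ _ _).symm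

/-- The maps between tensor products of words that permute the letters. -/
inductive Shuffle : ∀ l l' : List (V × ℕ), (word l ⟶ word l') → Prop
  | nil : Shuffle [] [] (𝟙 _)
  | cons (a : V × ℕ) {l l' : List (V × ℕ)} {σ : word l ⟶ word l'} :
      Shuffle l l' σ → Shuffle (a :: l) (a :: l') (a.1 ◁ σ)
  | swap (a b : V × ℕ) (l : List (V × ℕ)) :
      Shuffle (a :: b :: l) (b :: a :: l) (sw' a.1 b.1 (word l))
  | trans {l₁ l₂ l₃ : List (V × ℕ)} {σ : word l₁ ⟶ word l₂} {τ : word l₂ ⟶ word l₃} :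
      Shuffle l₁ l₂ σ → Shuffle l₂ l₃ τ → Shuffle l₁ l₃ (σ ≫ τ)

theorem sw'_sw' (X Y Z : V) : sw' X Y Z ≫ sw' Y X Z = 𝟙 _ := by
  simp only [sw', Category.assoc, Iso.hom_inv_id_assoc]
  rw [← comp_whiskerRight_assoc, SymmetricCategory.symmetry]
  simp

theorem sw'_naturality (X Y : V) {Z Z' : V} (f : Z ⟶ Z') :
    sw' X Y Z ≫ Y ◁ X ◁ f = X ◁ Y ◁ f ≫ sw' X Y Z' := by
  simp only [sw', Category.assoc]
  rw [associator_inv_naturality_right_assoc, whisker_exchange_assoc]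
  simp

theorem sw'_naturality_assoc (X Y : V) {Z Z' W : V} (f : Z ⟶ Z') (h : Y ⊗ (X ⊗ Z') ⟶ W) :
    sw' X Y Z ≫ Y ◁ X ◁ f ≫ h = X ◁ Y ◁ f ≫ sw' X Y Z' ≫ h := by
  rw [← Category.assoc, sw'_naturality, Category.assoc]

/-- The Yang-Baxter equation. -/
theorem sw'_braid (X Y Z W : V) :
    X ◁ sw' Y Z W ≫ sw' X Z (Y ⊗ W) ≫ Z ◁ sw' X Y W =
      sw' X Y (Z ⊗ W) ≫ Y ◁ sw' X Z W ≫ sw' Y Z (X ⊗ W) := by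
  have h := BraidedCategory.yang_baxter X Y Z
  simp only [sw']
  trans (α_ X Y (Z ⊗ W)).inv ≫ (α_ (X ⊗ Y) Z W).inv ≫ ((α_ X Y Z).hom ≫ X ◁ (β_ Y Z).hom ≫
    (α_ _ _ _).inv ≫ (β_ X Z).hom ▷ Y ≫ (α_ _ _ _).hom ≫ Z ◁ (β_ X Y).hom) ▷ W ≫ (α_ _ _ _).hom ≫
      Z ◁ (α_ _ _ _).hom
  · monoidal
  · trans (α_ X Y (Z ⊗ W)).inv ≫ (α_ (X ⊗ Y) Z W).inv ≫ ((β_ X Y).hom ▷ Z ≫ (α_ _ _ _).hom ≫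
      Y ◁ (β_ X Z).hom ≫ (α_ _ _ _).inv ≫ (β_ Y Z).hom ▷ X ≫ (α_ _ _ _).hom) ▷ W ≫ (α_ _ _ _).hom ≫
      Z ◁ (α_ _ _ _).hom
    · congr 4
      rw [← h, Iso.hom_inv_id_assoc]
    · monoidal

/-- A swap of the first two letters does not see what is appended behind them; this is the swap case
of `Shuffle.append_right`. -/
theorem sw'_append (X Y Z W : V) :
    X ◁ (α_ _ _ _).inv ≫ (α_ _ _ _).inv ≫ sw' X Y Z ▷ W ≫ (α_ _ _ _).hom ≫ Y ◁ (α_ _ _ _).hom =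
      sw' X Y (Z ⊗ W) := by
  simp only [sw']
  monoidal

namespace Shuffle

variable {l l' : List (V × ℕ)}

theorem of_eq {σ τ : word l ⟶ word l'} (h : Shuffle l l' σ) (e : σ = τ) : Shuffle l l' τ := e ▸ h

theorem refl (l : List (V × ℕ)) : Shuffle l l (𝟙 _) := by
  induction l with
  | nil => exact nil
  | cons a l ih => exact (ih.cons a).of_eq (MonoidalCategory.whiskerLeft_id _ _)

theorem exists_inv {σ : word l ⟶ word l'} (h : Shuffle l l' σ) :
    ∃ τ, Shuffle l' l τ ∧ σ ≫ τ = 𝟙 _ ∧ τ ≫ σ = 𝟙 _ := by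
  induction h with
  | nil => exact ⟨𝟙 _, nil, by simp, by simp⟩
  | cons a _ ih =>
    obtain ⟨τ, h, h1, h2⟩ := ih
    refine ⟨a.1 ◁ τ, h.cons a, ?_, ?_⟩
    · exact (MonoidalCategory.whiskerLeft_comp _ _ _).symm.trans
        ((congrArg _ h1).trans (MonoidalCategory.whiskerLeft_id _ _))
    · exact (MonoidalCategory.whiskerLeft_comp _ _ _).symm.trans
        ((congrArg _ h2).trans (MonoidalCategory.whiskerLeft_id _ _))
  | swap a b l => exact ⟨_, swap b a l, sw'_sw' _ _ _, sw'_sw' _ _ _⟩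
  | trans _ _ ih ih' =>
    obtain ⟨τ, h, h1, h2⟩ := ih
    obtain ⟨τ', h', h1', h2'⟩ := ih'
    refine ⟨τ' ≫ τ, h'.trans h, ?_, ?_⟩
    · simp [reassoc_of% h1', h1]
    · simp [reassoc_of% h2, h2']

theorem isIso {σ : word l ⟶ word l'} (h : Shuffle l l' σ) : IsIso σ := by
  obtain ⟨τ, _, h1, h2⟩ := h.exists_inv
  exact ⟨τ, h1, h2⟩

theorem perm {σ : word l ⟶ word l'} (h : Shuffle l l' σ) : l.Perm l' := by
  induction h with
  | nil => exact .refl _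
  | cons a _ ih => exact ih.cons a
  | swap a b l => exact .swap _ _ _
  | trans _ _ ih ih' => exact ih.trans ih'

/-- Together with `append_right`, this makes the pairing of elements independent of representatives.
-/
theorem append_left (k : List (V × ℕ)) {σ : word l ⟶ word l'} (h : Shuffle l l' σ) :
    Shuffle (k ++ l) (k ++ l')
      ((wordAppend k l).hom ≫ word k ◁ σ ≫ (wordAppend k l').inv) := by
  induction k with
  | nil =>
    refine h.of_eq ?_
    change _ = (λ_ _).inv ≫ 𝟙_ V ◁ σ ≫ (λ_ _).hom
    simp
  | cons a k ih =>
    refine (ih.cons a).of_eq ?_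
    change _ = (a.1 ◁ (wordAppend k l).hom ≫ (α_ _ _ _).inv) ≫ (a.1 ⊗ word k) ◁ σ ≫
      (α_ _ _ _).hom ≫ a.1 ◁ (wordAppend k l').inv
    simp

theorem append_right (k : List (V × ℕ)) {σ : word l ⟶ word l'} (h : Shuffle l l' σ) :
    Shuffle (l ++ k) (l' ++ k)
      ((wordAppend l k).hom ≫ σ ▷ word k ≫ (wordAppend l' k).inv) := by
  induction h with
  | nil => exact (refl k).of_eq (by simp)
  | @cons a l l' σ _ ih =>
    refine (ih.cons a).of_eq ?_
    change _ = (a.1 ◁ (wordAppend l k).hom ≫ (α_ _ _ _).inv) ≫ (a.1 ◁ σ) ▷ word k ≫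
      (α_ _ _ _).hom ≫ a.1 ◁ (wordAppend l' k).inv
    simp
  | swap a b l =>
    refine (swap a b (l ++ k)).of_eq ?_
    change _ = (a.1 ◁ (b.1 ◁ (wordAppend l k).hom ≫ (α_ _ _ _).inv) ≫ (α_ _ _ _).inv) ≫
      sw' a.1 b.1 (word l) ▷ word k ≫
      (α_ _ _ _).hom ≫ b.1 ◁ ((α_ _ _ _).hom ≫ a.1 ◁ (wordAppend l k).inv)
    simp only [Category.assoc, MonoidalCategory.whiskerLeft_comp]
    have h := sw'_append a.1 b.1 (word l) (word k)
    rw [reassoc_of% h, sw'_naturality]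
    simp only [← MonoidalCategory.whiskerLeft_comp_assoc, Iso.hom_inv_id]
    simp
  | @trans l₁ l₂ l₃ _ _ _ _ ih ih' => exact (ih.trans ih').of_eq (by simp)

/-- The two lists are equal, but not by definition. Treating the comparison as a permutation avoids
transport along that equality. -/
theorem assoc (l l' l'' : List (V × ℕ)) : Shuffle ((l ++ l') ++ l'') (l ++ (l' ++ l''))
    ((wordAppend (l ++ l') l'').hom ≫ (wordAppend l l').hom ▷ _ ≫ (α_ _ _ _).hom ≫
      _ ◁ (wordAppend l' l'').inv ≫ (wordAppend l (l' ++ l'')).inv) := by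
  induction l with
  | nil =>
    refine (refl (l' ++ l'')).of_eq ?_
    change _ = (wordAppend l' l'').hom ≫ (λ_ _).inv ▷ _ ≫ (α_ _ _ _).hom ≫
      _ ◁ (wordAppend l' l'').inv ≫ (λ_ _).hom
    simp
  | cons a l ih =>
    refine (ih.cons a).of_eq ?_
    change _ = (a.1 ◁ (wordAppend (l ++ l') l'').hom ≫ (α_ _ _ _).inv) ≫
      (a.1 ◁ (wordAppend l l').hom ≫ (α_ _ _ _).inv) ▷ _ ≫ (α_ (a.1 ⊗ word l) _ _).hom ≫
      (a.1 ⊗ word l) ◁ (wordAppend l' l'').inv ≫ (α_ _ _ _).hom ≫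
        a.1 ◁ (wordAppend l (l' ++ l'')).inv
    monoidal

/-- A letter passes a word one letter at a time, and the hexagon identifies the result with the
braiding past the whole word. This is the inductive step of `comm`. -/
theorem cons_append (a : V × ℕ) (l l' : List (V × ℕ)) : Shuffle (a :: (l ++ l')) (l ++ a :: l')
    (a.1 ◁ (wordAppend l l').hom ≫ sw' _ _ _ ≫ (wordAppend l (a :: l')).inv) := by
  induction l with
  | nil =>
    refine (refl (a :: l')).of_eq ?_
    change _ = a.1 ◁ (λ_ _).inv ≫ sw' a.1 (𝟙_ V) (word l') ≫ (λ_ _).hom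
    simp [sw', braiding_tensorUnit_right]
  | cons b l ih =>
    refine ((swap a b _).trans (ih.cons b)).of_eq ?_
    change _ = a.1 ◁ (b.1 ◁ (wordAppend l l').hom ≫ (α_ _ _ _).inv) ≫ sw' a.1 (b.1 ⊗ word l) _ ≫
      (α_ _ _ _).hom ≫ b.1 ◁ (wordAppend l (a :: l')).inv
    have h : a.1 ◁ (α_ b.1 (word l) (word l')).inv ≫ sw' a.1 (b.1 ⊗ word l) _ ≫ (α_ _ _ _).hom =
        sw' _ _ _ ≫ b.1 ◁ sw' _ _ _ := by
      simp only [sw', BraidedCategory.braiding_tensor_right_hom]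
      monoidal
    simp only [Category.assoc, MonoidalCategory.whiskerLeft_comp]
    rw [reassoc_of% h, sw'_naturality_assoc]

theorem append_nil (l : List (V × ℕ)) :
    Shuffle l (l ++ []) ((ρ_ _).inv ≫ (wordAppend l []).inv) := by
  induction l with
  | nil =>
    refine nil.of_eq ?_
    change 𝟙 (𝟙_ V) = (ρ_ (𝟙_ V)).inv ≫ (λ_ (𝟙_ V)).hom
    rw [← unitors_inv_equal, Iso.inv_hom_id]
  | cons a l ih =>
    refine (ih.cons a).of_eq ?_
    change _ = (ρ_ _).inv ≫ (α_ _ _ _).hom ≫ a.1 ◁ (wordAppend l []).inv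
    simp

/-- By the other hexagon, the braiding of two words is built by moving the letters of the first word
past the second one by one. -/
theorem comm (l l' : List (V × ℕ)) : Shuffle (l ++ l') (l' ++ l)
    ((wordAppend l l').hom ≫ (β_ _ _).hom ≫ (wordAppend l' l).inv) := by
  induction l with
  | nil =>
    refine (append_nil l').of_eq ?_
    change (ρ_ _).inv ≫ (wordAppend l' []).inv = (λ_ _).inv ≫ (β_ (𝟙_ V) _).hom ≫ (wordAppend l' []).inv
    simp
  | cons a l ih =>
    refine ((ih.cons a).trans (cons_append a l' l)).of_eq ?_
    change _ = (a.1 ◁ (wordAppend l l').hom ≫ (α_ _ _ _).inv) ≫ (β_ (a.1 ⊗ word l) _).hom ≫ _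
    simp only [sw', BraidedCategory.braiding_tensor_left_hom]
    simp

end Shuffle

/-- Insertion of a letter into a word sorted by labels, with the induced map. -/
def insertWord (a : V × ℕ) : ∀ l : List (V × ℕ), Σ l', (a.1 ⊗ word l ⟶ word l')
  | [] => ⟨[a], 𝟙 _⟩
  | b :: l => if a.2 ≤ b.2 then ⟨a :: b :: l, 𝟙 _⟩ else
      ⟨b :: (insertWord a l).1, sw' _ _ _ ≫ b.1 ◁ (insertWord a l).2⟩

/-- Precomposition of a map to a word. -/
def preWord {X Y : V} (f : X ⟶ Y) (s : Σ l, (Y ⟶ word l)) : Σ l, (X ⟶ word l) :=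
  ⟨s.1, f ≫ s.2⟩

/-- Insertion of a letter into a word with a map. -/
def consWord (a : V × ℕ) {X : V} (s : Σ l, (X ⟶ word l)) : Σ l, (a.1 ⊗ X ⟶ word l) :=
  ⟨(insertWord a s.1).1, a.1 ◁ s.2 ≫ (insertWord a s.1).2⟩

/-- Sorting of a word by labels, with the induced map. -/
def sortWord : ∀ l : List (V × ℕ), Σ l', (word l ⟶ word l')
  | [] => ⟨[], 𝟙 _⟩
  | a :: l => consWord a (sortWord l)

theorem preWord_preWord {X Y Z : V} (f : X ⟶ Y) (g : Y ⟶ Z) (s : Σ l, (Z ⟶ word l)) :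
    preWord f (preWord g s) = preWord (f ≫ g) s := by
  simp [preWord]

theorem preWord_id {X : V} (s : Σ l, (X ⟶ word l)) : preWord (𝟙 X) s = s := by
  simp [preWord]

theorem consWord_preWord (a : V × ℕ) {X Y : V} (f : X ⟶ Y) (s : Σ l, (Y ⟶ word l)) :
    consWord a (preWord f s) = preWord (a.1 ◁ f) (consWord a s) := by
  simp [preWord, consWord]

theorem insertWord_le {a b : V × ℕ} (h : a.2 ≤ b.2) (l : List (V × ℕ)) :
    insertWord a (b :: l) = ⟨a :: b :: l, 𝟙 _⟩ := by
  rw [insertWord, if_pos h]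

theorem insertWord_gt {a b : V × ℕ} (h : ¬ a.2 ≤ b.2) (l : List (V × ℕ)) :
    insertWord a (b :: l) =
      ⟨b :: (insertWord a l).1, sw' _ _ _ ≫ b.1 ◁ (insertWord a l).2⟩ := by
  rw [insertWord, if_neg h]

theorem consWord_le {a b : V × ℕ} (h : a.2 ≤ b.2) {X : V} (l : List (V × ℕ))
    (f : X ⟶ word (b :: l)) : consWord a ⟨b :: l, f⟩ = ⟨a :: b :: l, a.1 ◁ f⟩ := by
  rw [consWord, insertWord_le h]
  exact congrArg (Sigma.mk _) (Category.comp_id _)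

theorem consWord_gt {a b : V × ℕ} (h : ¬ a.2 ≤ b.2) {X : V} (l : List (V × ℕ))
    (f : X ⟶ word (b :: l)) : consWord a ⟨b :: l, f⟩ =
      ⟨b :: (insertWord a l).1, a.1 ◁ f ≫ sw' _ _ _ ≫ b.1 ◁ (insertWord a l).2⟩ := by
  rw [consWord, insertWord_gt h]

/-- Induction on the word, according to which of the two letters stops in front of its head. If at
least one stops, the two sides differ by a swap followed by its inverse. -/
theorem consWord_insertWord_aux {a b : V × ℕ} (hab : a.2 < b.2) (l : List (V × ℕ)) :
    consWord a (insertWord b l) = preWord (sw' _ _ _) (consWord b (insertWord a l)) := by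
  induction l with
  | nil =>
    rw [insertWord, insertWord, consWord_le hab.le, consWord_gt hab.not_ge]
    refine congrArg (Sigma.mk _) ?_
    simp only [insertWord]
    have := sw'_sw' a.1 b.1 (word [])
    simp [this]
  | cons c l ih =>
    by_cases hbc : b.2 ≤ c.2
    · have hac := hab.le.trans hbc
      rw [insertWord_le hbc, insertWord_le hac, consWord_le hab.le, consWord_gt hab.not_ge,
        insertWord_le hbc]
      refine congrArg (Sigma.mk _) ?_
      have := sw'_sw' a.1 b.1 (word (c :: l))
      simp [this]
    · by_cases hac : a.2 ≤ c.2
      · rw [insertWord_gt hbc, insertWord_le hac, consWord_le hac, consWord_gt hab.not_ge,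
          insertWord_gt hbc]
        refine congrArg (Sigma.mk _) ?_
        have := sw'_sw' a.1 b.1 (word (c :: l))
        simp [reassoc_of% this]
      · rw [insertWord_gt hbc, insertWord_gt hac, consWord_gt hac, consWord_gt hbc]
        -- Both letters pass `c`: the Yang-Baxter equation lets them be exchanged before or after
        -- passing it, and the induction hypothesis treats the tail.
        have h := sw'_braid a.1 b.1 c.1 (word l)
        have h1 := congrArg (fun s : Σ l', (a.1 ⊗ b.1 ⊗ word l ⟶ word l') =>
          (⟨c :: s.1, a.1 ◁ sw' b.1 c.1 _ ≫ sw' a.1 c.1 _ ≫ c.1 ◁ s.2⟩ :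
            Σ l', (a.1 ⊗ b.1 ⊗ c.1 ⊗ word l ⟶ word l'))) ih
        convert h1 using 1
        · refine congrArg (Sigma.mk _) ?_
          simp [consWord, sw'_naturality_assoc]
        · refine congrArg (Sigma.mk _) ?_
          simp [consWord, preWord, sw'_naturality_assoc, reassoc_of% h]

/-- Distinctness is essential: with equal labels the letter inserted last would come first, so the
two sides would end on differently ordered words. -/
theorem consWord_consWord {a b : V × ℕ} (hab : a.2 ≠ b.2) {X : V} (s : Σ l, (X ⟶ word l)) :
    consWord a (consWord b s) = preWord (sw' _ _ _) (consWord b (consWord a s)) := by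
  have h : consWord a (insertWord b s.1) =
      preWord (sw' _ _ _) (consWord b (insertWord a s.1)) := by
    rcases lt_or_gt_of_ne hab with h | h
    · exact consWord_insertWord_aux h _
    · rw [consWord_insertWord_aux h, preWord_preWord, sw'_sw', preWord_id]
  have e (a b : V × ℕ) : consWord a (consWord b s) =
      preWord (a.1 ◁ b.1 ◁ s.2) (consWord a (insertWord b s.1)) :=
    consWord_preWord a (b.1 ◁ s.2) (insertWord b s.1)
  rw [e, e, h, preWord_preWord, preWord_preWord, sw'_naturality]

/-- The coherence theorem for symmetric monoidal categories in the form used here. As sorting is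
invertible, it determines a permutation map from its source and target once the labels are distinct.
Only a swap needs an argument, and that is the commutation of two insertions. -/
theorem Shuffle.sortWord_eq {l l' : List (V × ℕ)} {σ : word l ⟶ word l'} (h : Shuffle l l' σ)
    (hl : (l.map Prod.snd).Nodup) : sortWord l = preWord σ (sortWord l') := by
  induction h with
  | nil => rw [preWord_id]
  | cons a _ ih =>
    rw [sortWord, ih (List.nodup_cons.1 hl).2, consWord_preWord]; rfl
  | swap a b l =>
    have hab : a.2 ≠ b.2 := fun h => by simp [h] at hl
    exact consWord_consWord hab _
  | trans h _ ih ih' =>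
    rw [ih hl, ih' ((h.perm.map _).nodup_iff.1 hl), preWord_preWord]

instance isIso_sw' (X Y Z : V) : IsIso (sw' X Y Z) := ⟨sw' Y X Z, sw'_sw' _ _ _, sw'_sw' _ _ _⟩

instance isIso_insertWord (a : V × ℕ) (l : List (V × ℕ)) : IsIso (insertWord a l).2 := by
  induction l with
  | nil => exact IsIso.id _
  | cons b l ih =>
    by_cases h : a.2 ≤ b.2
    · rw [insertWord_le h]; exact IsIso.id _
    · rw [insertWord_gt h]
      exact IsIso.comp_isIso' (isIso_sw' _ _ _) inferInstance

instance isIso_sortWord (l : List (V × ℕ)) : IsIso (sortWord l).2 := by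
  induction l with
  | nil => exact IsIso.id _
  | cons a l ih => exact IsIso.comp_isIso' inferInstance (isIso_insertWord _ _)

end Words

/-! ### Generalised elements -/

section Elements

variable {V : Type u} [Category.{v} V] [MonoidalCategory V] [SymmetricCategory V]

/-- Two maps out of words that differ by a permutation of the letters. -/
def ShuffleRel (X : V) (p q : Σ l : List (V × ℕ), (word l ⟶ X)) : Prop :=
  ∃ σ, Shuffle p.1 q.1 σ ∧ p.2 = σ ≫ q.2

/-- The generalised elements of `X`: maps to `X` from the tensor product of a word of labelled
objects, up to permutation of the letters. -/
def El (X : V) : Type (max u v) := Quot (ShuffleRel X)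

namespace El

variable {X Y Z W : V}

/-- The image of an element. -/
def map (f : X ⟶ Y) : El X → El Y :=
  Quot.map (fun p => ⟨p.1, p.2 ≫ f⟩) (by
    rintro ⟨l, x⟩ ⟨l', y⟩ ⟨σ, h, e⟩
    exact ⟨σ, h, by simp only at e; simp [e]⟩)

/-- The pair of two elements. -/
def pair : El X → El Y → El (X ⊗ Y) :=
  Quot.map₂ (fun p q => ⟨p.1 ++ q.1, (wordAppend _ _).hom ≫ (p.2 ⊗ₘ q.2)⟩)
    (by
      rintro ⟨l, x⟩ ⟨l', y⟩ ⟨l'', z⟩ ⟨σ, h, e⟩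
      refine ⟨_, h.append_left l, ?_⟩
      simp only at e
      simp [e, MonoidalCategory.tensorHom_def'])
    (by
      rintro ⟨l, x⟩ ⟨l', y⟩ ⟨l'', z⟩ ⟨σ, h, e⟩
      refine ⟨_, h.append_right l'', ?_⟩
      simp only at e
      simp [e, MonoidalCategory.tensorHom_def])

variable (V) in
/-- The element of the unit object. -/
def one : El (𝟙_ V) := Quot.mk _ ⟨[], 𝟙 _⟩

@[simp]
theorem map_id (x : El X) : map (𝟙 X) x = x := by
  induction x using Quot.ind
  exact congrArg (Quot.mk _) (congrArg (Sigma.mk _) (Category.comp_id _))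

@[simp]
theorem map_comp (f : X ⟶ Y) (g : Y ⟶ Z) (x : El X) : map (f ≫ g) x = map g (map f x) := by
  induction x using Quot.ind
  exact congrArg (Quot.mk _) (congrArg (Sigma.mk _) (Category.assoc _ _ _).symm)

@[simp]
theorem map_tensor (f : X ⟶ Y) (g : Z ⟶ W) (x : El X) (z : El Z) :
    map (f ⊗ₘ g) (pair x z) = pair (map f x) (map g z) := by
  induction x using Quot.ind
  induction z using Quot.ind
  refine congrArg (Quot.mk _) (congrArg (Sigma.mk _) ?_)
  simp

@[simp]
theorem map_assoc (x : El X) (y : El Y) (z : El Z) :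
    map (α_ X Y Z).hom (pair (pair x y) z) = pair x (pair y z) := by
  induction x using Quot.ind
  induction y using Quot.ind
  induction z using Quot.ind
  refine Quot.sound ⟨_, Shuffle.assoc _ _ _, ?_⟩
  simp [comp_tensor, tensor_comp]

-- Here the identification of elements up to permutation is needed: the two sides are represented on
-- the words `l ++ l'` and `l' ++ l`.
@[simp]
theorem map_braid (x : El X) (y : El Y) : map (β_ X Y).hom (pair x y) = pair y x := by
  induction x using Quot.ind
  induction y using Quot.ind
  refine Quot.sound ⟨_, Shuffle.comm _ _, ?_⟩
  simp

@[simp]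
theorem map_left (x : El X) : map (λ_ X).hom (pair (one V) x) = x := by
  induction x using Quot.ind
  refine congrArg (Quot.mk _) (congrArg (Sigma.mk _) ?_)
  change ((λ_ _).inv ≫ (𝟙 (𝟙_ V) ⊗ₘ _)) ≫ _ = _
  simp

end El
end Elements

end ProV

namespace ProV

/-! ### Calculation with elements, and generic elements -/

section Elements

variable {V : Type u} [Category.{v} V] [MonoidalCategory V] [SymmetricCategory V]

namespace El

variable {X Y Z W X' Y' Z' : V}

@[simp]
theorem map_whiskerLeft (f : Y ⟶ Z) (x : El X) (y : El Y) :
    map (X ◁ f) (pair x y) = pair x (map f y) := by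
  rw [← id_tensorHom, map_tensor, map_id]

@[simp]
theorem map_whiskerRight (f : Y ⟶ Z) (x : El X) (y : El Y) :
    map (f ▷ X) (pair y x) = pair (map f y) x := by
  rw [← tensorHom_id, map_tensor, map_id]

@[simp]
theorem map_assoc_inv (x : El X) (y : El Y) (z : El Z) :
    map (α_ X Y Z).inv (pair x (pair y z)) = pair (pair x y) z := by
  rw [← map_assoc, ← map_comp, Iso.hom_inv_id, map_id]

@[simp]
theorem map_left_inv (x : El X) : map (λ_ X).inv x = pair (one V) x := by
  conv_lhs => rw [← map_left x]
  rw [← map_comp, Iso.hom_inv_id, map_id]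

@[simp]
theorem map_right (x : El X) : map (ρ_ X).hom (pair x (one V)) = x := by
  rw [← braiding_leftUnitor, map_comp, map_braid, map_left]

@[simp]
theorem map_right_inv (x : El X) : map (ρ_ X).inv x = pair x (one V) := by
  conv_lhs => rw [← map_right x]
  rw [← map_comp, Iso.hom_inv_id, map_id]

@[simp]
theorem map_mu (x : El X) (x' : El X') (y : El Y) (y' : El Y') :
    map (tensorμ X X' Y Y') (pair (pair x x') (pair y y')) = pair (pair x y) (pair x' y') := by
  simp only [tensorμ, map_comp, map_assoc, map_assoc_inv, map_whiskerLeft, map_whiskerRight,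
    map_braid]

@[simp]
theorem map_tt (f : X ⊗ Y ⟶ Z) (f' : X' ⊗ Y' ⟶ Z') (x : El X) (x' : El X') (y : El Y)
    (y' : El Y') : map (tt f f') (pair (pair x x') (pair y y')) =
      pair (map f (pair x y)) (map f' (pair x' y')) := by
  simp only [tt, map_comp, map_mu, map_tensor]

@[simp]
theorem map_sw' (x : El X) (y : El Y) (z : El Z) :
    map (sw' X Y Z) (pair x (pair y z)) = pair y (pair x z) := by
  simp only [sw', map_comp, map_assoc, map_assoc_inv, map_whiskerRight, map_braid]

/-- An element is generic if it is invertible on a word with distinct labels, all between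
`n` and `m`. -/
def Generic (x : El X) (n m : ℕ) : Prop :=
  n ≤ m ∧ ∃ (l : List (V × ℕ)) (f : word l ≅ X), (l.map Prod.snd).Nodup ∧
    (∀ a ∈ l, n ≤ a.2 ∧ a.2 < m) ∧ x = Quot.mk _ ⟨l, f.hom⟩

/-- The element of `X` given by the letter `X` with label `n`. -/
def letter (X : V) (n : ℕ) : El X := Quot.mk _ ⟨[(X, n)], (ρ_ X).hom⟩

theorem generic_letter (X : V) (n : ℕ) : Generic (letter X n) n (n + 1) :=
  ⟨n.le_succ, [(X, n)], ρ_ X, by simp, by simp, rfl⟩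

theorem generic_one (n : ℕ) : Generic (one V) n n :=
  ⟨le_rfl, [], Iso.refl _, by simp, by simp, rfl⟩

/-- The half-open label intervals from `n` to `m` and from `m` to `k` are disjoint, so the
concatenated word again has distinct labels. -/
theorem Generic.pair {x : El X} {y : El Y} {n m k : ℕ} (hx : Generic x n m)
    (hy : Generic y m k) : Generic (pair x y) n k := by
  obtain ⟨hnm, l, f, hl, hn, rfl⟩ := hx
  obtain ⟨hmk, l', g, hl', hn', rfl⟩ := hy
  refine ⟨hnm.trans hmk, l ++ l', wordAppend l l' ≪≫ (f ⊗ᵢ g), ?_, ?_, rfl⟩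
  · rw [List.map_append, List.nodup_append]
    refine ⟨hl, hl', ?_⟩
    rintro _ ha _ hb rfl
    obtain ⟨a, ha, e⟩ := List.mem_map.1 ha
    obtain ⟨b, hb, e'⟩ := List.mem_map.1 hb
    have := (hn a ha).2
    have := (hn' b hb).1
    omega
  · intro a ha
    rcases List.mem_append.1 ha with h | h
    · exact ⟨(hn a h).1, (hn a h).2.trans_le hmk⟩
    · exact ⟨hnm.trans (hn' a h).1, (hn' a h).2⟩

open Classical in
/-- The representative of an element on a sorted word. -/
def normalForm (X : V) : El X → Option (Σ l : List (V × ℕ), (word l ⟶ X)) :=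
  Quot.lift (fun p => if (p.1.map Prod.snd).Nodup then
    some ⟨(sortWord p.1).1, inv (sortWord p.1).2 ≫ p.2⟩ else none) (by
      rintro ⟨l, x⟩ ⟨l', y⟩ ⟨σ, h, e⟩
      simp only at e h ⊢
      -- Having distinct labels is invariant under permutation, so equivalent representatives fall
      -- into the same case. Words with repeated labels have no canonical sorting map and get the
      -- value `none`.
      have hn := (h.perm.map Prod.snd).nodup_iff
      by_cases hl : (l.map Prod.snd).Nodup
      · rw [if_pos hl, if_pos (hn.1 hl), e]
        have := h.isIso
        have h1 := h.sortWord_eq hl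
        -- Generalising the sorted word to a variable `s` lets the equation between dependent pairs
        -- be substituted.
        have h2 : ∀ (s : Σ l', (word l ⟶ word l')) (hs : IsIso s.2),
            s = preWord σ (sortWord l') → (⟨s.1, inv s.2 ≫ σ ≫ y⟩ : Σ l, (word l ⟶ X)) =
              ⟨(sortWord l').1, inv (sortWord l').2 ≫ y⟩ := by
          rintro s hs rfl
          refine congrArg (Sigma.mk _) ?_
          exact (IsIso.inv_comp_eq _).2 (by simp [preWord])
        exact congrArg some (h2 _ _ h1)
      · rw [if_neg hl, if_neg (fun h => hl (hn.2 h))])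

/-- The normal form of the image of `x` under `f` is the inverse of the sorting map, then the
isomorphism that represents `x`, then `f`. The isomorphisms cancel. This is the passage from
elements back to maps. -/
theorem Generic.ext {x : El X} {n m : ℕ} (hx : Generic x n m) {f g : X ⟶ Y}
    (h : map f x = map g x) : f = g := by
  obtain ⟨_, l, i, hl, _, rfl⟩ := hx
  have h1 := congrArg (normalForm Y) h
  simp only [map, Quot.map, normalForm, if_pos hl, Option.some.injEq] at h1
  have h2 := eq_of_heq (Sigma.mk.inj h1).2
  simpa using h2

end El

/-! ### Jointly epic families that carry generic elements -/

open El

/-- A jointly epic family of maps to `X` with generic elements of their domains; `all` expresses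
that a property holds for the images of these generic elements. -/
class Cover (X : V) where
  ι : Type v
  K : ι → V
  i : ∀ a, K a ⟶ X
  len : ι → ℕ
  gen : ∀ a, ℕ → El (K a)
  generic : ∀ a n, Generic (gen a n) n (n + len a)
  epi : ∀ {R Z : V} (f g : R ⊗ X ⟶ Z), (∀ a, R ◁ i a ≫ f = R ◁ i a ≫ g) → f = g
  all : (El X → Prop) → Prop
  all_spec : ∀ P, all P → ∀ a n, P (El.map (i a) (gen a n))

namespace Cover

/-- The working principle of the proof: equality of maps is tested on the generators of the source.
The spectator object of `epi` is the unit here, and labelling may start at `0`. -/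
theorem ext {X Z : V} [Cover X] {f g : X ⟶ Z} (h : all fun e : El X => El.map f e = El.map g e) :
    f = g := by
  rw [← cancel_epi (λ_ X).hom]
  refine epi _ _ fun a => ?_
  rw [leftUnitor_naturality_assoc, leftUnitor_naturality_assoc]
  congr 1
  refine (generic a 0).ext ?_
  rw [map_comp, map_comp]
  exact all_spec _ h a 0

/-- The covering of an object by itself. -/
instance (priority := low) leaf (X : V) : Cover X where
  ι := PUnit
  K _ := X
  i _ := 𝟙 X
  len _ := 1
  gen _ := letter X
  generic _ n := generic_letter X n
  epi f g h := by simpa using h ⟨⟩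
  all P := ∀ x, P x
  all_spec P h _ n := h _

instance unit : Cover (𝟙_ V) where
  ι := PUnit
  K _ := 𝟙_ V
  i _ := 𝟙 _
  len _ := 0
  gen _ _ := one V
  generic _ n := generic_one n
  epi f g h := by simpa using h ⟨⟩
  all P := P (one V)
  all_spec P h _ n := by rwa [map_id]

/-- The labels of the second factor start where those of the first end, which keeps the pair
generic. For this `len` is recorded and `gen` takes a starting label. The spectator object in `epi`
is what makes the property pass to tensor products. -/
instance tensor (X Y : V) [Cover X] [Cover Y] : Cover (X ⊗ Y) where
  ι := ι X × ι Y
  K a := K a.1 ⊗ K a.2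
  i a := i a.1 ⊗ₘ i a.2
  len a := len a.1 + len a.2
  gen a n := pair (gen a.1 n) (gen a.2 (n + len a.1))
  generic a n := (generic _ _).pair (by rw [← add_assoc]; exact generic _ _)
  epi {R Z} f g h := by
    -- One factor at a time: first `Y` is tested with spectator `R ⊗ X`, then, after a braiding, `X`
    -- with spectator `R ⊗ K b`.
    rw [← cancel_epi (α_ R X Y).hom]
    refine epi _ _ fun b => ?_
    rw [← cancel_epi ((R ⊗ X) ◁ 𝟙 (K b)), ← cancel_epi (R ◁ (β_ (K b) X).hom ≫ (α_ _ _ _).inv),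
      ← cancel_epi (α_ _ _ _).hom]
    refine epi _ _ fun a => ?_
    have := (α_ R (K b) (K a)).hom ≫= R ◁ (β_ (K b) (K a)).hom ≫= h (a, b)
    rw [MonoidalCategory.tensorHom_def] at this
    have e : R ◁ K b ◁ i a ≫ R ◁ (β_ (K b) X).hom = R ◁ (β_ (K b) (K a)).hom ≫ R ◁ i a ▷ K b := by
      simp only [← MonoidalCategory.whiskerLeft_comp, BraidedCategory.braiding_naturality_right]
    simpa [reassoc_of% e] using this
  all P := all fun x => all fun y => P (pair x y)
  all_spec P h a n := by
    rw [map_tensor]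
    exact all_spec _ (all_spec (fun x => all fun y => P (pair x y)) h a.1 n) a.2 _

end Cover

end Elements

end ProV

namespace ProV

/-! ### Generic elements of colimits -/

section Coends

variable {V : Type u} [Category.{v} V] [MonoidalCategory V] [SymmetricCategory V]

/-- The covering of a colimit induced by coverings of the objects that are glued. -/
@[reducible]
def Cover.ofIsCoend [MonoidalClosed V] {ι ρ : Type v} {K : ι → V} {R : ρ → V} {s t : ρ → ι}
    {l : ∀ j, R j ⟶ K (s j)} {r : ∀ j, R j ⟶ K (t j)} {P : V} {i : ∀ a, K a ⟶ P}
    (h : IsCoend l r i) [∀ a, Cover (K a)] : Cover P where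
  ι := Σ a, Cover.ι (K a)
  K a := Cover.K a.2
  i a := Cover.i a.2 ≫ i a.1
  len a := Cover.len a.2
  gen a := Cover.gen a.2
  generic a := Cover.generic a.2
  -- Closedness enters here: tensoring with `R` preserves the colimit, so the coprojections stay
  -- jointly epic.
  epi {R Z} f g hfg := (h.whiskerLeft R).ext _ _ fun a => Cover.epi _ _ fun b => by
    simpa using hfg ⟨a, b⟩
  all Q := ∀ a, Cover.all fun e : El (K a) => Q (El.map (i a) e)
  all_spec Q hQ a n := by
    rw [El.map_comp]
    exact Cover.all_spec _ (hQ a.1) a.2 n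

end Coends

/-! ### The ordinary category of generalised elements of a `V`-category -/

variable (V : Type u) [Category.{v} V] [MonoidalCategory V] [SymmetricCategory V]

/-- The underlying ordinary category of generalised elements of a `V`-category. -/
def Und (_ : Type u) (C : Type v) : Type v := C

variable {C D : Type v} [EnrichedCategory V C] [EnrichedCategory V D]

/-- The identity as an element. -/
def idE (X : C) : El (X ⟶[V] X) := El.map (eId V X) (El.one V)

/-- The enriched axioms evaluated on elements. The morphisms are generalised elements rather than
points, so an equation between composites of generic ones is as strong as the corresponding equation
of maps in `V`. -/
instance : Category (Und V C) where
  Hom X Y := El (EnrichedCategory.Hom (V := V) (C := C) X Y)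
  id X := idE V (C := C) X
  comp {X Y Z} f g := El.map (eComp V (C := C) X Y Z) (El.pair f g)
  id_comp {X Y} f := by
    change El.map _ (El.pair (El.map (eId V (C := C) X) (El.one V)) f) = f
    rw [← El.map_whiskerRight, ← El.map_comp]
    exact (congrArg (El.map · _) (eId_eComp V (C := C) X Y)).trans (El.map_left f)
  comp_id {X Y} f := by
    change El.map _ (El.pair f (El.map (eId V (C := C) Y) (El.one V))) = f
    rw [← El.map_whiskerLeft, ← El.map_comp]
    exact (congrArg (El.map · _) (eComp_eId V (C := C) X Y)).trans (El.map_right f)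
  assoc {W X Y Z} f g h := by
    have := congrArg (El.map · (El.pair (El.pair f g) h)) (e_assoc' V (C := C) W X Y Z)
    simpa using this.symm

/-- An object of a `V`-category as an object of the underlying category. -/
abbrev Und.of (X : C) : Und V C := X

/-- The morphisms of the underlying category. -/
abbrev Mor (X Y : C) : Type (max u v) := Und.of V X ⟶ Und.of V Y

variable {V}

/-- An element of a hom object as a morphism of the underlying category. -/
abbrev toMor {X Y : C} (f : El (X ⟶[V] Y)) : Mor V X Y := f

theorem map_eComp {X Y Z : C} (f : Mor V X Y) (g : Mor V Y Z) :
    El.map (eComp V X Y Z) (El.pair f g) = f ≫ g := rfl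

theorem map_rComp {X Y Z : C} (f : Mor V X Y) (g : Mor V Y Z) :
    El.map (rComp X Y Z) (El.pair g f) = f ≫ g := by
  rw [rComp, El.map_comp, El.map_braid]
  rfl

theorem map_pre {X Y : C} (f : 𝟙_ V ⟶ (X ⟶[V] Y)) {Z : C} (g : Mor V Y Z) :
    El.map (pre f Z) g = (toMor (El.map f (El.one V))) ≫ g := by
  simp only [pre, El.map_comp, El.map_left_inv, El.map_whiskerRight]
  rfl

theorem map_post {Y Z : C} (f : 𝟙_ V ⟶ (Y ⟶[V] Z)) {X : C} (g : Mor V X Y) :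
    El.map (post f X) g = g ≫ (toMor (El.map f (El.one V))) := by
  simp only [post, El.map_comp, El.map_right_inv, El.map_whiskerLeft]
  rfl

theorem idE_prod (X : C × D) : idE V X = El.pair (idE V X.1) (idE V X.2) := by
  change El.map ((λ_ (𝟙_ V)).inv ≫ (eId V X.1 ⊗ₘ eId V X.2)) _ = _
  rw [El.map_comp, El.map_left_inv, El.map_tensor]
  rfl

theorem idE_punit (X : PUnit) : idE V X = El.one V := El.map_id _

/-! ### Profunctors, their maps and their composition on elements -/

namespace Prof

variable {A A' A₁ A₂ A₃ B B' B₁ B₂ B₃ E D' E' C' : Type v} [EnrichedCategory V A] [EnrichedCategory V A']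
  [EnrichedCategory V A₁] [EnrichedCategory V A₂] [EnrichedCategory V A₃]
  [EnrichedCategory V B] [EnrichedCategory V B'] [EnrichedCategory V B₁] [EnrichedCategory V B₂]
  [EnrichedCategory V B₃] [EnrichedCategory V E] [EnrichedCategory V D'] [EnrichedCategory V E']
  [EnrichedCategory V C']

/-- The left action on elements. -/
def lE (F : Prof V C D) {d d' : D} {c : C} (h : El (d ⟶[V] d')) (x : El (F.obj d' c)) :
    El (F.obj d c) := El.map (F.la d d' c) (El.pair h x)

/-- The right action on elements. -/
def rE (F : Prof V C D) {d : D} {c c' : C} (x : El (F.obj d c)) (h : El (c ⟶[V] c')) :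
    El (F.obj d c') := El.map (F.ra d c c') (El.pair x h)

/-- The effect of a map of profunctors on elements. -/
def ap {F G : Prof V C D} (f : F ⟶ G) {d : D} {c : C} (x : El (F.obj d c)) : El (G.obj d c) :=
  El.map (Hom.app f d c) x

/-- For the coverings used below, `Cover.all` unfolds to quantifiers over the generators, so each
axiom becomes an equation with named objects and morphisms. -/
theorem hom_ext {F G : Prof V C D} [∀ d c, Cover (F.obj d c)] {f g : F ⟶ G}
    (h : ∀ d c, Cover.all fun x : El (F.obj d c) => ap f x = ap g x) : f = g :=
  Hom.ext (funext fun d => funext fun c => Cover.ext (h d c))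

theorem lE_idE (F : Prof V C D) {d : D} {c : C} (x : El (F.obj d c)) : lE F (idE V d) x = x := by
  rw [lE, idE, ← El.map_whiskerRight, ← El.map_comp, F.la_id, El.map_left]

@[simp]
theorem ap_id {F : Prof V C D} {d : D} {c : C} (x : El (F.obj d c)) : ap (𝟙 F) x = x :=
  El.map_id x

@[simp]
theorem ap_comp {F G H : Prof V C D} (f : F ⟶ G) (g : G ⟶ H) {d : D} {c : C}
    (x : El (F.obj d c)) : ap (f ≫ g) x = ap g (ap f x) :=
  El.map_comp _ _ x

@[simp]
theorem ap_tensHom {F F' : Prof V C D} {G G' : Prof V C' D'} (f : F ⟶ F') (g : G ⟶ G')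
    {d : D × D'} {c : C × C'} (x : El (F.obj d.1 c.1)) (y : El (G.obj d.2 c.2)) :
    ap (tensHom f g) (d := d) (c := c) (El.pair x y) = El.pair (ap f x) (ap g y) :=
  El.map_tensor _ _ _ _

@[simp]
theorem ap_tensHomRes {F : Prof V C D} {F' : Prof V B D} {G : Prof V C' D'} {G' : Prof V B' D'}
    {K : EnrichedFunctor V C B} {L : EnrichedFunctor V C' B'} (f : F ⟶ F'.resR K)
    (g : G ⟶ G'.resR L) {d : D × D'} {c : C × C'} (x : El (F.obj d.1 c.1))
    (y : El (G.obj d.2 c.2)) :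
    ap (tensHomRes f g) (d := d) (c := c) (El.pair x y) = El.pair (ap f x) (ap g y) :=
  El.map_tensor _ _ _ _

@[simp]
theorem ap_resId (F : Prof V C D) {d : D} {c : C} (x : El (F.obj d c)) : ap (resId F) x = x :=
  El.map_id x

@[simp]
theorem ap_tensAssoc (X : Prof V A B) (Y : Prof V C D) (Z : Prof V C' D') {d : (B × D) × D'}
    {c : (A × C) × C'} (x : El (X.obj d.1.1 c.1.1)) (y : El (Y.obj d.1.2 c.1.2))
    (z : El (Z.obj d.2 c.2)) : ap (tensAssoc X Y Z) (d := d) (c := c) (El.pair (El.pair x y) z) =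
      El.pair x (El.pair y z) := El.map_assoc _ _ _

@[simp]
theorem ap_tensLeft (X : Prof V A B) {d : PUnit × B} {c : PUnit × A} (x : El (X.obj d.2 c.2)) :
    ap (tensLeft X) (d := d) (c := c) (El.pair (El.one V) x) = x := El.map_left _

@[simp]
theorem ap_tensRight (X : Prof V A B) {d : B × PUnit} {c : A × PUnit} (x : El (X.obj d.1 c.1)) :
    ap (tensRight X) (d := d) (c := c) (El.pair x (El.one V)) = x := El.map_right _

theorem ap_oneProd {d c : C × D} (x : El (d ⟶[V] c)) : ap (oneProd C D) x = x := El.map_id _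

variable [MonoidalClosed V] [HasColimitsOfSize.{v, v} V]

/-- The image of a pair of elements under a coprojection. -/
def cp (G : Prof V D E) (F : Prof V C D) {e : E} {c : C} (d : D) (x : El (G.obj e d))
    (y : El (F.obj d c)) : El ((G.comp F).obj e c) := El.map (inj G F d e c) (El.pair x y)

/-- The covering of the coend, with its test condition restated through `cp` so that the rules for
`cp` apply to it directly. -/
instance (G : Prof V D E) (F : Prof V C D) (e : E) (c : C) [∀ d, Cover (G.obj e d)]
    [∀ d, Cover (F.obj d c)] : Cover ((G.comp F).obj e c) :=
  { Cover.ofIsCoend (isCoend G F e c) with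
    all := fun P => ∀ d, Cover.all fun x => Cover.all fun y => P (cp G F d x y)
    all_spec := (Cover.ofIsCoend (isCoend G F e c)).all_spec }

/-- The gluing relation of the coend. The standard forms of elements of composites rest on it. -/
theorem cp_bal (G : Prof V D E) (F : Prof V C D) {e : E} {c : C} {d d' : D} (x : El (G.obj e d))
    (h : El (d ⟶[V] d')) (y : El (F.obj d' c)) :
    cp G F d' (rE G x h) y = cp G F d x (lE F h y) := by
  have := congrArg (El.map · (El.pair (El.pair x h) y)) (inj_bal G F d d' e c)
  simpa [cp, lE, rE] using this

@[simp]
theorem lE_comp (G : Prof V D E) (F : Prof V C D) {e e' : E} {c : C} (d : D) (h : El (e ⟶[V] e'))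
    (x : El (G.obj e' d)) (y : El (F.obj d c)) :
    lE (G.comp F) h (cp G F d x y) = cp G F d (lE G h x) y := by
  have := congrArg (El.map · (El.pair h (El.pair x y))) (inj_la G F d e e' c)
  simpa [cp, lE, rE] using this

@[simp]
theorem rE_comp (G : Prof V D E) (F : Prof V C D) {e : E} {c c' : C} (d : D) (h : El (c ⟶[V] c'))
    (x : El (G.obj e d)) (y : El (F.obj d c)) :
    rE (G.comp F) (cp G F d x y) h = cp G F d x (rE F y h) := by
  have := congrArg (El.map · (El.pair (El.pair x y) h)) (inj_ra G F d e c c')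
  simpa [cp, lE, rE] using this

@[simp]
theorem ap_lift (G : Prof V D E) (F : Prof V C D) (H : Prof V C E)
    (k : ∀ d e c, G.obj e d ⊗ F.obj d c ⟶ H.obj e c) (bal) (hl) (hr) {d : D} {e : E} {c : C}
    (x : El (G.obj e d)) (y : El (F.obj d c)) :
    ap (lift G F H k bal hl hr) (cp G F d x y) = El.map (k d e c) (El.pair x y) := by
  rw [ap, cp, ← El.map_comp, inj_lift]

@[simp]
theorem ap_hcomp {G G' : Prof V D E} {F F' : Prof V C D} (g : G ⟶ G') (f : F ⟶ F') {d : D} {e : E}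
    {c : C} (x : El (G.obj e d)) (y : El (F.obj d c)) :
    ap (hcomp g f) (cp G F d x y) = cp G' F' d (ap g x) (ap f y) := by
  rw [hcomp, ap_lift, El.map_comp, El.map_tensor]
  rfl

@[simp]
theorem ap_as (H : Prof V D E) (G : Prof V C D) (F : Prof V B C) {e : E} {b : B} (d : D) (c : C)
    (x : El (H.obj e d)) (y : El (G.obj d c)) (z : El (F.obj c b)) :
    ap (as H G F) (cp (H.comp G) F c (cp H G d x y) z) =
      cp H (G.comp F) d x (cp G F c y z) := by
  rw [as, ap_lift, cp, ← El.map_whiskerRight, ← El.map_comp]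
  -- The outer coend has been removed by `ap_lift`; what is left is the map that the definition of
  -- `as` obtains from the inner coend, and `fac` gives its value.
  erw [((isCoend H G e c).whiskerRight (F.obj c b)).fac]
  simp [cp]

@[simp]
theorem ap_as' (H : Prof V D E) (G : Prof V C D) (F : Prof V B C) {e : E} {b : B} (d : D) (c : C)
    (x : El (H.obj e d)) (y : El (G.obj d c)) (z : El (F.obj c b)) :
    ap (as' H G F) (cp H (G.comp F) d x (cp G F c y z)) =
      cp (H.comp G) F c (cp H G d x y) z := by
  rw [as', ap_lift, cp, ← El.map_whiskerLeft, ← El.map_comp]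
  erw [((isCoend G F d b).whiskerLeft (H.obj e d)).fac]
  simp [cp]

@[simp]
theorem ap_lu (F : Prof V C D) {d e : D} {c : C} (h : El (e ⟶[V] d)) (x : El (F.obj d c)) :
    ap (lu F) (cp (one D) F d h x) = lE F h x := ap_lift _ _ _ _ _ _ _ _ _

@[simp]
theorem ap_ru (F : Prof V C D) {e : D} {c d : C} (x : El (F.obj e d)) (h : El (d ⟶[V] c)) :
    ap (ru F) (cp F (one C) d x h) = rE F x h := ap_lift _ _ _ _ _ _ _ _ _

@[simp]
theorem ap_lu' (F : Prof V C D) {e : D} {c : C} (x : El (F.obj e c)) :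
    ap (lu' F) x = cp (one D) F e (idE V e) x := by
  change El.map ((λ_ _).inv ≫ eId V e ▷ _ ≫ inj (one D) F e e c) x = _
  simp [cp, idE]

@[simp]
theorem ap_ru' (F : Prof V C D) {e : D} {c : C} (x : El (F.obj e c)) :
    ap (ru' F) x = cp F (one C) c x (idE V c) := by
  change El.map ((ρ_ _).inv ≫ _ ◁ eId V c ≫ inj F (one C) c e c) x = _
  simp [cp, idE]

@[simp]
theorem ap_ix (G : Prof V D E) (F : Prof V C D) (G' : Prof V D' E') (F' : Prof V C' D')
    {d : D × D'} {e : E × E'} {c : C × C'} (x : El (G.obj e.1 d.1)) (x' : El (G'.obj e.2 d.2))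
    (y : El (F.obj d.1 c.1)) (y' : El (F'.obj d.2 c.2)) :
    ap (ix G F G' F') (cp (G.tens G') (F.tens F') (e := e) (c := c) d (El.pair x x')
      (El.pair y y')) = El.pair (cp G F d.1 x y) (cp G' F' d.2 x' y') := by
  rw [ix, ap_lift, El.map_tt]
  rfl

-- The inverse interchange is built by an existence argument and has no formula of its own; its
-- value is read off from that of `ix`, whose inverse it is.
@[simp]
theorem ap_ix' (G : Prof V D E) (F : Prof V C D) (G' : Prof V D' E') (F' : Prof V C' D')
    {e : E × E'} {c : C × C'} (d : D) (d' : D') (x : El (G.obj e.1 d)) (x' : El (G'.obj e.2 d'))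
    (y : El (F.obj d c.1)) (y' : El (F'.obj d' c.2)) :
    ap (ix' G F G' F') (d := e) (c := c) (El.pair (cp G F d x y) (cp G' F' d' x' y')) =
      cp (G.tens G') (F.tens F') (d, d') (El.pair x x') (El.pair y y') := by
  have h : ix G F G' F' ≫ ix' G F G' F' = 𝟙 _ := by
    refine Hom.ext (funext fun d => funext fun c => ?_)
    exact (isCoend _ _ _ _).ext _ _ fun d => by
      change _ ≫ _ ≫ (ix_exists G F G' F' _ _ (fun d => inj _ _ d _ _)
        (fun d d' => inj_bal _ _ _ _ _ _)).choose = _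
      rw [ix, reassoc_of% inj_lift, tt, Category.assoc, (ix_exists G F G' F' _ _ (fun d => inj _ _ d _ _)
        (fun d d' => inj_bal _ _ _ _ _ _)).choose_spec d, tensorμ_tensorδ_assoc]
      exact (Category.comp_id _).symm
  have h1 := ap_ix G F G' F' (d := (d, d')) (e := e) (c := c) x x' y y'
  rw [← h1, ← ap_comp, h, ap_id]

@[simp]
theorem ap_push (F : Prof V D E) (H : EnrichedFunctor V D' D) (X : Prof V C' D') (Y : Prof V C D)
    (K : EnrichedFunctor V C' C) (θ : X ⟶ (Y.resL H).resR K) {d : D'} {e : E} {c : C'}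
    (x : El (F.obj e (H.obj d))) (y : El (X.obj d c)) :
    ap (push F H X Y K θ) (cp (F.resR H) X d x y) = cp F Y (H.obj d) x (ap θ y) := by
  rw [push, ap_lift, El.map_comp, El.map_whiskerLeft]
  rfl

@[simp]
theorem ap_compRes (F : Prof V D E) {X : Prof V C D} {Y : Prof V B D} {K : EnrichedFunctor V C B}
    (θ : X ⟶ Y.resR K) {d : D} {e : E} {c : C} (x : El (F.obj e d)) (y : El (X.obj d c)) :
    ap (compRes F θ) (cp F X d x y) = cp F Y d x (ap θ y) := by
  rw [compRes, ap_lift, El.map_comp, El.map_whiskerLeft]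
  rfl

end Prof

end ProV

namespace ProV

variable {V : Type u} [Category.{v} V] [MonoidalCategory V] [SymmetricCategory V]

/-! ### `V`-functors and `V`-natural isomorphisms on elements -/

section Functors

variable {C D E : Type v} [EnrichedCategory V C] [EnrichedCategory V D] [EnrichedCategory V E]

/-- The effect on elements of a `V`-functor of two variables. -/
def biE (F : EnrichedFunctor V (C × D) E) {X X' : C} {Y Y' : D} (f : Mor V X X')
    (g : Mor V Y Y') : Mor V (F.obj (X, Y)) (F.obj (X', Y')) :=
  El.map (F.map (X, Y) (X', Y')) (El.pair f g)

theorem map_functor_id (F : EnrichedFunctor V C D) (X : C) :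
    El.map (F.map X X) (idE V X) = idE V (F.obj X) := by
  rw [idE, ← El.map_comp, F.map_id, idE]

@[simp]
theorem biE_id (F : EnrichedFunctor V (C × D) E) (X : C) (Y : D) :
    biE F (𝟙 (Und.of V X)) (𝟙 (Und.of V Y)) =
      𝟙 (Und.of V (F.obj (X, Y))) :=
  (congrArg _ (idE_prod (V := V) (X, Y)).symm).trans (map_functor_id F (X, Y))

theorem biE_comp (F : EnrichedFunctor V (C × D) E) {X X' X'' : C} {Y Y' Y'' : D} (f : Mor V X X')
    (f' : Mor V X' X'') (g : Mor V Y Y') (g' : Mor V Y' Y'') :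
    biE F f g ≫ biE F f' g' = biE F (f ≫ f') (g ≫ g') := by
  have h := congrArg (El.map · (El.pair (El.pair f g) (El.pair f' g')))
    (F.map_comp (X, Y) (X', Y') (X'', Y''))
  rw [El.map_comp, El.map_comp, El.map_tensor] at h
  refine h.symm.trans (congrArg _ ?_)
  exact El.map_tt _ _ _ _ _ _

theorem biE_comp_assoc (F : EnrichedFunctor V (C × D) E) {X X' X'' : C} {Y Y' Y'' : D}
    (f : Mor V X X') (f' : Mor V X' X'') (g : Mor V Y Y') (g' : Mor V Y' Y'') {Z : E}
    (h : Mor V (F.obj (X'', Y'')) Z) :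
    biE F f g ≫ biE F f' g' ≫ h = biE F (f ≫ f') (g ≫ g') ≫ h := by
  rw [← Category.assoc, biE_comp]

theorem map_post_post {X Y Z W : C} (f : 𝟙_ V ⟶ (X ⟶[V] Y)) (g : 𝟙_ V ⟶ (Y ⟶[V] Z))
    (h : 𝟙_ V ⟶ (Z ⟶[V] W)) : El.map (f ≫ post g X ≫ post h X) (El.one V) =
      toMor (El.map f (El.one V)) ≫ toMor (El.map g (El.one V)) ≫ toMor (El.map h (El.one V)) := by
  rw [El.map_comp, El.map_comp, map_post, map_post]
  exact Category.assoc _ _ _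

theorem map_sectL (F : EnrichedFunctor V (C × D) E) (X : C) {Y Y' : D} (g : Mor V Y Y') :
    El.map ((sectL F X).map Y Y') g = biE F (𝟙 (Und.of V X)) g := by
  simp only [sectL, El.map_comp, El.map_left_inv, El.map_whiskerRight]
  rfl

theorem map_sectR (F : EnrichedFunctor V (C × D) E) (Y : D) {X X' : C} (f : Mor V X X') :
    El.map ((sectR F Y).map X X') f = biE F f (𝟙 (Und.of V Y)) := by
  simp only [sectR, El.map_comp, El.map_right_inv, El.map_whiskerLeft]
  rfl

theorem map_pmap (F : EnrichedFunctor V (C × D) E) {X X' : C} {Y Y' : D} (f : 𝟙_ V ⟶ (X ⟶[V] X'))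
    (g : 𝟙_ V ⟶ (Y ⟶[V] Y')) : El.map (pmap F f g) (El.one V) =
      biE F (toMor (El.map f (El.one V))) (toMor (El.map g (El.one V))) := by
  rw [pmap, El.map_comp, El.map_comp, El.map_left_inv, El.map_tensor]
  rfl

/-- The isomorphism of underlying objects given by a `V`-natural isomorphism. -/
def VNatIso.isoE {F G : EnrichedFunctor V C D} (τ : VNatIso F G) (X : C) :
    (Und.of V (F.obj X)) ≅ (Und.of V (G.obj X)) where
  hom := El.map (τ.hom X) (El.one V)
  inv := El.map (τ.inv X) (El.one V)
  hom_inv_id := by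
    have h := congrArg (El.map · (El.one V)) (τ.hom_inv X)
    simp only [El.map_comp] at h
    exact (map_post _ _).symm.trans h
  inv_hom_id := by
    have h := congrArg (El.map · (El.one V)) (τ.inv_hom X)
    simp only [El.map_comp] at h
    exact (map_post _ _).symm.trans h

/-- The naturality axiom is an equation of maps out of a hom object, so it can be evaluated at
generalised elements and not only at points. -/
theorem VNatIso.isoE_natural {F G : EnrichedFunctor V C D} (τ : VNatIso F G) {X Y : C}
    (f : El (X ⟶[V] Y)) :
    (toMor (El.map (F.map X Y) f)) ≫ (τ.isoE Y).hom =
      (τ.isoE X).hom ≫ (toMor (El.map (G.map X Y) f)) := by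
  have h := congrArg (El.map · f) (τ.natural X Y)
  simp only [El.map_comp] at h
  exact ((map_post _ _).symm.trans h).trans (map_pre _ _)

end Functors

/-! ### Coherence in a module over a monoidal `V`-category -/

section Modules

variable {C M : Type v} [EnrichedCategory V C] [EnrichedCategory V M]
variable {S : MonoidalStr V C} (L : ModuleStr S M)

/-- The associator of a monoidal `V`-category. -/
def MonoidalStr.as (S : MonoidalStr V C) (x y z : C) :
    (Und.of V (S.tensor.obj (S.tensor.obj (x, y), z))) ≅
      (Und.of V (S.tensor.obj (x, S.tensor.obj (y, z)))) := S.assoc.isoE ((x, y), z)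

/-- The left unitor of a monoidal `V`-category. -/
def MonoidalStr.lu (S : MonoidalStr V C) (x : C) :
    (Und.of V (S.tensor.obj (S.unit, x))) ≅ (Und.of V x) := S.left.isoE x

/-- The right unitor of a monoidal `V`-category. -/
def MonoidalStr.ru (S : MonoidalStr V C) (x : C) :
    (Und.of V (S.tensor.obj (x, S.unit))) ≅ (Und.of V x) := S.right.isoE x

theorem MonoidalStr.triangleE (S : MonoidalStr V C) (x y : C) :
    (S.as x S.unit y).hom ≫ biE S.tensor (𝟙 _) (S.lu y).hom = biE S.tensor (S.ru x).hom (𝟙 _) := by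
  have h := congrArg (El.map · (El.one V)) (S.triangle x y)
  exact (congrArg _ (map_pmap _ _ _).symm).trans ((map_post _ _).symm.trans
    ((El.map_comp _ _ _).symm.trans (h.trans (map_pmap _ _ _))))

namespace ModuleStr

/-- The action of an object on an object. -/
abbrev ob (x : C) (m : M) : M := L.act.obj (x, m)

/-- The associator of a module. -/
def as (x y : C) (m : M) : (Und.of V (L.ob (S.tensor.obj (x, y)) m)) ≅
    (Und.of V (L.ob x (L.ob y m))) := L.assoc.isoE ((x, y), m)

/-- The unitor of a module. -/
def lu (m : M) : (Und.of V (L.ob S.unit m)) ≅ (Und.of V m) := L.left.isoE m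

theorem as_natural {x x' y y' : C} {m m' : M} (k : Mor V x x') (h : Mor V y y') (f : Mor V m m') :
    biE L.act (biE S.tensor k h) f ≫ (L.as x' y' m').hom = (L.as x y m).hom ≫ biE L.act k (biE L.act h f) := by
  refine Eq.trans ?_ ((L.assoc.isoE_natural (X := ((x, y), m)) (Y := ((x', y'), m'))
    (El.pair (El.pair k h) f)).trans ?_)
  · refine congrArg (· ≫ _) (Eq.symm ?_)
    refine (El.map_comp _ _ _).trans (congrArg _ ?_)
    exact (El.map_tensor _ _ _ _).trans (congrArg _ (El.map_id _))
  · refine congrArg (_ ≫ ·) ?_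
    refine (El.map_comp _ _ _).trans ?_
    refine (congrArg _ (El.map_assoc _ _ _)).trans ?_
    refine (El.map_comp _ _ _).trans (congrArg _ ?_)
    exact (El.map_tensor _ _ _ _).trans (congrArg (El.pair · _) (El.map_id _))

theorem as_natural_assoc {x x' y y' : C} {m m' z : M} (k : Mor V x x') (h : Mor V y y')
    (f : Mor V m m') (g : Mor V (L.ob x' (L.ob y' m')) z) :
    biE L.act (biE S.tensor k h) f ≫ (L.as x' y' m').hom ≫ g =
      (L.as x y m).hom ≫ biE L.act k (biE L.act h f) ≫ g := by
  rw [← Category.assoc, as_natural, Category.assoc]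

theorem lu_natural {m m' : M} (f : Mor V m m') :
    biE L.act (𝟙 (Und.of V S.unit)) f ≫ (L.lu m').hom = (L.lu m).hom ≫ f := by
  refine Eq.trans ?_ ((L.left.isoE_natural f).trans ?_)
  · exact congrArg (· ≫ _) (map_sectL _ _ _).symm
  · exact congrArg (_ ≫ ·) (El.map_id f)

theorem lu_natural_assoc {m m' z : M} (f : Mor V m m') (g : Mor V m' z) :
    biE L.act (𝟙 (Und.of V S.unit)) f ≫ (L.lu m').hom ≫ g = (L.lu m).hom ≫ f ≫ g := by
  rw [← Category.assoc, lu_natural, Category.assoc]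

theorem pentagonE (x y z : C) (m : M) :
    (L.as (S.tensor.obj (x, y)) z m).hom ≫ (L.as x y (L.ob z m)).hom =
      biE L.act (S.as x y z).hom (𝟙 _) ≫ (L.as x (S.tensor.obj (y, z)) m).hom ≫
        biE L.act (𝟙 _) (L.as y z m).hom := by
  have h := congrArg (El.map · (El.one V)) (L.pentagon x y z m)
  refine (map_post _ _).symm.trans ((El.map_comp _ _ _).symm.trans (h.trans ?_))
  refine (map_post_post _ _ _).trans ?_
  exact congrArg₂ (fun f g => f ≫ (L.as x (S.tensor.obj (y, z)) m).hom ≫ g) (map_pmap _ _ _)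
    (map_pmap _ _ _)

theorem triangleE (x : C) (m : M) :
    (L.as x S.unit m).hom ≫ biE L.act (𝟙 _) (L.lu m).hom = biE L.act (S.ru x).hom (𝟙 _) := by
  have h := congrArg (El.map · (El.one V)) (L.triangle x m)
  exact (congrArg _ (map_pmap _ _ _).symm).trans ((map_post _ _).symm.trans
    ((El.map_comp _ _ _).symm.trans (h.trans (map_pmap _ _ _))))

/-- The action of the unit is faithful, since `lu` makes it isomorphic to the identity functor. -/
theorem act_unit_injective {m m' : M} {f g : Mor V m m'}
    (h : biE L.act (𝟙 (Und.of V S.unit)) f = biE L.act (𝟙 _) g) : f = g := by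
  have := (L.lu_natural f).symm.trans ((congrArg (· ≫ _) h).trans (L.lu_natural g))
  rwa [cancel_epi] at this

/-- Kelly's coherence: the left triangle follows from the pentagon and the triangle. -/
theorem left_triangleE (y : C) (m : M) :
    (L.as S.unit y m).hom ≫ (L.lu (L.ob y m)).hom = biE L.act (S.lu y).hom (𝟙 _) := by
  apply L.act_unit_injective
  -- By faithfulness it is enough to compare after acting with the unit. The comparison starts from
  -- the pentagon at two units, followed by the unitor of `y ⊡ m`.
  have h1 := L.pentagonE S.unit S.unit y m =≫ biE L.act (𝟙 _) (L.lu (L.ob y m)).hom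
  have h2 := L.triangleE S.unit (L.ob y m)
  have h3 := S.triangleE S.unit y
  have h4 := L.as_natural (S.ru S.unit).hom (𝟙 (Und.of V y)) (𝟙 (Und.of V m))
  have h5 := L.as_natural (𝟙 (Und.of V S.unit)) (S.lu y).hom (𝟙 (Und.of V m))
  rw [biE_id] at h4
  -- Both paths are preceded by the same two isomorphisms, which are cancelled below. The triangles
  -- of `C` and of the module, with naturality of the associator in its first two variables, turn
  -- the pentagon into this equation.
  have h6 : biE L.act (S.as S.unit S.unit y).hom (𝟙 _) ≫ (L.as S.unit (S.tensor.obj (S.unit, y)) m).hom ≫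
      biE L.act (𝟙 (Und.of V S.unit)) ((L.as S.unit y m).hom ≫ (L.lu (L.ob y m)).hom) =
      biE L.act (S.as S.unit S.unit y).hom (𝟙 _) ≫ (L.as S.unit (S.tensor.obj (S.unit, y)) m).hom ≫
      biE L.act (𝟙 (Und.of V S.unit)) (biE L.act (S.lu y).hom (𝟙 _)) := by
    rw [← h5, biE_comp_assoc, h3, Category.id_comp, h4, ← h2]
    rw [Category.assoc, Category.assoc, Category.assoc, biE_comp, Category.id_comp] at h1
    exact h1.symm
  have hi : IsIso (biE L.act (S.as S.unit S.unit y).hom (𝟙 (Und.of V m))) :=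
    ⟨biE L.act (S.as S.unit S.unit y).inv (𝟙 _), by rw [biE_comp]; simp, by rw [biE_comp]; simp⟩
  rw [cancel_epi, cancel_epi] at h6
  exact h6

end ModuleStr
end Modules

end ProV

namespace ProV

variable {V : Type u} [Category.{v} V] [MonoidalCategory V] [SymmetricCategory V]

/-! ### The profunctors `Id`, `M` and `U` on elements -/

section Hom

variable {M : Type v} [EnrichedCategory V M]

/-- A pair of morphisms as an element of a hom object of `Mᵒᵖ ⊗ M`. -/
def hE {d d' : Mᵒᵖ × M} (f : Mor V d'.1.unop d.1.unop) (g : Mor V d.2 d'.2) :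
    El (d ⟶[V] d') := El.pair f g

/-- The covering of the hom objects of `Mᵒᵖ ⊗ M`. -/
instance (priority := high) Cover.hE (d d' : Mᵒᵖ × M) : Cover (d ⟶[V] d') :=
  { Cover.tensor (d'.1.unop ⟶[V] d.1.unop) (d.2 ⟶[V] d'.2) with
    all := fun P => ∀ (f : Mor V d'.1.unop d.1.unop) (g : Mor V d.2 d'.2), P (ProV.hE f g)
    all_spec := (Cover.tensor (d'.1.unop ⟶[V] d.1.unop) (d.2 ⟶[V] d'.2)).all_spec }

/-- The covering of the hom objects of a tensor product. -/
instance Cover.prod {C D : Type v} [EnrichedCategory V C] [EnrichedCategory V D] (d d' : C × D)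
    [Cover (d.1 ⟶[V] d'.1)] [Cover (d.2 ⟶[V] d'.2)] : Cover (d ⟶[V] d') :=
  Cover.tensor (d.1 ⟶[V] d'.1) (d.2 ⟶[V] d'.2)

instance Cover.punit (d d' : PUnit.{v + 1}) : Cover (d ⟶[V] d') := Cover.unit

theorem idE_eq_hE (d : Mᵒᵖ × M) :
    idE V d = hE (𝟙 (Und.of V d.1.unop)) (𝟙 (Und.of V d.2)) := idE_prod d

theorem lE_one_hE {d d' c : Mᵒᵖ × M} (f : Mor V d'.1.unop d.1.unop) (g : Mor V d.2 d'.2)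
    (f' : Mor V c.1.unop d'.1.unop) (g' : Mor V d'.2 c.2) :
    Prof.lE (Prof.one (Mᵒᵖ × M)) (hE f g) (hE f' g') = hE (f' ≫ f) (g ≫ g') := by
  refine (El.map_tt _ _ _ _ _ _).trans (congrArg (El.pair · _) ?_)
  exact map_rComp f' f

theorem rE_one_hE {d d' c : Mᵒᵖ × M} (f : Mor V d'.1.unop d.1.unop) (g : Mor V d.2 d'.2)
    (f' : Mor V c.1.unop d'.1.unop) (g' : Mor V d'.2 c.2) :
    Prof.rE (Prof.one (Mᵒᵖ × M)) (hE f g) (hE f' g') = hE (f' ≫ f) (g ≫ g') :=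
  lE_one_hE f g f' g'

/-- Three morphisms as an element of the multiplication profunctor. -/
def mE {d : Mᵒᵖ × M} {c : (Mᵒᵖ × M) × (Mᵒᵖ × M)} (f : Mor V c.1.1.unop d.1.unop)
    (g : Mor V c.2.1.unop c.1.2) (h : Mor V d.2 c.2.2) : El ((mulP V M).obj d c) :=
  El.pair f (El.pair g h)

/-- The covering of the multiplication profunctor. -/
instance (d : Mᵒᵖ × M) (c : (Mᵒᵖ × M) × (Mᵒᵖ × M)) : Cover ((mulP V M).obj d c) :=
  { Cover.tensor (c.1.1.unop ⟶[V] d.1.unop) ((c.2.1.unop ⟶[V] c.1.2) ⊗ (d.2 ⟶[V] c.2.2)) with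
    all := fun P => ∀ (f : Mor V c.1.1.unop d.1.unop) (g : Mor V c.2.1.unop c.1.2)
      (h : Mor V d.2 c.2.2), P (mE f g h)
    all_spec := (Cover.tensor (c.1.1.unop ⟶[V] d.1.unop)
      ((c.2.1.unop ⟶[V] c.1.2) ⊗ (d.2 ⟶[V] c.2.2))).all_spec }

theorem lE_mE {d d' : Mᵒᵖ × M} {c : (Mᵒᵖ × M) × (Mᵒᵖ × M)} (u : Mor V d'.1.unop d.1.unop)
    (w : Mor V d.2 d'.2) (f : Mor V c.1.1.unop d'.1.unop)
    (g : Mor V c.2.1.unop c.1.2) (h : Mor V d'.2 c.2.2) :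
    Prof.lE (mulP V M) (hE u w) (mE f g h) = mE (f ≫ u) g (w ≫ h) := by
  refine (El.map_comp _ _ _).trans ?_
  refine (congrArg _ (El.map_whiskerRight _ _ _)).trans ?_
  refine (congrArg (fun t => El.map _ (El.pair t _)) ((El.map_tensor _ _ _ _).trans
    (congrArg₂ El.pair (El.map_id _) (El.map_left_inv _)))).trans ?_
  refine (El.map_tt _ _ _ _ _ _).trans ?_
  refine congrArg₂ El.pair (map_rComp f u) ?_
  refine (El.map_tt _ _ _ _ _ _).trans ?_
  exact congrArg₂ El.pair (El.map_left _) rfl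

/-- The middle leg joins the two inputs, so it receives one morphism from each of them; the outer
legs receive one each. -/
theorem rE_mE {d : Mᵒᵖ × M} {c c' : (Mᵒᵖ × M) × (Mᵒᵖ × M)} (f : Mor V c.1.1.unop d.1.unop)
    (g : Mor V c.2.1.unop c.1.2) (h : Mor V d.2 c.2.2)
    (u : Mor V c'.1.1.unop c.1.1.unop) (w : Mor V c.1.2 c'.1.2)
    (u' : Mor V c'.2.1.unop c.2.1.unop) (w' : Mor V c.2.2 c'.2.2) :
    Prof.rE (mulP V M) (c' := c') (mE f g h) (El.pair (hE u w) (hE u' w')) =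
      mE (u ≫ f) (u' ≫ g ≫ w) (h ≫ w') := by
  refine (El.map_comp _ _ _).trans ?_
  refine (congrArg _ (El.map_whiskerLeft _ _ _)).trans ?_
  refine (congrArg (fun t => El.map _ (El.pair _ t)) ((El.map_comp _ _ _).trans
    ((congrArg _ (El.map_assoc _ _ _)).trans ((El.map_tensor _ _ _ _).trans
    (congrArg₂ El.pair (El.map_id _) (El.map_assoc_inv _ _ _)))))).trans ?_
  refine (El.map_tt _ _ _ _ _ _).trans ?_
  refine congrArg₂ El.pair (map_rComp u f) ?_
  refine (El.map_tt _ _ _ _ _ _).trans ?_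
  refine congrArg₂ El.pair ?_ rfl
  refine (El.map_comp _ _ _).trans ((congrArg _ (El.map_assoc_inv _ _ _)).trans ?_)
  refine (El.map_comp _ _ _).trans ((congrArg _ (El.map_whiskerRight _ _ _)).trans ?_)
  exact (El.map_comp _ _ _).trans (congrArg _ (El.map_braid _ _))

/-- A morphism as an element of the evaluation profunctor. -/
def uE {d : Mᵒᵖ × M} {c : PUnit.{v + 1}} (f : Mor V d.2 d.1.unop) : El ((Prof.ev (V := V) M).obj d c) := f

/-- The covering of the evaluation profunctor. -/
instance (d : Mᵒᵖ × M) (c : PUnit.{v + 1}) : Cover ((Prof.ev (V := V) M).obj d c) :=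
  { Cover.leaf (d.2 ⟶[V] d.1.unop) with
    all := fun P => ∀ f : Mor V d.2 d.1.unop, P (uE f)
    all_spec := (Cover.leaf (d.2 ⟶[V] d.1.unop)).all_spec }

theorem lE_uE {d d' : Mᵒᵖ × M} {c : PUnit.{v + 1}} (u : Mor V d'.1.unop d.1.unop)
    (w : Mor V d.2 d'.2) (f : Mor V d'.2 d'.1.unop) :
    Prof.lE (Prof.ev (V := V) M) (c := c) (hE u w) (uE f) = uE (w ≫ f ≫ u) := by
  refine (El.map_comp _ _ _).trans ((congrArg _ (El.map_assoc _ _ _)).trans ?_)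
  refine (El.map_comp _ _ _).trans ((congrArg _ (El.map_whiskerLeft _ _ _)).trans ?_)
  refine (El.map_comp _ _ _).trans ((congrArg _ (El.map_braid _ _)).trans ?_)
  exact Category.assoc w f u

theorem rE_uE {d : Mᵒᵖ × M} {c c' : PUnit.{v + 1}} (f : Mor V d.2 d.1.unop) :
    Prof.rE (Prof.ev (V := V) M) (d := d) (c := c) (c' := c') (uE f) (El.one V) = uE f := El.map_right _

end Hom

/-! ### The profunctor `T` on elements -/

namespace Prof.Glue

variable {C D : Type v} [EnrichedCategory V C] [EnrichedCategory V D] [MonoidalClosed V]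
  [HasColimitsOfSize.{v, v} V] (g : Prof.Glue (V := V) C D)

theorem map_la_inj (a : g.ι) {d d' : D} {c : C} (h : El (d ⟶[V] d')) (x : El ((g.K a).obj d' c)) :
    Prof.lE g.coend h (El.map (g.inj a d' c) x) = El.map (g.inj a d c) (Prof.lE (g.K a) h x) := by
  have e := congrArg (El.map · (El.pair h x)) (g.inj_la a d d' c)
  simp only [El.map_comp, El.map_whiskerLeft] at e
  exact e

theorem map_ra_inj (a : g.ι) {d : D} {c c' : C} (x : El ((g.K a).obj d c)) (h : El (c ⟶[V] c')) :
    Prof.rE g.coend (El.map (g.inj a d c) x) h = El.map (g.inj a d c') (Prof.rE (g.K a) x h) := by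
  have e := congrArg (El.map · (El.pair x h)) (g.inj_ra a d c c')
  simp only [El.map_comp, El.map_whiskerRight] at e
  exact e

end Prof.Glue

namespace ModuleStr

variable {C M : Type v} [EnrichedCategory V C] [EnrichedCategory V M]
variable {S : MonoidalStr V C} (L : ModuleStr S M) [MonoidalClosed V] [HasColimitsOfSize.{v, v} V]

/-- A pair of morphisms as an element of the profunctor `T`. -/
def tE {d c : Mᵒᵖ × M} (x : C) (f : Mor V (L.ob x c.1.unop) d.1.unop)
    (g : Mor V d.2 (L.ob x c.2)) : El (L.T.obj d c) :=
  El.map (L.ιT x d.1.unop d.2 c.1.unop c.2) (El.pair f g)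

/-- The covering of the profunctor `T` induced by the coverings of the integrands. -/
@[reducible]
def coverT (d c : Mᵒᵖ × M) : Cover (L.T.obj d c) :=
  @Cover.ofIsCoend _ _ _ _ _ _ _ _ _ _ _ _ _ _ _
    ((Prof.glue₂ (Prof.one Mᵒᵖ) (Prof.one M) ((opProd C M).comp V (opF L.act)) L.act).isCoend d c)
    fun x => Cover.tensor (L.ob x c.1.unop ⟶[V] d.1.unop) (d.2 ⟶[V] L.ob x c.2)

/-- The covering of the profunctor `T`. -/
instance (d c : Mᵒᵖ × M) : Cover (L.T.obj d c) :=
  { L.coverT d c with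
    all := fun P => ∀ (x : C) (f : Mor V (L.ob x c.1.unop) d.1.unop)
      (g : Mor V d.2 (L.ob x c.2)), P (L.tE x f g)
    all_spec := (L.coverT d c).all_spec }

theorem lE_tE {d d' c : Mᵒᵖ × M} (x : C) (u : Mor V d'.1.unop d.1.unop) (w : Mor V d.2 d'.2)
    (f : Mor V (L.ob x c.1.unop) d'.1.unop) (g : Mor V d'.2 (L.ob x c.2)) :
    Prof.lE L.T (hE u w) (L.tE x f g) = L.tE x (f ≫ u) (w ≫ g) := by
  refine (Prof.Glue.map_la_inj _ _ _ _).trans (congrArg _ ?_)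
  exact (El.map_tt _ _ _ _ _ _).trans (congrArg (El.pair · _) (map_rComp f u))

theorem rE_tE {d c c' : Mᵒᵖ × M} (x : C) (u : Mor V c'.1.unop c.1.unop) (w : Mor V c.2 c'.2)
    (f : Mor V (L.ob x c.1.unop) d.1.unop) (g : Mor V d.2 (L.ob x c.2)) :
    Prof.rE L.T (L.tE x f g) (hE u w) =
      L.tE (c := c') x (biE L.act (𝟙 (Und.of V x)) u ≫ f) (g ≫ biE L.act (𝟙 (Und.of V x)) w) := by
  refine (Prof.Glue.map_ra_inj _ _ _ _).trans (congrArg _ ?_)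
  refine (El.map_tt _ _ _ _ _ _).trans (congrArg₂ El.pair ?_ ?_)
  · refine (El.map_comp _ _ _).trans ((congrArg _ (El.map_whiskerLeft _ _ _)).trans ?_)
    refine (map_rComp _ f).trans (congrArg (· ≫ f) ?_)
    refine (map_sectL _ _ _).trans ((El.map_comp _ _ _).trans ?_)
    exact congrArg _ (El.map_id _)
  · refine (El.map_comp _ _ _).trans ((congrArg _ (El.map_whiskerLeft _ _ _)).trans ?_)
    exact congrArg (g ≫ ·) (map_sectL _ _ _)

/-- The gluing relation in `x`. In the gluing diagram the leg on which `k` does not act is paired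
with the unit object, which is why the unitors appear in the calculation. -/
theorem tE_bal {d c : Mᵒᵖ × M} {x x' : C} (k : Mor V x x')
    (f : Mor V (L.ob x' c.1.unop) d.1.unop) (g : Mor V d.2 (L.ob x c.2)) :
    L.tE (d := d) (c := c) x (biE L.act k (𝟙 (Und.of V c.1.unop)) ≫ f) g =
      L.tE x' f (g ≫ biE L.act k (𝟙 (Und.of V c.2))) := by
  have h := congrArg (El.map · (El.pair (El.pair f g) k))
    ((Prof.glue₂ (Prof.one Mᵒᵖ) (Prof.one M) ((opProd C M).comp V (opF L.act)) L.act).isCoend d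
      c |>.cond (x, x'))
  refine Eq.trans (Eq.trans (congrArg (El.map (L.ιT x d.1.unop d.2 c.1.unop c.2)) ?_)
    (El.map_comp _ _ _).symm) (h.trans (Eq.trans (El.map_comp _ _ _) (congrArg _ ?_)))
  · refine Eq.symm ?_
    refine (El.map_comp _ _ _).trans ((congrArg _ ((El.map_whiskerLeft _ _ _).trans
      (congrArg _ (El.map_right_inv _)))).trans ?_)
    refine (El.map_tt _ _ _ _ _ _).trans (congrArg₂ El.pair ?_ (El.map_right _))
    refine (El.map_comp _ _ _).trans ((congrArg _ (El.map_whiskerLeft _ _ _)).trans ?_)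
    refine (map_rComp _ f).trans (congrArg (· ≫ f) ?_)
    refine (map_sectR _ _ _).trans ((El.map_comp _ _ _).trans ?_)
    exact congrArg _ (El.map_id _)
  · refine (El.map_comp _ _ _).trans ((congrArg _ ((El.map_whiskerLeft _ _ _).trans
      (congrArg _ (El.map_left_inv _)))).trans ?_)
    refine (El.map_tt _ _ _ _ _ _).trans (congrArg₂ El.pair (El.map_right _) ?_)
    refine (El.map_comp _ _ _).trans ((congrArg _ (El.map_whiskerLeft _ _ _)).trans ?_)
    exact congrArg (g ≫ ·) (map_sectR _ _ _)

end ModuleStr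

end ProV

namespace ProV

variable {V : Type u} [Category.{v} V] [MonoidalCategory V] [SymmetricCategory V]

/-! ### The prescribed components on elements -/

section Components

variable {C M : Type v} [EnrichedCategory V C] [EnrichedCategory V M]

theorem map_alphaComp {a b m₁ n₁ m₂ n₂ m₃ n₃ p q p' q' : M} (f : Mor V p a) (g : Mor V p' q)
    (h : Mor V b q') (f' : Mor V m₁ p) (g' : Mor V m₂ n₁) (h' : Mor V q n₂) (k : Mor V m₃ p')
    (l : Mor V q' n₃) : El.map (alphaComp a b m₁ n₁ m₂ n₂ m₃ n₃ p q p' q')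
      (El.pair (El.pair f (El.pair g h)) (El.pair (El.pair f' (El.pair g' h')) (El.pair k l))) =
    El.pair (f' ≫ f) (El.pair g' (El.pair (k ≫ g ≫ h') (h ≫ l))) := by
  simp only [alphaComp, El.map_comp, El.map_mu, El.map_tensor, El.map_assoc_inv, El.map_tt,
    El.map_assoc, El.map_whiskerLeft, El.map_whiskerRight]
  erw [map_rComp, map_rComp, map_rComp, map_eComp, Category.assoc]

theorem map_alphaExpand {a b m₁ n₁ m₂ n₂ m₃ n₃ : M} (f : Mor V m₁ a) (g : Mor V m₂ n₁)
    (h : Mor V m₃ n₂) (k : Mor V b n₃) : El.map (alphaExpand a b m₁ n₁ m₂ n₂ m₃ n₃)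
      (El.pair f (El.pair g (El.pair h k))) =
    El.pair (El.pair f (El.pair g k)) (El.pair (El.pair (𝟙 (Und.of V m₁)) (𝟙 (Und.of V n₁)))
      (El.pair (𝟙 (Und.of V m₂)) (El.pair h (𝟙 (Und.of V n₃))))) := by
  simp only [alphaExpand, twoId, El.map_comp, El.map_tensor, El.map_assoc_inv, El.map_braid,
    El.map_left_inv, El.map_right_inv, El.map_whiskerLeft, El.map_whiskerRight]
  rfl

theorem map_lambdaMap {a b m n p q p' q' : M} (f : Mor V p a) (g : Mor V p' q)
    (h : Mor V b q') (w : Mor V q p) (k : Mor V m p') (l : Mor V q' n) :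
    El.map (lambdaMap a b m n p q p' q')
      (El.pair (El.pair f (El.pair g h)) (El.pair w (El.pair k l))) =
    El.pair (k ≫ g ≫ w ≫ f) (h ≫ l) := by
  simp only [lambdaMap, El.map_comp, El.map_tt, El.map_assoc_inv, El.map_whiskerRight]
  erw [map_rComp, map_rComp, map_rComp, map_eComp, Category.assoc]

theorem map_rhoMap {a b m n p q p' q' : M} (f : Mor V p a) (g : Mor V p' q)
    (h : Mor V b q') (k : Mor V m p) (l : Mor V q n) (w : Mor V q' p') :
    El.map (rhoMap a b m n p q p' q')
      (El.pair (El.pair f (El.pair g h)) (El.pair (El.pair k l) w)) =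
    El.pair (k ≫ f) (h ≫ w ≫ g ≫ l) := by
  simp only [rhoMap, El.map_comp, El.map_tt, El.map_assoc, El.map_whiskerLeft]
  erw [map_rComp, map_rComp, map_eComp, map_eComp, Category.assoc]

namespace ModuleStr

variable {S : MonoidalStr V C} (L : ModuleStr S M)

theorem map_muMap {x y : C} {a b m n p q : M} (f : Mor V (L.ob x p) a) (g : Mor V b (L.ob x q))
    (f' : Mor V (L.ob y m) p) (g' : Mor V q (L.ob y n)) :
    El.map (L.muMap x y a b m n p q) (El.pair (El.pair f g) (El.pair f' g')) =
      El.pair ((L.as x y m).hom ≫ biE L.act (𝟙 (Und.of V x)) f' ≫ f)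
        (g ≫ biE L.act (𝟙 (Und.of V x)) g' ≫ (L.as x y n).inv) := by
  refine (El.map_tt _ _ _ _ _ _).trans (congrArg₂ El.pair ?_ ?_)
  · refine (El.map_comp _ _ _).trans ((congrArg _ (El.map_whiskerLeft _ _ _)).trans ?_)
    refine (El.map_comp _ _ _).trans ((congrArg _ (map_rComp _ f)).trans ?_)
    exact (map_pre _ _).trans (congrArg (fun t => (L.as x y m).hom ≫ t ≫ f) (map_sectL _ _ _))
  · refine (El.map_comp _ _ _).trans ((congrArg _ (El.map_whiskerLeft _ _ _)).trans ?_)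
    refine (El.map_comp _ _ _).trans ((map_post _ _).trans ?_)
    refine (congrArg (fun t => (g ≫ t) ≫ (L.as x y n).inv) (map_sectL _ _ _)).trans ?_
    exact Category.assoc _ _ _

theorem map_etaMap {a b m n : M} (f : Mor V m a) (g : Mor V b n) :
    El.map (L.etaMap a b m n) (El.pair f g) =
      El.pair ((L.lu m).hom ≫ f) (g ≫ (L.lu n).inv) :=
  (El.map_tensor _ _ _ _).trans (congrArg₂ El.pair (map_pre _ _) (map_post _ _))

theorem map_tauMap {x : C} {a b m₁ n₁ m₂ n₂ p q : M} (f : Mor V (L.ob x p) a)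
    (g : Mor V b (L.ob x q)) (h : Mor V m₁ p) (k : Mor V m₂ n₁) (l : Mor V q n₂) :
    El.map (L.tauMap x a b m₁ n₁ m₂ n₂ p q) (El.pair (El.pair f g) (El.pair h (El.pair k l))) =
      El.pair (biE L.act (𝟙 (Und.of V x)) h ≫ f) (El.pair (biE L.act (𝟙 (Und.of V x)) k)
        (g ≫ biE L.act (𝟙 (Und.of V x)) l)) := by
  refine (El.map_comp _ _ _).trans ((congrArg _ (El.map_mu _ _ _ _)).trans ?_)
  refine (El.map_tensor _ _ _ _).trans (congrArg₂ El.pair ?_ ?_)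
  · refine (El.map_comp _ _ _).trans ((congrArg _ (El.map_whiskerLeft _ _ _)).trans ?_)
    exact (map_rComp _ f).trans (congrArg (· ≫ f) (map_sectL _ _ _))
  · refine (El.map_comp _ _ _).trans ((congrArg _ (El.map_sw' _ _ _)).trans ?_)
    refine (El.map_tensor _ _ _ _).trans (congrArg₂ El.pair (map_sectL _ _ _) ?_)
    refine (El.map_comp _ _ _).trans ((congrArg _ (El.map_whiskerLeft _ _ _)).trans ?_)
    exact congrArg (g ≫ ·) (map_sectL _ _ _)

theorem map_nuMap {x : C} {a b m n : M} (f : Mor V (L.ob x m) a) (g : Mor V b (L.ob x n))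
    (h : Mor V n m) : El.map (L.nuMap x a b m n) (El.pair (El.pair f g) h) =
      g ≫ biE L.act (𝟙 (Und.of V x)) h ≫ f := by
  refine (El.map_comp _ _ _).trans ((congrArg _ ((El.map_whiskerRight _ _ _).trans
    (congrArg (El.pair · _) (El.map_braid _ _)))).trans ?_)
  refine (El.map_comp _ _ _).trans ((congrArg _ (El.map_assoc _ _ _)).trans ?_)
  refine (El.map_comp _ _ _).trans ((congrArg _ (El.map_whiskerLeft _ _ _)).trans ?_)
  refine congrArg (g ≫ ·) ?_
  refine (El.map_comp _ _ _).trans ((congrArg _ (El.map_whiskerLeft _ _ _)).trans ?_)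
  exact (map_rComp _ f).trans (congrArg (· ≫ f) (map_sectL _ _ _))

end ModuleStr
end Components

/-! ### Maps of profunctors checked on elements -/

namespace Prof

variable {C D E : Type v} [EnrichedCategory V C] [EnrichedCategory V D] [EnrichedCategory V E]
  [∀ c c' : C, Cover (c ⟶[V] c')] [∀ c c' : D, Cover (c ⟶[V] c')] [∀ c c' : E, Cover (c ⟶[V] c')]

/-- A map of profunctors given by maps that commute with the actions on elements. -/
def homE {F G : Prof V C D} [∀ d c, Cover (F.obj d c)] (k : ∀ d c, F.obj d c ⟶ G.obj d c)
    (hl : ∀ (d d' : D) c, Cover.all fun h : El (d ⟶[V] d') => Cover.all fun x : El (F.obj d' c) =>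
      El.map (k d c) (lE F h x) = lE G h (El.map (k d' c) x))
    (hr : ∀ d (c c' : C), Cover.all fun x : El (F.obj d c) => Cover.all fun h : El (c ⟶[V] c') =>
      El.map (k d c') (rE F x h) = rE G (El.map (k d c) x) h) : F ⟶ G where
  app := k
  la_app d d' c := by
    apply Cover.ext
    have := hl d d' c
    simpa [lE, Cover.all] using this
  ra_app d c c' := by
    apply Cover.ext
    have := hr d c c'
    simpa [rE, Cover.all] using this

variable [MonoidalClosed V] [HasColimitsOfSize.{v, v} V]

/-- The map out of a composition of profunctors given by maps that are balanced and commute with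
the actions on elements. -/
def liftE (G : Prof V D E) (F : Prof V C D) (H : Prof V C E) [∀ e d, Cover (G.obj e d)]
    [∀ d c, Cover (F.obj d c)] (k : ∀ d e c, G.obj e d ⊗ F.obj d c ⟶ H.obj e c)
    (bal : ∀ (d d' : D) e c, Cover.all fun x : El (G.obj e d) => Cover.all fun h : El (d ⟶[V] d') =>
      Cover.all fun y : El (F.obj d' c) =>
      El.map (k d' e c) (El.pair (rE G x h) y) = El.map (k d e c) (El.pair x (lE F h y)))
    (hl : ∀ d (e e' : E) c, Cover.all fun h : El (e ⟶[V] e') => Cover.all fun x : El (G.obj e' d) =>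
      Cover.all fun y : El (F.obj d c) =>
      El.map (k d e c) (El.pair (lE G h x) y) = lE H h (El.map (k d e' c) (El.pair x y)))
    (hr : ∀ d e (c c' : C), Cover.all fun x : El (G.obj e d) => Cover.all fun y : El (F.obj d c) =>
      Cover.all fun h : El (c ⟶[V] c') =>
      El.map (k d e c') (El.pair x (rE F y h)) = rE H (El.map (k d e c) (El.pair x y)) h) :
    G.comp F ⟶ H :=
  lift G F H k
    (fun d d' e c => by
      apply Cover.ext
      have := bal d d' e c
      simpa [lE, rE, Cover.all] using this)
    (fun d e e' c => by
      apply Cover.ext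
      have := hl d e e' c
      simpa [lE, rE, Cover.all] using this)
    (fun d e c c' => by
      apply Cover.ext
      have := hr d e c c'
      simpa [lE, rE, Cover.all] using this)

end Prof

end ProV

namespace ProV

variable {V : Type u} [Category.{v} V] [MonoidalCategory V] [SymmetricCategory V]
variable {C M : Type v} [EnrichedCategory V C] [EnrichedCategory V M]
variable {S : MonoidalStr V C} [MonoidalClosed V] [HasColimitsOfSize.{v, v} V]

/-! ### Descent along the coend that defines `T` -/

namespace ModuleStr

variable (L : ModuleStr S M)

/-- Maps out of the profunctor `T`, given on elements. -/
theorem exists_descT {d c : Mᵒᵖ × M} {Y Z : V} [Cover Y]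
    (k : ∀ x : C, ((L.ob x c.1.unop ⟶[V] d.1.unop) ⊗ (d.2 ⟶[V] L.ob x c.2)) ⊗ Y ⟶ Z)
    (hk : ∀ (x x' : C) (t : Mor V x x') (f : Mor V (L.ob x' c.1.unop) d.1.unop)
      (g : Mor V d.2 (L.ob x c.2)), Cover.all fun y : El Y =>
      El.map (k x) (El.pair (El.pair (biE L.act t (𝟙 (Und.of V c.1.unop)) ≫ f) g) y) =
        El.map (k x') (El.pair (El.pair f (g ≫ biE L.act t (𝟙 (Und.of V c.2)))) y)) :
    ∃ K : L.T.obj d c ⊗ Y ⟶ Z, ∀ (x : C) (f : Mor V (L.ob x c.1.unop) d.1.unop)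
      (g : Mor V d.2 (L.ob x c.2)) (y : El Y),
      El.map K (El.pair (L.tE x f g) y) = El.map (k x) (El.pair (El.pair f g) y) := by
  obtain ⟨K, hK⟩ := (((Prof.glue₂ (Prof.one Mᵒᵖ) (Prof.one M) ((opProd C M).comp V (opF L.act))
    L.act).isCoend d c).whiskerRight Y).exists_desc k (by
      rintro ⟨x, x'⟩
      let R : V := ((L.ob x' c.1.unop ⟶[V] d.1.unop) ⊗ (d.2 ⟶[V] L.ob x c.2)) ⊗ (x ⟶[V] x')
      -- The test principle on the gluing object, restated with its generators typed as morphisms so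
      -- that they can be composed.
      have : ∀ φ ψ : R ⊗ Y ⟶ Z, (∀ (f : Mor V (L.ob x' c.1.unop) d.1.unop)
          (g : Mor V d.2 (L.ob x c.2)) (t : Mor V x x'), Cover.all fun y : El Y =>
          El.map φ (El.pair (El.pair (El.pair f g) t) y) =
            El.map ψ (El.pair (El.pair (El.pair f g) t) y)) → φ = ψ :=
        fun φ ψ h => Cover.ext h
      refine this _ _ fun f g t => cast (congrArg Cover.all (funext fun y => congrArg₂ Eq
        (Eq.symm ((El.map_comp _ _ _).trans ?_)) (Eq.symm ((El.map_comp _ _ _).trans ?_))))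
        (hk x x' t f g)
      · refine (congrArg _ (El.map_whiskerRight _ _ _)).trans
          (congrArg (fun e => El.map _ (El.pair e y)) ?_)
        refine (El.map_comp _ _ _).trans ((congrArg _ ((El.map_whiskerLeft _ _ _).trans
          (congrArg _ (El.map_right_inv _)))).trans ?_)
        refine (El.map_tt _ _ _ _ _ _).trans (congrArg₂ El.pair ?_ (El.map_right _))
        refine (El.map_comp _ _ _).trans ((congrArg _ (El.map_whiskerLeft _ _ _)).trans ?_)
        refine (map_rComp _ f).trans (congrArg (· ≫ f) ?_)
        refine (map_sectR _ _ _).trans ((El.map_comp _ _ _).trans ?_)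
        exact congrArg _ (El.map_id _)
      · refine (congrArg _ (El.map_whiskerRight _ _ _)).trans
          (congrArg (fun e => El.map _ (El.pair e y)) ?_)
        refine (El.map_comp _ _ _).trans ((congrArg _ ((El.map_whiskerLeft _ _ _).trans
          (congrArg _ (El.map_left_inv _)))).trans ?_)
        refine (El.map_tt _ _ _ _ _ _).trans (congrArg₂ El.pair (El.map_right _) ?_)
        refine (El.map_comp _ _ _).trans ((congrArg _ (El.map_whiskerLeft _ _ _)).trans ?_)
        exact congrArg (g ≫ ·) (map_sectR _ _ _))
  refine ⟨K, fun x f g y => ?_⟩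
  have := congrArg (El.map · (El.pair (El.pair f g) y)) (hK x)
  refine Eq.trans ?_ this
  refine Eq.trans ?_ (El.map_comp _ _ _).symm
  exact congrArg _ (El.map_whiskerRight _ _ _).symm

end ModuleStr

end ProV

namespace ProV

variable {V : Type u} [Category.{v} V] [MonoidalCategory V] [SymmetricCategory V]

/-! ### Standard forms in the composite of `M` with `T ⊗ T` -/

namespace Prof

variable {C D C' D' : Type v} [EnrichedCategory V C] [EnrichedCategory V D]
  [EnrichedCategory V C'] [EnrichedCategory V D']

theorem lE_tens (F : Prof V C D) (G : Prof V C' D') {d d' : D × D'} {c : C × C'}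
    (h : El (d.1 ⟶[V] d'.1)) (h' : El (d.2 ⟶[V] d'.2)) (x : El (F.obj d'.1 c.1))
    (y : El (G.obj d'.2 c.2)) : lE (F.tens G) (d := d) (d' := d') (c := c) (El.pair h h')
      (El.pair x y) = El.pair (lE F h x) (lE G h' y) := El.map_tt _ _ _ _ _ _

theorem rE_tens (F : Prof V C D) (G : Prof V C' D') {d : D × D'} {c c' : C × C'}
    (x : El (F.obj d.1 c.1)) (y : El (G.obj d.2 c.2)) (h : El (c.1 ⟶[V] c'.1))
    (h' : El (c.2 ⟶[V] c'.2)) : rE (F.tens G) (d := d) (c := c) (c' := c') (El.pair x y)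
      (El.pair h h') = El.pair (rE F x h) (rE G y h') := El.map_tt _ _ _ _ _ _

/-- The balancing relation for `M`: morphisms that act on the two branches are absorbed into the
three legs of the root. All standard forms below come from it. -/
theorem cp_mE {M : Type v} [EnrichedCategory V M] [MonoidalClosed V] [HasColimitsOfSize.{v, v} V]
    (F : Prof V C (Mᵒᵖ × M)) (G : Prof V C' (Mᵒᵖ × M)) {e : Mᵒᵖ × M}
    {d d' : (Mᵒᵖ × M) × (Mᵒᵖ × M)} {c : C × C'} (f : Mor V d.1.1.unop e.1.unop)
    (g : Mor V d.2.1.unop d.1.2) (h : Mor V e.2 d.2.2)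
    (u : Mor V d'.1.1.unop d.1.1.unop) (w : Mor V d.1.2 d'.1.2)
    (u' : Mor V d'.2.1.unop d.2.1.unop) (w' : Mor V d.2.2 d'.2.2)
    (x : El (F.obj d'.1 c.1)) (y : El (G.obj d'.2 c.2)) :
    cp (mulP V M) (F.tens G) (c := c) d (mE f g h)
        (El.pair (lE F (hE u w) x) (lE G (hE u' w') y)) =
      cp (mulP V M) (F.tens G) (c := c) d' (mE (u ≫ f) (u' ≫ g ≫ w) (h ≫ w')) (El.pair x y) := by
  refine (congrArg _ (lE_tens F G _ _ _ _).symm).trans ?_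
  refine (cp_bal _ _ _ _ _).symm.trans ?_
  exact congrArg (cp (mulP V M) (F.tens G) (c := c) d' · (El.pair x y)) (rE_mE f g h u w u' w')

end Prof

variable {C M : Type v} [EnrichedCategory V C] [EnrichedCategory V M]
variable {S : MonoidalStr V C} [MonoidalClosed V] [HasColimitsOfSize.{v, v} V]

namespace ModuleStr

variable (L : ModuleStr S M)

theorem as_inv_natural {x x' y y' : C} {m m' : M} (k : Mor V x x') (h : Mor V y y')
    (f : Mor V m m') : (L.as x y m).inv ≫ biE L.act (biE S.tensor k h) f =
      biE L.act k (biE L.act h f) ≫ (L.as x' y' m').inv := by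
  rw [Iso.inv_comp_eq, ← as_natural_assoc, Iso.hom_inv_id, Category.comp_id]

theorem lu_inv_natural {m m' : M} (f : Mor V m m') :
    (L.lu m).inv ≫ biE L.act (𝟙 (Und.of V S.unit)) f = f ≫ (L.lu m').inv := by
  rw [Iso.inv_comp_eq, ← lu_natural_assoc, Iso.hom_inv_id, Category.comp_id]

theorem lu_inv_natural_assoc {m m' z : M} (f : Mor V m m') (g : Mor V (L.ob S.unit m') z) :
    (L.lu m).inv ≫ biE L.act (𝟙 (Und.of V S.unit)) f ≫ g = f ≫ (L.lu m').inv ≫ g := by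
  rw [← Category.assoc, lu_inv_natural, Category.assoc]

/-- The form in which the relation of `T` is applied: two representatives are compared by exhibiting
one morphism `k` that fits both legs. -/
theorem tE_eq {d c : Mᵒᵖ × M} {x x' : C} (k : Mor V x x')
    {f : Mor V (L.ob x c.1.unop) d.1.unop} {f' : Mor V (L.ob x' c.1.unop) d.1.unop}
    {g : Mor V d.2 (L.ob x c.2)} {g' : Mor V d.2 (L.ob x' c.2)}
    (hf : f = biE L.act k (𝟙 (Und.of V c.1.unop)) ≫ f')
    (hg : g' = g ≫ biE L.act k (𝟙 (Und.of V c.2))) :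
    L.tE (d := d) (c := c) x f g = L.tE x' f' g' := by
  rw [hf, hg, tE_bal]

/-- The element of `T` given by an object `x` and identities. -/
def iE (x : C) (c : Mᵒᵖ × M) : El (L.T.obj (op (L.ob x c.1.unop), L.ob x c.2) c) :=
  L.tE x (𝟙 (Und.of V (L.ob x c.1.unop))) (𝟙 (Und.of V (L.ob x c.2)))

/-- The generators of `T` arise from the elements with identity legs by the left action, so in a
tree their legs can be pushed into the root. -/
theorem lE_iE {d c : Mᵒᵖ × M} (x : C) (f : Mor V (L.ob x c.1.unop) d.1.unop)
    (g : Mor V d.2 (L.ob x c.2)) : 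
    Prof.lE L.T (d' := (op (L.ob x c.1.unop), L.ob x c.2)) (hE f g) (L.iE x c) = L.tE x f g := by
  refine (L.lE_tE _ _ _ _ _).trans ?_
  exact congrArg₂ (L.tE x) (Category.id_comp _) (Category.comp_id _)

/-- The elements with identities as components generate the composition of `M` with `T ⊗ T`. -/
theorem cp_tE {e : Mᵒᵖ × M} {d c : (Mᵒᵖ × M) × (Mᵒᵖ × M)} (f : Mor V d.1.1.unop e.1.unop)
    (g : Mor V d.2.1.unop d.1.2) (h : Mor V e.2 d.2.2) (x y : C)
    (k : Mor V (L.ob x c.1.1.unop) d.1.1.unop) (l : Mor V d.1.2 (L.ob x c.1.2))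
    (k' : Mor V (L.ob y c.2.1.unop) d.2.1.unop) (l' : Mor V d.2.2 (L.ob y c.2.2)) :
    Prof.cp (mulP V M) (L.T.tens L.T) (c := c) d (mE f g h)
        (El.pair (L.tE x k l) (L.tE y k' l')) =
      Prof.cp (mulP V M) (L.T.tens L.T) (c := c)
        ((op (L.ob x c.1.1.unop), L.ob x c.1.2), (op (L.ob y c.2.1.unop), L.ob y c.2.2))
        (mE (k ≫ f) (k' ≫ g ≫ l) (h ≫ l')) (El.pair (L.iE x c.1) (L.iE y c.2)) := by
  rw [← lE_iE L x k l, ← lE_iE L y k' l']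
  exact Prof.cp_mE (d' := ((op (L.ob x c.1.1.unop), L.ob x c.1.2), (op (L.ob y c.2.1.unop),
    L.ob y c.2.2))) _ _ _ _ _ _ _ _ _ _ _

/-- The composite of three morphisms as an element of the composition of `M` with `T ⊗ T`. -/
def wE {e : Mᵒᵖ × M} {c : (Mᵒᵖ × M) × (Mᵒᵖ × M)} (x y : C)
    (f : Mor V (L.ob x c.1.1.unop) e.1.unop) (g : Mor V (L.ob y c.2.1.unop) (L.ob x c.1.2))
    (h : Mor V e.2 (L.ob y c.2.2)) : El (((mulP V M).comp (L.T.tens L.T)).obj e c) :=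
  Prof.cp (mulP V M) (L.T.tens L.T) (c := c)
    ((op (L.ob x c.1.1.unop), L.ob x c.1.2), (op (L.ob y c.2.1.unop), L.ob y c.2.2))
    (mE f g h) (El.pair (L.iE x c.1) (L.iE y c.2))

/-- Both sides are standard forms of a single element. Its left branch is represented either over
`x`, with `t` on the contravariant leg, or over `x'`, with `t` on the covariant leg, and pushing `t`
into the root gives the two sides. -/
theorem wE_bal_left {e : Mᵒᵖ × M} {c : (Mᵒᵖ × M) × (Mᵒᵖ × M)} {x x' : C} (y : C) (t : Mor V x x')
    (f : Mor V (L.ob x' c.1.1.unop) e.1.unop) (g : Mor V (L.ob y c.2.1.unop) (L.ob x c.1.2))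
    (h : Mor V e.2 (L.ob y c.2.2)) : L.wE (c := c) x y (biE L.act t (𝟙 _) ≫ f) g h =
      L.wE x' y f (g ≫ biE L.act t (𝟙 _)) h := by
  have h1 := L.cp_tE (d := ((op (L.ob x' c.1.1.unop), L.ob x c.1.2), (op (L.ob y c.2.1.unop),
    L.ob y c.2.2))) (c := c) f g h x y (biE L.act t (𝟙 _)) (𝟙 _) (𝟙 _) (𝟙 _)
  have h2 := L.cp_tE (d := ((op (L.ob x' c.1.1.unop), L.ob x c.1.2), (op (L.ob y c.2.1.unop),
    L.ob y c.2.2))) (c := c) f g h x' y (𝟙 _) (biE L.act t (𝟙 _)) (𝟙 _) (𝟙 _)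
  have h3 : L.tE (d := (op (L.ob x' c.1.1.unop), L.ob x c.1.2)) (c := c.1) x
      (biE L.act t (𝟙 _)) (𝟙 _) = L.tE x' (𝟙 _) (biE L.act t (𝟙 _)) :=
    L.tE_eq t (Category.comp_id _).symm (Category.id_comp _).symm
  rw [h3] at h1
  have h4 := h1.symm.trans h2
  simp only [Category.comp_id, Category.id_comp] at h4
  exact h4

/-- The same argument in the right branch. With `wE_bal_left` it lets a morphism travel from the
first leg through the middle to the last, as the dinaturality of `τ` requires. -/
theorem wE_bal_right {e : Mᵒᵖ × M} {c : (Mᵒᵖ × M) × (Mᵒᵖ × M)} (x : C) {y y' : C} (t : Mor V y y')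
    (f : Mor V (L.ob x c.1.1.unop) e.1.unop) (g : Mor V (L.ob y' c.2.1.unop) (L.ob x c.1.2))
    (h : Mor V e.2 (L.ob y c.2.2)) : L.wE (c := c) x y f (biE L.act t (𝟙 _) ≫ g) h =
      L.wE x y' f g (h ≫ biE L.act t (𝟙 _)) := by
  have h1 := L.cp_tE (d := ((op (L.ob x c.1.1.unop), L.ob x c.1.2), (op (L.ob y' c.2.1.unop),
    L.ob y c.2.2))) (c := c) f g h x y (𝟙 _) (𝟙 _) (biE L.act t (𝟙 _)) (𝟙 _)
  have h2 := L.cp_tE (d := ((op (L.ob x c.1.1.unop), L.ob x c.1.2), (op (L.ob y' c.2.1.unop),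
    L.ob y c.2.2))) (c := c) f g h x y' (𝟙 _) (𝟙 _) (𝟙 _) (biE L.act t (𝟙 _))
  have h3 : L.tE (d := (op (L.ob y' c.2.1.unop), L.ob y c.2.2)) (c := c.2) y
      (biE L.act t (𝟙 _)) (𝟙 _) = L.tE y' (𝟙 _) (biE L.act t (𝟙 _)) :=
    L.tE_eq t (Category.comp_id _).symm (Category.id_comp _).symm
  rw [h3] at h1
  have h4 := h1.symm.trans h2
  simp only [Category.comp_id, Category.id_comp] at h4
  exact h4

theorem lE_wE {e e' : Mᵒᵖ × M} {c : (Mᵒᵖ × M) × (Mᵒᵖ × M)} (x y : C)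
    (u : Mor V e'.1.unop e.1.unop) (w : Mor V e.2 e'.2)
    (f : Mor V (L.ob x c.1.1.unop) e'.1.unop) (g : Mor V (L.ob y c.2.1.unop) (L.ob x c.1.2))
    (h : Mor V e'.2 (L.ob y c.2.2)) : Prof.lE ((mulP V M).comp (L.T.tens L.T)) (hE u w)
      (L.wE (c := c) x y f g h) = L.wE x y (f ≫ u) g (w ≫ h) := by
  refine (Prof.lE_comp _ _ _ _ _ _).trans ?_
  exact congrArg (Prof.cp _ _ _ · _) (lE_mE _ _ _ _ _)

theorem rE_iE {c c' : Mᵒᵖ × M} (x : C) (u : Mor V c'.1.unop c.1.unop) (w : Mor V c.2 c'.2) :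
    Prof.rE L.T (L.iE x c) (hE u w) = L.tE (c := c') (d := (op (L.ob x c.1.unop), L.ob x c.2)) x
      (biE L.act (𝟙 (Und.of V x)) u) (biE L.act (𝟙 (Und.of V x)) w) := by
  refine (L.rE_tE _ _ _ _ _).trans ?_
  exact congrArg₂ (L.tE x) (Category.comp_id _) (Category.id_comp _)

theorem rE_wE {e : Mᵒᵖ × M} {c c' : (Mᵒᵖ × M) × (Mᵒᵖ × M)} (x y : C)
    (f : Mor V (L.ob x c.1.1.unop) e.1.unop) (g : Mor V (L.ob y c.2.1.unop) (L.ob x c.1.2))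
    (h : Mor V e.2 (L.ob y c.2.2)) (u : Mor V c'.1.1.unop c.1.1.unop) (w : Mor V c.1.2 c'.1.2)
    (u' : Mor V c'.2.1.unop c.2.1.unop) (w' : Mor V c.2.2 c'.2.2) :
    Prof.rE ((mulP V M).comp (L.T.tens L.T)) (c' := c') (L.wE (c := c) x y f g h)
        (El.pair (hE u w) (hE u' w')) =
      L.wE x y (biE L.act (𝟙 _) u ≫ f) (biE L.act (𝟙 _) u' ≫ g ≫ biE L.act (𝟙 _) w)
        (h ≫ biE L.act (𝟙 _) w') := by
  refine (Prof.rE_comp _ _ _ _ _ _).trans ?_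
  refine (congrArg (Prof.cp _ _ _ _) (Prof.rE_tens _ _ _ _ _ _)).trans ?_
  refine (congrArg (Prof.cp _ _ _ _) (congrArg₂ El.pair (L.rE_iE _ _ _)
    (L.rE_iE _ _ _))).trans ?_
  exact L.cp_tE _ _ _ _ _ _ _ _ _

end ModuleStr

end ProV

namespace ProV

variable {V : Type u} [Category.{v} V] [MonoidalCategory V] [SymmetricCategory V]
variable {C M : Type v} [EnrichedCategory V C] [EnrichedCategory V M]
variable {S : MonoidalStr V C} [MonoidalClosed V] [HasColimitsOfSize.{v, v} V]

/-! ### Existence of `ν`, `η`, `μ` and `τ` -/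

namespace ModuleStr

variable (L : ModuleStr S M)

/-- Dinaturality in `x` is the interchange law for the action, and the balancing condition is
functoriality of `x ⊡ -`. -/
theorem exists_nu : ∃ ν : L.T.comp (Prof.ev M) ⟶ Prof.ev M,
    ∀ (d e : Mᵒᵖ × M) (c : PUnit.{v + 1}) (x : C) (f : Mor V (L.ob x e.1.unop) d.1.unop)
      (g : Mor V d.2 (L.ob x e.2)) (w : Mor V e.2 e.1.unop),
      Prof.ap ν (Prof.cp L.T (Prof.ev M) e (L.tE x f g) (uE (c := c) w)) =
        uE (g ≫ biE L.act (𝟙 (Und.of V x)) w ≫ f) := by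
  have key : ∀ (e d : Mᵒᵖ × M) (c : PUnit.{v + 1}),
      ∃ K : L.T.obj d e ⊗ (Prof.ev (V := V) M).obj e c ⟶ (Prof.ev (V := V) M).obj d c,
      ∀ (x : C) (f : Mor V (L.ob x e.1.unop) d.1.unop) (g : Mor V d.2 (L.ob x e.2))
      (w : Mor V e.2 e.1.unop), El.map K (El.pair (L.tE x f g) (uE (c := c) w)) =
        uE (c := c) (g ≫ biE L.act (𝟙 (Und.of V x)) w ≫ f) := by
    intro e d c
    obtain ⟨K, hK⟩ := L.exists_descT (d := d) (c := e) (Y := (Prof.ev (V := V) M).obj e c)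
      (Z := (Prof.ev (V := V) M).obj d c)
      (fun x => L.nuMap x d.1.unop d.2 e.1.unop e.2) (by
        intro x x' t f g (w : Mor V e.2 e.1.unop)
        refine (L.map_nuMap _ _ w).trans (Eq.trans ?_ (L.map_nuMap _ _ w).symm)
        simp [biE_comp_assoc])
    exact ⟨K, fun x f g w => (hK x f g _).trans (L.map_nuMap _ _ _)⟩
  choose K hK using key
  refine ⟨Prof.liftE _ _ _ K ?_ ?_ ?_, ?_⟩
  · intro e e' d c x f g u w w'
    rw [rE_tE, lE_uE, hK, hK]
    simp [biE_comp_assoc]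
  · intro e d d' c u w x f g w'
    rw [lE_tE, hK, hK, lE_uE]
    simp
  · intro e d c c' x f g w'
    exact (congrArg (fun t => El.map _ (El.pair _ t)) (rE_uE w')).trans
      ((hK _ _ _ _ _ _ _).trans
        ((congrArg (Prof.rE _ · _) (hK _ _ _ _ _ _ _)).trans (rE_uE _)).symm)
  · intro d e c x f g w
    exact (Prof.ap_lift _ _ _ _ _ _ _ _ _).trans (hK _ _ _ _ _ _ _)

/-- No relation has to be respected, since the source is not a coend. The right action is preserved
by naturality of `lu`. -/
theorem exists_eta : ∃ η : Prof.one (Mᵒᵖ × M) ⟶ L.T,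
    ∀ (d c : Mᵒᵖ × M) (f : Mor V c.1.unop d.1.unop) (g : Mor V d.2 c.2),
      Prof.ap η (hE f g) = L.tE (d := d) (c := c) S.unit ((L.lu c.1.unop).hom ≫ f) (g ≫ (L.lu c.2).inv) := by
  have key : ∀ (d c : Mᵒᵖ × M), ∃ K : (d ⟶[V] c) ⟶ L.T.obj d c, 
    ∀ (f : Mor V c.1.unop d.1.unop) (g : Mor V d.2 c.2), El.map K (hE f g) =
      L.tE S.unit ((L.lu c.1.unop).hom ≫ f) (g ≫ (L.lu c.2).inv) := fun d c =>
    ⟨L.etaMap d.1.unop d.2 c.1.unop c.2 ≫ L.ιT S.unit d.1.unop d.2 c.1.unop c.2, fun f g =>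
      (El.map_comp _ _ _).trans (congrArg _ (L.map_etaMap f g))⟩
  choose K hK using key
  refine ⟨Prof.homE (F := Prof.one (Mᵒᵖ × M)) K ?_ ?_, hK⟩
  · intro d d' c u w f g
    refine (congrArg _ (lE_one_hE _ _ _ _)).trans ?_
    rw [hK, hK, lE_tE]
    simp
  · intro d c c' f g u w
    refine (congrArg _ (rE_one_hE _ _ _ _)).trans ?_
    rw [hK, hK, rE_tE]
    rw [lu_natural_assoc, Category.assoc, Category.assoc, lu_inv_natural]

/-- Three coends are descended in turn: over `y`, over `x`, and over the middle object. The first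
two conditions come from naturality of the associator in its `C`-variables, with the relation of `T`
at the tensor product. -/
theorem exists_mu : ∃ μ : L.T.comp L.T ⟶ L.T,
    ∀ (d e c : Mᵒᵖ × M) (x y : C) (f : Mor V (L.ob x e.1.unop) d.1.unop)
      (g : Mor V d.2 (L.ob x e.2)) (f' : Mor V (L.ob y c.1.unop) e.1.unop)
      (g' : Mor V e.2 (L.ob y c.2)),
      Prof.ap μ (Prof.cp L.T L.T e (L.tE x f g) (L.tE (c := c) y f' g')) =
        L.tE (S.tensor.obj (x, y)) ((L.as x y _).hom ≫ biE L.act (𝟙 (Und.of V x)) f' ≫ f)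
          (g ≫ biE L.act (𝟙 (Und.of V x)) g' ≫ (L.as x y _).inv) := by
  have key : ∀ (e d c : Mᵒᵖ × M),
      ∃ K : L.T.obj d e ⊗ L.T.obj e c ⟶ L.T.obj d c,
      ∀ (x y : C) (f : Mor V (L.ob x e.1.unop) d.1.unop)
      (g : Mor V d.2 (L.ob x e.2)) (f' : Mor V (L.ob y c.1.unop) e.1.unop)
      (g' : Mor V e.2 (L.ob y c.2)), El.map K (El.pair (L.tE x f g) (L.tE y f' g')) =
        L.tE (S.tensor.obj (x, y)) ((L.as x y _).hom ≫ biE L.act (𝟙 (Und.of V x)) f' ≫ f)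
          (g ≫ biE L.act (𝟙 (Und.of V x)) g' ≫ (L.as x y _).inv) := by
    intro e d c
    -- The braiding puts the second copy of `T` on the left, the side on which `exists_descT` works.
    -- It is undone by another braiding when `x` is descended.
    have h0 : ∀ (x y : C) (f : Mor V (L.ob x e.1.unop) d.1.unop)
      (g : Mor V d.2 (L.ob x e.2)) (f' : Mor V (L.ob y c.1.unop) e.1.unop)
      (g' : Mor V e.2 (L.ob y c.2)), El.map ((β_ _ _).hom ≫
        L.muMap x y d.1.unop d.2 c.1.unop c.2 e.1.unop e.2 ≫ L.ιT _ _ _ _ _)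
        (El.pair (El.pair f' g') (El.pair f g)) = 
        L.tE (S.tensor.obj (x, y)) ((L.as x y _).hom ≫ biE L.act (𝟙 (Und.of V x)) f' ≫ f)
          (g ≫ biE L.act (𝟙 (Und.of V x)) g' ≫ (L.as x y _).inv) := by
      intro x y f g f' g'
      refine (El.map_comp _ _ _).trans ((congrArg _ (El.map_braid _ _)).trans ?_)
      exact (El.map_comp _ _ _).trans (congrArg _ (L.map_muMap f g f' g'))
    have h1 := fun x : C => L.exists_descT (d := e) (c := c)
      (Y := (L.ob x e.1.unop ⟶[V] d.1.unop) ⊗ (d.2 ⟶[V] L.ob x e.2))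
      (Z := L.T.obj d c) (fun y => (β_ _ _).hom ≫
        L.muMap x y d.1.unop d.2 c.1.unop c.2 e.1.unop e.2 ≫ L.ιT _ _ _ _ _) (by
        intro y y' t f' g' f g
        refine (h0 x y f g _ _).trans (Eq.trans ?_ (h0 x y' f g _ _).symm)
        -- The two representatives over `x ⊠ y` and `x ⊠ y'` are related by `x ⊠ t`.
        refine L.tE_eq (biE S.tensor (𝟙 _) t) ?_ ?_
        · rw [as_natural_assoc, biE_comp_assoc, Category.comp_id]
        · simp only [Category.assoc]
          rw [as_inv_natural, biE_comp_assoc, Category.comp_id])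
    choose K hK using h1
    obtain ⟨K', hK'⟩ := L.exists_descT (d := d) (c := e) (Y := L.T.obj e c) (Z := L.T.obj d c)
      (fun x => (β_ _ _).hom ≫ K x) (by
        intro x x' t f g y f' g'
        refine (El.map_comp _ _ _).trans (Eq.trans ?_ (El.map_comp _ _ _).symm)
        rw [El.map_braid, El.map_braid, hK, hK]
        refine (h0 x y _ _ _ _).trans (Eq.trans ?_ (h0 x' y _ _ _ _).symm)
        refine L.tE_eq (biE S.tensor t (𝟙 _)) ?_ ?_
        · rw [as_natural_assoc, biE_comp_assoc, biE_comp_assoc, biE_id]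
          simp
        · simp only [Category.assoc]
          rw [as_inv_natural, biE_comp_assoc, biE_comp_assoc, biE_id]
          simp)
    refine ⟨K', fun x y f g f' g' => ?_⟩
    rw [hK', El.map_comp, El.map_braid, hK]
    exact h0 x y f g f' g'
  choose K hK using key
  refine ⟨Prof.liftE _ _ _ K ?_ ?_ ?_, ?_⟩
  · intro e e' d c x f g u w y f' g'
    rw [rE_tE, lE_tE, hK, hK]
    simp [biE_comp_assoc]
  · intro e d d' c u w x f g y f' g'
    rw [lE_tE, hK, hK, lE_tE]
    simp
  · intro e d c c' x f g y f' g' u w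
    rw [rE_tE, hK, hK, rE_tE]
    simp only [Category.assoc]
    rw [← biE_id S.tensor, as_natural_assoc, as_inv_natural, biE_comp_assoc, biE_comp_assoc]
    simp
  · intro d e c x y f g f' g'
    exact (Prof.ap_lift _ _ _ _ _ _ _ _ _).trans (hK _ _ _ _ _ _ _ _ _)

theorem map_tauMap_wE {d e : Mᵒᵖ × M} {c : (Mᵒᵖ × M) × (Mᵒᵖ × M)} (x : C)
    (f : Mor V (L.ob x e.1.unop) d.1.unop) (g : Mor V d.2 (L.ob x e.2))
    (h : Mor V c.1.1.unop e.1.unop) (k : Mor V c.2.1.unop c.1.2) (l : Mor V e.2 c.2.2) :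
    El.map (L.tauMap x d.1.unop d.2 c.1.1.unop c.1.2 c.2.1.unop c.2.2 e.1.unop e.2 ≫ (ρ_ _).inv ≫
        _ ◁ ((λ_ (𝟙_ V)).inv ≫ (L.idT x c.1.1.unop c.1.2 ⊗ₘ L.idT x c.2.1.unop c.2.2)) ≫
        (mulP V M).inj (L.T.tens L.T)
          ((op ((L.ac x).obj c.1.1.unop), (L.ac x).obj c.1.2), (op ((L.ac x).obj c.2.1.unop),
            (L.ac x).obj c.2.2)) d c)
      (El.pair (El.pair f g) (El.pair h (El.pair k l))) =
    L.wE (e := d) (c := c) x x (biE L.act (𝟙 _) h ≫ f) (biE L.act (𝟙 _) k)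
      (g ≫ biE L.act (𝟙 _) l) := by
  have hid : ∀ m n : M, El.map (L.idT x m n) (El.one V) = L.iE x (op m, n) := by
    intro m n
    change _ = El.map (L.ιT x (L.ob x m) (L.ob x n) m n)
      (El.pair (𝟙 (Und.of V (L.ob x m))) (𝟙 (Und.of V (L.ob x n))))
    refine (El.map_comp _ _ _).trans (congrArg (El.map _) ?_)
    refine (El.map_comp _ _ _).trans ((congrArg _ (El.map_left_inv _)).trans ?_)
    exact El.map_tensor _ _ _ _
  refine (El.map_comp _ _ _).trans ((congrArg _ (L.map_tauMap f g h k l)).trans ?_)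
  refine (El.map_comp _ _ _).trans ((congrArg _ (El.map_right_inv _)).trans ?_)
  refine (El.map_comp _ _ _).trans ((congrArg _ (El.map_whiskerLeft _ _ _)).trans ?_)
  refine congrArg (fun t => El.map _ (El.pair _ t)) ?_
  refine (El.map_comp _ _ _).trans ((congrArg _ (El.map_left_inv _)).trans ?_)
  exact (El.map_tensor _ _ _ _).trans (congrArg₂ El.pair (hid _ _) (hid _ _))

/-- The object `x` is duplicated, so a morphism `t` of `C` has to be moved in both branches; this is
the only point in the descent that goes beyond functoriality. -/
theorem exists_tau : ∃ τ : L.T.comp (mulP V M) ⟶ (mulP V M).comp (L.T.tens L.T),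
    ∀ (d e : Mᵒᵖ × M) (c : (Mᵒᵖ × M) × (Mᵒᵖ × M)) (x : C)
      (f : Mor V (L.ob x e.1.unop) d.1.unop) (g : Mor V d.2 (L.ob x e.2))
      (h : Mor V c.1.1.unop e.1.unop) (k : Mor V c.2.1.unop c.1.2) (l : Mor V e.2 c.2.2),
      Prof.ap τ (Prof.cp L.T (mulP V M) e (L.tE x f g) (mE (c := c) h k l)) =
        L.wE (e := d) (c := c) x x (biE L.act (𝟙 _) h ≫ f) (biE L.act (𝟙 _) k)
          (g ≫ biE L.act (𝟙 _) l) := by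
  have key : ∀ (e d : Mᵒᵖ × M) (c : (Mᵒᵖ × M) × (Mᵒᵖ × M)),
      ∃ K : L.T.obj d e ⊗ (mulP V M).obj e c ⟶ ((mulP V M).comp (L.T.tens L.T)).obj d c,
      ∀ (x : C) (f : Mor V (L.ob x e.1.unop) d.1.unop) (g : Mor V d.2 (L.ob x e.2))
      (h : Mor V c.1.1.unop e.1.unop) (k : Mor V c.2.1.unop c.1.2) (l : Mor V e.2 c.2.2),
      El.map K (El.pair (L.tE x f g) (mE (c := c) h k l)) =
        L.wE (e := d) (c := c) x x (biE L.act (𝟙 _) h ≫ f) (biE L.act (𝟙 _) k)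
          (g ≫ biE L.act (𝟙 _) l) := by
    intro e d c
    obtain ⟨K, hK⟩ := L.exists_descT (d := d) (c := e) (Y := (mulP V M).obj e c)
      (Z := ((mulP V M).comp (L.T.tens L.T)).obj d c)
      (fun x => L.tauMap x d.1.unop d.2 c.1.1.unop c.1.2 c.2.1.unop c.2.2 e.1.unop e.2 ≫ (ρ_ _).inv ≫
        _ ◁ ((λ_ (𝟙_ V)).inv ≫ (L.idT x c.1.1.unop c.1.2 ⊗ₘ L.idT x c.2.1.unop c.2.2)) ≫
        (mulP V M).inj (L.T.tens L.T)
          ((op ((L.ac x).obj c.1.1.unop), (L.ac x).obj c.1.2), (op ((L.ac x).obj c.2.1.unop),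
            (L.ac x).obj c.2.2)) d c) (by
        intro x x' t f g h k l
        refine (L.map_tauMap_wE _ _ _ _ _ _).trans (Eq.trans ?_ (L.map_tauMap_wE _ _ _ _ _ _).symm)
        have h1 : biE L.act (𝟙 (Und.of V x)) h ≫ biE L.act t (𝟙 _) ≫ f =
            biE L.act t (𝟙 _) ≫ biE L.act (𝟙 (Und.of V x')) h ≫ f := by
          simp [biE_comp_assoc]
        have h2 : (g ≫ biE L.act t (𝟙 _)) ≫ biE L.act (𝟙 (Und.of V x')) l =
            (g ≫ biE L.act (𝟙 (Und.of V x)) l) ≫ biE L.act t (𝟙 _) := by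
          simp [biE_comp]
        -- One side carries `t` to the middle leg from the first leg, the other from the last. The
        -- two middle legs then agree by the interchange law.
        rw [h1, h2, wE_bal_left, ← wE_bal_right, biE_comp, biE_comp]
        simp)
    exact ⟨K, fun x f g h k l => (hK x f g _).trans (L.map_tauMap_wE _ _ _ _ _ _)⟩
  choose K hK using key
  refine ⟨Prof.liftE _ _ _ K ?_ ?_ ?_, ?_⟩
  · intro e e' d c x f g u w h k l
    rw [rE_tE, lE_mE, hK, hK]
    simp [biE_comp_assoc, biE_comp]
  · intro e d d' c u w x f g h k l
    rw [lE_tE, hK, hK, lE_wE]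
    simp
  · intro e d c c' x f g h k l u w u' w'
    refine (congrArg (fun t => El.map _ (El.pair _ t)) (rE_mE _ _ _ _ _ _ _)).trans ?_
    rw [hK, hK]
    refine Eq.trans ?_ (L.rE_wE _ _ _ _ _ _ _ _ _).symm
    simp [biE_comp_assoc, biE_comp]
  · intro d e c x f g h k l
    exact (Prof.ap_lift _ _ _ _ _ _ _ _ _).trans (hK _ _ _ _ _ _ _ _ _)

end ModuleStr

end ProV

namespace ProV

variable {V : Type u} [Category.{v} V] [MonoidalCategory V] [SymmetricCategory V]

namespace Prof

variable {B C D : Type v} [EnrichedCategory V B] [EnrichedCategory V C] [EnrichedCategory V D]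

theorem rE_resR (F : Prof V C D) (K : EnrichedFunctor V B C) {d : D} {c c' : B}
    (x : El (F.obj d (K.obj c))) (h : El (c ⟶[V] c')) :
    rE (F.resR K) (c := c) (c' := c') x h = rE F x (El.map (K.map c c') h) :=
  (El.map_comp _ _ _).trans (congrArg _ (El.map_whiskerLeft _ _ _))

theorem isIso_of_app {F G : Prof V C D} (f : F ⟶ G) (g : ∀ d c, G.obj d c ⟶ F.obj d c)
    (h : ∀ d c, Hom.app f d c ≫ g d c = 𝟙 _) (h' : ∀ d c, g d c ≫ Hom.app f d c = 𝟙 _) :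
    IsIso f :=
  ⟨invHom f g h h', Hom.ext (funext fun d => funext fun c => h d c),
    Hom.ext (funext fun d => funext fun c => h' d c)⟩

end Prof

variable {M : Type v} [EnrichedCategory V M] [MonoidalClosed V] [HasColimitsOfSize.{v, v} V]

/-! ### Standard forms on the two sides of the associativity map -/

section Alpha

/-- A leaf is exhibited as a morphism acting on identities, so that `cp_mE` can move the morphism
into the root; `lE_mE_id` does the same for the outer legs of a branch `M`. -/
theorem lE_one_id {d c : Mᵒᵖ × M} (f : Mor V c.1.unop d.1.unop) (g : Mor V d.2 c.2) :
    Prof.lE (Prof.one (Mᵒᵖ × M)) (hE f g) (hE (𝟙 (Und.of V c.1.unop)) (𝟙 (Und.of V c.2))) =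
      hE f g := by
  rw [lE_one_hE, Category.id_comp, Category.comp_id]

theorem lE_mE_id {d : Mᵒᵖ × M} {c : (Mᵒᵖ × M) × (Mᵒᵖ × M)} (f : Mor V c.1.1.unop d.1.unop)
    (g : Mor V c.2.1.unop c.1.2) (h : Mor V d.2 c.2.2) :
    Prof.lE (mulP V M) (d' := (c.1.1, c.2.2)) (hE f h)
      (mE (𝟙 (Und.of V c.1.1.unop)) g (𝟙 (Und.of V c.2.2))) = mE f g h := by
  rw [lE_mE, Category.id_comp, Category.comp_id]

/-- Four morphisms as an element of `M • (1 ⊗ M)`. -/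
def qE {d : Mᵒᵖ × M} {c : (Mᵒᵖ × M) × ((Mᵒᵖ × M) × (Mᵒᵖ × M))} (f : Mor V c.1.1.unop d.1.unop)
    (g : Mor V c.2.1.1.unop c.1.2) (h : Mor V c.2.2.1.unop c.2.1.2) (k : Mor V d.2 c.2.2.2) :
    El (((mulP V M).comp ((Prof.one (Mᵒᵖ × M)).tens (mulP V M))).obj d c) :=
  Prof.cp _ _ (c.1, (c.2.1.1, c.2.2.2)) (mE f g k)
    (El.pair (hE (𝟙 _) (𝟙 _)) (mE (𝟙 _) h (𝟙 _)))

/-- Four morphisms as an element of `M • (M ⊗ 1)`. -/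
def qE' {d : Mᵒᵖ × M} {c : ((Mᵒᵖ × M) × (Mᵒᵖ × M)) × (Mᵒᵖ × M)}
    (f : Mor V c.1.1.1.unop d.1.unop)
    (g : Mor V c.1.2.1.unop c.1.1.2) (h : Mor V c.2.1.unop c.1.2.2) (k : Mor V d.2 c.2.2) :
    El (((mulP V M).comp ((mulP V M).tens (Prof.one (Mᵒᵖ × M)))).obj d c) :=
  Prof.cp _ _ ((c.1.1.1, c.1.2.2), c.2) (mE f h k)
    (El.pair (mE (𝟙 _) g (𝟙 _)) (hE (𝟙 _) (𝟙 _)))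

/-- The element depends only on four composites. The leg `g'` connects two inputs of the same
branch, so it cannot be moved to the root and stays in place. -/
theorem cp_eq_qE {d : Mᵒᵖ × M} {e : (Mᵒᵖ × M) × (Mᵒᵖ × M)}
    {c : (Mᵒᵖ × M) × ((Mᵒᵖ × M) × (Mᵒᵖ × M))} (f : Mor V e.1.1.unop d.1.unop)
    (g : Mor V e.2.1.unop e.1.2) (h : Mor V d.2 e.2.2) (k : Mor V c.1.1.unop e.1.1.unop)
    (l : Mor V e.1.2 c.1.2) (f' : Mor V c.2.1.1.unop e.2.1.unop)
    (g' : Mor V c.2.2.1.unop c.2.1.2) (h' : Mor V e.2.2 c.2.2.2) :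
    Prof.cp (mulP V M) ((Prof.one (Mᵒᵖ × M)).tens (mulP V M)) (c := c) e (mE f g h)
        (El.pair (hE k l) (mE f' g' h')) =
      qE (k ≫ f) (f' ≫ g ≫ l) g' (h ≫ h') := by
  rw [← lE_one_id k l, ← lE_mE_id f' g' h']
  exact Prof.cp_mE (d' := (c.1, (c.2.1.1, c.2.2.2))) _ _ _ _ _ _ _ _ _ _ _

theorem cp_eq_qE' {d : Mᵒᵖ × M} {e : (Mᵒᵖ × M) × (Mᵒᵖ × M)}
    {c : ((Mᵒᵖ × M) × (Mᵒᵖ × M)) × (Mᵒᵖ × M)} (f : Mor V e.1.1.unop d.1.unop)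
    (g : Mor V e.2.1.unop e.1.2) (h : Mor V d.2 e.2.2) (f' : Mor V c.1.1.1.unop e.1.1.unop)
    (g' : Mor V c.1.2.1.unop c.1.1.2) (h' : Mor V e.1.2 c.1.2.2)
    (k : Mor V c.2.1.unop e.2.1.unop) (l : Mor V e.2.2 c.2.2) :
    Prof.cp (mulP V M) ((mulP V M).tens (Prof.one (Mᵒᵖ × M))) (c := c) e (mE f g h)
        (El.pair (mE f' g' h') (hE k l)) =
      qE' (f' ≫ f) g' (k ≫ g ≫ h') (h ≫ l) := by
  rw [← lE_one_id k l, ← lE_mE_id f' g' h']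
  exact Prof.cp_mE (d' := ((c.1.1.1, c.1.2.2), c.2)) _ _ _ _ _ _ _ _ _ _ _

theorem lE_qE {d d' : Mᵒᵖ × M} {c : (Mᵒᵖ × M) × ((Mᵒᵖ × M) × (Mᵒᵖ × M))}
    (u : Mor V d'.1.unop d.1.unop) (w : Mor V d.2 d'.2) (f : Mor V c.1.1.unop d'.1.unop)
    (g : Mor V c.2.1.1.unop c.1.2) (h : Mor V c.2.2.1.unop c.2.1.2) (k : Mor V d'.2 c.2.2.2) :
    Prof.lE ((mulP V M).comp ((Prof.one (Mᵒᵖ × M)).tens (mulP V M))) (hE u w) (qE f g h k) =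
      qE (f ≫ u) g h (w ≫ k) :=
  (Prof.lE_comp _ _ _ _ _ _).trans (congrArg (Prof.cp _ _ _ · _) (lE_mE _ _ _ _ _))

theorem lE_qE' {d d' : Mᵒᵖ × M} {c : ((Mᵒᵖ × M) × (Mᵒᵖ × M)) × (Mᵒᵖ × M)}
    (u : Mor V d'.1.unop d.1.unop) (w : Mor V d.2 d'.2) (f : Mor V c.1.1.1.unop d'.1.unop)
    (g : Mor V c.1.2.1.unop c.1.1.2) (h : Mor V c.2.1.unop c.1.2.2) (k : Mor V d'.2 c.2.2) :
    Prof.lE ((mulP V M).comp ((mulP V M).tens (Prof.one (Mᵒᵖ × M)))) (hE u w) (qE' f g h k) =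
      qE' (f ≫ u) g h (w ≫ k) :=
  (Prof.lE_comp _ _ _ _ _ _).trans (congrArg (Prof.cp _ _ _ · _) (lE_mE _ _ _ _ _))

theorem rE_qE {d : Mᵒᵖ × M} {c c' : (Mᵒᵖ × M) × ((Mᵒᵖ × M) × (Mᵒᵖ × M))}
    (f : Mor V c.1.1.unop d.1.unop) (g : Mor V c.2.1.1.unop c.1.2) (h : Mor V c.2.2.1.unop c.2.1.2)
    (k : Mor V d.2 c.2.2.2) (u₁ : Mor V c'.1.1.unop c.1.1.unop) (w₁ : Mor V c.1.2 c'.1.2)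
    (u₂ : Mor V c'.2.1.1.unop c.2.1.1.unop) (w₂ : Mor V c.2.1.2 c'.2.1.2)
    (u₃ : Mor V c'.2.2.1.unop c.2.2.1.unop) (w₃ : Mor V c.2.2.2 c'.2.2.2) :
    Prof.rE ((mulP V M).comp ((Prof.one (Mᵒᵖ × M)).tens (mulP V M))) (c' := c') (qE f g h k)
        (El.pair (hE u₁ w₁) (El.pair (hE u₂ w₂) (hE u₃ w₃))) =
      qE (u₁ ≫ f) (u₂ ≫ g ≫ w₁) (u₃ ≫ h ≫ w₂) (k ≫ w₃) := by
  refine (Prof.rE_comp _ _ _ _ _ _).trans ?_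
  refine (congrArg (Prof.cp _ _ _ _) ((Prof.rE_tens _ _ _ _ _ _).trans
    (congrArg₂ El.pair (rE_one_hE _ _ _ _) (rE_mE _ _ _ _ _ _ _)))).trans ?_
  refine (cp_eq_qE _ _ _ _ _ _ _ _).trans ?_
  simp

theorem rE_qE' {d : Mᵒᵖ × M} {c c' : ((Mᵒᵖ × M) × (Mᵒᵖ × M)) × (Mᵒᵖ × M)}
    (f : Mor V c.1.1.1.unop d.1.unop)
    (g : Mor V c.1.2.1.unop c.1.1.2) (h : Mor V c.2.1.unop c.1.2.2) (k : Mor V d.2 c.2.2)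
    (u₁ : Mor V c'.1.1.1.unop c.1.1.1.unop) (w₁ : Mor V c.1.1.2 c'.1.1.2)
    (u₂ : Mor V c'.1.2.1.unop c.1.2.1.unop) (w₂ : Mor V c.1.2.2 c'.1.2.2)
    (u₃ : Mor V c'.2.1.unop c.2.1.unop) (w₃ : Mor V c.2.2 c'.2.2) :
    Prof.rE ((mulP V M).comp ((mulP V M).tens (Prof.one (Mᵒᵖ × M)))) (c' := c') (qE' f g h k)
        (El.pair (El.pair (hE u₁ w₁) (hE u₂ w₂)) (hE u₃ w₃)) =
      qE' (u₁ ≫ f) (u₂ ≫ g ≫ w₁) (u₃ ≫ h ≫ w₂) (k ≫ w₃) := by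
  refine (Prof.rE_comp _ _ _ _ _ _).trans ?_
  refine (congrArg (Prof.cp _ _ _ _) ((Prof.rE_tens _ _ _ _ _ _).trans
    (congrArg₂ El.pair (rE_mE _ _ _ _ _ _ _) (rE_one_hE _ _ _ _)))).trans ?_
  refine (cp_eq_qE' _ _ _ _ _ _ _ _).trans ?_
  simp

theorem map_alphaMap_qE {d : Mᵒᵖ × M} {e : (Mᵒᵖ × M) × (Mᵒᵖ × M)}
    {c : ((Mᵒᵖ × M) × (Mᵒᵖ × M)) × (Mᵒᵖ × M)} (f : Mor V e.1.1.unop d.1.unop)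
    (g : Mor V e.2.1.unop e.1.2) (h : Mor V d.2 e.2.2) (f' : Mor V c.1.1.1.unop e.1.1.unop)
    (g' : Mor V c.1.2.1.unop c.1.1.2) (h' : Mor V e.1.2 c.1.2.2)
    (k : Mor V c.2.1.unop e.2.1.unop) (l : Mor V e.2.2 c.2.2) :
    El.map (alphaMap d.1.unop d.2 c.1.1.1.unop c.1.1.2 c.1.2.1.unop c.1.2.2 c.2.1.unop c.2.2
        e.1.1.unop e.1.2 e.2.1.unop e.2.2 ≫
      (mulP V M).inj ((Prof.one (Mᵒᵖ × M)).tens (mulP V M)) (c.1.1, (c.1.2.1, c.2.2)) d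
          (c.1.1, (c.1.2, c.2)))
      (El.pair (mE f g h) (El.pair (mE f' g' h') (hE k l))) =
    qE (c := (c.1.1, (c.1.2, c.2))) (f' ≫ f) g' (k ≫ g ≫ h') (h ≫ l) := by
  refine (El.map_comp _ _ _).trans (congrArg _ ?_)
  refine (El.map_comp _ _ _).trans ((congrArg _ (map_alphaComp f g h f' g' h' k l)).trans ?_)
  exact map_alphaExpand _ _ _ _

/-- The component of the inverse of the associativity map. -/
def alphaInvMap (a b m₁ n₁ m₂ n₂ m₃ n₃ p q p' q' : M) :
    ((p ⟶[V] a) ⊗ ((p' ⟶[V] q) ⊗ (b ⟶[V] q'))) ⊗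
      (((m₁ ⟶[V] p) ⊗ (q ⟶[V] n₁)) ⊗ ((m₂ ⟶[V] p') ⊗ ((m₃ ⟶[V] n₂) ⊗ (q' ⟶[V] n₃)))) ⟶
    ((m₁ ⟶[V] a) ⊗ ((m₃ ⟶[V] n₂) ⊗ (b ⟶[V] n₃))) ⊗
      (((m₁ ⟶[V] m₁) ⊗ ((m₂ ⟶[V] n₁) ⊗ (n₂ ⟶[V] n₂))) ⊗ ((m₃ ⟶[V] m₃) ⊗ (n₃ ⟶[V] n₃))) :=
  tensorμ _ _ _ _ ≫ (((α_ _ _ _).inv ≫ rComp m₁ p a ▷ _) ⊗ₘ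
    tt (rComp m₂ p' q) (sw' _ _ _ ≫ _ ◁ eComp V b q' n₃)) ≫
  (α_ _ _ _).hom ≫ _ ◁ ((α_ _ _ _).inv ≫ rComp m₂ q n₁ ▷ _ ≫ (β_ _ _).hom) ≫ (α_ _ _ _).inv ≫
  _ ◁ ((ρ_ _).inv ≫ (((λ_ _).inv ≫ (eId V m₁ ⊗ₘ ((ρ_ _).inv ≫ _ ◁ eId V n₂))) ⊗ₘ twoId V m₃ n₃))

theorem map_alphaInvMap {a b m₁ n₁ m₂ n₂ m₃ n₃ p q p' q' : M} (f : Mor V p a) (g : Mor V p' q)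
    (h : Mor V b q') (k : Mor V m₁ p) (l : Mor V q n₁) (f' : Mor V m₂ p') (g' : Mor V m₃ n₂)
    (h' : Mor V q' n₃) : El.map (alphaInvMap a b m₁ n₁ m₂ n₂ m₃ n₃ p q p' q')
      (El.pair (El.pair f (El.pair g h)) (El.pair (El.pair k l) (El.pair f' (El.pair g' h')))) =
    El.pair (El.pair (k ≫ f) (El.pair g' (h ≫ h')))
      (El.pair (El.pair (𝟙 (Und.of V m₁)) (El.pair (f' ≫ g ≫ l) (𝟙 (Und.of V n₂))))
        (El.pair (𝟙 (Und.of V m₃)) (𝟙 (Und.of V n₃)))) := by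
  simp only [alphaInvMap, twoId, El.map_comp, El.map_mu, El.map_tensor, El.map_assoc_inv,
    El.map_tt, El.map_sw', El.map_braid, El.map_left_inv, El.map_right_inv,
    El.map_assoc, El.map_whiskerLeft, El.map_whiskerRight]
  erw [map_rComp, map_rComp, map_rComp, map_eComp, Category.assoc]
  rfl

theorem map_alphaInvMap_qE {d : Mᵒᵖ × M} {e : (Mᵒᵖ × M) × (Mᵒᵖ × M)}
    {c : (Mᵒᵖ × M) × ((Mᵒᵖ × M) × (Mᵒᵖ × M))} (f : Mor V e.1.1.unop d.1.unop)
    (g : Mor V e.2.1.unop e.1.2) (h : Mor V d.2 e.2.2) (k : Mor V c.1.1.unop e.1.1.unop)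
    (l : Mor V e.1.2 c.1.2) (f' : Mor V c.2.1.1.unop e.2.1.unop)
    (g' : Mor V c.2.2.1.unop c.2.1.2) (h' : Mor V e.2.2 c.2.2.2) :
    El.map (alphaInvMap d.1.unop d.2 c.1.1.unop c.1.2 c.2.1.1.unop c.2.1.2 c.2.2.1.unop c.2.2.2
        e.1.1.unop e.1.2 e.2.1.unop e.2.2 ≫
      (mulP V M).inj ((mulP V M).tens (Prof.one (Mᵒᵖ × M))) ((c.1.1, c.2.1.2), c.2.2) d
          ((c.1, c.2.1), c.2.2))
      (El.pair (mE f g h) (El.pair (hE k l) (mE f' g' h'))) =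
    qE' (c := ((c.1, c.2.1), c.2.2)) (k ≫ f) (f' ≫ g ≫ l) g' (h ≫ h') := by
  exact (El.map_comp _ _ _).trans (congrArg _ (map_alphaInvMap f g h k l f' g' h'))

end Alpha

end ProV

namespace ProV

variable {V : Type u} [Category.{v} V] [MonoidalCategory V] [SymmetricCategory V]
variable {M : Type v} [EnrichedCategory V M] [MonoidalClosed V] [HasColimitsOfSize.{v, v} V]

/-! ### The associativity map and its inverse -/

section Associator

variable (V M)

/-- The prescribed value depends only on the four composites along the chain, and these are
unchanged when a morphism passes between root and branches, by associativity in `M`. -/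
theorem exists_alpha : ∃ α : (mulP V M).comp ((mulP V M).tens (Prof.one (Mᵒᵖ × M))) ⟶
      ((mulP V M).comp ((Prof.one (Mᵒᵖ × M)).tens (mulP V M))).resR (assocF _ _ _),
    ∀ (d : Mᵒᵖ × M) (e : (Mᵒᵖ × M) × (Mᵒᵖ × M)) (c : ((Mᵒᵖ × M) × (Mᵒᵖ × M)) × (Mᵒᵖ × M))
      (f : Mor V e.1.1.unop d.1.unop) (g : Mor V e.2.1.unop e.1.2) (h : Mor V d.2 e.2.2)
      (f' : Mor V c.1.1.1.unop e.1.1.unop) (g' : Mor V c.1.2.1.unop c.1.1.2)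
      (h' : Mor V e.1.2 c.1.2.2) (k : Mor V c.2.1.unop e.2.1.unop) (l : Mor V e.2.2 c.2.2),
      Prof.ap α (Prof.cp _ _ (c := c) e (mE f g h) (El.pair (mE f' g' h') (hE k l))) =
        qE (c := (c.1.1, (c.1.2, c.2))) (f' ≫ f) g' (k ≫ g ≫ h') (h ≫ l) := by
  refine ⟨Prof.liftE _ _ _ (fun e d c => alphaMap d.1.unop d.2 c.1.1.1.unop c.1.1.2 c.1.2.1.unop
      c.1.2.2 c.2.1.unop c.2.2 e.1.1.unop e.1.2 e.2.1.unop e.2.2 ≫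
      (mulP V M).inj ((Prof.one (Mᵒᵖ × M)).tens (mulP V M)) (c.1.1, (c.1.2.1, c.2.2)) d
          (c.1.1, (c.1.2, c.2))) ?_ ?_ ?_, ?_⟩
  · intro e e' d c f g h u w u' w' f' g' h' k l
    refine (congrArg (fun t => El.map _ (El.pair t _)) (rE_mE _ _ _ _ _ _ _)).trans ?_
    refine Eq.trans ?_ (congrArg (fun t => El.map _ (El.pair _ t)) ((Prof.lE_tens _ _ _ _ _ _).trans
      (congrArg₂ El.pair (lE_mE _ _ _ _ _) (lE_one_hE _ _ _ _)))).symm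
    refine (map_alphaMap_qE _ _ _ _ _ _ _ _).trans (Eq.trans ?_
      (map_alphaMap_qE _ _ _ _ _ _ _ _).symm)
    simp
  · intro e d d' c u w f g h f' g' h' k l
    refine (congrArg (fun t => El.map _ (El.pair t _)) (lE_mE _ _ _ _ _)).trans ?_
    refine (map_alphaMap_qE _ _ _ _ _ _ _ _).trans (Eq.trans ?_
      (congrArg (Prof.lE _ _) (map_alphaMap_qE _ _ _ _ _ _ _ _)).symm)
    refine Eq.trans ?_ (lE_qE _ _ _ _ _ _).symm
    simp
  · intro e d c c' f g h f' g' h' k l u₁ w₁ u₂ w₂ u₃ w₃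
    refine (congrArg (fun t => El.map _ (El.pair _ t)) ((Prof.rE_tens _ _ _ _ _ _).trans
      (congrArg₂ El.pair (rE_mE _ _ _ _ _ _ _) (rE_one_hE _ _ _ _)))).trans ?_
    refine (map_alphaMap_qE _ _ _ _ _ _ _ _).trans (Eq.trans ?_
      (Prof.rE_resR ((mulP V M).comp ((Prof.one (Mᵒᵖ × M)).tens (mulP V M))) (assocF _ _ _)
        (c := c) (c' := c') _ _).symm)
    refine Eq.trans ?_ (congrArg₂ (Prof.rE ((mulP V M).comp ((Prof.one (Mᵒᵖ × M)).tens
      (mulP V M)))) (map_alphaMap_qE _ _ _ _ _ _ _ _) (El.map_assoc _ _ _)).symm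
    refine Eq.trans ?_ (rE_qE _ _ _ _ _ _ _ _ _ _).symm
    simp
  · intro d e c f g h f' g' h' k l
    exact (Prof.ap_lift _ _ _ _ _ _ _ _ _).trans (map_alphaMap_qE _ _ _ _ _ _ _ _)

theorem exists_alpha_inv : ∃ β : (mulP V M).comp ((Prof.one (Mᵒᵖ × M)).tens (mulP V M)) ⟶
      ((mulP V M).comp ((mulP V M).tens (Prof.one (Mᵒᵖ × M)))).resR (assocF' _ _ _),
    ∀ (d : Mᵒᵖ × M) (e : (Mᵒᵖ × M) × (Mᵒᵖ × M)) (c : (Mᵒᵖ × M) × ((Mᵒᵖ × M) × (Mᵒᵖ × M)))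
      (f : Mor V e.1.1.unop d.1.unop) (g : Mor V e.2.1.unop e.1.2) (h : Mor V d.2 e.2.2)
      (k : Mor V c.1.1.unop e.1.1.unop) (l : Mor V e.1.2 c.1.2)
      (f' : Mor V c.2.1.1.unop e.2.1.unop) (g' : Mor V c.2.2.1.unop c.2.1.2)
      (h' : Mor V e.2.2 c.2.2.2),
      Prof.ap β (Prof.cp _ _ (c := c) e (mE f g h) (El.pair (hE k l) (mE f' g' h'))) =
        qE' (c := ((c.1, c.2.1), c.2.2)) (k ≫ f) (f' ≫ g ≫ l) g' (h ≫ h') := by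
  refine ⟨Prof.liftE _ _ _ (fun e d c => alphaInvMap d.1.unop d.2 c.1.1.unop c.1.2 c.2.1.1.unop
      c.2.1.2 c.2.2.1.unop c.2.2.2 e.1.1.unop e.1.2 e.2.1.unop e.2.2 ≫
      (mulP V M).inj ((mulP V M).tens (Prof.one (Mᵒᵖ × M))) ((c.1.1, c.2.1.2), c.2.2) d
          ((c.1, c.2.1), c.2.2)) ?_ ?_ ?_, ?_⟩
  · intro e e' d c f g h u w u' w' k l f' g' h'
    refine (congrArg (fun t => El.map _ (El.pair t _)) (rE_mE _ _ _ _ _ _ _)).trans ?_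
    refine Eq.trans ?_ (congrArg (fun t => El.map _ (El.pair _ t)) ((Prof.lE_tens _ _ _ _ _ _).trans
      (congrArg₂ El.pair (lE_one_hE _ _ _ _) (lE_mE _ _ _ _ _)))).symm
    refine (map_alphaInvMap_qE _ _ _ _ _ _ _ _).trans (Eq.trans ?_
      (map_alphaInvMap_qE _ _ _ _ _ _ _ _).symm)
    simp
  · intro e d d' c u w f g h k l f' g' h'
    refine (congrArg (fun t => El.map _ (El.pair t _)) (lE_mE _ _ _ _ _)).trans ?_
    refine (map_alphaInvMap_qE _ _ _ _ _ _ _ _).trans (Eq.trans ?_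
      (congrArg (Prof.lE _ _) (map_alphaInvMap_qE _ _ _ _ _ _ _ _)).symm)
    refine Eq.trans ?_ (lE_qE' _ _ _ _ _ _).symm
    simp
  · intro e d c c' f g h k l f' g' h' u₁ w₁ u₂ w₂ u₃ w₃
    refine (congrArg (fun t => El.map _ (El.pair _ t)) ((Prof.rE_tens _ _ _ _ _ _).trans
      (congrArg₂ El.pair (rE_one_hE _ _ _ _) (rE_mE _ _ _ _ _ _ _)))).trans ?_
    refine (map_alphaInvMap_qE _ _ _ _ _ _ _ _).trans (Eq.trans ?_
      (Prof.rE_resR ((mulP V M).comp ((mulP V M).tens (Prof.one (Mᵒᵖ × M)))) (assocF' _ _ _)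
        (c := c) (c' := c') _ _).symm)
    refine Eq.trans ?_ (congrArg₂ (Prof.rE ((mulP V M).comp ((mulP V M).tens
      (Prof.one (Mᵒᵖ × M))))) (map_alphaInvMap_qE _ _ _ _ _ _ _ _) (El.map_assoc_inv _ _ _)).symm
    refine Eq.trans ?_ (rE_qE' _ _ _ _ _ _ _ _ _ _).symm
    simp
  · intro d e c f g h k l f' g' h'
    exact (Prof.ap_lift _ _ _ _ _ _ _ _ _).trans (map_alphaInvMap_qE _ _ _ _ _ _ _ _)

variable {V M}

/-- The map and the candidate inverse keep the same four composites and only change which connecting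
leg sits in a branch. Either round trip therefore replaces a generator by its standard form, which
is the same element. -/
theorem isIso_alpha {α : (mulP V M).comp ((mulP V M).tens (Prof.one (Mᵒᵖ × M))) ⟶
      ((mulP V M).comp ((Prof.one (Mᵒᵖ × M)).tens (mulP V M))).resR (assocF _ _ _)}
    (hα : ∀ (d : Mᵒᵖ × M) (e : (Mᵒᵖ × M) × (Mᵒᵖ × M)) (c : ((Mᵒᵖ × M) × (Mᵒᵖ × M)) × (Mᵒᵖ × M))
      (f : Mor V e.1.1.unop d.1.unop) (g : Mor V e.2.1.unop e.1.2) (h : Mor V d.2 e.2.2)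
      (f' : Mor V c.1.1.1.unop e.1.1.unop) (g' : Mor V c.1.2.1.unop c.1.1.2)
      (h' : Mor V e.1.2 c.1.2.2) (k : Mor V c.2.1.unop e.2.1.unop) (l : Mor V e.2.2 c.2.2),
      Prof.ap α (Prof.cp _ _ (c := c) e (mE f g h) (El.pair (mE f' g' h') (hE k l))) =
        qE (c := (c.1.1, (c.1.2, c.2))) (f' ≫ f) g' (k ≫ g ≫ h') (h ≫ l)) : IsIso α := by
  obtain ⟨β, hβ⟩ := exists_alpha_inv V M
  refine Prof.isIso_of_app α (fun d c => Prof.Hom.app β d (c.1.1, (c.1.2, c.2))) ?_ ?_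
  · intro d c
    apply Cover.ext
    intro e f g h f' g' h' k l
    refine (El.map_comp _ _ _).trans (Eq.trans ?_ (El.map_id _).symm)
    refine (congrArg (El.map _) (hα _ _ _ _ _ _ _ _ _ _ _)).trans ?_
    refine (hβ _ _ _ _ _ _ _ _ _ _ _).trans (Eq.trans ?_ (cp_eq_qE' _ _ _ _ _ _ _ _).symm)
    simp
    rfl
  · intro d c
    -- Stated for objects bracketed to the right; at the rebracketing of `c` the objects on both
    -- sides agree by definition.
    have key : ∀ c' : (Mᵒᵖ × M) × ((Mᵒᵖ × M) × (Mᵒᵖ × M)),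
        Prof.Hom.app β d c' ≫ Prof.Hom.app α d ((c'.1, c'.2.1), c'.2.2) = 𝟙 _ := by
      intro c'
      apply Cover.ext
      intro e f g h k l f' g' h'
      refine (El.map_comp _ _ _).trans (Eq.trans ?_ (El.map_id _).symm)
      refine (congrArg (El.map _) (hβ _ _ _ _ _ _ _ _ _ _ _)).trans ?_
      refine (hα _ _ _ _ _ _ _ _ _ _ _).trans (Eq.trans ?_ (cp_eq_qE _ _ _ _ _ _ _ _).symm)
      simp
      rfl
    exact key _

end Associator

/-! ### The unit maps and their inverses -/

section Unitors

theorem map_lambdaMap_hE {d : Mᵒᵖ × M} {e : (Mᵒᵖ × M) × (Mᵒᵖ × M)} {c : PUnit.{v + 1} × (Mᵒᵖ × M)}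
    (f : Mor V e.1.1.unop d.1.unop) (g : Mor V e.2.1.unop e.1.2) (h : Mor V d.2 e.2.2)
    (w : Mor V e.1.2 e.1.1.unop) (k : Mor V c.2.1.unop e.2.1.unop) (l : Mor V e.2.2 c.2.2) :
    El.map (lambdaMap d.1.unop d.2 c.2.1.unop c.2.2 e.1.1.unop e.1.2 e.2.1.unop e.2.2)
      (El.pair (mE f g h) (El.pair (uE (c := c.1) w) (hE k l))) =
    hE (d := d) (d' := c.2) (k ≫ g ≫ w ≫ f) (h ≫ l) := map_lambdaMap f g h w k l

theorem map_rhoMap_hE {d : Mᵒᵖ × M} {e : (Mᵒᵖ × M) × (Mᵒᵖ × M)} {c : (Mᵒᵖ × M) × PUnit.{v + 1}}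
    (f : Mor V e.1.1.unop d.1.unop) (g : Mor V e.2.1.unop e.1.2) (h : Mor V d.2 e.2.2)
    (k : Mor V c.1.1.unop e.1.1.unop) (l : Mor V e.1.2 c.1.2) (w : Mor V e.2.2 e.2.1.unop) :
    El.map (rhoMap d.1.unop d.2 c.1.1.unop c.1.2 e.1.1.unop e.1.2 e.2.1.unop e.2.2)
      (El.pair (mE f g h) (El.pair (hE k l) (uE (c := c.2) w))) =
    hE (d := d) (d' := c.1) (k ≫ f) (h ≫ w ≫ g ≫ l) := map_rhoMap f g h k l w

variable (V M)

theorem exists_l : ∃ l : (mulP V M).comp ((Prof.ev M).tens (Prof.one (Mᵒᵖ × M))) ⟶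
      (Prof.one (Mᵒᵖ × M)).resR (leftF _),
    ∀ (d : Mᵒᵖ × M) (e : (Mᵒᵖ × M) × (Mᵒᵖ × M)) (c : PUnit.{v + 1} × (Mᵒᵖ × M))
      (f : Mor V e.1.1.unop d.1.unop) (g : Mor V e.2.1.unop e.1.2) (h : Mor V d.2 e.2.2)
      (w : Mor V e.1.2 e.1.1.unop) (k : Mor V c.2.1.unop e.2.1.unop) (l' : Mor V e.2.2 c.2.2),
      Prof.ap l (Prof.cp _ _ (c := c) e (mE f g h) (El.pair (uE w) (hE k l'))) =
        hE (k ≫ g ≫ w ≫ f) (h ≫ l') := by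
  refine ⟨Prof.liftE _ _ _ (fun e d c => lambdaMap d.1.unop d.2 c.2.1.unop c.2.2
    e.1.1.unop e.1.2 e.2.1.unop e.2.2) ?_ ?_ ?_, ?_⟩
  · intro e e' d c f g h u w u' w' x k l
    refine (congrArg (fun t => El.map _ (El.pair t _)) (rE_mE _ _ _ _ _ _ _)).trans ?_
    refine Eq.trans ?_ (congrArg (fun t => El.map _ (El.pair _ t)) ((Prof.lE_tens _ _ _ _ _ _).trans
      (congrArg₂ El.pair (lE_uE _ _ _) (lE_one_hE _ _ _ _)))).symm
    refine (map_lambdaMap_hE _ _ _ _ _ _).trans (Eq.trans ?_ (map_lambdaMap_hE _ _ _ _ _ _).symm)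
    simp
  · intro e d d' c u w f g h x k l
    refine (congrArg (fun t => El.map _ (El.pair t _)) (lE_mE _ _ _ _ _)).trans ?_
    refine (map_lambdaMap_hE _ _ _ _ _ _).trans (Eq.trans ?_
      (congrArg (Prof.lE (Prof.one (Mᵒᵖ × M)) _) (map_lambdaMap_hE _ _ _ _ _ _)).symm)
    refine Eq.trans ?_ (lE_one_hE _ _ _ _).symm
    simp
  · intro e d c c' f g h x k l u w
    refine (congrArg (fun t => El.map _ (El.pair _ t)) ((Prof.rE_tens _ _ _ _ _ _).trans
      (congrArg₂ El.pair (rE_uE _) (rE_one_hE _ _ _ _)))).trans ?_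
    refine (map_lambdaMap_hE _ _ _ _ _ _).trans (Eq.trans ?_
      (Prof.rE_resR (Prof.one (Mᵒᵖ × M)) (leftF _) (c := c) (c' := c') _ _).symm)
    refine Eq.trans ?_ (congrArg₂ (Prof.rE (Prof.one (Mᵒᵖ × M)))
      (map_lambdaMap_hE _ _ _ _ _ _) (El.map_left _)).symm
    refine Eq.trans ?_ (rE_one_hE _ _ _ _).symm
    simp only [Category.assoc]
    exact congrArg (hE _) (Category.assoc _ _ _).symm
  · intro d e c f g h w k l
    exact (Prof.ap_lift _ _ _ _ _ _ _ _ _).trans (map_lambdaMap_hE _ _ _ _ _ _)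

theorem exists_r : ∃ r : (mulP V M).comp ((Prof.one (Mᵒᵖ × M)).tens (Prof.ev M)) ⟶
      (Prof.one (Mᵒᵖ × M)).resR (rightF _),
    ∀ (d : Mᵒᵖ × M) (e : (Mᵒᵖ × M) × (Mᵒᵖ × M)) (c : (Mᵒᵖ × M) × PUnit.{v + 1})
      (f : Mor V e.1.1.unop d.1.unop) (g : Mor V e.2.1.unop e.1.2) (h : Mor V d.2 e.2.2)
      (k : Mor V c.1.1.unop e.1.1.unop) (l' : Mor V e.1.2 c.1.2) (w : Mor V e.2.2 e.2.1.unop),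
      Prof.ap r (Prof.cp _ _ (c := c) e (mE f g h) (El.pair (hE k l') (uE w))) =
        hE (k ≫ f) (h ≫ w ≫ g ≫ l') := by
  refine ⟨Prof.liftE _ _ _ (fun e d c => rhoMap d.1.unop d.2 c.1.1.unop c.1.2
    e.1.1.unop e.1.2 e.2.1.unop e.2.2) ?_ ?_ ?_, ?_⟩
  · intro e e' d c f g h u w u' w' k l x
    refine (congrArg (fun t => El.map _ (El.pair t _)) (rE_mE _ _ _ _ _ _ _)).trans ?_
    refine Eq.trans ?_ (congrArg (fun t => El.map _ (El.pair _ t)) ((Prof.lE_tens _ _ _ _ _ _).trans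
      (congrArg₂ El.pair (lE_one_hE _ _ _ _) (lE_uE _ _ _)))).symm
    refine (map_rhoMap_hE _ _ _ _ _ _).trans (Eq.trans ?_ (map_rhoMap_hE _ _ _ _ _ _).symm)
    simp
  · intro e d d' c u w f g h k l x
    refine (congrArg (fun t => El.map _ (El.pair t _)) (lE_mE _ _ _ _ _)).trans ?_
    refine (map_rhoMap_hE _ _ _ _ _ _).trans (Eq.trans ?_
      (congrArg (Prof.lE (Prof.one (Mᵒᵖ × M)) _) (map_rhoMap_hE _ _ _ _ _ _)).symm)
    refine Eq.trans ?_ (lE_one_hE _ _ _ _).symm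
    simp
  · intro e d c c' f g h k l x u w
    refine (congrArg (fun t => El.map _ (El.pair _ t)) ((Prof.rE_tens _ _ _ _ _ _).trans
      (congrArg₂ El.pair (rE_one_hE _ _ _ _) (rE_uE _)))).trans ?_
    refine (map_rhoMap_hE _ _ _ _ _ _).trans (Eq.trans ?_
      (Prof.rE_resR (Prof.one (Mᵒᵖ × M)) (rightF _) (c := c) (c' := c') _ _).symm)
    refine Eq.trans ?_ (congrArg₂ (Prof.rE (Prof.one (Mᵒᵖ × M)))
      (map_rhoMap_hE _ _ _ _ _ _) (El.map_right _)).symm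
    refine Eq.trans ?_ (rE_one_hE _ _ _ _).symm
    simp only [Category.assoc]
    exact congrArg (hE _) ((Category.assoc _ _ _).trans (congrArg (h ≫ ·)
      ((Category.assoc _ _ _).trans (congrArg (x ≫ ·) (Category.assoc _ _ _))))).symm
  · intro d e c f g h k l w
    exact (Prof.ap_lift _ _ _ _ _ _ _ _ _).trans (map_rhoMap_hE _ _ _ _ _ _)

variable {V M}

/-- Two morphisms as an element of `M • (U ⊗ 1)`. -/
def eE {d : Mᵒᵖ × M} {c : PUnit.{v + 1} × (Mᵒᵖ × M)} (f : Mor V c.2.1.unop d.1.unop)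
    (g : Mor V d.2 c.2.2) :
    El (((mulP V M).comp ((Prof.ev M).tens (Prof.one (Mᵒᵖ × M)))).obj d c) :=
  Prof.cp _ _ ((c.2.1, c.2.1.unop), c.2) (mE f (𝟙 _) g)
    (El.pair (uE (c := c.1) (𝟙 _)) (hE (𝟙 _) (𝟙 _)))

/-- Two morphisms as an element of `M • (1 ⊗ U)`. -/
def eE' {d : Mᵒᵖ × M} {c : (Mᵒᵖ × M) × PUnit.{v + 1}} (f : Mor V c.1.1.unop d.1.unop)
    (g : Mor V d.2 c.1.2) :
    El (((mulP V M).comp ((Prof.one (Mᵒᵖ × M)).tens (Prof.ev M))).obj d c) :=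
  Prof.cp _ _ (c.1, (op c.1.2, c.1.2)) (mE f (𝟙 _) g)
    (El.pair (hE (𝟙 _) (𝟙 _)) (uE (c := c.2) (𝟙 _)))

/-- Three uses of the balancing relation: the leaf of `Id` goes into the root, the middle leg moves
from the root into the element of `U`, and the element of `U` then moves into the first leg. Only
two composites remain. -/
theorem cp_eq_eE {d : Mᵒᵖ × M} {e : (Mᵒᵖ × M) × (Mᵒᵖ × M)} {c : PUnit.{v + 1} × (Mᵒᵖ × M)}
    (f : Mor V e.1.1.unop d.1.unop) (g : Mor V e.2.1.unop e.1.2) (h : Mor V d.2 e.2.2)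
    (w : Mor V e.1.2 e.1.1.unop) (k : Mor V c.2.1.unop e.2.1.unop) (l : Mor V e.2.2 c.2.2) :
    Prof.cp (mulP V M) ((Prof.ev M).tens (Prof.one (Mᵒᵖ × M))) (c := c) e (mE f g h)
        (El.pair (uE w) (hE k l)) = eE (k ≫ g ≫ w ≫ f) (h ≫ l) := by
  have h1 := Prof.cp_mE (Prof.ev M) (Prof.one (Mᵒᵖ × M)) (c := c) (d := e)
    (d' := ((e.1.1, e.1.2), c.2)) f g h (𝟙 _) (𝟙 _) k l (uE w) (hE (𝟙 _) (𝟙 _))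
  have h2 := Prof.cp_mE (Prof.ev M) (Prof.one (Mᵒᵖ × M)) (e := d) (c := c)
    (d := ((e.1.1, c.2.1.unop), c.2)) (d' := ((e.1.1, e.1.2), c.2)) f (𝟙 _) (h ≫ l) (𝟙 _) (k ≫ g)
      (𝟙 _) (𝟙 _) (uE w) (hE (𝟙 _) (𝟙 _))
  have h3 := Prof.cp_mE (Prof.ev M) (Prof.one (Mᵒᵖ × M)) (e := d) (c := c)
    (d := ((e.1.1, c.2.1.unop), c.2)) (d' := ((c.2.1, c.2.1.unop), c.2)) f (𝟙 _) (h ≫ l)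
      (k ≫ g ≫ w) (𝟙 _) (𝟙 _) (𝟙 _) (uE (𝟙 _)) (hE (𝟙 _) (𝟙 _))
  rw [lE_uE, lE_one_hE] at h1 h2 h3
  simp only [Category.comp_id, Category.id_comp, Category.assoc] at h1 h2 h3
  exact h1.trans (h2.symm.trans h3)

/-- The mirror image of `cp_eq_eE`: the middle leg and the element of `U` end in the last leg
instead of the first. -/
theorem cp_eq_eE' {d : Mᵒᵖ × M} {e : (Mᵒᵖ × M) × (Mᵒᵖ × M)} {c : (Mᵒᵖ × M) × PUnit.{v + 1}}
    (f : Mor V e.1.1.unop d.1.unop) (g : Mor V e.2.1.unop e.1.2) (h : Mor V d.2 e.2.2)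
    (k : Mor V c.1.1.unop e.1.1.unop) (l : Mor V e.1.2 c.1.2) (w : Mor V e.2.2 e.2.1.unop) :
    Prof.cp (mulP V M) ((Prof.one (Mᵒᵖ × M)).tens (Prof.ev M)) (c := c) e (mE f g h)
        (El.pair (hE k l) (uE w)) = eE' (k ≫ f) (h ≫ w ≫ g ≫ l) := by
  have h1 := Prof.cp_mE (Prof.one (Mᵒᵖ × M)) (Prof.ev M) (c := c) (d := e)
    (d' := (c.1, (e.2.1, e.2.2))) f g h k l (𝟙 _) (𝟙 _) (hE (𝟙 _) (𝟙 _)) (uE w)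
  have h2 := Prof.cp_mE (Prof.one (Mᵒᵖ × M)) (Prof.ev M) (e := d) (c := c)
    (d := (c.1, (op c.1.2, e.2.2))) (d' := (c.1, (e.2.1, e.2.2))) (k ≫ f) (𝟙 _) h (𝟙 _) (𝟙 _)
      (g ≫ l) (𝟙 _) (hE (𝟙 _) (𝟙 _)) (uE w)
  have h3 := Prof.cp_mE (Prof.one (Mᵒᵖ × M)) (Prof.ev M) (e := d) (c := c)
    (d := (c.1, (op c.1.2, e.2.2))) (d' := (c.1, (op c.1.2, c.1.2))) (k ≫ f) (𝟙 _) h (𝟙 _) (𝟙 _)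
      (𝟙 _) (w ≫ g ≫ l) (hE (𝟙 _) (𝟙 _)) (uE (𝟙 _))
  rw [lE_uE, lE_one_hE] at h1 h2 h3
  simp only [Category.comp_id, Category.id_comp, Category.assoc] at h1 h2 h3
  exact h1.trans (h2.symm.trans h3)

theorem isIso_l {l : (mulP V M).comp ((Prof.ev M).tens (Prof.one (Mᵒᵖ × M))) ⟶
      (Prof.one (Mᵒᵖ × M)).resR (leftF _)}
    (hl : ∀ (d : Mᵒᵖ × M) (e : (Mᵒᵖ × M) × (Mᵒᵖ × M)) (c : PUnit.{v + 1} × (Mᵒᵖ × M))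
      (f : Mor V e.1.1.unop d.1.unop) (g : Mor V e.2.1.unop e.1.2) (h : Mor V d.2 e.2.2)
      (w : Mor V e.1.2 e.1.1.unop) (k : Mor V c.2.1.unop e.2.1.unop) (l' : Mor V e.2.2 c.2.2),
      Prof.ap l (Prof.cp _ _ (c := c) e (mE f g h) (El.pair (uE w) (hE k l'))) =
        hE (k ≫ g ≫ w ≫ f) (h ≫ l')) : IsIso l := by
  -- The inverse inserts four identities: one on the middle leg, one in `U`, and the pair in `Id`.
  -- On elements it produces the standard form.
  have key : ∀ (d : Mᵒᵖ × M) (c : PUnit.{v + 1} × (Mᵒᵖ × M)), ∃ K : (d ⟶[V] c.2) ⟶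
      ((mulP V M).comp ((Prof.ev M).tens (Prof.one (Mᵒᵖ × M)))).obj d c,
      ∀ (f : Mor V c.2.1.unop d.1.unop) (g : Mor V d.2 c.2.2), El.map K (hE f g) = eE f g :=
    fun d c => ⟨(c.2.1.unop ⟶[V] d.1.unop) ◁ ((λ_ _).inv ≫ eId V c.2.1.unop ▷ _) ≫ (ρ_ _).inv ≫
      _ ◁ ((λ_ _).inv ≫ (eId V c.2.1.unop ⊗ₘ twoId V c.2.1.unop c.2.2)) ≫
      (mulP V M).inj ((Prof.ev M).tens (Prof.one (Mᵒᵖ × M))) ((c.2.1, c.2.1.unop), c.2) d c, by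
      intro f g
      refine (El.map_comp _ _ _).trans ((congrArg (El.map _) (El.map_whiskerLeft _ _ _)).trans ?_)
      refine (El.map_comp _ _ _).trans ((congrArg (El.map _) (El.map_right_inv _)).trans ?_)
      refine (El.map_comp _ _ _).trans ((congrArg (El.map _) (El.map_whiskerLeft _ _ _)).trans ?_)
      refine congrArg (El.map _) (congrArg₂ El.pair (congrArg (El.pair f) ?_) ?_)
      · refine (El.map_comp _ _ _).trans ((congrArg (El.map _) (El.map_left_inv _)).trans ?_)
        exact El.map_whiskerRight _ _ _
      · refine (El.map_comp _ _ _).trans ((congrArg (El.map _) (El.map_left_inv _)).trans ?_)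
        refine (El.map_tensor _ _ _ _).trans (congrArg (El.pair _) ?_)
        refine (El.map_comp _ _ _).trans ((congrArg (El.map _) (El.map_left_inv _)).trans ?_)
        exact El.map_tensor _ _ _ _⟩
  choose K hK using key
  refine Prof.isIso_of_app l K ?_ ?_
  · intro d c
    apply Cover.ext
    intro e f g h w k l'
    refine (El.map_comp _ _ _).trans (Eq.trans ?_ (El.map_id _).symm)
    refine (congrArg (El.map _) (hl _ _ _ _ _ _ _ _ _)).trans ?_
    exact (hK _ _ _ _).trans (cp_eq_eE _ _ _ _ _ _).symm
  · intro d c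
    -- Naming the object as a hom object selects its covering by pairs of morphisms.
    refine Cover.ext (X := d ⟶[V] c.2) ?_
    intro f g
    refine (El.map_comp _ _ _).trans (Eq.trans ?_ (El.map_id _).symm)
    refine (congrArg (El.map _) (hK _ _ _ _)).trans ?_
    refine (hl _ _ _ _ _ _ _ _ _).trans ?_
    simp
    rfl

theorem isIso_r {r : (mulP V M).comp ((Prof.one (Mᵒᵖ × M)).tens (Prof.ev M)) ⟶
      (Prof.one (Mᵒᵖ × M)).resR (rightF _)}
    (hr : ∀ (d : Mᵒᵖ × M) (e : (Mᵒᵖ × M) × (Mᵒᵖ × M)) (c : (Mᵒᵖ × M) × PUnit.{v + 1})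
      (f : Mor V e.1.1.unop d.1.unop) (g : Mor V e.2.1.unop e.1.2) (h : Mor V d.2 e.2.2)
      (k : Mor V c.1.1.unop e.1.1.unop) (l' : Mor V e.1.2 c.1.2) (w : Mor V e.2.2 e.2.1.unop),
      Prof.ap r (Prof.cp _ _ (c := c) e (mE f g h) (El.pair (hE k l') (uE w))) =
        hE (k ≫ f) (h ≫ w ≫ g ≫ l')) : IsIso r := by
  have key : ∀ (d : Mᵒᵖ × M) (c : (Mᵒᵖ × M) × PUnit.{v + 1}), ∃ K : (d ⟶[V] c.1) ⟶
      ((mulP V M).comp ((Prof.one (Mᵒᵖ × M)).tens (Prof.ev M))).obj d c,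
      ∀ (f : Mor V c.1.1.unop d.1.unop) (g : Mor V d.2 c.1.2), El.map K (hE f g) = eE' f g :=
    fun d c => ⟨(c.1.1.unop ⟶[V] d.1.unop) ◁ ((λ_ _).inv ≫ eId V c.1.2 ▷ _) ≫ (ρ_ _).inv ≫
      _ ◁ ((λ_ _).inv ≫ (twoId V c.1.1.unop c.1.2 ⊗ₘ eId V c.1.2)) ≫
      (mulP V M).inj ((Prof.one (Mᵒᵖ × M)).tens (Prof.ev M)) (c.1, (op c.1.2, c.1.2)) d c, by
      intro f g
      refine (El.map_comp _ _ _).trans ((congrArg (El.map _) (El.map_whiskerLeft _ _ _)).trans ?_)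
      refine (El.map_comp _ _ _).trans ((congrArg (El.map _) (El.map_right_inv _)).trans ?_)
      refine (El.map_comp _ _ _).trans ((congrArg (El.map _) (El.map_whiskerLeft _ _ _)).trans ?_)
      refine congrArg (El.map _) (congrArg₂ El.pair (congrArg (El.pair f) ?_) ?_)
      · refine (El.map_comp _ _ _).trans ((congrArg (El.map _) (El.map_left_inv _)).trans ?_)
        exact El.map_whiskerRight _ _ _
      · refine (El.map_comp _ _ _).trans ((congrArg (El.map _) (El.map_left_inv _)).trans ?_)
        refine (El.map_tensor _ _ _ _).trans (congrArg (El.pair · _) ?_)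
        refine (El.map_comp _ _ _).trans ((congrArg (El.map _) (El.map_left_inv _)).trans ?_)
        exact El.map_tensor _ _ _ _⟩
  choose K hK using key
  refine Prof.isIso_of_app r K ?_ ?_
  · intro d c
    apply Cover.ext
    intro e f g h k l' w
    refine (El.map_comp _ _ _).trans (Eq.trans ?_ (El.map_id _).symm)
    refine (congrArg (El.map _) (hr _ _ _ _ _ _ _ _ _)).trans ?_
    exact (hK _ _ _ _).trans (cp_eq_eE' _ _ _ _ _ _).symm
  · intro d c
    refine Cover.ext (X := d ⟶[V] c.1) ?_
    intro f g
    refine (El.map_comp _ _ _).trans (Eq.trans ?_ (El.map_id _).symm)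
    refine (congrArg (El.map _) (hK _ _ _ _)).trans ?_
    refine (hr _ _ _ _ _ _ _ _ _).trans ?_
    simp
    rfl

end Unitors

end ProV

namespace ProV

variable {V : Type u} [Category.{v} V] [MonoidalCategory V] [SymmetricCategory V]
variable {C M : Type v} [EnrichedCategory V C] [EnrichedCategory V M]
variable {S : MonoidalStr V C} [MonoidalClosed V] [HasColimitsOfSize.{v, v} V]

/-! ### The canonical data: uniqueness, and agreement of the two descriptions -/

namespace ModuleStr

variable (L : ModuleStr S M)

/-- The canonical data, described on elements. -/
structure IsCanonicalE (P : Prof.ProbimonadData L.T (mulP V M) (Prof.ev M)) : Prop where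
  mu : ∀ (d e c : Mᵒᵖ × M) (x y : C) (f : Mor V (L.ob x e.1.unop) d.1.unop)
    (g : Mor V d.2 (L.ob x e.2)) (f' : Mor V (L.ob y c.1.unop) e.1.unop)
    (g' : Mor V e.2 (L.ob y c.2)),
    Prof.ap P.μ (Prof.cp L.T L.T e (L.tE x f g) (L.tE (c := c) y f' g')) =
      L.tE (S.tensor.obj (x, y)) ((L.as x y _).hom ≫ biE L.act (𝟙 (Und.of V x)) f' ≫ f)
        (g ≫ biE L.act (𝟙 (Und.of V x)) g' ≫ (L.as x y _).inv)
  eta : ∀ (d c : Mᵒᵖ × M) (f : Mor V c.1.unop d.1.unop) (g : Mor V d.2 c.2),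
    Prof.ap P.η (hE f g) =
      L.tE (d := d) (c := c) S.unit ((L.lu c.1.unop).hom ≫ f) (g ≫ (L.lu c.2).inv)
  tau : ∀ (d e : Mᵒᵖ × M) (c : (Mᵒᵖ × M) × (Mᵒᵖ × M)) (x : C)
    (f : Mor V (L.ob x e.1.unop) d.1.unop) (g : Mor V d.2 (L.ob x e.2))
    (h : Mor V c.1.1.unop e.1.unop) (k : Mor V c.2.1.unop c.1.2) (l : Mor V e.2 c.2.2),
    Prof.ap P.τ (Prof.cp L.T (mulP V M) e (L.tE x f g) (mE (c := c) h k l)) =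
      L.wE (e := d) (c := c) x x (biE L.act (𝟙 _) h ≫ f) (biE L.act (𝟙 _) k)
        (g ≫ biE L.act (𝟙 _) l)
  nu : ∀ (d e : Mᵒᵖ × M) (c : PUnit.{v + 1}) (x : C) (f : Mor V (L.ob x e.1.unop) d.1.unop)
    (g : Mor V d.2 (L.ob x e.2)) (w : Mor V e.2 e.1.unop),
    Prof.ap P.ν (Prof.cp L.T (Prof.ev M) e (L.tE x f g) (uE (c := c) w)) =
      uE (g ≫ biE L.act (𝟙 (Und.of V x)) w ≫ f)
  alpha : ∀ (d : Mᵒᵖ × M) (e : (Mᵒᵖ × M) × (Mᵒᵖ × M)) (c : ((Mᵒᵖ × M) × (Mᵒᵖ × M)) × (Mᵒᵖ × M))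
    (f : Mor V e.1.1.unop d.1.unop) (g : Mor V e.2.1.unop e.1.2) (h : Mor V d.2 e.2.2)
    (f' : Mor V c.1.1.1.unop e.1.1.unop) (g' : Mor V c.1.2.1.unop c.1.1.2)
    (h' : Mor V e.1.2 c.1.2.2) (k : Mor V c.2.1.unop e.2.1.unop) (l : Mor V e.2.2 c.2.2),
    Prof.ap P.α (Prof.cp _ _ (c := c) e (mE f g h) (El.pair (mE f' g' h') (hE k l))) =
      qE (c := (c.1.1, (c.1.2, c.2))) (f' ≫ f) g' (k ≫ g ≫ h') (h ≫ l)
  l : ∀ (d : Mᵒᵖ × M) (e : (Mᵒᵖ × M) × (Mᵒᵖ × M)) (c : PUnit.{v + 1} × (Mᵒᵖ × M))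
    (f : Mor V e.1.1.unop d.1.unop) (g : Mor V e.2.1.unop e.1.2) (h : Mor V d.2 e.2.2)
    (w : Mor V e.1.2 e.1.1.unop) (k : Mor V c.2.1.unop e.2.1.unop) (l' : Mor V e.2.2 c.2.2),
    Prof.ap P.l (Prof.cp _ _ (c := c) e (mE f g h) (El.pair (uE w) (hE k l'))) =
      hE (k ≫ g ≫ w ≫ f) (h ≫ l')
  r : ∀ (d : Mᵒᵖ × M) (e : (Mᵒᵖ × M) × (Mᵒᵖ × M)) (c : (Mᵒᵖ × M) × PUnit.{v + 1})
    (f : Mor V e.1.1.unop d.1.unop) (g : Mor V e.2.1.unop e.1.2) (h : Mor V d.2 e.2.2)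
    (k : Mor V c.1.1.unop e.1.1.unop) (l' : Mor V e.1.2 c.1.2) (w : Mor V e.2.2 e.2.1.unop),
    Prof.ap P.r (Prof.cp _ _ (c := c) e (mE f g h) (El.pair (hE k l') (uE w))) =
      hE (k ≫ f) (h ≫ w ≫ g ≫ l')

theorem exists_isCanonicalE :
    ∃ P : Prof.ProbimonadData L.T (mulP V M) (Prof.ev M), L.IsCanonicalE P := by
  obtain ⟨μ, hμ⟩ := L.exists_mu
  obtain ⟨η, hη⟩ := L.exists_eta
  obtain ⟨τ, hτ⟩ := L.exists_tau
  obtain ⟨ν, hν⟩ := L.exists_nu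
  obtain ⟨α, hα⟩ := exists_alpha V M
  obtain ⟨l, hl⟩ := exists_l V M
  obtain ⟨r, hr⟩ := exists_r V M
  exact ⟨⟨μ, η, τ, ν, α, l, r⟩, ⟨hμ, hη, hτ, hν, hα, hl, hr⟩⟩

variable {L}

/-- The elements on which the seven maps are prescribed generate their sources. -/
theorem IsCanonicalE.unique {P P' : Prof.ProbimonadData L.T (mulP V M) (Prof.ev M)}
    (h : L.IsCanonicalE P) (h' : L.IsCanonicalE P') : P' = P := by
  apply Prof.ProbimonadData.ext
  · refine Prof.hom_ext fun d c e x f g y f' g' => ?_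
    exact (h'.mu _ _ _ _ _ _ _ _ _).trans (h.mu _ _ _ _ _ _ _ _ _).symm
  · refine Prof.hom_ext fun d c f g => ?_
    exact (h'.eta _ _ _ _).trans (h.eta _ _ _ _).symm
  · refine Prof.hom_ext fun d c e x f g h₁ k l => ?_
    exact (h'.tau _ _ _ _ _ _ _ _ _).trans (h.tau _ _ _ _ _ _ _ _ _).symm
  · refine Prof.hom_ext fun d c e x f g w => ?_
    exact (h'.nu _ _ _ _ _ _ _).trans (h.nu _ _ _ _ _ _ _).symm
  · refine Prof.hom_ext fun d c e f g h₁ f' g' h₂ k l => ?_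
    exact (h'.alpha _ _ _ _ _ _ _ _ _ _ _).trans (h.alpha _ _ _ _ _ _ _ _ _ _ _).symm
  · refine Prof.hom_ext fun d c e f g h₁ w k l => ?_
    exact (h'.l _ _ _ _ _ _ _ _ _).trans (h.l _ _ _ _ _ _ _ _ _).symm
  · refine Prof.hom_ext fun d c e f g h₁ k l w => ?_
    exact (h'.r _ _ _ _ _ _ _ _ _).trans (h.r _ _ _ _ _ _ _ _ _).symm

section Components

variable (P : Prof.ProbimonadData L.T (mulP V M) (Prof.ev M))

theorem map_mu_comp (x y : C) {a b m n p q : M} (f : Mor V (L.ob x p) a) (g : Mor V b (L.ob x q))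
    (f' : Mor V (L.ob y m) p) (g' : Mor V q (L.ob y n)) :
    El.map ((L.ιT x a b p q ⊗ₘ L.ιT y p q m n) ≫ L.T.inj L.T (op p, q) (op a, b) (op m, n) ≫
        P.μ.app (op a, b) (op m, n)) (El.pair (El.pair f g) (El.pair f' g')) =
      Prof.ap P.μ (Prof.cp L.T L.T (e := (op a, b)) (c := (op m, n)) (op p, q)
        (L.tE x f g) (L.tE y f' g')) :=
  (El.map_comp _ _ _).trans ((congrArg (El.map _) (El.map_tensor _ _ _ _)).trans
    (El.map_comp _ _ _))

theorem map_tau_comp (x : C) {a b m₁ n₁ m₂ n₂ p q : M} (f : Mor V (L.ob x p) a)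
    (g : Mor V b (L.ob x q)) (h : Mor V m₁ p) (k : Mor V m₂ n₁) (l : Mor V q n₂) :
    El.map (L.ιT x a b p q ▷ _ ≫
        L.T.inj (mulP V M) (op p, q) (op a, b) ((op m₁, n₁), (op m₂, n₂)) ≫
        P.τ.app (op a, b) ((op m₁, n₁), (op m₂, n₂)))
        (El.pair (El.pair f g) (El.pair h (El.pair k l))) =
      Prof.ap P.τ (Prof.cp L.T (mulP V M) (e := (op a, b)) (c := ((op m₁, n₁), (op m₂, n₂)))
        (op p, q) (L.tE x f g) (mE h k l)) :=
  (El.map_comp _ _ _).trans ((congrArg (El.map _) (El.map_whiskerRight _ _ _)).trans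
    (El.map_comp _ _ _))

theorem map_nu_comp (x : C) {a b m n : M} (f : Mor V (L.ob x m) a)
    (g : Mor V b (L.ob x n)) (h : Mor V n m) :
    El.map (L.ιT x a b m n ▷ _ ≫ L.T.inj (Prof.ev M) (op m, n) (op a, b) PUnit.unit ≫
        P.ν.app (op a, b) PUnit.unit) (El.pair (El.pair f g) h) =
      Prof.ap P.ν (Prof.cp L.T (Prof.ev M) (e := (op a, b)) (c := PUnit.unit)
        (op m, n) (L.tE x f g) (uE h)) :=
  (El.map_comp _ _ _).trans ((congrArg (El.map _) (El.map_whiskerRight _ _ _)).trans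
    (El.map_comp _ _ _))

variable {P}

/-- From elements back to maps: both sides of each condition are maps out of tensor products of hom
objects, where generic elements decide equality. -/
theorem IsCanonicalE.isCanonical (h : L.IsCanonicalE P) : L.IsCanonical P where
  mu x y a b m n p q := Cover.ext fun (f : Mor V (L.ob x p) a) (g : Mor V b (L.ob x q))
    (f' : Mor V (L.ob y m) p) (g' : Mor V q (L.ob y n)) =>
    (map_mu_comp P x y f g f' g').trans ((h.mu _ _ _ _ _ _ _ _ _).trans
      ((El.map_comp _ _ _).trans (congrArg _ (L.map_muMap f g f' g'))).symm)
  eta a b m n := Cover.ext fun (f : Mor V m a) (g : Mor V b n) =>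
    (h.eta (op a, b) (op m, n) f g).trans
      ((El.map_comp _ _ _).trans (congrArg _ (L.map_etaMap f g))).symm
  tau x a b m₁ n₁ m₂ n₂ p q := by
    refine Cover.ext (X := ((L.ob x p ⟶[V] a) ⊗ (b ⟶[V] L.ob x q)) ⊗ ((m₁ ⟶[V] p) ⊗
      ((m₂ ⟶[V] n₁) ⊗ (q ⟶[V] n₂)))) ?_
    intro f g h₁ k l
    exact (map_tau_comp P x f g h₁ k l).trans ((h.tau _ _ _ _ _ _ _ _ _).trans
      (L.map_tauMap_wE (d := (op a, b)) (e := (op p, q)) (c := ((op m₁, n₁), (op m₂, n₂)))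
        x f g h₁ k l).symm)
  nu x a b m n := by
    refine Cover.ext (X := ((L.ob x m ⟶[V] a) ⊗ (b ⟶[V] L.ob x n)) ⊗ (n ⟶[V] m)) ?_
    intro f g w
    exact (map_nu_comp P x f g w).trans ((h.nu _ _ _ _ _ _ _).trans (L.map_nuMap f g w).symm)
  alpha a b m₁ n₁ m₂ n₂ m₃ n₃ p q p' q' := by
    refine Cover.ext (X := ((p ⟶[V] a) ⊗ ((p' ⟶[V] q) ⊗ (b ⟶[V] q'))) ⊗
      (((m₁ ⟶[V] p) ⊗ ((m₂ ⟶[V] n₁) ⊗ (q ⟶[V] n₂))) ⊗ ((m₃ ⟶[V] p') ⊗ (q' ⟶[V] n₃)))) ?_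
    intro f g h₁ f' g' h₂ k l
    exact (El.map_comp _ _ _).trans ((h.alpha (op a, b) ((op p, q), (op p', q'))
      (((op m₁, n₁), (op m₂, n₂)), (op m₃, n₃)) f g h₁ f' g' h₂ k l).trans
      (map_alphaMap_qE (d := (op a, b)) (e := ((op p, q), (op p', q')))
      (c := (((op m₁, n₁), (op m₂, n₂)), (op m₃, n₃))) f g h₁ f' g' h₂ k l).symm)
  l a b m n p q p' q' := by
    refine Cover.ext (X := ((p ⟶[V] a) ⊗ ((p' ⟶[V] q) ⊗ (b ⟶[V] q'))) ⊗
      ((q ⟶[V] p) ⊗ ((m ⟶[V] p') ⊗ (q' ⟶[V] n)))) ?_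
    intro f g h₁ w k l
    exact (El.map_comp _ _ _).trans ((h.l (op a, b) ((op p, q), (op p', q'))
      (PUnit.unit, (op m, n)) f g h₁ w k l).trans (map_lambdaMap f g h₁ w k l).symm)
  r a b m n p q p' q' := by
    refine Cover.ext (X := ((p ⟶[V] a) ⊗ ((p' ⟶[V] q) ⊗ (b ⟶[V] q'))) ⊗
      (((m ⟶[V] p) ⊗ (q ⟶[V] n)) ⊗ (q' ⟶[V] p'))) ?_
    intro f g h₁ k l w
    exact (El.map_comp _ _ _).trans ((h.r (op a, b) ((op p, q), (op p', q'))
      ((op m, n), PUnit.unit) f g h₁ k l w).trans (map_rhoMap f g h₁ k l w).symm)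

/-- The converse is evaluation of each equation of maps at arbitrary elements; it carries uniqueness
over to the data as prescribed in the claim. -/
theorem IsCanonical.isCanonicalE (h : L.IsCanonical P) : L.IsCanonicalE P where
  mu d e c x y f g f' g' := (map_mu_comp P x y f g f' g').symm.trans
    ((congrArg (El.map · _) (h.mu _ _ _ _ _ _ _ _)).trans
      ((El.map_comp _ _ _).trans (congrArg _ (L.map_muMap f g f' g'))))
  eta d c f g := (congrArg (El.map · (hE f g)) (h.eta d.1.unop d.2 c.1.unop c.2)).trans
    ((El.map_comp _ _ _).trans (congrArg _ (L.map_etaMap f g)))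
  tau d e c x f g h₁ k l := (map_tau_comp P x f g h₁ k l).symm.trans
    ((congrArg (El.map · _) (h.tau _ _ _ _ _ _ _ _ _)).trans (L.map_tauMap_wE x f g h₁ k l))
  nu d e c x f g w := (map_nu_comp P x f g w).symm.trans
    ((congrArg (El.map · _) (h.nu _ _ _ _ _)).trans (L.map_nuMap f g w))
  alpha d e c f g h₁ f' g' h₂ k l := (El.map_comp _ _ _).symm.trans
    ((congrArg (El.map · _) (h.alpha _ _ _ _ _ _ _ _ _ _ _ _)).trans
      (map_alphaMap_qE f g h₁ f' g' h₂ k l))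
  l d e c f g h₁ w k l := (El.map_comp _ _ _).symm.trans
    ((congrArg (El.map · _) (h.l _ _ _ _ _ _ _ _)).trans (map_lambdaMap f g h₁ w k l))
  r d e c f g h₁ k l w := (El.map_comp _ _ _).symm.trans
    ((congrArg (El.map · _) (h.r _ _ _ _ _ _ _ _)).trans (map_rhoMap f g h₁ k l w))

end Components

end ModuleStr

end ProV

namespace ProV

variable {V : Type u} [Category.{v} V] [MonoidalCategory V] [SymmetricCategory V]

/-! ### The structure maps at the root of a tree, on elements -/

section Trees

variable [MonoidalClosed V] [HasColimitsOfSize.{v, v} V]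

namespace Prof

variable {A B₁ B₂ B₁' B₂' : Type v} [EnrichedCategory V A] [EnrichedCategory V B₁]
  [EnrichedCategory V B₂] [EnrichedCategory V B₁'] [EnrichedCategory V B₂']

theorem ap_convHom (M : Prof V (A × A) A) {F F' : Prof V B₁ A} {G G' : Prof V B₂ A} (f : F ⟶ F')
    (g : G ⟶ G') {a : A} {e : A × A} {c : B₁ × B₂} (x : El (M.obj a e)) (y : El (F.obj e.1 c.1))
    (z : El (G.obj e.2 c.2)) :
    ap (convHom M f g) (cp M (F.tens G) (c := c) e x (El.pair y z)) =
      cp M (F'.tens G') (c := c) e x (El.pair (ap f y) (ap g z)) :=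
  (ap_hcomp _ _ _ _).trans (congrArg₂ (cp M (F'.tens G') e) (ap_id _) (ap_tensHom _ _ _ _))

theorem ap_convHomRes (M : Prof V (A × A) A) {F : Prof V B₁ A} {F' : Prof V B₁' A}
    {G : Prof V B₂ A} {G' : Prof V B₂' A} {K : EnrichedFunctor V B₁ B₁'}
    {L : EnrichedFunctor V B₂ B₂'} (f : F ⟶ F'.resR K) (g : G ⟶ G'.resR L) {a : A} {e : A × A}
    {c : B₁ × B₂} (x : El (M.obj a e)) (y : El (F.obj e.1 c.1)) (z : El (G.obj e.2 c.2)) :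
    ap (convHomRes M f g) (cp M (F.tens G) (c := c) e x (El.pair y z)) =
      cp M (F'.tens G') (c := (K.obj c.1, L.obj c.2)) e x (El.pair (ap f y) (ap g z)) :=
  (ap_compRes _ _ _ _).trans (congrArg (cp M (F'.tens G') e x) (ap_tensHomRes _ _ _ _))

end Prof

variable {C M : Type v} [EnrichedCategory V C] [EnrichedCategory V M] {S : MonoidalStr V C}
variable {L : ModuleStr S M} {P : Prof.ProbimonadData L.T (mulP V M) (Prof.ev M)}
variable {B₁ B₂ B₃ : Type v} [EnrichedCategory V B₁] [EnrichedCategory V B₂]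
  [EnrichedCategory V B₃]

namespace ModuleStr.IsCanonicalE

/-- After rebracketing, `τ` acts on the root alone; the interchange then distributes its two
identity elements of `T` over the branches. -/
theorem ap_tauAt (hP : L.IsCanonicalE P) (F : Prof V B₁ (Mᵒᵖ × M)) (G : Prof V B₂ (Mᵒᵖ × M))
    {d e : Mᵒᵖ × M} {q : (Mᵒᵖ × M) × (Mᵒᵖ × M)} {c : B₁ × B₂} (x : C)
    (f : Mor V (L.ob x e.1.unop) d.1.unop) (g : Mor V d.2 (L.ob x e.2))
    (h : Mor V q.1.1.unop e.1.unop) (k : Mor V q.2.1.unop q.1.2) (l : Mor V e.2 q.2.2)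
    (s : El (F.obj q.1 c.1)) (t : El (G.obj q.2 c.2)) :
    Prof.ap (Prof.tauAt P.τ F G) (Prof.cp L.T (Prof.conv (mulP V M) F G) e (L.tE x f g)
        (Prof.cp (mulP V M) (F.tens G) (c := c) q (mE h k l) (El.pair s t))) =
      Prof.cp (mulP V M) ((L.T.comp F).tens (L.T.comp G)) (c := c)
        ((op (L.ob x q.1.1.unop), L.ob x q.1.2), (op (L.ob x q.2.1.unop), L.ob x q.2.2))
        (mE (biE L.act (𝟙 _) h ≫ f) (biE L.act (𝟙 _) k) (g ≫ biE L.act (𝟙 _) l))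
        (El.pair (Prof.cp L.T F q.1 (L.iE x q.1) s) (Prof.cp L.T G q.2 (L.iE x q.2) t)) := by
  rw [Prof.tauAt, Prof.ap_comp, Prof.ap_comp, Prof.ap_comp, Prof.ap_as', Prof.ap_hcomp, hP.tau,
    Prof.ap_id, wE, Prof.ap_as, Prof.ap_hcomp, Prof.ap_id]
  exact congrArg (Prof.cp _ _ _ _) (Prof.ap_ix _ _ _ _ _ _ _ _)

/-- The auxiliary identities leave no trace on elements, so the tree is simply rebracketed. The leg
between the second and third branches becomes `g ≫ h'`. -/
theorem ap_alphaAt (hP : L.IsCanonicalE P) (F : Prof V B₁ (Mᵒᵖ × M)) (G : Prof V B₂ (Mᵒᵖ × M))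
    (H : Prof V B₃ (Mᵒᵖ × M)) {d : Mᵒᵖ × M} {e q : (Mᵒᵖ × M) × (Mᵒᵖ × M)} {c : (B₁ × B₂) × B₃}
    (f : Mor V e.1.1.unop d.1.unop) (g : Mor V e.2.1.unop e.1.2) (h : Mor V d.2 e.2.2)
    (f' : Mor V q.1.1.unop e.1.1.unop) (g' : Mor V q.2.1.unop q.1.2) (h' : Mor V e.1.2 q.2.2)
    (s : El (F.obj q.1 c.1.1)) (t : El (G.obj q.2 c.1.2)) (w : El (H.obj e.2 c.2)) :
    Prof.ap (Prof.alphaAt P.α F G H) (Prof.cp (mulP V M) ((Prof.conv (mulP V M) F G).tens H)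
        (c := c) e (mE f g h)
        (El.pair (Prof.cp (mulP V M) (F.tens G) (c := c.1) q (mE f' g' h') (El.pair s t)) w)) =
      Prof.cp (mulP V M) (F.tens (Prof.conv (mulP V M) G H)) (c := (c.1.1, (c.1.2, c.2)))
        (q.1, (q.2.1, e.2.2)) (mE (f' ≫ f) g' h)
        (El.pair s (Prof.cp (mulP V M) (G.tens H) (c := (c.1.2, c.2)) (q.2, e.2)
          (mE (𝟙 _) (g ≫ h') (𝟙 _)) (El.pair t w))) := by
  rw [Prof.alphaAt, Prof.ap_comp, Prof.ap_comp, Prof.ap_comp, Prof.ap_comp, Prof.ap_hcomp,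
    Prof.ap_id]
  -- The third branch is given an identity leaf, so that the upper two levels of the tree have the
  -- shape of the source of `α`.
  refine Eq.trans (congrArg (Prof.ap _) (congrArg (Prof.ap _) (congrArg (Prof.ap _)
    (congrArg (Prof.ap _) (congrArg (Prof.cp _ _ _ _) ((Prof.ap_comp _ _ _).trans ((congrArg (Prof.ap _) ((Prof.ap_tensHom _ _ _ _).trans
      (congrArg₂ El.pair (Prof.ap_id _) ((Prof.ap_lu' _ _).trans (congrArg (Prof.cp _ _ _ · _) (idE_eq_hE _)))))).trans
      (Prof.ap_ix' _ _ _ _ _ _ _ _ _ _)))))))) ?_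
  refine Eq.trans (congrArg (Prof.ap _) (congrArg (Prof.ap _) (congrArg (Prof.ap _)
    (Prof.ap_as' _ _ _ _ _ _ _ _)))) ?_
  refine Eq.trans (congrArg (Prof.ap _) (congrArg (Prof.ap _) ((Prof.ap_hcomp _ _ _ _).trans
    (congrArg₂ (Prof.cp _ _ _) (hP.alpha d e (q, e.2) f g h f' g' h' (𝟙 _) (𝟙 _))
      (Prof.ap_id _))))) ?_
  refine (congrArg (Prof.ap _) ((Prof.ap_push _ _ _ _ _ _ _ _).trans
    (congrArg (Prof.cp _ _ _ _) (Prof.ap_tensAssoc _ _ _ _ _ _)))).trans ?_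
  refine (Prof.ap_comp _ _ _).trans ?_
  refine (congrArg (Prof.ap _) (Prof.ap_as _ _ _ _ _ _ _ _)).trans ?_
  refine (Prof.ap_hcomp _ _ _ _).trans ?_
  refine congrArg₂ (Prof.cp _ _ _) ((Prof.ap_id _).trans ?_) ?_
  · rw [Category.comp_id]
  refine (Prof.ap_comp _ _ _).trans ((congrArg (Prof.ap _) (Prof.ap_ix _ _ _ _ _ _ _ _)).trans ?_)
  refine (Prof.ap_tensHom _ _ _ _).trans (congrArg₂ El.pair ?_ ((Prof.ap_id _).trans ?_))
  · refine (Prof.ap_lu _ _ _).trans ?_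
    exact (congrArg (Prof.lE _ · _) (idE_eq_hE _).symm).trans (Prof.lE_idE _ _)
  · rw [Category.id_comp]
    rfl

/-- With an identity leaf inserted on the remaining branch, `l` returns the composite morphism as an
element of `Id`, which then acts on that branch; `ap_rhoAt` works in the same way. -/
theorem ap_lambdaAt (hP : L.IsCanonicalE P) (F : Prof V B₁ (Mᵒᵖ × M))
    {d : Mᵒᵖ × M} {e : (Mᵒᵖ × M) × (Mᵒᵖ × M)} {c : PUnit.{v + 1} × B₁}
    (f : Mor V e.1.1.unop d.1.unop) (g : Mor V e.2.1.unop e.1.2) (h : Mor V d.2 e.2.2)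
    (w : Mor V e.1.2 e.1.1.unop) (s : El (F.obj e.2 c.2)) :
    Prof.ap (Prof.lambdaAt P.l F) (Prof.cp (mulP V M) ((Prof.ev M).tens F) (c := c) e (mE f g h)
        (El.pair (uE w) s)) =
      Prof.lE F (hE (g ≫ w ≫ f) h) s := by
  rw [Prof.lambdaAt, Prof.ap_comp, Prof.ap_comp, Prof.ap_comp, Prof.ap_comp, Prof.ap_hcomp,
    Prof.ap_id]
  refine Eq.trans (congrArg (Prof.ap _) (congrArg (Prof.ap _) (congrArg (Prof.ap _)
    (congrArg (Prof.ap _) (congrArg (Prof.cp _ _ _ _) ((Prof.ap_comp _ _ _).trans ((congrArg (Prof.ap _) ((Prof.ap_tensHom _ _ _ _).trans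
      (congrArg₂ El.pair (Prof.ap_ru' _ _) ((Prof.ap_lu' _ _).trans (congrArg (Prof.cp _ _ _ · _) (idE_eq_hE _)))))).trans
      (Prof.ap_ix' _ _ _ _ _ _ _ _ _ _)))))))) ?_
  refine Eq.trans (congrArg (Prof.ap _) (congrArg (Prof.ap _) (congrArg (Prof.ap _)
    (Prof.ap_as' _ _ _ _ _ _ _ _)))) ?_
  refine Eq.trans (congrArg (Prof.ap _) (congrArg (Prof.ap _) ((Prof.ap_hcomp _ _ _ _).trans
    (congrArg₂ (Prof.cp _ _ _) (hP.l d e (c.1, e.2) f g h w (𝟙 _) (𝟙 _))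
      (Prof.ap_id _))))) ?_
  -- The inserted identity of the unit `V`-category has to be recognised as `El.one` before the left
  -- unitor can absorb it.
  refine (congrArg (Prof.ap _) ((Prof.ap_push _ _ _ _ _ _ _ _).trans
    (congrArg (Prof.cp _ _ _ _) ((congrArg (Prof.ap (Prof.tensLeft F)) (congrArg (El.pair · s)
      (idE_punit c.1))).trans (Prof.ap_tensLeft _ _))))).trans ?_
  refine (Prof.ap_lu _ _ _).trans ?_
  refine congrArg (Prof.lE F · s) ?_
  rw [Category.id_comp]
  exact congrArg (hE _) (Category.comp_id _)

theorem ap_rhoAt (hP : L.IsCanonicalE P) (F : Prof V B₁ (Mᵒᵖ × M))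
    {d : Mᵒᵖ × M} {e : (Mᵒᵖ × M) × (Mᵒᵖ × M)} {c : B₁ × PUnit.{v + 1}}
    (f : Mor V e.1.1.unop d.1.unop) (g : Mor V e.2.1.unop e.1.2) (h : Mor V d.2 e.2.2)
    (s : El (F.obj e.1 c.1)) (w : Mor V e.2.2 e.2.1.unop) :
    Prof.ap (Prof.rhoAt P.r F) (Prof.cp (mulP V M) (F.tens (Prof.ev M)) (c := c) e (mE f g h)
        (El.pair s (uE w))) =
      Prof.lE F (hE f (h ≫ w ≫ g)) s := by
  rw [Prof.rhoAt, Prof.ap_comp, Prof.ap_comp, Prof.ap_comp, Prof.ap_comp, Prof.ap_hcomp,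
    Prof.ap_id]
  refine Eq.trans (congrArg (Prof.ap _) (congrArg (Prof.ap _) (congrArg (Prof.ap _)
    (congrArg (Prof.ap _) (congrArg (Prof.cp _ _ _ _) ((Prof.ap_comp _ _ _).trans ((congrArg (Prof.ap _) ((Prof.ap_tensHom _ _ _ _).trans
      (congrArg₂ El.pair ((Prof.ap_lu' _ _).trans (congrArg (Prof.cp _ _ _ · _) (idE_eq_hE _))) (Prof.ap_ru' _ _)))).trans
      (Prof.ap_ix' _ _ _ _ _ _ _ _ _ _)))))))) ?_
  refine Eq.trans (congrArg (Prof.ap _) (congrArg (Prof.ap _) (congrArg (Prof.ap _)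
    (Prof.ap_as' _ _ _ _ _ _ _ _)))) ?_
  refine Eq.trans (congrArg (Prof.ap _) (congrArg (Prof.ap _) ((Prof.ap_hcomp _ _ _ _).trans
    (congrArg₂ (Prof.cp _ _ _) (hP.r d e (e.1, c.2) f g h (𝟙 _) (𝟙 _) w)
      (Prof.ap_id _))))) ?_
  refine (congrArg (Prof.ap _) ((Prof.ap_push _ _ _ _ _ _ _ _).trans
    (congrArg (Prof.cp _ _ _ _) ((congrArg (Prof.ap (Prof.tensRight F)) (congrArg (El.pair s)
      (idE_punit c.2))).trans (Prof.ap_tensRight _ _))))).trans ?_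
  refine (Prof.ap_lu _ _ _).trans ?_
  refine congrArg (Prof.lE F · s) ?_
  rw [Category.id_comp]
  exact congrArg (fun z => hE _ (h ≫ w ≫ z)) (Category.comp_id _)

end ModuleStr.IsCanonicalE

end Trees

end ProV

namespace ProV

/-! ### The axioms of a probimonad -/

variable {V : Type u} [Category.{v} V] [MonoidalCategory V] [SymmetricCategory V]
variable [MonoidalClosed V] [HasColimitsOfSize.{v, v} V]
variable {C M : Type v} [EnrichedCategory V C] [EnrichedCategory V M] {S : MonoidalStr V C}
variable {L : ModuleStr S M} {P : Prof.ProbimonadData L.T (mulP V M) (Prof.ev M)}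

theorem Prof.ap_comp_resRHom {B D E : Type v} [EnrichedCategory V B] [EnrichedCategory V D]
    [EnrichedCategory V E] {F : Prof V B E} {G H : Prof V D E} {K : EnrichedFunctor V B D}
    (f : F ⟶ G.resR K) (g : G ⟶ H) {e : E} {b : B} (x : El (F.obj e b)) :
    ap (f ≫ resRHom g K) x = ap (F := G) (G := H) (c := K.obj b) g (ap f x) :=
  ap_comp _ _ _

/-- The case of `cp_mE` in which identities act on the left branch. It aligns the two sides of
`tau_alpha`. -/
theorem Prof.cp_mE_right {B B' : Type v} [EnrichedCategory V B] [EnrichedCategory V B']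
    (F : Prof V B (Mᵒᵖ × M)) (G : Prof V B' (Mᵒᵖ × M)) {e : Mᵒᵖ × M}
    {d : (Mᵒᵖ × M) × (Mᵒᵖ × M)} {d' : Mᵒᵖ × M} {c : B × B'} (f : Mor V d.1.1.unop e.1.unop)
    (g : Mor V d.2.1.unop d.1.2) (h : Mor V e.2 d.2.2)
    (u : Mor V d'.1.unop d.2.1.unop) (w : Mor V d.2.2 d'.2)
    (x : El (F.obj d.1 c.1)) (y : El (G.obj d' c.2)) :
    cp (mulP V M) (F.tens G) (c := c) d (mE f g h) (El.pair x (lE G (hE u w) y)) =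
      cp (mulP V M) (F.tens G) (c := c) (d.1, d') (mE f (u ≫ g) (h ≫ w)) (El.pair x y) := by
  have hx : lE F (hE (𝟙 (Und.of V d.1.1.unop)) (𝟙 (Und.of V d.1.2))) x = x :=
    (congrArg (lE F · x) (idE_eq_hE d.1).symm).trans (lE_idE F x)
  refine (congrArg (cp _ _ _ _) (congrArg (El.pair · _) hx.symm)).trans ?_
  refine (cp_mE (d' := (d.1, d')) F G f g h _ _ u w x y).trans ?_
  refine congrArg₂ (fun s t => cp (mulP V M) (F.tens G) (c := c) (d.1, d')
    (mE s (u ≫ t) (h ≫ w)) (El.pair x y)) (Category.id_comp _) (Category.comp_id _)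

theorem cp_hE {e : Mᵒᵖ × M} {d c : (Mᵒᵖ × M) × (Mᵒᵖ × M)} (f : Mor V d.1.1.unop e.1.unop)
    (g : Mor V d.2.1.unop d.1.2) (h : Mor V e.2 d.2.2) (k : Mor V c.1.1.unop d.1.1.unop)
    (l : Mor V d.1.2 c.1.2) (k' : Mor V c.2.1.unop d.2.1.unop) (l' : Mor V d.2.2 c.2.2) :
    Prof.cp (mulP V M) ((Prof.one _).tens (Prof.one _)) (c := c) d (mE f g h)
        (El.pair (hE k l) (hE k' l')) =
      Prof.cp (mulP V M) ((Prof.one _).tens (Prof.one _)) (c := c) c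
        (mE (k ≫ f) (k' ≫ g ≫ l) (h ≫ l'))
        (El.pair (hE (𝟙 (Und.of V c.1.1.unop)) (𝟙 (Und.of V c.1.2)))
          (hE (𝟙 (Und.of V c.2.1.unop)) (𝟙 (Und.of V c.2.2)))) := by
  rw [← lE_one_id k l, ← lE_one_id k' l']
  exact Prof.cp_mE _ _ _ _ _ _ _ _ _ _ _

namespace ModuleStr

-- The pentagon for the covariant legs of `T`. The associator of `C` is not inverted, because one
-- and the same morphism of `C` has to compare both legs in `tE_eq`.
variable (L) in
theorem pentagonE_inv (x y z : C) (m : M) :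
    (L.as x y (L.ob z m)).inv ≫ (L.as (S.tensor.obj (x, y)) z m).inv ≫
        biE L.act (S.as x y z).hom (𝟙 _) =
      biE L.act (𝟙 _) (L.as y z m).inv ≫ (L.as x (S.tensor.obj (y, z)) m).inv := by
  have h : biE L.act (𝟙 (Und.of V x)) (L.as y z m).inv ≫ biE L.act (𝟙 _) (L.as y z m).hom = 𝟙 _ := by
    rw [biE_comp]; simp
  have h' : biE L.act (𝟙 (Und.of V x)) (L.as y z m).hom ≫ biE L.act (𝟙 _) (L.as y z m).inv = 𝟙 _ := by
    rw [biE_comp]; simp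
  rw [Iso.inv_comp_eq, Iso.inv_comp_eq]
  have := L.pentagonE x y z m =≫ (biE L.act (𝟙 _) (L.as y z m).inv ≫
    (L.as x (S.tensor.obj (y, z)) m).inv)
  simp only [Category.assoc] at this
  rw [this, reassoc_of% h', Iso.hom_inv_id]
  exact (Category.comp_id _).symm

namespace IsCanonicalE

variable (hP : L.IsCanonicalE P)
include hP

/-- The two products lie over `(x ⊠ y) ⊠ z` and `x ⊠ (y ⊠ z)`. The associator of `C` relates them in
the coend, and the two legs are the pentagon and its inverse form, after the innermost morphisms are
moved by naturality. -/
theorem mu_assoc : Prof.hcomp P.μ (𝟙 L.T) ≫ P.μ =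
    Prof.as L.T L.T L.T ≫ Prof.hcomp (𝟙 L.T) P.μ ≫ P.μ := by
  refine Prof.hom_ext fun d c e₂ e₁ x f g y f' g' z f'' g'' => ?_
  beta_reduce
  rw [Prof.ap_comp, Prof.ap_comp, Prof.ap_comp, Prof.ap_hcomp, Prof.ap_id, Prof.ap_as,
    Prof.ap_hcomp, Prof.ap_id, hP.mu, hP.mu, hP.mu, hP.mu]
  refine L.tE_eq (S.as x y z).hom ?_ ?_
  · have h1 := L.pentagonE x y z c.1.unop =≫ (biE L.act (𝟙 (Und.of V x))
      (biE L.act (𝟙 (Und.of V y)) f'') ≫ biE L.act (𝟙 _) f' ≫ f)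
    have h2 := L.as_natural_assoc (𝟙 (Und.of V x)) (𝟙 (Und.of V y)) f''
      (biE L.act (𝟙 _) f' ≫ f)
    rw [biE_id] at h2
    rw [h2]
    simp only [biE_comp_assoc, Category.comp_id, Category.assoc] at h1 ⊢
    exact h1
  · have h1 := L.pentagonE_inv x y z c.2
    have h2 := L.as_inv_natural (𝟙 (Und.of V x)) (𝟙 (Und.of V y)) g''
    rw [biE_id] at h2
    simp only [Category.assoc]
    rw [reassoc_of% h2, h1]
    simp only [biE_comp_assoc, Category.comp_id]

/-- The two representatives are related by the left unitor of `C`. This needs the triangle with the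
unit on the left, which is not an axiom of a module. -/
theorem eta_mu : Prof.hcomp P.η (𝟙 L.T) ≫ P.μ = Prof.lu L.T := by
  refine Prof.hom_ext fun d c e u w x f g => ?_
  beta_reduce
  rw [Prof.ap_comp, Prof.ap_hcomp, Prof.ap_id, hP.eta, hP.mu, Prof.ap_lu, lE_tE]
  refine L.tE_eq (S.lu x).hom ?_ ?_
  · rw [lu_natural_assoc, ← left_triangleE]
    simp
  · rw [← left_triangleE]
    simp only [Category.assoc]
    rw [lu_inv_natural_assoc]
    simp

/-- Related by the right unitor of `C`, using the module triangle itself. -/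
theorem mu_eta : Prof.hcomp (𝟙 L.T) P.η ≫ P.μ = Prof.ru L.T := by
  refine Prof.hom_ext fun d c e x f g u w => ?_
  beta_reduce
  rw [Prof.ap_comp, Prof.ap_hcomp, Prof.ap_id, hP.eta, hP.mu, Prof.ap_ru, rE_tE]
  refine L.tE_eq (S.ru x).hom ?_ ?_
  · rw [← triangleE]
    simp [biE_comp_assoc]
  · rw [← triangleE]
    simp [biE_comp]

/-- The inverse associator on one leg of the product and the associator on the other conjugate the
action of `x ⊠ y` into that of `y` followed by that of `x`. -/
theorem mu_nu : Prof.hcomp P.μ (𝟙 (Prof.ev M)) ≫ P.ν =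
    Prof.as L.T L.T (Prof.ev M) ≫ Prof.hcomp (𝟙 L.T) P.ν ≫ P.ν := by
  refine Prof.hom_ext fun d c e₂ e₁ x f g y f' g' w => ?_
  beta_reduce
  rw [Prof.ap_comp, Prof.ap_comp, Prof.ap_comp, Prof.ap_hcomp, Prof.ap_id, Prof.ap_as,
    Prof.ap_hcomp, Prof.ap_id, hP.mu, hP.nu, hP.nu, hP.nu]
  refine congrArg uE ?_
  have h := L.as_natural_assoc (𝟙 (Und.of V x)) (𝟙 (Und.of V y)) w (biE L.act (𝟙 _) f' ≫ f)
  rw [biE_id] at h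
  simp only [Category.assoc]
  rw [h, Iso.inv_hom_id_assoc]
  simp [biE_comp_assoc]

theorem eta_nu : Prof.hcomp P.η (𝟙 (Prof.ev M)) ≫ P.ν = Prof.lu (Prof.ev M) := by
  refine Prof.hom_ext fun d c e u w x => ?_
  beta_reduce
  rw [Prof.ap_comp, Prof.ap_hcomp, Prof.ap_id, hP.eta, hP.nu, Prof.ap_lu, lE_uE]
  refine congrArg uE ?_
  rw [lu_natural_assoc]
  simp

/-- In standard form the outer legs agree by naturality of the unitor. On the middle leg, the
unitors from the two copies of `η` conjugate `g` into its image under the unit action. -/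
theorem eta_tau : Prof.hcomp P.η (𝟙 (mulP V M)) ≫ P.τ =
    Prof.lu (mulP V M) ≫ Prof.ru' (mulP V M) ≫
      Prof.hcomp (𝟙 (mulP V M)) (Prof.oneProd _ _) ≫ Prof.convHom (mulP V M) P.η P.η := by
  refine Prof.hom_ext fun d c e u w f g h => ?_
  beta_reduce
  rw [Prof.ap_comp, Prof.ap_comp, Prof.ap_comp, Prof.ap_comp, Prof.ap_hcomp, Prof.ap_id, hP.eta,
    hP.tau, Prof.ap_lu, lE_mE, Prof.ap_ru', Prof.ap_hcomp, Prof.ap_id, Prof.ap_oneProd]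
  refine Eq.trans ?_ (congrArg (Prof.ap _) (congrArg (Prof.cp _ _ _ _) ((idE_prod c).trans
    (congrArg₂ El.pair (idE_eq_hE c.1) (idE_eq_hE c.2))))).symm
  refine Eq.trans ?_ (Prof.ap_convHom _ _ _ _ _ _).symm
  rw [hP.eta, hP.eta, cp_tE]
  simp only [Category.assoc, Category.comp_id, Category.id_comp]
  rw [lu_natural_assoc, lu_inv_natural]
  refine congrArg (L.wE (c := c) S.unit S.unit _ · _) ?_
  rw [← lu_natural_assoc, Iso.hom_inv_id, Category.comp_id]

theorem ap_mu_iE (x y : C) (c : Mᵒᵖ × M) : Prof.ap P.μ (Prof.cp L.T L.T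
    (op (L.ob y c.1.unop), L.ob y c.2) (L.iE x (op (L.ob y c.1.unop), L.ob y c.2)) (L.iE y c)) =
      L.tE (d := (op (L.ob x (L.ob y c.1.unop)), L.ob x (L.ob y c.2)))
        (S.tensor.obj (x, y)) (L.as x y c.1.unop).hom (L.as x y c.2).inv := by
  refine (hP.mu _ _ _ _ _ _ _ _ _).trans (congrArg₂ (L.tE _) ?_ ?_)
  · exact (congrArg ((L.as x y _).hom ≫ ·) ((congrArg (· ≫ _) (biE_id _ _ _)).trans
      (Category.comp_id _))).trans (Category.comp_id _)
  · exact (Category.id_comp _).trans ((congrArg (· ≫ (L.as x y _).inv) (biE_id _ _ _)).trans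
      (Category.id_comp _))

/-- Each branch contains a product of identity elements, whose legs are an associator and an inverse
associator. Pushed into the root they match the other side by naturality; on the middle leg they
conjugate the iterated action into that of `x ⊠ y`. -/
theorem mu_tau : Prof.hcomp P.μ (𝟙 (mulP V M)) ≫ P.τ =
    Prof.as L.T L.T (mulP V M) ≫ Prof.hcomp (𝟙 L.T) P.τ ≫ Prof.tauAt P.τ L.T L.T ≫
      Prof.convHom (mulP V M) P.μ P.μ := by
  refine Prof.hom_ext fun d c e₂ e₁ x f g y f' g' h k l => ?_
  beta_reduce
  rw [Prof.ap_comp, Prof.ap_comp, Prof.ap_comp, Prof.ap_comp, Prof.ap_hcomp, Prof.ap_id,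
    Prof.ap_as, Prof.ap_hcomp, Prof.ap_id, hP.mu, hP.tau, hP.tau, wE, wE]
  refine Eq.trans ?_ (congrArg (Prof.ap _) (hP.ap_tauAt _ _ _ _ _ _ _ _ _ _)).symm
  refine Eq.trans ?_ (Prof.ap_convHom _ _ _ _ _ _).symm
  refine Eq.trans ?_ (congrArg (Prof.cp _ _ _ _) (congrArg₂ El.pair (hP.ap_mu_iE _ _ _)
    (hP.ap_mu_iE _ _ _))).symm
  refine Eq.trans ?_ (L.cp_tE _ _ _ _ _ _ _ _ _).symm
  have h1 := L.as_natural_assoc (𝟙 (Und.of V x)) (𝟙 (Und.of V y)) h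
    (biE L.act (𝟙 (Und.of V x)) f' ≫ f)
  have h2 := L.as_natural_assoc (𝟙 (Und.of V x)) (𝟙 (Und.of V y)) k (L.as x y c.1.2).inv
  have h3 := L.as_inv_natural (𝟙 (Und.of V x)) (𝟙 (Und.of V y)) l
  rw [biE_id] at h1 h2 h3
  refine congrArg (Prof.cp _ _ _ · _) ?_
  simp only [Category.assoc, biE_comp_assoc, Category.comp_id]
  rw [h1, ← h2, Iso.hom_inv_id, h3]
  simp only [Category.assoc, biE_comp_assoc, Category.comp_id]

theorem ap_nu_iE (x : C) (e : Mᵒᵖ × M) (c : PUnit.{v + 1}) (u : Mor V e.2 e.1.unop) :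
    Prof.ap P.ν (Prof.cp L.T (Prof.ev M) e (L.iE x e) (uE (c := c) u)) =
      uE (biE L.act (𝟙 (Und.of V x)) u) :=
  (hP.nu _ _ _ _ _ _ _).trans (congrArg uE ((Category.id_comp _).trans (Category.comp_id _)))

theorem ap_tau_iE (x : C) (e : Mᵒᵖ × M) (c : (Mᵒᵖ × M) × (Mᵒᵖ × M))
    (h : Mor V c.1.1.unop e.1.unop) (k : Mor V c.2.1.unop c.1.2) (l : Mor V e.2 c.2.2) :
    Prof.ap P.τ (Prof.cp L.T (mulP V M) e (L.iE x e) (mE (c := c) h k l)) =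
      L.wE (e := (op (L.ob x e.1.unop), L.ob x e.2)) (c := c) x x
        (biE L.act (𝟙 (Und.of V x)) h) (biE L.act (𝟙 _) k) (biE L.act (𝟙 _) l) :=
  (hP.tau _ _ _ _ _ _ _ _ _).trans (congrArg₂ (L.wE (c := c) x x · _ ·)
    (Category.comp_id _) (Category.id_comp _))

/-- Applying `x ⊡ -` to the factors and composing agrees with composing and then applying it. The
same reason proves `tau_r`. -/
theorem tau_l : Prof.tauAt P.τ (Prof.ev M) (Prof.one _) ≫ Prof.convHom (mulP V M) P.ν
      (Prof.ru L.T) ≫ Prof.lambdaAt P.l L.T =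
    Prof.compRes L.T P.l ≫ Prof.resRHom (Prof.ru L.T) _ := by
  refine Prof.hom_ext fun d c e₂ x f g e₁ a b h u k l => ?_
  beta_reduce
  rw [Prof.ap_comp, Prof.ap_comp, Prof.ap_comp, Prof.ap_compRes, hP.l]
  refine (congrArg (Prof.ap _) ((congrArg (Prof.ap _) (hP.ap_tauAt _ _ _ _ _ _ _ _ _ _)).trans
    ((Prof.ap_convHom _ _ _ _ _ _).trans (congrArg (Prof.cp _ _ _ _) (congrArg₂ El.pair
      (hP.ap_nu_iE _ _ _ _) ((Prof.ap_ru _ _ _).trans (L.rE_iE _ _ _))))))).trans ?_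
  refine (hP.ap_lambdaAt _ _ _ _ _ _).trans ((L.lE_tE _ _ _ _ _).trans ?_)
  refine Eq.trans ?_ ((Prof.ap_ru _ _ _).trans (L.rE_tE _ _ _ _ _)).symm
  simp [biE_comp_assoc, biE_comp]

theorem tau_r : Prof.tauAt P.τ (Prof.one _) (Prof.ev M) ≫ Prof.convHom (mulP V M)
      (Prof.ru L.T) P.ν ≫ Prof.rhoAt P.r L.T =
    Prof.compRes L.T P.r ≫ Prof.resRHom (Prof.ru L.T) _ := by
  refine Prof.hom_ext fun d c e₂ x f g e₁ a b h k l u => ?_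
  beta_reduce
  rw [Prof.ap_comp, Prof.ap_comp, Prof.ap_comp, Prof.ap_compRes, hP.r]
  refine (congrArg (Prof.ap _) ((congrArg (Prof.ap _) (hP.ap_tauAt _ _ _ _ _ _ _ _ _ _)).trans
    ((Prof.ap_convHom _ _ _ _ _ _).trans (congrArg (Prof.cp _ _ _ _) (congrArg₂ El.pair
      ((Prof.ap_ru _ _ _).trans (L.rE_iE _ _ _)) (hP.ap_nu_iE _ _ _ _)))))).trans ?_
  refine (hP.ap_rhoAt _ _ _ _ _ _).trans ((L.lE_tE _ _ _ _ _).trans ?_)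
  refine Eq.trans ?_ ((Prof.ap_ru _ _ _).trans (L.rE_tE _ _ _ _ _)).symm
  simp [biE_comp_assoc, biE_comp]

/-- Both sides apply `x ⊡ -` to every leg and rebracket, so functoriality suffices once the
morphisms have the same position in the tree. -/
theorem tau_alpha : Prof.tauAt P.τ (mulP V M) (Prof.one _) ≫
      Prof.convHom (mulP V M) P.τ (Prof.ru L.T) ≫ Prof.alphaAt P.α L.T L.T L.T =
    Prof.compRes L.T P.α ≫ Prof.resRHom (Prof.tauAt P.τ (Prof.one _) (mulP V M) ≫
      Prof.convHom (mulP V M) (Prof.ru L.T) P.τ) _ := by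
  refine Prof.hom_ext fun d c e₂ x f g e₁ a b h a₁ b₁ h₁ k l => ?_
  beta_reduce
  rw [Prof.ap_comp, Prof.ap_comp, Prof.ap_comp, Prof.ap_compRes, hP.alpha]
  refine (congrArg (Prof.ap _) ((congrArg (Prof.ap _) (hP.ap_tauAt _ _ _ _ _ _ _ _ _ _)).trans
    ((Prof.ap_convHom _ _ _ _ _ _).trans (congrArg (Prof.cp _ _ _ _) (congrArg₂ El.pair
      (hP.ap_tau_iE _ _ _ _ _ _) ((Prof.ap_ru _ _ _).trans (L.rE_iE _ _ _))))))).trans ?_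
  refine (hP.ap_alphaAt _ _ _ _ _ _ _ _ _ _ _ _).trans ?_
  refine (congrArg (Prof.cp _ _ _ _) (congrArg (El.pair _) (L.cp_tE _ _ _ _ _ _ _ _ _))).trans ?_
  refine Eq.trans ?_ ((Prof.ap_comp _ _ _).trans ((congrArg (Prof.ap _)
    (hP.ap_tauAt _ _ _ _ _ _ _ _ _ _)).trans
    ((Prof.ap_convHom _ _ _ _ _ _).trans (congrArg (Prof.cp _ _ _ _) (congrArg₂ El.pair
      ((Prof.ap_ru _ _ _).trans (L.rE_iE _ _ _)) (hP.ap_tau_iE _ _ _ _ _ _)))))).symm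
  -- On the left the last morphism `x ⊡ l` sits in the inner root, on the right in the outer root.
  -- Writing it as a left action on the branch lets it pass to the outer root.
  have key : L.wE (e := (op (L.ob x c.1.2.1.unop), L.ob x e₁.2.2)) (c := (c.1.2, c.2)) x x
      (𝟙 (Und.of V (L.ob x c.1.2.1.unop)) ≫ 𝟙 (Und.of V (L.ob x c.1.2.1.unop)))
      (biE L.act (𝟙 _) k ≫ (biE L.act (𝟙 _) b ≫ biE L.act (𝟙 _) h₁) ≫
        𝟙 (Und.of V (L.ob x c.1.2.2)))
      (𝟙 (Und.of V (L.ob x e₁.2.2)) ≫ biE L.act (𝟙 (Und.of V x)) l) =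
      Prof.lE ((mulP V M).comp (L.T.tens L.T)) (d' := (op (L.ob x c.1.2.1.unop), L.ob x c.2.2))
        (hE (𝟙 (Und.of V (L.ob x c.1.2.1.unop))) (biE L.act (𝟙 (Und.of V x)) l))
        (L.wE (c := (c.1.2, c.2)) x x (biE L.act (𝟙 (Und.of V x)) (𝟙 (Und.of V c.1.2.1.unop)))
          (biE L.act (𝟙 _) (k ≫ b ≫ h₁)) (biE L.act (𝟙 (Und.of V x)) (𝟙 (Und.of V c.2.2)))) := by
    refine Eq.trans ?_ (L.lE_wE _ _ _ _ _ _ _).symm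
    simp [biE_id, biE_comp]
  have key' : L.tE (d := (op (L.ob x c.1.1.1.unop), L.ob x c.1.1.2)) (c := c.1.1) x
      (biE L.act (𝟙 _) (𝟙 _)) (biE L.act (𝟙 _) (𝟙 _)) = L.iE x c.1.1 := by
    rw [biE_id, biE_id]
    rfl
  refine (congrArg (Prof.cp _ _ _ _) (congrArg (El.pair _) key)).trans ?_
  refine (Prof.cp_mE_right _ _ _ _ _ _ _ _ _).trans ?_
  refine Eq.trans ?_ (congrArg (Prof.cp _ _ _ _) (congrArg (El.pair · _) key')).symm
  refine congrArg (Prof.cp _ _ _ · _) ?_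
  simp [biE_comp_assoc, biE_comp]

/-- Both sides have the same standard form in `M • (1 ⊗ 1)`, given by `cp_hE`; its middle leg is the
composite that runs through the element `u` of `U`. -/
theorem triangle (a : Mᵒᵖ × M) (x : _) :
    (Prof.alphaAt P.α (Prof.one _) (Prof.ev M) (Prof.one _) ≫ Prof.resRHom
      (Prof.convHomRes (mulP V M) (Prof.resId (Prof.one _)) P.l) _).app a x =
      (Prof.convHomRes (mulP V M) P.r (Prof.resId (Prof.one _))).app a x := by
  refine Cover.ext fun e a₁ b₁ h₁ e' a₂ b₂ h₂ k l u k' l' => ?_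
  have hA := hP.ap_alphaAt (Prof.one _) (Prof.ev M) (Prof.one _) (c := x) a₁ b₁ h₁ a₂ b₂ h₂
    (hE k l) (uE u) (hE k' l')
  have hB := Prof.ap_convHomRes (mulP V M) (Prof.resId (Prof.one _)) P.l (a := a)
    (e := (e'.1, (e'.2.1, e.2.2))) (c := (x.1.1, (x.1.2, x.2))) (mE (a₂ ≫ a₁) b₂ h₁) (hE k l)
    (Prof.cp (mulP V M) _ (c := (x.1.2, x.2)) (e'.2, e.2) (mE (𝟙 _) (b₁ ≫ h₂) (𝟙 _))
      (El.pair (uE u) (hE k' l')))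
  have hC := Prof.ap_convHomRes (mulP V M) P.r (Prof.resId (Prof.one _)) (c := (x.1, x.2))
    (mE a₁ b₁ h₁) (Prof.cp (mulP V M) _ (c := x.1) e' (mE a₂ b₂ h₂)
      (El.pair (hE k l) (uE u))) (hE k' l')
  rw [Prof.ap_resId, hP.l] at hB
  rw [Prof.ap_resId, hP.r] at hC
  have hD := cp_hE (d := (e'.1, (e'.2.1, e.2.2))) (c := (x.1.1, x.2)) (a₂ ≫ a₁) b₂ h₁ k l
    (k' ≫ (b₁ ≫ h₂) ≫ u ≫ 𝟙 _) (𝟙 _ ≫ l')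
  have hF := cp_hE (d := e) (c := (x.1.1, x.2)) a₁ b₁ h₁ (k ≫ a₂) (h₂ ≫ u ≫ b₂ ≫ l) k' l'
  have h1 := hB.trans hD
  have h2 := hC.trans hF
  have h3 := (Prof.ap_comp_resRHom (Prof.alphaAt P.α (Prof.one _) (Prof.ev M) (Prof.one _))
    (Prof.convHomRes (mulP V M) (Prof.resId (Prof.one _)) P.l) (e := a) (b := x)
    (Prof.cp (mulP V M) _ e (mE a₁ b₁ h₁) (El.pair (Prof.cp (mulP V M)
      ((Prof.one _).tens (Prof.ev M)) (c := x.1) e' (mE a₂ b₂ h₂) (El.pair (hE k l) (uE u)))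
        (hE k' l')))).trans (congrArg (Prof.ap _) hA)
  simp only [Category.assoc, Category.comp_id, Category.id_comp] at h1 h2
  have h4 := h1.trans h2.symm
  beta_reduce
  exact h3.trans h4

/-- Each use of `α` keeps the leaves and only regroups the legs of a chain of morphisms. Along
either path a generator therefore reaches the same tree. -/
theorem pentagon (a : Mᵒᵖ × M) (x : _) :
    (Prof.alphaAt P.α (Prof.conv (mulP V M) (Prof.one (Mᵒᵖ × M)) (Prof.one (Mᵒᵖ × M)))
        (Prof.one (Mᵒᵖ × M)) (Prof.one (Mᵒᵖ × M)) ≫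
      Prof.resRHom (Prof.alphaAt P.α (Prof.one (Mᵒᵖ × M)) (Prof.one (Mᵒᵖ × M))
        (Prof.conv (mulP V M) (Prof.one (Mᵒᵖ × M)) (Prof.one (Mᵒᵖ × M)))) _).app a x =
    (Prof.convHomRes (mulP V M) (Prof.alphaAt P.α (Prof.one (Mᵒᵖ × M)) (Prof.one (Mᵒᵖ × M))
        (Prof.one (Mᵒᵖ × M))) (Prof.resId (Prof.one (Mᵒᵖ × M))) ≫
      Prof.resRHom (Prof.alphaAt P.α (Prof.one (Mᵒᵖ × M))
          (Prof.conv (mulP V M) (Prof.one (Mᵒᵖ × M)) (Prof.one (Mᵒᵖ × M)))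
          (Prof.one (Mᵒᵖ × M)) ≫
        Prof.resRHom (Prof.convHomRes (mulP V M) (Prof.resId (Prof.one (Mᵒᵖ × M)))
          (Prof.alphaAt P.α (Prof.one (Mᵒᵖ × M)) (Prof.one (Mᵒᵖ × M))
            (Prof.one (Mᵒᵖ × M)))) _) _).app a x := by
  refine Cover.ext fun e A B D e₁ A₁ B₁ D₁ e₂ A₂ B₂ D₂ k l k₁ l₁ k₂ l₂ k₃ l₃ => ?_
  have h1 := hP.ap_alphaAt (Prof.conv (mulP V M) (Prof.one (Mᵒᵖ × M)) (Prof.one (Mᵒᵖ × M)))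
    (Prof.one (Mᵒᵖ × M)) (Prof.one (Mᵒᵖ × M)) (d := a) (e := e) (q := e₁) (c := x) A B D A₁ B₁ D₁
    (Prof.cp (mulP V M) _ (c := x.1.1) e₂ (mE A₂ B₂ D₂) (El.pair (hE k l) (hE k₁ l₁)))
    (hE k₂ l₂) (hE k₃ l₃)
  have h2 := hP.ap_alphaAt (Prof.one (Mᵒᵖ × M)) (Prof.one (Mᵒᵖ × M))
    (Prof.conv (mulP V M) (Prof.one (Mᵒᵖ × M)) (Prof.one (Mᵒᵖ × M))) (d := a)
    (e := (e₁.1, (e₁.2.1, e.2.2))) (q := e₂) (c := (x.1.1, (x.1.2, x.2)))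
    (A₁ ≫ A) B₁ D A₂ B₂ D₂ (hE k l) (hE k₁ l₁)
    (Prof.cp (mulP V M) _ (c := (x.1.2, x.2)) (e₁.2, e.2) (mE (𝟙 _) (B ≫ D₁) (𝟙 _))
      (El.pair (hE k₂ l₂) (hE k₃ l₃)))
  have h3 := Prof.ap_convHomRes (mulP V M) (Prof.alphaAt P.α (Prof.one (Mᵒᵖ × M))
    (Prof.one (Mᵒᵖ × M)) (Prof.one (Mᵒᵖ × M))) (Prof.resId (Prof.one (Mᵒᵖ × M))) (a := a)
    (e := e) (c := (x.1, x.2)) (mE A B D) (Prof.cp (mulP V M) _ (c := x.1) e₁ (mE A₁ B₁ D₁)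
      (El.pair (Prof.cp (mulP V M) _ (c := x.1.1) e₂ (mE A₂ B₂ D₂)
        (El.pair (hE k l) (hE k₁ l₁))) (hE k₂ l₂))) (hE k₃ l₃)
  rw [Prof.ap_resId, hP.ap_alphaAt] at h3
  have h4 := hP.ap_alphaAt (Prof.one (Mᵒᵖ × M)) (Prof.conv (mulP V M) (Prof.one (Mᵒᵖ × M))
    (Prof.one (Mᵒᵖ × M))) (Prof.one (Mᵒᵖ × M)) (d := a) (e := e) (q := (e₂.1, (e₂.2.1, e₁.2.2)))
    (c := ((x.1.1.1, (x.1.1.2, x.1.2)), x.2)) A B D (A₂ ≫ A₁) B₂ D₁ (hE k l)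
    (Prof.cp (mulP V M) _ (c := (x.1.1.2, x.1.2)) (e₂.2, e₁.2) (mE (𝟙 _) (B₁ ≫ D₂) (𝟙 _))
      (El.pair (hE k₁ l₁) (hE k₂ l₂))) (hE k₃ l₃)
  have h5 := Prof.ap_convHomRes (mulP V M) (Prof.resId (Prof.one (Mᵒᵖ × M)))
    (Prof.alphaAt P.α (Prof.one (Mᵒᵖ × M)) (Prof.one (Mᵒᵖ × M)) (Prof.one (Mᵒᵖ × M))) (a := a)
    (e := (e₂.1, (e₂.2.1, e.2.2))) (c := (x.1.1.1, ((x.1.1.2, x.1.2), x.2)))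
    (mE ((A₂ ≫ A₁) ≫ A) B₂ D) (hE k l) (Prof.cp (mulP V M) _ (c := ((x.1.1.2, x.1.2), x.2))
      ((e₂.2.1, e₁.2.2), e.2) (mE (𝟙 _) (B ≫ D₁) (𝟙 _)) (El.pair
        (Prof.cp (mulP V M) _ (c := (x.1.1.2, x.1.2)) (e₂.2, e₁.2) (mE (𝟙 _) (B₁ ≫ D₂) (𝟙 _))
          (El.pair (hE k₁ l₁) (hE k₂ l₂))) (hE k₃ l₃)))
  rw [Prof.ap_resId, hP.ap_alphaAt] at h5
  have h6 := (Prof.ap_comp_resRHom (Prof.alphaAt P.α (Prof.conv (mulP V M) (Prof.one (Mᵒᵖ × M))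
      (Prof.one (Mᵒᵖ × M))) (Prof.one (Mᵒᵖ × M)) (Prof.one (Mᵒᵖ × M)))
    (Prof.alphaAt P.α (Prof.one (Mᵒᵖ × M)) (Prof.one (Mᵒᵖ × M))
        (Prof.conv (mulP V M) (Prof.one (Mᵒᵖ × M)) (Prof.one (Mᵒᵖ × M)))) (e := a) (b := x)
    (Prof.cp (mulP V M) _ (c := x) e (mE A B D) (El.pair (Prof.cp (mulP V M) _ (c := x.1) e₁
      (mE A₁ B₁ D₁) (El.pair (Prof.cp (mulP V M) _ (c := x.1.1) e₂ (mE A₂ B₂ D₂)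
        (El.pair (hE k l) (hE k₁ l₁))) (hE k₂ l₂))) (hE k₃ l₃)))).trans (congrArg (Prof.ap _) h1)
  have h7 := (Prof.ap_comp_resRHom (Prof.alphaAt P.α (Prof.one (Mᵒᵖ × M)) (Prof.conv (mulP V M)
      (Prof.one (Mᵒᵖ × M)) (Prof.one (Mᵒᵖ × M))) (Prof.one (Mᵒᵖ × M)))
    (Prof.convHomRes (mulP V M) (Prof.resId (Prof.one (Mᵒᵖ × M)))
      (Prof.alphaAt P.α (Prof.one (Mᵒᵖ × M)) (Prof.one (Mᵒᵖ × M)) (Prof.one (Mᵒᵖ × M)))) (e := a)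
    (b := ((x.1.1.1, (x.1.1.2, x.1.2)), x.2)) (Prof.cp (mulP V M) _
      (c := ((x.1.1.1, (x.1.1.2, x.1.2)), x.2)) e (mE A B D) (El.pair (Prof.cp (mulP V M) _
      (c := (x.1.1.1, (x.1.1.2, x.1.2))) (e₂.1, (e₂.2.1, e₁.2.2)) (mE (A₂ ≫ A₁) B₂ D₁)
      (El.pair (hE k l) (Prof.cp (mulP V M) _ (c := (x.1.1.2, x.1.2)) (e₂.2, e₁.2)
        (mE (𝟙 _) (B₁ ≫ D₂) (𝟙 _)) (El.pair (hE k₁ l₁) (hE k₂ l₂))))) (hE k₃ l₃)))).trans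
      (congrArg (Prof.ap _) h4)
  have h8 := (Prof.ap_comp_resRHom (Prof.convHomRes (mulP V M) (Prof.alphaAt P.α
      (Prof.one (Mᵒᵖ × M)) (Prof.one (Mᵒᵖ × M)) (Prof.one (Mᵒᵖ × M)))
      (Prof.resId (Prof.one (Mᵒᵖ × M))))
    (Prof.alphaAt P.α (Prof.one (Mᵒᵖ × M)) (Prof.conv (mulP V M) (Prof.one (Mᵒᵖ × M))
        (Prof.one (Mᵒᵖ × M))) (Prof.one (Mᵒᵖ × M)) ≫
      Prof.resRHom (Prof.convHomRes (mulP V M) (Prof.resId (Prof.one (Mᵒᵖ × M)))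
        (Prof.alphaAt P.α (Prof.one (Mᵒᵖ × M)) (Prof.one (Mᵒᵖ × M))
          (Prof.one (Mᵒᵖ × M)))) _) (e := a) (b := x)
    (Prof.cp (mulP V M) _ (c := x) e (mE A B D) (El.pair (Prof.cp (mulP V M) _ (c := x.1) e₁
      (mE A₁ B₁ D₁) (El.pair (Prof.cp (mulP V M) _ (c := x.1.1) e₂ (mE A₂ B₂ D₂)
        (El.pair (hE k l) (hE k₁ l₁))) (hE k₂ l₂))) (hE k₃ l₃)))).trans (congrArg (Prof.ap _) h3)
  have h9 := h6.trans h2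
  have h10 := h8.trans (h7.trans h5)
  -- The resulting trees differ only in the bracketing of composites in `M` and in superfluous
  -- identities.
  simp only [Category.assoc, Category.comp_id] at h9 h10
  beta_reduce
  exact h9.trans h10.symm

theorem isProbimonad : P.IsProbimonad where
  mu_assoc := hP.mu_assoc
  eta_mu := hP.eta_mu
  mu_eta := hP.mu_eta
  alpha_iso := isIso_alpha hP.alpha
  l_iso := isIso_l hP.l
  r_iso := isIso_r hP.r
  pentagon := hP.pentagon
  triangle := hP.triangle
  mu_tau := hP.mu_tau
  eta_tau := hP.eta_tau
  mu_nu := hP.mu_nu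
  eta_nu := hP.eta_nu
  tau_alpha := hP.tau_alpha
  tau_l := hP.tau_l
  tau_r := hP.tau_r

end IsCanonicalE
end ModuleStr

end ProV

end

theorem mainTheorem4 {V : Type u} [Category.{v} V] [MonoidalCategory V] [SymmetricCategory V]
    [MonoidalClosed V] [HasLimitsOfSize.{v, v} V] [HasColimitsOfSize.{v, v} V]
    {C M : Type v} [EnrichedCategory V C] [EnrichedCategory V M]
    (S : ProV.MonoidalStr V C) (L : ProV.ModuleStr S M) :
    ∃ P : ProV.Prof.ProbimonadData L.T (ProV.mulP V M) (ProV.Prof.ev M),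
      L.IsCanonical P ∧ P.IsProbimonad ∧ ∀ P', L.IsCanonical P' → P' = P := by
  obtain ⟨P, hP⟩ := L.exists_isCanonicalE
  exact ⟨P, hP.isCanonical, hP.isProbimonad, fun P' h' => hP.unique h'.isCanonicalE⟩
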